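/- Let $n\ge 3$. For $p>0$ put $c_p=2^{p/2}\Gamma(\tfrac p2+1)$, $\alpha_p(r)=c_p\,r^{-p/2}I_{p/2}(r)$ (with $\alpha_p(0)=1$) and $\beta_p(r)=c_p^{-1}r^{-p/2}K_{p/2}(r)$, where $I,K$ are the modified Bessel functions, and for $s\ge r\ge 0$, $s>0$, let $$\delta(r,s)=rs\,\varphi(r,s),\qquad \varphi(r,s)=\tfrac12\Big[n\alpha_n(r)\beta_n(s)+\tfrac1n\alpha_n(r)\beta_{n-2}(s)-n\alpha_{n-2}(r)\beta_n(s)\Big].$$ Then $\delta$ is the Green kernel of the inertia operator $(1-\Delta)^2$ on radial vector fields on $\mathbb R^n$, where $\Delta(u\,\partial_r)=\big(u''+\frac{n-1}{r}u'-\frac{n-1}{r^2}u\big)\partial_r$: for every continuous $\omega:[0,\infty)\to\mathbb R$ with $\omega(r)\to0$ as $r\to\infty$, the function $u(r)=\int_0^r\delta(s,r)s^{n-1}\omega(s)\,ds+\int_r^\infty\delta(r,s)s^{n-1}\omega(s)\,ds$ (the integrals converge) is $C^4$ on $(0,\infty)$, satisfies $(1-\Delta)^2(u\,\partial_r)=\omega\,\partial_r$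 there, and tends to $0$ as $r\to0$ and as $r\to\infty$. Let the initial momentum $\omega_0:[0,\infty)\to\mathbb R$ be continuous and bounded with $\int_0^\infty r^{n-1}\omega_0(r)^2\,dr<\infty$ (for instance, any $\omega_0$ for which $\omega_0(r)\,\partial_r$ is a vector field in $H^\infty(\mathbb R^n,\mathbb R^n)$). Suppose that $\omega_0(r)\le 0$ for all $r\ge 0$ and that $\omega_0$ is not identically zero. Consider the radial particle-trajectory equation $$\frac{\partial\gamma}{\partial t}(t,r)=\int_0^r\frac{\delta(\gamma(t,s),\gamma(t,r))}{\gamma_s(t,s)}\,s^{n-1}\omega_0(s)\,ds+\int_r^\infty\frac{\delta(\gamma(t,r),\gamma(t,s))}{\gamma_s(t,s)}\,s^{n-1}\omega_0(s)\,ds,\qquad \gamma(0,r)=r.$$ A solution on $[0,T)$ is a function $\gamma$ satisfying it for $0\le t<T$, $r\ge0$, such that the integrals converge, $\gamma(t,0)=0$, and $\gamma_r$ exists, is continuous on $[0,T)\times[0,\infty)$, and on each $[0,T']\times[0,\infty)$ with $T'<T$ is bounded above and below by positive constants. Then the solution breaks down in finite time by $\gamma_r$ reaching zero. That is, there are $0<T<\infty$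 and a solution $\gamma$ on $[0,T)$ which is the unique maximal one (every solution on an interval $[0,T')$ has $T'\le T$ and coincides with $\gamma$ on $[0,T')$), such that $\gamma(T,r):=\lim_{t\nearrow T}\gamma(t,r)$ exists for every $r\ge 0$, and for some $r\ge 0$ one has $\lim_{t\nearrow T}\gamma_r(t,r)=0$ and $\gamma_r(T,r)=0$ (a one-sided derivative if $r=0$). -/

import Mathlib

open Set Filter Topology MeasureTheory

namespace RadialEPDiff

noncomputable section

/-- Modified Bessel function of the first kind
`I_ν(x) = ∑ₖ (x/2)^(2k+ν) / (k! Γ(k+ν+1))`, used for `ν > 0` and `x > 0`. -/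
def besselI (ν x : ℝ) : ℝ :=
  ∑' k : ℕ, (x / 2) ^ (2 * (k : ℝ) + ν) / ((k.factorial : ℝ) * Real.Gamma ((k : ℝ) + ν + 1))

/-- Modified Bessel function of the second kind
`K_ν(x) = ∫₀^∞ exp(-x cosh t) cosh(ν t) dt`, used for `x > 0`. -/
def besselK (ν x : ℝ) : ℝ :=
  ∫ t in Ioi (0 : ℝ), Real.exp (-x * Real.cosh t) * Real.cosh (ν * t)

/-- The constant `c_p = 2^(p/2) Γ(p/2 + 1)`. -/
def besselConst (p : ℝ) : ℝ := (2 : ℝ) ^ (p / 2) * Real.Gamma (p / 2 + 1)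

/-- `α_p(r) = c_p r^(-p/2) I_{p/2}(r)`, with its limiting value `1` at `r = 0`. -/
def alpha (p r : ℝ) : ℝ :=
  if r = 0 then 1 else besselConst p * r ^ (-(p / 2)) * besselI (p / 2) r

/-- `β_p(r) = c_p⁻¹ r^(-p/2) K_{p/2}(r)`, for `r > 0`. -/
def beta (p r : ℝ) : ℝ :=
  (besselConst p)⁻¹ * r ^ (-(p / 2)) * besselK (p / 2) r

/-- The function `φ(r,s)`, meaningful for `0 ≤ r ≤ s`, `0 < s`. -/
def phi (n : ℕ) (r s : ℝ) : ℝ :=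
  (1 / 2) * ((n : ℝ) * alpha n r * beta n s + (1 / (n : ℝ)) * alpha n r * beta ((n : ℝ) - 2) s
    - (n : ℝ) * alpha ((n : ℝ) - 2) r * beta n s)

/-- The Green kernel `δ(r,s) = r s φ(r,s)` of `(1 - Δ)²` on radial vector fields on `ℝⁿ`; the
second argument is always the larger one. -/
def greenKernel (n : ℕ) (r s : ℝ) : ℝ := r * s * phi n r s

/-- The vector Laplacian of `u(r) ∂_r` on `ℝⁿ`, as a radial function. -/
def radialLaplacian (n : ℕ) (u : ℝ → ℝ) (r : ℝ) : ℝ :=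
  deriv (deriv u) r + ((n : ℝ) - 1) / r * deriv u r - ((n : ℝ) - 1) / r ^ 2 * u r

/-- `1 - Δ` acting on `u(r) ∂_r`. -/
def radialHelmholtz (n : ℕ) (u : ℝ → ℝ) (r : ℝ) : ℝ := u r - radialLaplacian n u r

/-- The inertia operator `(1 - Δ)²` acting on `u(r) ∂_r`. -/
def radialInertia (n : ℕ) (u : ℝ → ℝ) : ℝ → ℝ := radialHelmholtz n (radialHelmholtz n u)

/-- For a radial diffeomorphism `γ` with derivative `ρ` and momentum density
`z₀(s) = s^(n-1) ω₀(s)`, the right-hand side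
`∫₀^r δ(γ(s),γ(r)) z₀(s)/ρ(s) ds + ∫_r^∞ δ(γ(r),γ(s)) z₀(s)/ρ(s) ds`
of the particle-trajectory equation with kernel `δ`. -/
def trajectoryField (n : ℕ) (δ : ℝ → ℝ → ℝ) (ω₀ γ ρ : ℝ → ℝ) (r : ℝ) : ℝ :=
  (∫ s in Ioc 0 r, δ (γ s) (γ r) * (s ^ (n - 1) * ω₀ s / ρ s))
    + ∫ s in Ioi r, δ (γ r) (γ s) * (s ^ (n - 1) * ω₀ s / ρ s)

/-- Convergence of the two integrals in `trajectoryField`. -/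
def TrajectoryIntegrable (n : ℕ) (δ : ℝ → ℝ → ℝ) (ω₀ γ ρ : ℝ → ℝ) (r : ℝ) : Prop :=
  IntegrableOn (fun s => δ (γ s) (γ r) * (s ^ (n - 1) * ω₀ s / ρ s)) (Ioc 0 r) ∧
    IntegrableOn (fun s => δ (γ r) (γ s) * (s ^ (n - 1) * ω₀ s / ρ s)) (Ioi r)

/-- `δ` is the Green kernel of `(1 - Δ)²` on radial vector fields: for every continuous `ω`
vanishing at infinity, `u(r) = ∫₀^r δ(s,r) s^(n-1) ω(s) ds + ∫_r^∞ δ(r,s) s^(n-1) ω(s) ds`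
(the case `γ = id`, `ρ = 1` of `trajectoryField`) solves `(1 - Δ)² (u ∂_r) = ω ∂_r`
and vanishes at `0` and at infinity. -/
def IsRadialGreenKernel (n : ℕ) (δ : ℝ → ℝ → ℝ) : Prop :=
  ∀ ω : ℝ → ℝ, ContinuousOn ω (Ici 0) → Tendsto ω atTop (𝓝 0) →
    (∀ r, 0 ≤ r → TrajectoryIntegrable n δ ω id (fun _ => 1) r) ∧
    ContDiffOn ℝ 4 (trajectoryField n δ ω id (fun _ => 1)) (Ioi 0) ∧
    (∀ r, 0 < r → radialInertia n (trajectoryField n δ ω id (fun _ => 1)) r = ω r) ∧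
    Tendsto (trajectoryField n δ ω id (fun _ => 1)) (𝓝[>] 0) (𝓝 0) ∧
    Tendsto (trajectoryField n δ ω id (fun _ => 1)) atTop (𝓝 0)

/-- `γ`, with spatial derivative `ρ = γ_r`, is a solution on the time interval `[0,T)`, in the class
of `C¹` radial diffeomorphisms, of the particle-trajectory equation with kernel `δ`
and `γ(0,r) = r`. Only the values for `0 ≤ t < T` and `r ≥ 0` matter. -/
structure IsTrajectory (n : ℕ) (δ : ℝ → ℝ → ℝ) (ω₀ : ℝ → ℝ) (T : ℝ) (γ ρ : ℝ → ℝ → ℝ) :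
    Prop where
  initial : ∀ r, 0 ≤ r → γ 0 r = r
  fixes_origin : ∀ t ∈ Ico 0 T, γ t 0 = 0
  hasDeriv_space : ∀ t ∈ Ico 0 T, ∀ r, 0 ≤ r → HasDerivWithinAt (γ t) (ρ t r) (Ici 0) r
  continuous_deriv : ContinuousOn (fun x : ℝ × ℝ => ρ x.1 x.2) (Ico 0 T ×ˢ Ici 0)
  bounds : ∀ T' < T, ∃ a b : ℝ, 0 < a ∧ ∀ t ∈ Icc 0 T', ∀ r, 0 ≤ r → a ≤ ρ t r ∧ ρ t r ≤ b
  integrable : ∀ t ∈ Ico 0 T, ∀ r, 0 ≤ r → TrajectoryIntegrable n δ ω₀ (γ t) (ρ t) r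
  hasDeriv_time : ∀ t ∈ Ico 0 T, ∀ r, 0 ≤ r →
    HasDerivWithinAt (fun τ => γ τ r) (trajectoryField n δ ω₀ (γ t) (ρ t) r) (Ico 0 T) t

end

end RadialEPDiff

/-! Structure of the kernel. Let `a(x) = x α_n(x)` and `b(x) = x β_n(x)` be the solutions of the
radial Helmholtz equation that are regular at the origin and decaying at infinity. The Green
function of `1 - Δ` is `a(min) b(max)`, and `δ` is its composition with itself against `w^(n-1) dw`.
Hence `δ` is a bilinear expression in `a` and `b` whose coefficients are integrals of positive
functions (`greenKernel_eq_kernForm`). The bounds `|a'| ≤ (1 + (n+1)/x) a` and `|b'| ≤ (1 + (n+1)/x)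
b` then pass to `δ`: its derivatives are bounded by `δ` itself times such factors, up to the term
`a(x) b(y)` in the pure second derivatives. Decay and positivity come from the same form, and the
Green property from variation of constants.

Well-posedness. For `ρ = γ_r` the equation becomes `γ_t = U`, `ρ_t = ρ V`, where `U` is the velocity
along particles and `V` the velocity gradient. The right-hand side is Lipschitz in the supremum norm
of the pair, because perturbations of `γ` vanish at the origin and this cancels the factor `1/x`.
Picard–Lindelöf gives a flow whose lifespan depends only on the bounds for `ρ`
(`exists_local_flow`). Every trajectory is such a flow (`IsTrajectory.flow`), and flows are unique
(`Flow.unique`).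

Finite lifespan. Nonpositive momentum moves every particle inwards. On an interval `[p, q]` with `ω₀
≤ -z` the bound `δ(x,y) ≥ c x` and convexity of `1/ρ` give `U(r) ≤ -const (r'-r)²/γ(r') · γ(r)` for
`r < r'`. Along radii decreasing to `p`, with gaps halved at each step, the bound on `γ` improves by
a factor `8` over a time proportional to `2^(-k)`. These times are summable, so `γ(p)` would vanish
at a finite time (`exists_lifespan_bound`).

Breakdown at the origin. Conservation of energy and Cauchy–Schwarz bound the velocity wherever `γ ≥
1`, so distant particles are stretched only boundedly. For the others `V` is controlled by `V` at
the origin, which is the time derivative of `log ρ(t,0)`. A flow with `ρ(t,0)` bounded below can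
therefore be continued (`Flow.exists_extension_of_le_ρ_zero`). At the maximal time the decreasing
quantity `ρ(t,0)` must tend to zero, and `γ(T,r) ≤ γ(t,r)` makes the derivative of `γ(T,·)` at the
origin vanish. -/

namespace RadialEPDiff

/-! ### Power series of the regular Bessel solution -/

noncomputable section

/-- Coefficients of the even power series of `alpha p`. -/
def alphaCoeff (p : ℝ) (k : ℕ) : ℝ :=
  Real.Gamma (p / 2 + 1) / (4 ^ k * (k.factorial : ℝ) * Real.Gamma ((k : ℝ) + p / 2 + 1))

/-- The entire even function that extends `alpha p` to the real line. -/
def alphaSeries (p x : ℝ) : ℝ := ∑' k : ℕ, alphaCoeff p k * x ^ (2 * k)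

lemma gamma_half_pos {p : ℝ} (hp : -2 < p) (k : ℕ) :
    0 < Real.Gamma ((k : ℝ) + p / 2 + 1) :=
  Real.Gamma_pos_of_pos (by have := k.cast_nonneg (α := ℝ); linarith)

lemma alphaCoeff_pos {p : ℝ} (hp : -2 < p) (k : ℕ) : 0 < alphaCoeff p k := by
  have h0 := gamma_half_pos hp 0
  have hk := gamma_half_pos hp k
  simp only [Nat.cast_zero, zero_add] at h0
  unfold alphaCoeff; positivity

lemma alphaCoeff_zero {p : ℝ} (hp : -2 < p) : alphaCoeff p 0 = 1 := by
  have h0 := gamma_half_pos hp 0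
  simp only [Nat.cast_zero, zero_add] at h0
  simp [alphaCoeff, h0.ne']

lemma gamma_half_succ {p : ℝ} (hp : -2 < p) (k : ℕ) :
    Real.Gamma (((k + 1 : ℕ) : ℝ) + p / 2 + 1)
      = ((k : ℝ) + p / 2 + 1) * Real.Gamma ((k : ℝ) + p / 2 + 1) := by
  rw [← Real.Gamma_add_one (by have := k.cast_nonneg (α := ℝ); linarith)]
  push_cast; ring_nf

lemma alphaCoeff_succ {p : ℝ} (hp : -2 < p) (k : ℕ) :
    alphaCoeff p (k + 1) * (2 * ((k : ℝ) + 1) * (p + 2 * (k + 1))) = alphaCoeff p k := by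
  have hk := gamma_half_pos hp k
  have hk0 : (0 : ℝ) < k + p / 2 + 1 := by have := k.cast_nonneg (α := ℝ); linarith
  have hf : (0 : ℝ) < k.factorial := by positivity
  unfold alphaCoeff
  rw [gamma_half_succ hp, Nat.factorial_succ]
  push_cast
  have : p + 2 * ((k : ℝ) + 1) = 2 * (k + p / 2 + 1) := by ring
  rw [this]
  generalize Real.Gamma ((k : ℝ) + p / 2 + 1) = G at hk ⊢
  generalize (k : ℝ) + p / 2 + 1 = q at hk0 ⊢
  field_simp
  ring

lemma alphaCoeff_shift {p : ℝ} (hp : -2 < p) (k : ℕ) :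
    alphaCoeff (p + 2) k = alphaCoeff p (k + 1) * (2 * ((k : ℝ) + 1) * (p + 2)) := by
  have hk := gamma_half_pos hp (k + 1)
  have hk0 : (0 : ℝ) < p / 2 + 1 := by linarith
  have hf : (0 : ℝ) < k.factorial := by positivity
  unfold alphaCoeff
  have e1 : (p + 2) / 2 + 1 = (p / 2 + 1) + 1 := by ring
  have e2 : (k : ℝ) + (p + 2) / 2 + 1 = ((k + 1 : ℕ) : ℝ) + p / 2 + 1 := by push_cast; ring
  rw [e1, Real.Gamma_add_one hk0.ne', e2, Nat.factorial_succ]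
  have hk1 : (0 : ℝ) < k + 1 := by positivity
  have hp2 : p + 2 = 2 * (p / 2 + 1) := by ring
  rw [hp2]
  push_cast
  push_cast at hk
  field_simp
  ring

/-- Consecutive coefficients have ratio `1 / (2(k+1)(p+2(k+1)))`, which is at most `1/(k+1)` once `p
≥ -1`. The range down to `-1` lets the contiguous relation reach the index `p - 2` for every `p ≥
1`. -/
lemma alphaCoeff_le {p : ℝ} (hp : -1 ≤ p) (k : ℕ) : alphaCoeff p k ≤ 1 / (k.factorial : ℝ) := by
  induction k with
  | zero => simp [alphaCoeff_zero (by linarith : -2 < p)]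
  | succ k ih =>
    have h := alphaCoeff_succ (by linarith : -2 < p) k
    have hpos := alphaCoeff_pos (by linarith : -2 < p) (k + 1)
    have hk0 : (0 : ℝ) ≤ k := by positivity
    have hf : (0 : ℝ) < k.factorial := by positivity
    rw [Nat.factorial_succ, le_div_iff₀ (by positivity)]
    rw [← h, le_div_iff₀ hf] at ih
    push_cast
    have : alphaCoeff p (k + 1) * ((k + 1) * (k.factorial : ℝ))
      ≤ alphaCoeff p (k + 1) * (2 * ((k : ℝ) + 1) * (p + 2 * (k + 1))) * k.factorial := by
      have : alphaCoeff p (k + 1) * (2 * ((k : ℝ) + 1) * (p + 2 * (k + 1))) * k.factorial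
        = alphaCoeff p (k + 1) * ((k + 1) * (k.factorial : ℝ)) * (2 * (p + 2 * (k + 1))) := by ring
      rw [this]
      exact le_mul_of_one_le_right (by positivity) (by linarith)
    linarith

lemma summable_alphaSeries {p : ℝ} (hp : -1 ≤ p) (x : ℝ) :
    Summable fun k : ℕ => alphaCoeff p k * x ^ (2 * k) := by
  refine Summable.of_norm_bounded (Real.summable_pow_div_factorial (x ^ 2)) fun k => ?_
  have hpos := (alphaCoeff_pos (by linarith : -2 < p) k).le
  rw [Real.norm_eq_abs, abs_of_nonneg (mul_nonneg hpos (by rw [pow_mul]; positivity)), pow_mul,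
    div_eq_inv_mul, ← one_div]
  exact mul_le_mul_of_nonneg_right (alphaCoeff_le hp k) (by positivity)

/-- Termwise differentiation, dominated on a ball of radius `|x| + 1`. The coefficient shift
identifies the derived series with the series of index `p + 2`. -/
lemma alphaSeries_hasDerivAt {p : ℝ} (hp : -1 ≤ p) (x : ℝ) :
    HasDerivAt (alphaSeries p) (x * alphaSeries (p + 2) x / (p + 2)) x := by
  have hp2 : 0 < p + 2 := by linarith
  have hp' : -2 < p := by linarith
  set R : ℝ := |x| + 1
  have hR : 0 < R := by positivity
  have key : ∀ k : ℕ, alphaCoeff p (k + 1) * (((2 * (k + 1) : ℕ) : ℝ)) =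
      alphaCoeff (p + 2) k / (p + 2) := by
    intro k
    rw [alphaCoeff_shift hp']
    push_cast
    field_simp
  have hd : HasDerivAt (fun z => ∑' k : ℕ, alphaCoeff p k * z ^ (2 * k))
      (∑' k : ℕ, alphaCoeff p k * (((2 * k : ℕ) : ℝ) * x ^ (2 * k - 1))) x := by
    refine hasDerivAt_tsum_of_isPreconnected (𝕜 := ℝ)
      (g := fun (k : ℕ) (z : ℝ) => alphaCoeff p k * z ^ (2 * k))
      (g' := fun (k : ℕ) (z : ℝ) => alphaCoeff p k * (((2 * k : ℕ) : ℝ) * z ^ (2 * k - 1)))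
      (u := fun k : ℕ => alphaCoeff p k * (((2 * k : ℕ) : ℝ) * R ^ (2 * k - 1)))
      (t := Metric.ball 0 R) (y₀ := x) ?_ Metric.isOpen_ball
      (convex_ball (0 : ℝ) R).isPreconnected ?_ ?_ ?_ (summable_alphaSeries hp x) ?_
    · rw [← summable_nat_add_iff 1]
      have := (summable_alphaSeries (by linarith : -1 ≤ p + 2) R).mul_left (R / (p + 2))
      refine this.congr fun k => ?_
      have h := key k
      rw [← mul_assoc (alphaCoeff p (k + 1)), h]
      have : 2 * (k + 1) - 1 = 2 * k + 1 := by omega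
      rw [this]; ring
    · intro k y _
      exact (hasDerivAt_pow (2 * k) y).const_mul _
    · intro k y hy
      have hy' : |y| ≤ R := by simpa using (mem_ball_zero_iff.1 hy).le
      have hpos := (alphaCoeff_pos hp' k).le
      rw [Real.norm_eq_abs, abs_mul, abs_mul, abs_of_nonneg hpos, abs_of_nonneg (by positivity),
        abs_pow]
      gcongr
    · simp [R]
    · simp [R]
  have e : ∑' k : ℕ, alphaCoeff p k * (((2 * k : ℕ) : ℝ) * x ^ (2 * k - 1))
      = x * alphaSeries (p + 2) x / (p + 2) := by
    rw [tsum_eq_zero_add']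
    · simp only [mul_zero, Nat.cast_zero, zero_mul, zero_add]
      rw [mul_div_right_comm, alphaSeries, ← tsum_mul_left]
      refine tsum_congr fun k => ?_
      rw [← mul_assoc, key]
      have : 2 * (k + 1) - 1 = 2 * k + 1 := by omega
      rw [this]; ring
    · have := (summable_alphaSeries (by linarith : -1 ≤ p + 2) x).mul_left (x / (p + 2))
      refine this.congr fun k => ?_
      have h := key k
      rw [← mul_assoc (alphaCoeff p (k + 1)), h]
      have : 2 * (k + 1) - 1 = 2 * k + 1 := by omega
      rw [this]; ring
  rw [← e]; exact hd

/-- Comparison of the coefficients of `x^(2k)`. It expresses the index `n - 2` occurring in `φ`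
through `α_n` and its derivative. -/
lemma alphaSeries_rec {p : ℝ} (hp : 1 ≤ p) (x : ℝ) :
    alphaSeries (p - 2) x = alphaSeries p x + x ^ 2 * alphaSeries (p + 2) x / (p * (p + 2)) := by
  have h1 := summable_alphaSeries (by linarith : -1 ≤ p) x
  have h2 := summable_alphaSeries (by linarith : -1 ≤ p + 2) x
  have h3 := summable_alphaSeries (by linarith : -1 ≤ p - 2) x
  unfold alphaSeries
  rw [h1.tsum_eq_zero_add, h3.tsum_eq_zero_add, add_assoc, mul_div_right_comm, ← tsum_mul_left,
    ← Summable.tsum_add ((summable_nat_add_iff 1).2 h1) (h2.mul_left _)]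
  congr 1
  · simp [alphaCoeff_zero (by linarith : -2 < p), alphaCoeff_zero (by linarith : -2 < p - 2)]
  · refine tsum_congr fun k => ?_
    have a1 := alphaCoeff_shift (by linarith : -2 < p) k
    have a2 := alphaCoeff_shift (by linarith : -2 < p - 2) k
    have a3 := alphaCoeff_succ (by linarith : -2 < p) k
    have hk : (0 : ℝ) < k + 1 := by positivity
    have e : p - 2 + 2 = p := by ring
    rw [e] at a2
    have a4 : alphaCoeff (p - 2) (k + 1) = alphaCoeff p (k + 1) * (p + 2 * (k + 1)) / p := by
      rw [← a3] at a2
      field_simp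
      have : 2 * ((k : ℝ) + 1) ≠ 0 := by positivity
      apply mul_left_cancel₀ this
      linarith
    rw [a4, a1]
    have : (p + 2) ≠ 0 := by linarith
    have : p ≠ 0 := by linarith
    field_simp
    ring

lemma one_le_alphaSeries {p : ℝ} (hp : -1 ≤ p) (x : ℝ) : 1 ≤ alphaSeries p x := by
  have h := (summable_alphaSeries hp x).le_tsum 0 fun k _ =>
    mul_nonneg (alphaCoeff_pos (by linarith) k).le (by rw [pow_mul]; positivity)
  simpa [alphaSeries, alphaCoeff_zero (by linarith : -2 < p)] using h

lemma alphaSeries_zero {p : ℝ} (hp : -1 ≤ p) : alphaSeries p 0 = 1 := by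
  rw [alphaSeries, tsum_eq_single 0]
  · simp [alphaCoeff_zero (by linarith : -2 < p)]
  · intro k hk
    simp [hk]

lemma alpha_eq_alphaSeries {p : ℝ} (hp : 0 < p) {r : ℝ} (hr : 0 ≤ r) :
    alpha p r = alphaSeries p r := by
  rcases hr.eq_or_lt with rfl | hr
  · simp [alpha, alphaSeries_zero (by linarith : -1 ≤ p)]
  rw [alpha, if_neg hr.ne', besselI, ← tsum_mul_left, alphaSeries]
  refine tsum_congr fun k => ?_
  rw [besselConst, alphaCoeff, Real.rpow_add (by positivity), Real.div_rpow hr.le (by norm_num) (p / 2),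
    Real.rpow_neg hr.le]
  have e : (2 : ℝ) * (k : ℝ) = ((2 * k : ℕ) : ℝ) := by push_cast; ring
  rw [e, Real.rpow_natCast, div_pow]
  have h4 : (2 : ℝ) ^ (2 * k) = 4 ^ k := by rw [pow_mul]; norm_num
  rw [h4]
  have h1 : (0 : ℝ) < r ^ (p / 2) := by positivity
  have h2 : (0 : ℝ) < 2 ^ (p / 2) := by positivity
  have h3 := gamma_half_pos (by linarith : -2 < p) k
  field_simp

end

/-! ### The decaying Bessel solution -/

noncomputable section

lemma sq_div_four_le_cosh {t : ℝ} (ht : 0 ≤ t) : t ^ 2 / 4 ≤ Real.cosh t := by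
  have h1 := Real.quadratic_le_exp_of_nonneg ht
  have h2 := Real.exp_pos (-t)
  rw [Real.cosh_eq]; nlinarith

lemma integrableOn_exp_neg_cosh_mul_exp {x : ℝ} (hx : 0 < x) (c : ℝ) :
    IntegrableOn (fun t => Real.exp (-x * Real.cosh t) * Real.exp (c * t)) (Ioi 0) := by
  have hdom : IntegrableOn (fun t : ℝ => Real.exp ((c + 1) ^ 2 / x) * Real.exp (-t)) (Ioi 0) :=
    (integrableOn_exp_neg_Ioi 0).const_mul _
  refine hdom.mono' (Continuous.aestronglyMeasurable (by fun_prop)) ?_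
  refine (ae_restrict_mem measurableSet_Ioi).mono fun t ht => ?_
  have ht0 : (0 : ℝ) ≤ t := le_of_lt ht
  rw [Real.norm_eq_abs, abs_of_pos (by positivity), ← Real.exp_add, ← Real.exp_add]
  apply Real.exp_le_exp.2
  -- Since `cosh t ≥ t²/4`, completing the square in `-x t²/4 + (c+1) t` leaves a remainder of at
  -- most `(c+1)²/x`; the spare `-t` in the exponent ensures integrability.
  have h1 := mul_le_mul_of_nonneg_left (sq_div_four_le_cosh ht0) hx.le
  have h2 : (c + 1) ^ 2 / x - (c + 1) * t + x * (t ^ 2 / 4) = (x * t / 2 - (c + 1)) ^ 2 / x := by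
    field_simp; ring
  have h3 : 0 ≤ (x * t / 2 - (c + 1)) ^ 2 / x := by positivity
  nlinarith

lemma cosh_mul_le_exp {ν t : ℝ} (ht : 0 ≤ t) : Real.cosh (ν * t) ≤ Real.exp (|ν| * t) := by
  rw [← Real.cosh_abs, abs_mul, abs_of_nonneg ht]
  have : Real.sinh (|ν| * t) + Real.cosh (|ν| * t) = Real.exp (|ν| * t) := Real.sinh_add_cosh _
  have h2 : 0 ≤ Real.sinh (|ν| * t) := Real.sinh_nonneg_iff.2 (by positivity)
  linarith

lemma integrableOn_besselK {x : ℝ} (hx : 0 < x) (ν : ℝ) :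
    IntegrableOn (fun t => Real.exp (-x * Real.cosh t) * Real.cosh (ν * t)) (Ioi 0) := by
  refine (integrableOn_exp_neg_cosh_mul_exp hx |ν|).mono'
    (Continuous.aestronglyMeasurable (by fun_prop)) ?_
  refine (ae_restrict_mem measurableSet_Ioi).mono fun t ht => ?_
  rw [Real.norm_eq_abs, abs_of_pos (mul_pos (Real.exp_pos _) (Real.cosh_pos _))]
  exact mul_le_mul_of_nonneg_left (cosh_mul_le_exp (le_of_lt ht)) (Real.exp_pos _).le

lemma cosh_mul_cosh_eq (ν t : ℝ) : Real.cosh t * Real.cosh (ν * t)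
    = (Real.cosh ((ν + 1) * t) + Real.cosh ((ν - 1) * t)) / 2 := by
  have e1 : (ν + 1) * t = ν * t + t := by ring
  have e2 : (ν - 1) * t = ν * t - t := by ring
  rw [e1, e2, Real.cosh_add, Real.cosh_sub]; ring

lemma sinh_mul_sinh_eq (ν t : ℝ) : Real.sinh t * Real.sinh (ν * t)
    = (Real.cosh ((ν + 1) * t) - Real.cosh ((ν - 1) * t)) / 2 := by
  have e1 : (ν + 1) * t = ν * t + t := by ring
  have e2 : (ν - 1) * t = ν * t - t := by ring
  rw [e1, e2, Real.cosh_add, Real.cosh_sub]; ring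

lemma besselK_hasDerivAt (ν : ℝ) {x : ℝ} (hx : 0 < x) :
    HasDerivAt (besselK ν) (-(besselK (ν + 1) x + besselK (ν - 1) x) / 2) x := by
  have hx2 : 0 < x / 2 := by positivity
  have hInt : ∀ y : ℝ, 0 < y → IntegrableOn
      (fun t => Real.exp (-y * Real.cosh t) * (Real.cosh t * Real.cosh (ν * t))) (Ioi 0) := by
    intro y hy
    have := ((integrableOn_besselK hy (ν + 1)).add (integrableOn_besselK hy (ν - 1))).div_const 2
    refine this.congr (Eventually.of_forall fun t => ?_)
    simp only [Pi.add_apply]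
    rw [cosh_mul_cosh_eq]; ring
  have key := hasDerivAt_integral_of_dominated_loc_of_deriv_le
    (μ := volume.restrict (Ioi (0 : ℝ))) (s := Ioi (x / 2)) (x₀ := x)
    (F := fun y t => Real.exp (-y * Real.cosh t) * Real.cosh (ν * t))
    (F' := fun y t => -(Real.exp (-y * Real.cosh t) * (Real.cosh t * Real.cosh (ν * t))))
    (bound := fun t => Real.exp (-(x / 2) * Real.cosh t) * (Real.cosh t * Real.cosh (ν * t)))
    (Ioi_mem_nhds (by linarith))
    (Eventually.of_forall fun y => Continuous.aestronglyMeasurable (by fun_prop))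
    (integrableOn_besselK hx ν) (Continuous.aestronglyMeasurable (by fun_prop))
    (Eventually.of_forall fun t y hy => ?_) (hInt _ hx2)
    (Eventually.of_forall fun t y hy => ?_)
  · refine (key.2).congr_deriv ?_
    have : ∫ t in Ioi (0 : ℝ), -(Real.exp (-x * Real.cosh t) * (Real.cosh t * Real.cosh (ν * t)))
        = ∫ t in Ioi (0 : ℝ), -((Real.exp (-x * Real.cosh t) * Real.cosh ((ν + 1) * t)
          + Real.exp (-x * Real.cosh t) * Real.cosh ((ν - 1) * t)) / 2) := by
      congr 1; ext t; rw [cosh_mul_cosh_eq]; ring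
    rw [this, integral_neg, integral_div, integral_add (integrableOn_besselK hx _)
      (integrableOn_besselK hx _)]
    simp only [besselK]; ring
  · have hc := Real.cosh_pos t
    have hc' := Real.cosh_pos (ν * t)
    rw [norm_neg, Real.norm_eq_abs, abs_of_pos (by positivity)]
    have hy' : x / 2 ≤ y := le_of_lt hy
    gcongr
  · have h1 : HasDerivAt (fun y => -y * Real.cosh t) (-Real.cosh t) y := by
      simpa using ((hasDerivAt_id y).neg.mul_const (Real.cosh t))
    refine (h1.exp.mul_const _).congr_deriv ?_
    ring

/-- Integrate the derivative of `exp(-x cosh t) sinh(ν t)`, which vanishes both at `0` and at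
infinity. -/
lemma besselK_rec (ν : ℝ) {x : ℝ} (hx : 0 < x) :
    besselK (ν + 1) x - besselK (ν - 1) x = 2 * ν / x * besselK ν x := by
  have hd : ∀ t ∈ Ici (0 : ℝ), HasDerivAt (fun t => Real.exp (-x * Real.cosh t) * Real.sinh (ν * t))
      (ν * (Real.exp (-x * Real.cosh t) * Real.cosh (ν * t))
        - x / 2 * (Real.exp (-x * Real.cosh t) * Real.cosh ((ν + 1) * t)
          - Real.exp (-x * Real.cosh t) * Real.cosh ((ν - 1) * t))) t := by
    intro t _
    have h1 : HasDerivAt (fun t => -x * Real.cosh t) (-x * Real.sinh t) t :=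
      (Real.hasDerivAt_cosh t).const_mul _
    have h2 : HasDerivAt (fun t => Real.sinh (ν * t)) (Real.cosh (ν * t) * ν) t := by
      simpa using ((hasDerivAt_id t).const_mul ν).sinh
    refine (h1.exp.mul h2).congr_deriv ?_
    have := sinh_mul_sinh_eq ν t
    linear_combination (-x * Real.exp (-x * Real.cosh t)) * this
  have i0 := integrableOn_besselK hx ν
  have i1 := integrableOn_besselK hx (ν + 1)
  have i2 := integrableOn_besselK hx (ν - 1)
  have hlim : Tendsto (fun t => Real.exp (-x * Real.cosh t) * Real.sinh (ν * t)) atTop (𝓝 0) := by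
    refine squeeze_zero_norm' (a := fun t => Real.exp ((|ν| + 1) ^ 2 / x) * Real.exp (-t)) ?_ ?_
    · filter_upwards [eventually_ge_atTop 0] with t ht
      rw [Real.norm_eq_abs, abs_mul, abs_of_pos (Real.exp_pos _)]
      have hs : |Real.sinh (ν * t)| ≤ Real.exp (|ν| * t) := by
        refine le_trans ?_ (cosh_mul_le_exp ht)
        rw [abs_le]
        have := Real.exp_pos (ν * t)
        have h2 := Real.exp_pos (-(ν * t))
        rw [Real.sinh_eq, Real.cosh_eq]
        constructor <;> linarith
      refine (mul_le_mul_of_nonneg_left hs (Real.exp_pos _).le).trans ?_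
      rw [← Real.exp_add, ← Real.exp_add]
      apply Real.exp_le_exp.2
      have h1 := mul_le_mul_of_nonneg_left (sq_div_four_le_cosh ht) hx.le
      have h2 : (|ν| + 1) ^ 2 / x - (|ν| + 1) * t + x * (t ^ 2 / 4)
          = (x * t / 2 - (|ν| + 1)) ^ 2 / x := by
        field_simp; ring
      have h3 : 0 ≤ (x * t / 2 - (|ν| + 1)) ^ 2 / x := by positivity
      nlinarith
    · have := (Real.tendsto_exp_neg_atTop_nhds_zero).const_mul (Real.exp ((|ν| + 1) ^ 2 / x))
      simpa using this
  have key := integral_Ioi_of_hasDerivAt_of_tendsto' hd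
    ((i0.const_mul ν).sub ((i1.sub i2).const_mul (x / 2))) hlim
  have hs : ∫ t in Ioi (0 : ℝ), (ν * (Real.exp (-x * Real.cosh t) * Real.cosh (ν * t))
        - x / 2 * (Real.exp (-x * Real.cosh t) * Real.cosh ((ν + 1) * t)
          - Real.exp (-x * Real.cosh t) * Real.cosh ((ν - 1) * t)))
      = ν * besselK ν x - x / 2 * (besselK (ν + 1) x - besselK (ν - 1) x) := by
    have h12 : IntegrableOn (fun t => Real.exp (-x * Real.cosh t) * Real.cosh ((ν + 1) * t)
        - Real.exp (-x * Real.cosh t) * Real.cosh ((ν - 1) * t)) (Ioi 0) := i1.sub i2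
    rw [integral_sub (i0.const_mul ν) (h12.const_mul (x / 2)), integral_const_mul,
      integral_const_mul, integral_sub i1 i2]
    rfl
  rw [hs] at key
  simp at key
  field_simp
  linarith

lemma besselK_pos (ν : ℝ) {x : ℝ} (hx : 0 < x) : 0 < besselK ν x := by
  rw [besselK, setIntegral_pos_iff_support_of_nonneg_ae _ (integrableOn_besselK hx ν)]
  · have : Function.support (fun t => Real.exp (-x * Real.cosh t) * Real.cosh (ν * t)) = univ := by
      ext t
      simp [Function.mem_support, (Real.cosh_pos _).ne']
    rw [this]; simp
  · exact Eventually.of_forall fun t => (mul_pos (Real.exp_pos _) (Real.cosh_pos _)).le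

lemma besselK_mono {ν ν' : ℝ} (h : |ν| ≤ |ν'|) {x : ℝ} (hx : 0 < x) :
    besselK ν x ≤ besselK ν' x := by
  refine setIntegral_mono_on (integrableOn_besselK hx ν) (integrableOn_besselK hx ν')
    measurableSet_Ioi fun t ht => ?_
  refine mul_le_mul_of_nonneg_left ?_ (Real.exp_pos _).le
  rw [Real.cosh_le_cosh, abs_mul, abs_mul]
  exact mul_le_mul_of_nonneg_right h (abs_nonneg _)

lemma besselK_le_exp (ν : ℝ) {x : ℝ} (hx : 1 ≤ x) :
    besselK ν x ≤ Real.exp (-(x - 1)) * besselK ν 1 := by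
  rw [besselK, besselK, ← integral_const_mul]
  refine setIntegral_mono_on (integrableOn_besselK (by linarith) ν)
    ((integrableOn_besselK one_pos ν).const_mul _) measurableSet_Ioi fun t _ => ?_
  rw [← mul_assoc, ← Real.exp_add]
  refine mul_le_mul_of_nonneg_right (Real.exp_le_exp.2 ?_) (Real.cosh_pos _).le
  have := mul_le_mul_of_nonneg_left (Real.one_le_cosh t) (by linarith : 0 ≤ x - 1)
  linarith

lemma gamma_integral_exp {ν : ℝ} (hν : 0 < ν) :
    Integrable (fun τ => Real.exp (-Real.exp τ + ν * τ)) ∧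
      ∫ τ, Real.exp (-Real.exp τ + ν * τ) = Real.Gamma ν := by
  have himg : Real.exp '' univ = Ioi 0 := by simp [Real.range_exp]
  have hinj : InjOn Real.exp univ := Real.exp_injective.injOn
  have hder : ∀ x ∈ (univ : Set ℝ), HasDerivWithinAt Real.exp (Real.exp x) univ x :=
    fun x _ => (Real.hasDerivAt_exp x).hasDerivWithinAt
  have hfun : (fun τ => |Real.exp τ| • (Real.exp (-Real.exp τ) * (Real.exp τ) ^ (ν - 1)))
      = fun τ => Real.exp (-Real.exp τ + ν * τ) := by
    ext τ
    rw [abs_of_pos (Real.exp_pos _), ← Real.exp_mul, smul_eq_mul, ← Real.exp_add, ← Real.exp_add]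
    ring_nf
  constructor
  · have := (integrableOn_image_iff_integrableOn_abs_deriv_smul MeasurableSet.univ hder hinj
      (fun x => Real.exp (-x) * x ^ (ν - 1))).1 (by
        rw [himg]; exact Real.GammaIntegral_convergent hν)
    rw [hfun] at this
    simpa using this
  · have := integral_image_eq_integral_abs_deriv_smul MeasurableSet.univ hder hinj
      (fun x => Real.exp (-x) * x ^ (ν - 1))
    rw [himg, ← Real.Gamma_eq_integral hν, hfun] at this
    simpa using this.symm

/-- By evenness `2 K_ν` is the integral of `exp(-x cosh t + ν t)` over the whole line, and the
translation by `log(2/x)` extracts the power of `x`. The remaining integrand is dominated by its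
value at `x = 0`, a Gamma integrand, which gives the behaviour at the origin. -/
lemma besselK_eq_integral (ν : ℝ) {x : ℝ} (hx : 0 < x) :
    x ^ ν * besselK ν x = 2 ^ (ν - 1) *
      ∫ τ, Real.exp (-Real.exp τ - x ^ 2 / 4 * Real.exp (-τ) + ν * τ) := by
  set g : ℝ → ℝ := fun t => Real.exp (-x * Real.cosh t + ν * t) with hg
  have hgi : IntegrableOn g (Ioi 0) := by
    refine (integrableOn_exp_neg_cosh_mul_exp hx ν).congr (Eventually.of_forall fun t => ?_)
    simp only [hg, Real.exp_add]
  have hgi' : IntegrableOn (fun t => g (-t)) (Ioi 0) := by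
    refine (integrableOn_exp_neg_cosh_mul_exp hx (-ν)).congr (Eventually.of_forall fun t => ?_)
    simp only [hg, Real.exp_add, Real.cosh_neg]; ring_nf
  have hK : 2 * besselK ν x = ∫ t, g t := by
    have h1 : ∫ t, g t = (∫ t in Iic 0, g t) + ∫ t in Ioi 0, g t := by
      have hi : IntegrableOn g (Iic 0) := by
        have := (integrable_indicator_iff measurableSet_Ioi).2 hgi'
        have h2 := this.comp_neg
        have h3 : (fun t => (Ioi (0 : ℝ)).indicator (fun t => g (-t)) (-t))
            = (Iio (0 : ℝ)).indicator g := by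
          ext t; simp [indicator]
        rw [h3, integrable_indicator_iff measurableSet_Iio] at h2
        exact (integrableOn_Iic_iff_integrableOn_Iio).2 h2
      have := setIntegral_union (s := Iic (0 : ℝ)) (t := Ioi 0) (f := g) (μ := volume)
        (by simp [Set.disjoint_left]) measurableSet_Ioi hi hgi
      rw [← this]; simp
    have h2 : ∫ t in Iic 0, g t = ∫ t in Ioi 0, g (-t) := by
      simp [integral_comp_neg_Ioi (0 : ℝ) g]
    rw [h1, h2, ← integral_add hgi' hgi, besselK, ← integral_const_mul]
    congr 1; ext t
    simp only [hg, Real.exp_add, Real.cosh_neg]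
    rw [Real.cosh_eq (ν * t)]; ring_nf
  have hshift : ∫ t, g t = (2 / x) ^ ν *
      ∫ τ, Real.exp (-Real.exp τ - x ^ 2 / 4 * Real.exp (-τ) + ν * τ) := by
    rw [← integral_add_right_eq_self g (Real.log (2 / x)), ← integral_const_mul]
    congr 1; ext τ
    have hpos : (0 : ℝ) < 2 / x := by positivity
    simp only [hg]
    have hc : Real.cosh (τ + Real.log (2 / x))
        = (Real.exp τ * (2 / x) + Real.exp (-τ) * (2 / x)⁻¹) / 2 := by
      rw [Real.cosh_eq, neg_add, Real.exp_add, Real.exp_add, Real.exp_neg (Real.log _),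
        Real.exp_log hpos]
    rw [Real.rpow_def_of_pos hpos, ← Real.exp_add, hc]
    congr 1
    field_simp
    ring
  have e : x ^ ν * (2 / x) ^ ν = 2 ^ ν := by
    rw [← Real.mul_rpow hx.le (by positivity)]; congr 1; field_simp
  have h2 : (2 : ℝ) ^ (ν - 1) = 2 ^ ν / 2 := by
    rw [Real.rpow_sub (by norm_num), Real.rpow_one]
  have : besselK ν x = (2 / x) ^ ν *
      (∫ τ, Real.exp (-Real.exp τ - x ^ 2 / 4 * Real.exp (-τ) + ν * τ)) / 2 := by
    rw [← hshift, ← hK]; ring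
  rw [this, h2, ← e]; ring

lemma tendsto_rpow_mul_besselK {ν : ℝ} (hν : 0 < ν) :
    Tendsto (fun x => x ^ ν * besselK ν x) (𝓝[>] 0) (𝓝 (2 ^ (ν - 1) * Real.Gamma ν)) := by
  obtain ⟨hi, he⟩ := gamma_integral_exp hν
  have hlim : Tendsto (fun x : ℝ => ∫ τ, Real.exp (-Real.exp τ - x ^ 2 / 4 * Real.exp (-τ) + ν * τ))
      (𝓝[>] 0) (𝓝 (∫ τ, Real.exp (-Real.exp τ + ν * τ))) := by
    refine tendsto_integral_filter_of_dominated_convergence _ ?_ ?_ hi ?_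
    · exact Eventually.of_forall fun x => Continuous.aestronglyMeasurable (by fun_prop)
    · refine Eventually.of_forall fun x => Eventually.of_forall fun τ => ?_
      rw [Real.norm_eq_abs, abs_of_pos (Real.exp_pos _)]
      apply Real.exp_le_exp.2
      have : 0 ≤ x ^ 2 / 4 * Real.exp (-τ) := by positivity
      linarith
    · refine Eventually.of_forall fun τ => ?_
      have hc : Continuous fun x : ℝ => Real.exp (-Real.exp τ - x ^ 2 / 4 * Real.exp (-τ) + ν * τ) := by
        fun_prop
      have := hc.tendsto 0
      simp only [ne_eq, OfNat.ofNat_ne_zero, not_false_eq_true, zero_pow, zero_div, zero_mul,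
        sub_zero] at this
      exact this.mono_left nhdsWithin_le_nhds
  rw [he] at hlim
  refine (hlim.const_mul _).congr' ?_
  filter_upwards [self_mem_nhdsWithin] with x hx
  exact (besselK_eq_integral ν hx).symm

lemma besselConst_pos {p : ℝ} (hp : -2 < p) : 0 < besselConst p :=
  mul_pos (by positivity) (Real.Gamma_pos_of_pos (by linarith))

lemma besselConst_add_two {p : ℝ} (hp : -2 < p) :
    besselConst (p + 2) = (p + 2) * besselConst p := by
  have e : (p + 2) / 2 = p / 2 + 1 := by ring
  rw [besselConst, besselConst, e, Real.Gamma_add_one (by linarith : p / 2 + 1 ≠ 0),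
    Real.rpow_add (by norm_num), Real.rpow_one]
  ring

lemma beta_pos {p : ℝ} (hp : -2 < p) {x : ℝ} (hx : 0 < x) : 0 < beta p x := by
  have := besselConst_pos hp
  have := besselK_pos (p / 2) hx
  unfold beta; positivity

lemma beta_hasDerivAt {p : ℝ} (hp : -2 < p) {x : ℝ} (hx : 0 < x) :
    HasDerivAt (beta p) (-(p + 2) * x * beta (p + 2) x) x := by
  have hc := besselConst_pos hp
  have h1 : HasDerivAt (fun x : ℝ => x ^ (-(p / 2))) (-(p / 2) * x ^ (-(p / 2) - 1)) x :=
    Real.hasDerivAt_rpow_const (Or.inl hx.ne')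
  have h2 := besselK_hasDerivAt (p / 2) hx
  have h3 := besselK_rec (p / 2) hx
  refine ((h1.const_mul (besselConst p)⁻¹).mul h2).congr_deriv ?_
  have e1 : (p + 2) / 2 = p / 2 + 1 := by ring
  have e3 : x ^ (-(p / 2 + 1)) = x ^ (-(p / 2)) / x := by
    rw [neg_add, Real.rpow_add hx, Real.rpow_neg_one]; ring
  have e2 : x ^ (-(p / 2) - 1) = x ^ (-(p / 2)) / x := by
    rw [Real.rpow_sub hx, Real.rpow_one]
  have hK : besselK (p / 2 - 1) x = besselK (p / 2 + 1) x - 2 * (p / 2) / x * besselK (p / 2) x := by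
    linarith
  rw [beta, besselConst_add_two hp, e1, e3, e2, hK]
  have : p + 2 ≠ 0 := by linarith
  field_simp
  ring

lemma beta_rec {p : ℝ} (hp : 0 < p) {x : ℝ} (hx : 0 < x) :
    beta (p - 2) x = p * ((p + 2) * x ^ 2 * beta (p + 2) x - p * beta p x) := by
  have hc := besselConst_pos (by linarith : -2 < p)
  have h3 := besselK_rec (p / 2) hx
  have e1 : (p + 2) / 2 = p / 2 + 1 := by ring
  have e1' : (p - 2) / 2 = p / 2 - 1 := by ring
  have e3 : x ^ (-(p / 2 + 1)) = x ^ (-(p / 2)) / x := by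
    rw [neg_add, Real.rpow_add hx, Real.rpow_neg_one]; ring
  have e2 : x ^ (-(p / 2 - 1)) = x ^ (-(p / 2)) * x := by
    rw [neg_sub, sub_eq_neg_add, Real.rpow_add hx, Real.rpow_one]
  have hcc : besselConst p = p * besselConst (p - 2) := by
    have := besselConst_add_two (by linarith : -2 < p - 2)
    simpa using this
  have hc' : besselConst (p - 2) = besselConst p / p := by rw [hcc]; field_simp
  have hK : besselK (p / 2 - 1) x = besselK (p / 2 + 1) x - 2 * (p / 2) / x * besselK (p / 2) x := by
    linarith
  simp only [beta]
  rw [besselConst_add_two (by linarith : -2 < p), e1, e1', e3, e2, hK, hc']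
  have : p + 2 ≠ 0 := by linarith
  field_simp

/-- `K_ν` increases with `|ν|`, and `|p/2 - 1| ≤ p/2` when `p ≥ 1`. Through the recurrence this
becomes an upper bound for the logarithmic derivative of `β`. -/
lemma beta_sub_two_le {p : ℝ} (hp : 1 ≤ p) {x : ℝ} (hx : 0 < x) :
    beta (p - 2) x ≤ p * x * beta p x := by
  have hc := besselConst_pos (by linarith : -2 < p)
  have e1' : (p - 2) / 2 = p / 2 - 1 := by ring
  have e2 : x ^ (-(p / 2 - 1)) = x ^ (-(p / 2)) * x := by
    rw [neg_sub, sub_eq_neg_add, Real.rpow_add hx, Real.rpow_one]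
  have hcc : besselConst p = p * besselConst (p - 2) := by
    have := besselConst_add_two (by linarith : -2 < p - 2)
    simpa using this
  have hc' : besselConst (p - 2) = besselConst p / p := by rw [hcc]; field_simp
  have hm : besselK (p / 2 - 1) x ≤ besselK (p / 2) x := by
    apply besselK_mono _ hx
    rw [abs_of_nonneg (by linarith : 0 ≤ p / 2), abs_le]
    constructor <;> linarith
  rw [beta, beta, e1', e2, hc']
  have : (besselConst p / p)⁻¹ * (x ^ (-(p / 2)) * x) * besselK (p / 2 - 1) x
      = (p * x * ((besselConst p)⁻¹ * x ^ (-(p / 2)))) * besselK (p / 2 - 1) x := by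
    field_simp
  rw [this]
  refine (mul_le_mul_of_nonneg_left hm (by positivity)).trans (le_of_eq (by ring))

/-- The constants `c_p` are normalised so that this limit is `1/p`; it fixes the value of the
Wronskian. -/
lemma tendsto_rpow_mul_beta {p : ℝ} (hp : 0 < p) :
    Tendsto (fun x => x ^ p * beta p x) (𝓝[>] 0) (𝓝 (1 / p)) := by
  have h := (tendsto_rpow_mul_besselK (by linarith : 0 < p / 2)).const_mul (besselConst p)⁻¹
  have e : (besselConst p)⁻¹ * (2 ^ (p / 2 - 1) * Real.Gamma (p / 2)) = 1 / p := by
    have hG := Real.Gamma_pos_of_pos (by linarith : 0 < p / 2)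
    rw [besselConst, Real.Gamma_add_one (by linarith), Real.rpow_sub (by norm_num), Real.rpow_one]
    field_simp
  rw [e] at h
  refine h.congr' ?_
  filter_upwards [self_mem_nhdsWithin] with x hx
  have hx : 0 < x := hx
  rw [beta]
  have : x ^ p = x ^ (p / 2) * x ^ (p / 2) := by rw [← Real.rpow_add hx]; ring_nf
  rw [this, Real.rpow_neg hx.le]
  field_simp

lemma beta_le_exp {p : ℝ} (hp : 0 ≤ p) {x : ℝ} (hx : 1 ≤ x) :
    beta p x ≤ beta p 1 * Real.exp 1 * Real.exp (-x) := by
  have hc := besselConst_pos (by linarith : -2 < p)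
  have h1 := besselK_le_exp (p / 2) hx
  have h2 : x ^ (-(p / 2)) ≤ 1 := Real.rpow_le_one_of_one_le_of_nonpos hx (by linarith)
  have h3 := besselK_pos (p / 2) one_pos
  have h4 := besselK_pos (p / 2) (by linarith : 0 < x)
  have e : Real.exp (-(x - 1)) = Real.exp 1 * Real.exp (-x) := by rw [← Real.exp_add]; ring_nf
  rw [e] at h1
  simp only [beta, Real.one_rpow, mul_one]
  calc (besselConst p)⁻¹ * x ^ (-(p / 2)) * besselK (p / 2) x
      ≤ (besselConst p)⁻¹ * 1 * (Real.exp 1 * Real.exp (-x) * besselK (p / 2) 1) := by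
        gcongr
    _ = _ := by ring

end

/-! ### Wronskian, moments and growth of the two solutions -/

noncomputable section

/-- The regular solution `α_n` of `f'' + (n + 1) / x f' = f`, as an even entire function. -/
def alphaN (n : ℕ) (x : ℝ) : ℝ := alphaSeries n x

/-- The derivative of `alphaN`. -/
def alphaD (n : ℕ) (x : ℝ) : ℝ := x * alphaSeries ((n : ℝ) + 2) x / ((n : ℝ) + 2)

/-- The derivative of `beta n`. -/
def betaD (n : ℕ) (x : ℝ) : ℝ := -((n : ℝ) + 2) * x * beta ((n : ℝ) + 2) x

lemma alphaN_hasDerivAt (n : ℕ) (x : ℝ) : HasDerivAt (alphaN n) (alphaD n x) x :=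
  alphaSeries_hasDerivAt (by have := n.cast_nonneg (α := ℝ); linarith) x

lemma alphaD_hasDerivAt (n : ℕ) {x : ℝ} (hx : 0 < x) :
    HasDerivAt (alphaD n) (alphaN n x - ((n : ℝ) + 1) / x * alphaD n x) x := by
  have hn := n.cast_nonneg (α := ℝ)
  have h := alphaSeries_hasDerivAt (by linarith : -1 ≤ (n : ℝ) + 2) x
  have hr := alphaSeries_rec (by linarith : 1 ≤ (n : ℝ) + 2) x
  refine (((hasDerivAt_id x).mul h).div_const _).congr_deriv ?_
  have e : (n : ℝ) + 2 - 2 = n := by ring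
  rw [e] at hr
  have h1 : (n : ℝ) + 2 ≠ 0 := by linarith
  have h2 : (n : ℝ) + 2 + 2 ≠ 0 := by linarith
  rw [alphaN, hr, alphaD]
  simp only [id]
  field_simp
  ring

lemma continuous_alphaN (n : ℕ) : Continuous (alphaN n) :=
  continuous_iff_continuousAt.2 fun x => (alphaN_hasDerivAt n x).continuousAt

lemma continuous_alphaD (n : ℕ) : Continuous (alphaD n) := by
  have hn := n.cast_nonneg (α := ℝ)
  have : Continuous (alphaSeries ((n : ℝ) + 2)) := continuous_iff_continuousAt.2 fun x =>
    (alphaSeries_hasDerivAt (by linarith : -1 ≤ (n : ℝ) + 2) x).continuousAt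
  unfold alphaD; fun_prop

lemma one_le_alphaN (n : ℕ) (x : ℝ) : 1 ≤ alphaN n x :=
  one_le_alphaSeries (by have := n.cast_nonneg (α := ℝ); linarith) x

lemma alphaN_pos (n : ℕ) (x : ℝ) : 0 < alphaN n x := zero_lt_one.trans_le (one_le_alphaN n x)

lemma alphaD_nonneg (n : ℕ) {x : ℝ} (hx : 0 ≤ x) : 0 ≤ alphaD n x := by
  have hn := n.cast_nonneg (α := ℝ)
  have := one_le_alphaSeries (by linarith : -1 ≤ (n : ℝ) + 2) x
  unfold alphaD; positivity

lemma alphaN_monotoneOn (n : ℕ) : MonotoneOn (alphaN n) (Ici 0) :=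
  monotoneOn_of_hasDerivWithinAt_nonneg (convex_Ici 0) (continuous_alphaN n).continuousOn
    (fun x _ => (alphaN_hasDerivAt n x).hasDerivWithinAt)
    (fun _ hx => alphaD_nonneg n (interior_subset hx))

lemma betaN_pos (n : ℕ) {x : ℝ} (hx : 0 < x) : 0 < beta n x :=
  beta_pos (by have := n.cast_nonneg (α := ℝ); linarith) hx

lemma betaN_hasDerivAt (n : ℕ) {x : ℝ} (hx : 0 < x) : HasDerivAt (beta n) (betaD n x) x :=
  beta_hasDerivAt (by have := n.cast_nonneg (α := ℝ); linarith) hx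

lemma betaD_neg (n : ℕ) {x : ℝ} (hx : 0 < x) : betaD n x < 0 := by
  have hn := n.cast_nonneg (α := ℝ)
  have := beta_pos (by linarith : -2 < (n : ℝ) + 2) hx
  have : 0 < ((n : ℝ) + 2) * x * beta ((n : ℝ) + 2) x := by positivity
  unfold betaD; linarith

lemma betaD_hasDerivAt (n : ℕ) {x : ℝ} (hx : 0 < x) :
    HasDerivAt (betaD n) (beta n x - ((n : ℝ) + 1) / x * betaD n x) x := by
  have hn := n.cast_nonneg (α := ℝ)
  have h := beta_hasDerivAt (by linarith : -2 < (n : ℝ) + 2) hx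
  have hr := beta_rec (by linarith : 0 < (n : ℝ) + 2) hx
  refine (((hasDerivAt_id x).const_mul (-((n : ℝ) + 2))).mul h).congr_deriv ?_
  have e : (n : ℝ) + 2 - 2 = n := by ring
  rw [e] at hr
  rw [hr, betaD]
  simp only [id]
  field_simp
  ring

/-- Abel's identity: the derivative vanishes by the two differential equations. The constant is read
off at the origin, where `x^(n+1) β'` tends to `-1` and the term `x^(n+1) α' β` tends to `0`. -/
lemma alphaN_mul_betaD_sub {n : ℕ} (hn : 1 ≤ n) {x : ℝ} (hx : 0 < x) :
    x ^ (n + 1) * (alphaN n x * betaD n x - alphaD n x * beta n x) = -1 := by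
  have hn1 : (1 : ℝ) ≤ n := by exact_mod_cast hn
  set W : ℝ → ℝ := fun x => x ^ (n + 1) * (alphaN n x * betaD n x - alphaD n x * beta n x)
  have hW : ∀ y ∈ Ioi (0 : ℝ), HasDerivAt W 0 y := by
    intro y hy
    have hy : 0 < y := hy
    refine ((hasDerivAt_pow (n + 1) y).mul (((alphaN_hasDerivAt n y).mul
      (betaD_hasDerivAt n hy)).sub ((alphaD_hasDerivAt n hy).mul (betaN_hasDerivAt n hy)))).congr_deriv
      ?_
    simp only [Nat.add_sub_cancel, pow_succ, Pi.mul_apply, Pi.sub_apply]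
    push_cast
    field_simp
    ring
  have hconst : ∀ y ∈ Ioi (0 : ℝ), W y = W x := by
    intro y hy
    exact (convex_Ioi (0 : ℝ)).is_const_of_fderivWithin_eq_zero (𝕜 := ℝ)
      (fun z hz => (hW z hz).differentiableAt.differentiableWithinAt)
      (fun z hz => by
        rw [fderivWithin_of_isOpen isOpen_Ioi hz]
        exact ((hW z hz).hasFDerivAt.fderiv).trans (by ext; simp)) hy hx
  have hl : Tendsto W (𝓝[>] 0) (𝓝 (1 * -1 - 0)) := by
    have h2 := tendsto_rpow_mul_beta (by linarith : 0 < (n : ℝ) + 2)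
    have h3 : Tendsto (fun y => y ^ (n + 1) * betaD n y) (𝓝[>] 0) (𝓝 (-1)) := by
      have := h2.const_mul (-((n : ℝ) + 2))
      have e : -((n : ℝ) + 2) * (1 / ((n : ℝ) + 2)) = -1 := by
        have : (n : ℝ) + 2 ≠ 0 := by linarith
        field_simp
      rw [e] at this
      refine this.congr' ?_
      filter_upwards [self_mem_nhdsWithin] with y hy
      have e2 : (y : ℝ) ^ ((n : ℝ) + 2) = y ^ (n + 2) := by
        rw [← Real.rpow_natCast]; push_cast; rfl
      rw [e2, betaD]; ring
    have h1 : Tendsto (alphaN n) (𝓝[>] 0) (𝓝 1) := by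
      have := (continuous_alphaN n).tendsto 0
      rw [alphaN, alphaSeries_zero (by linarith)] at this
      exact this.mono_left nhdsWithin_le_nhds
    have h4 : Tendsto (fun y => y ^ (n + 1) * (alphaD n y * beta n y)) (𝓝[>] 0) (𝓝 0) := by
      have h5 := tendsto_rpow_mul_beta (by linarith : 0 < (n : ℝ))
      have h6 : Tendsto (fun y => y * alphaD n y) (𝓝[>] 0) (𝓝 0) := by
        have hc : Continuous fun y => y * alphaD n y := continuous_id.mul (continuous_alphaD n)
        have := hc.tendsto 0
        simp only [zero_mul] at this
        exact this.mono_left nhdsWithin_le_nhds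
      have h7 := h6.mul h5
      rw [zero_mul] at h7
      refine h7.congr fun y => ?_
      rw [Real.rpow_natCast]; ring
    refine ((h1.mul h3).sub h4).congr fun y => ?_
    simp only [W]; ring
  have hl2 : Tendsto W (𝓝[>] 0) (𝓝 (W x)) := by
    refine tendsto_const_nhds.congr' ?_
    filter_upwards [self_mem_nhdsWithin] with y hy
    exact (hconst y hy).symm
  have := tendsto_nhds_unique hl2 hl
  simpa using this

/-- The antiderivative of `x ^ (n + 1) f g` for two solutions `f`, `g` of
`f'' + (n + 1) / x f' = f`, in terms of `f`, `f'`, `g` and `g'`. -/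
def pohozaev (n : ℕ) (f f1 g g1 : ℝ → ℝ) (x : ℝ) : ℝ :=
  x ^ (n + 2) * (f x * g x - f1 x * g1 x) / 2 - n / 4 * x ^ (n + 1) * (f x * g1 x + f1 x * g x)

lemma pohozaev_hasDerivAt (n : ℕ) {f f1 g g1 : ℝ → ℝ} {x : ℝ} (hx : 0 < x)
    (hf : HasDerivAt f (f1 x) x) (hf1 : HasDerivAt f1 (f x - ((n : ℝ) + 1) / x * f1 x) x)
    (hg : HasDerivAt g (g1 x) x) (hg1 : HasDerivAt g1 (g x - ((n : ℝ) + 1) / x * g1 x) x) :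
    HasDerivAt (pohozaev n f f1 g g1) (x ^ (n + 1) * (f x * g x)) x := by
  refine ((((hasDerivAt_pow (n + 2) x).mul ((hf.mul hg).sub (hf1.mul hg1))).div_const 2).sub
    (((hasDerivAt_pow (n + 1) x).const_mul ((n : ℝ) / 4)).mul
      ((hf.mul hg1).add (hf1.mul hg)))).congr_deriv ?_
  have e : n + 2 - 1 = n + 1 := by omega
  simp only [Nat.add_sub_cancel, e, pow_succ, Pi.mul_apply, Pi.sub_apply, Pi.add_apply]
  push_cast
  field_simp
  ring

/-- `∫₀ˣ w ^ (n + 1) α(w) ^ 2 dw`. -/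
def momA (n : ℕ) (x : ℝ) : ℝ := pohozaev n (alphaN n) (alphaD n) (alphaN n) (alphaD n) x

/-- An antiderivative of `w ^ (n + 1) α(w) β(w)`. -/
def momM (n : ℕ) (x : ℝ) : ℝ := pohozaev n (alphaN n) (alphaD n) (beta n) (betaD n) x

/-- `∫ₓ^∞ w ^ (n + 1) β(w) ^ 2 dw`. -/
def momB (n : ℕ) (x : ℝ) : ℝ := -pohozaev n (beta n) (betaD n) (beta n) (betaD n) x

lemma momA_hasDerivAt (n : ℕ) {x : ℝ} (hx : 0 < x) :
    HasDerivAt (momA n) (x ^ (n + 1) * (alphaN n x * alphaN n x)) x :=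
  pohozaev_hasDerivAt n hx (alphaN_hasDerivAt n x) (alphaD_hasDerivAt n hx)
    (alphaN_hasDerivAt n x) (alphaD_hasDerivAt n hx)

lemma momM_hasDerivAt (n : ℕ) {x : ℝ} (hx : 0 < x) :
    HasDerivAt (momM n) (x ^ (n + 1) * (alphaN n x * beta n x)) x :=
  pohozaev_hasDerivAt n hx (alphaN_hasDerivAt n x) (alphaD_hasDerivAt n hx)
    (betaN_hasDerivAt n hx) (betaD_hasDerivAt n hx)

lemma momB_hasDerivAt (n : ℕ) {x : ℝ} (hx : 0 < x) :
    HasDerivAt (momB n) (-(x ^ (n + 1) * (beta n x * beta n x))) x :=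
  (pohozaev_hasDerivAt n hx (betaN_hasDerivAt n hx) (betaD_hasDerivAt n hx)
    (betaN_hasDerivAt n hx) (betaD_hasDerivAt n hx)).neg

lemma continuous_momA (n : ℕ) : Continuous (momA n) := by
  have := continuous_alphaN n
  have := continuous_alphaD n
  unfold momA pohozaev; fun_prop

lemma momA_zero (n : ℕ) : momA n 0 = 0 := by simp [momA, pohozaev]

lemma momA_nonneg (n : ℕ) {x : ℝ} (hx : 0 ≤ x) : 0 ≤ momA n x := by
  have hm : MonotoneOn (momA n) (Ici 0) :=
    monotoneOn_of_hasDerivWithinAt_nonneg (convex_Ici 0) (continuous_momA n).continuousOn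
      (f' := fun x => x ^ (n + 1) * (alphaN n x * alphaN n x))
      (fun x hx => (momA_hasDerivAt n (by simpa using hx)).hasDerivWithinAt)
      (fun x hx => by
        have hx : 0 < x := by simpa using hx
        have := mul_self_nonneg (alphaN n x)
        positivity)
  have := hm (mem_Ici.2 le_rfl) (mem_Ici.2 hx) hx
  rwa [momA_zero] at this

/-- If `α' > α`, both terms of the Pohozaev expression for `∫₀ˣ w^(n+1) α²` would be nonpositive and
the first negative, although the integral is nonnegative. -/
lemma alphaD_le (n : ℕ) {x : ℝ} (hx : 0 < x) : alphaD n x ≤ alphaN n x := by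
  have h := momA_nonneg n hx.le
  have h1 := alphaN_pos n x
  have h2 := alphaD_nonneg n hx.le
  unfold momA pohozaev at h
  by_contra hc
  push Not at hc
  have h3 : alphaN n x * alphaN n x - alphaD n x * alphaD n x < 0 := by nlinarith
  have h4 : x ^ (n + 2) * (alphaN n x * alphaN n x - alphaD n x * alphaD n x) < 0 :=
    mul_neg_of_pos_of_neg (by positivity) h3
  have h5 : 0 ≤ (n : ℝ) / 4 * x ^ (n + 1) * (alphaN n x * alphaD n x + alphaD n x * alphaN n x) := by
    positivity
  linarith

/-- The previous bound in dimension `n - 2`, where `α_{n-2}' = x α_n / n` and the recurrence gives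
`α_{n-2} = α_n + x α_n' / n`. -/
lemma le_alphaD {n : ℕ} (hn : 3 ≤ n) {x : ℝ} (hx : 0 < x) :
    alphaN n x - n * alphaN n x / x ≤ alphaD n x := by
  have hn3 : (3 : ℝ) ≤ n := by exact_mod_cast hn
  have h := alphaD_le (n - 2) hx
  have hr := alphaSeries_rec (by linarith : 1 ≤ (n : ℝ)) x
  have e : ((n - 2 : ℕ) : ℝ) = n - 2 := by push_cast [Nat.cast_sub (by omega : 2 ≤ n)]; ring
  have e2 : (n : ℝ) - 2 + 2 = n := by ring
  rw [alphaD, alphaN, e, e2, hr] at h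
  have hd : x ^ 2 * alphaSeries (n + 2) x / (n * (n + 2)) = x * alphaD n x / n := by
    rw [alphaD]; field_simp
  rw [hd] at h
  have h' : x * alphaN n x / n ≤ alphaN n x + x * alphaD n x / n := h
  have h3 : x * alphaN n x ≤ n * alphaN n x + x * alphaD n x := by
    have := mul_le_mul_of_nonneg_left h' (by linarith : (0 : ℝ) ≤ n)
    have e3 : (n : ℝ) * (x * alphaN n x / n) = x * alphaN n x := by field_simp
    have e4 : (n : ℝ) * (alphaN n x + x * alphaD n x / n) = n * alphaN n x + x * alphaD n x := by
      field_simp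
    linarith
  rw [sub_le_iff_le_add, ← sub_le_iff_le_add', le_div_iff₀ hx]
  linarith

lemma tendsto_pow_mul_beta (n k : ℕ) :
    Tendsto (fun x => x ^ k * beta n x) atTop (𝓝 0) := by
  have hn := n.cast_nonneg (α := ℝ)
  have h := (Real.tendsto_pow_mul_exp_neg_atTop_nhds_zero k).const_mul (beta n 1 * Real.exp 1)
  rw [mul_zero] at h
  refine squeeze_zero' ?_ ?_ h
  · filter_upwards [eventually_gt_atTop 0] with x hx
    have := betaN_pos n hx
    positivity
  · filter_upwards [eventually_ge_atTop 1] with x hx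
    have := beta_le_exp hn hx
    have hx0 : 0 < x := by linarith
    calc x ^ k * beta n x ≤ x ^ k * (beta n 1 * Real.exp 1 * Real.exp (-x)) := by gcongr
      _ = _ := by ring

lemma tendsto_pow_mul_betaD (n k : ℕ) :
    Tendsto (fun x => x ^ k * betaD n x) atTop (𝓝 0) := by
  have h := (tendsto_pow_mul_beta (n + 2) (k + 1)).const_mul (-((n : ℝ) + 2))
  rw [mul_zero] at h
  refine h.congr fun x => ?_
  push_cast
  rw [betaD]; ring

lemma tendsto_momB (n : ℕ) : Tendsto (momB n) atTop (𝓝 0) := by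
  have h1 := tendsto_pow_mul_beta n
  have h2 := tendsto_pow_mul_betaD n
  have h := ((((h1 (n + 2)).mul (h1 0)).sub ((h2 (n + 2)).mul (h2 0))).div_const 2).sub
    ((((h1 (n + 1)).mul (h2 0)).const_mul (2 : ℝ)).const_mul ((n : ℝ) / 4))
  simp only [mul_zero, sub_zero, zero_div] at h
  have h' := h.neg
  rw [neg_zero] at h'
  refine h'.congr fun x => ?_
  simp only [momB, pohozaev, pow_zero]
  ring

lemma momB_antitoneOn (n : ℕ) : AntitoneOn (momB n) (Ioi 0) :=
  antitoneOn_of_hasDerivWithinAt_nonpos (convex_Ioi 0)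
    (fun x hx => (momB_hasDerivAt n hx).continuousAt.continuousWithinAt)
    (f' := fun x => -(x ^ (n + 1) * (beta n x * beta n x)))
    (fun x hx => (momB_hasDerivAt n (by simpa using hx)).hasDerivWithinAt)
    (fun x hx => by
      have hx : 0 < x := by simpa using hx
      have := mul_self_nonneg (beta n x)
      simp only [Left.neg_nonpos_iff]
      positivity)

lemma momB_nonneg (n : ℕ) {x : ℝ} (hx : 0 < x) : 0 ≤ momB n x := by
  refine le_of_tendsto (tendsto_momB n) ?_
  filter_upwards [eventually_ge_atTop x] with y hy
  exact momB_antitoneOn n hx (lt_of_lt_of_le hx hy) hy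

/-- Nonnegativity of `∫ₓ^∞ w^(n+1) β²` reads `n β(-β') ≤ x(β'² - β²)` in Pohozaev form. Both
inequalities follow from this single quadratic one. -/
lemma betaD_bounds (n : ℕ) {x : ℝ} (hx : 0 < x) :
    beta n x ≤ -betaD n x ∧ n * beta n x ≤ x * -betaD n x := by
  have h := momB_nonneg n hx
  have h1 := betaN_pos n hx
  have h2 := betaD_neg n hx
  have e : momB n x = x ^ (n + 1) / 2 * (x * (betaD n x ^ 2 - beta n x ^ 2)
      - n * (beta n x * -betaD n x)) := by
    rw [momB, pohozaev]; ring
  rw [e] at h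
  have h3 : 0 ≤ x * (betaD n x ^ 2 - beta n x ^ 2) - n * (beta n x * -betaD n x) :=
    nonneg_of_mul_nonneg_right h (by positivity)
  generalize betaD n x = q at *
  generalize beta n x = b at *
  have hn := n.cast_nonneg (α := ℝ)
  have h4 : 0 ≤ (n : ℝ) * (b * -q) := mul_nonneg hn (mul_nonneg h1.le (by linarith))
  constructor
  · by_contra hc
    push Not at hc
    nlinarith [mul_pos hx (by nlinarith : 0 < b ^ 2 - q ^ 2)]
  · by_contra hc
    push Not at hc
    nlinarith [mul_pos hx (by positivity : 0 < b ^ 2), mul_pos (by linarith : 0 < -q) (by linarith : 0 < n * b - x * -q)]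

lemma neg_betaD_le {n : ℕ} (hn : 1 ≤ n) {x : ℝ} (hx : 0 < x) :
    -betaD n x ≤ (1 + n / x) * beta n x := by
  have hn1 : (1 : ℝ) ≤ n := by exact_mod_cast hn
  have h1 := beta_sub_two_le hn1 hx
  have h2 := beta_rec (by linarith : 0 < (n : ℝ)) hx
  rw [h2] at h1
  have h3 : ((n : ℝ) + 2) * x ^ 2 * beta (n + 2) x = x * -betaD n x := by rw [betaD]; ring
  rw [h3, mul_assoc] at h1
  have h4 := le_of_mul_le_mul_left h1 (by linarith)
  have e : (1 + n / x) * beta n x = (x * beta n x + n * beta n x) / x := by field_simp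
  rw [e, le_div_iff₀ hx]
  linarith

/-- The Wronskian identity is a sum of two nonnegative terms equal to `1`, so each is at most `1`;
then `-β'` is replaced by its two lower bounds in terms of `β`. -/
lemma pow_mul_alphaN_mul_betaN_le {n : ℕ} (hn : 1 ≤ n) {x : ℝ} (hx : 0 < x) :
    x ^ (n + 1) * (alphaN n x * beta n x) ≤ 1 ∧ n * (x ^ n * (alphaN n x * beta n x)) ≤ 1 := by
  have hw := alphaN_mul_betaD_sub hn hx
  obtain ⟨h1, h2⟩ := betaD_bounds n hx
  have ha := alphaN_pos n x
  have ha1 := alphaD_nonneg n hx.le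
  have hb := betaN_pos n hx
  have hw' : x ^ (n + 1) * (alphaN n x * -betaD n x) + x ^ (n + 1) * (alphaD n x * beta n x) = 1 := by
    linarith
  have h3 : 0 ≤ x ^ (n + 1) * (alphaD n x * beta n x) := by positivity
  constructor
  · have : x ^ (n + 1) * (alphaN n x * beta n x) ≤ x ^ (n + 1) * (alphaN n x * -betaD n x) := by
      gcongr
    linarith
  · have : x ^ n * alphaN n x * (n * beta n x) ≤ x ^ n * alphaN n x * (x * -betaD n x) := by
      gcongr
    have e : x ^ n * alphaN n x * (x * -betaD n x) = x ^ (n + 1) * (alphaN n x * -betaD n x) := by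
      ring
    linarith

/-- Beyond `2n` one has `α' ≥ α/2`, so `α(w) exp(-w/2)` increases. On `[0, 2n]` only monotonicity of
`α` is available, and the factor `exp n` pays for the length of that interval. -/
lemma alphaN_growth {n : ℕ} (hn : 3 ≤ n) {x y : ℝ} (hx : 0 ≤ x) (hxy : x ≤ y) :
    alphaN n x ≤ Real.exp n * Real.exp (-(y - x) / 2) * alphaN n y := by
  have hn3 : (3 : ℝ) ≤ n := by exact_mod_cast hn
  have hmono := alphaN_monotoneOn n
  rcases le_total y (2 * n) with hy | hy
  · have h1 := hmono (mem_Ici.2 hx) (mem_Ici.2 (hx.trans hxy)) hxy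
    have h2 : 1 ≤ Real.exp n * Real.exp (-(y - x) / 2) := by
      rw [← Real.exp_add]; apply Real.one_le_exp; linarith
    have := alphaN_pos n y
    nlinarith
  · have hm : MonotoneOn (fun w => alphaN n w * Real.exp (-w / 2)) (Ici (2 * n : ℝ)) := by
      have hd : ∀ w, HasDerivAt (fun w => alphaN n w * Real.exp (-w / 2))
          (alphaD n w * Real.exp (-w / 2) + alphaN n w * (Real.exp (-w / 2) * (-1 / 2))) w := by
        intro w
        exact (alphaN_hasDerivAt n w).mul (((hasDerivAt_id w).neg.div_const 2).exp)
      refine monotoneOn_of_hasDerivWithinAt_nonneg (convex_Ici _)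
        (fun w _ => (hd w).continuousAt.continuousWithinAt) (fun w _ => (hd w).hasDerivWithinAt) ?_
      intro w hw
      have hw : 2 * (n : ℝ) < w := by simpa using hw
      have hw0 : 0 < w := by linarith
      have h1 := le_alphaD hn hw0
      have h2 := alphaN_pos n w
      have h3 : n * alphaN n w / w ≤ alphaN n w / 2 := by
        rw [div_le_div_iff₀ hw0 (by norm_num)]; nlinarith
      have h4 := Real.exp_pos (-w / 2)
      nlinarith
    set x' := max x (2 * n)
    have hx' : x' ≤ y := max_le hxy hy
    have h1 := hm (mem_Ici.2 (le_max_right x (2 * n))) (mem_Ici.2 hy) hx'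
    have h2 := hmono (mem_Ici.2 hx) (mem_Ici.2 (hx.trans (le_max_left x (2 * n)))) (le_max_left x (2 * n))
    simp only at h1
    have h3 : alphaN n x' ≤ Real.exp ((x' - y) / 2) * alphaN n y := by
      have h5 := mul_le_mul_of_nonneg_right h1 (Real.exp_pos (x' / 2)).le
      have e1 : alphaN n x' * Real.exp (-x' / 2) * Real.exp (x' / 2) = alphaN n x' := by
        rw [mul_assoc, ← Real.exp_add]; ring_nf; simp
      have e2 : alphaN n y * Real.exp (-y / 2) * Real.exp (x' / 2)
          = Real.exp ((x' - y) / 2) * alphaN n y := by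
        rw [mul_assoc, ← Real.exp_add]; ring_nf
      rwa [e1, e2] at h5
    refine h2.trans (h3.trans ?_)
    rw [← Real.exp_add]
    refine mul_le_mul_of_nonneg_right (Real.exp_le_exp.2 ?_) (alphaN_pos n y).le
    have : x' ≤ x + 2 * n := max_le (by linarith) (by linarith)
    linarith

end

/-! ### The Green kernel as a composition square, and its derivatives -/

noncomputable section

/-- The solution `x α_n(x)` of the radial Helmholtz equation that is regular at the origin. -/
def solA (n : ℕ) (x : ℝ) : ℝ := x * alphaN n x

/-- The derivative of `solA`. -/
def solA1 (n : ℕ) (x : ℝ) : ℝ := alphaN n x + x * alphaD n x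

/-- The second derivative of `solA`. -/
def solA2 (n : ℕ) (x : ℝ) : ℝ := x * alphaN n x - ((n : ℝ) - 1) * alphaD n x

/-- The solution `x β_n(x)` of the radial Helmholtz equation that decays at infinity. -/
def solB (n : ℕ) (x : ℝ) : ℝ := x * beta n x

/-- The derivative of `solB`. -/
def solB1 (n : ℕ) (x : ℝ) : ℝ := beta n x + x * betaD n x

/-- The second derivative of `solB`. -/
def solB2 (n : ℕ) (x : ℝ) : ℝ := x * beta n x - ((n : ℝ) - 1) * betaD n x

lemma solA_hasDerivAt (n : ℕ) (x : ℝ) : HasDerivAt (solA n) (solA1 n x) x := by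
  refine ((hasDerivAt_id x).mul (alphaN_hasDerivAt n x)).congr_deriv ?_
  simp [solA1]

lemma solA1_hasDerivAt (n : ℕ) {x : ℝ} (hx : 0 < x) : HasDerivAt (solA1 n) (solA2 n x) x := by
  refine ((alphaN_hasDerivAt n x).add
    ((hasDerivAt_id x).mul (alphaD_hasDerivAt n hx))).congr_deriv ?_
  simp only [solA2, id]
  field_simp
  ring

lemma solB_hasDerivAt (n : ℕ) {x : ℝ} (hx : 0 < x) : HasDerivAt (solB n) (solB1 n x) x := by
  refine ((hasDerivAt_id x).mul (betaN_hasDerivAt n hx)).congr_deriv ?_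
  simp [solB1]

lemma solB1_hasDerivAt (n : ℕ) {x : ℝ} (hx : 0 < x) : HasDerivAt (solB1 n) (solB2 n x) x := by
  refine ((betaN_hasDerivAt n hx).add
    ((hasDerivAt_id x).mul (betaD_hasDerivAt n hx))).congr_deriv ?_
  simp only [solB2, id]
  field_simp
  ring

lemma continuous_solA (n : ℕ) : Continuous (solA n) := continuous_id.mul (continuous_alphaN n)

lemma continuous_solA1 (n : ℕ) : Continuous (solA1 n) :=
  (continuous_alphaN n).add (continuous_id.mul (continuous_alphaD n))

lemma continuous_solA2 (n : ℕ) : Continuous (solA2 n) :=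
  (continuous_id.mul (continuous_alphaN n)).sub (continuous_const.mul (continuous_alphaD n))

lemma continuousOn_solB (n : ℕ) : ContinuousOn (solB n) (Ioi 0) := fun _ hx =>
  (solB_hasDerivAt n hx).continuousAt.continuousWithinAt

lemma continuousOn_solB1 (n : ℕ) : ContinuousOn (solB1 n) (Ioi 0) := fun _ hx =>
  (solB1_hasDerivAt n hx).continuousAt.continuousWithinAt

lemma continuousOn_solB2 (n : ℕ) : ContinuousOn (solB2 n) (Ioi 0) := fun x hx => by
  have h1 : ContinuousWithinAt (beta n) (Ioi 0) x :=
    (betaN_hasDerivAt n hx).continuousAt.continuousWithinAt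
  have h2 : ContinuousWithinAt (betaD n) (Ioi 0) x :=
    (betaD_hasDerivAt n hx).continuousAt.continuousWithinAt
  exact (continuousWithinAt_id.mul h1).sub (continuousWithinAt_const.mul h2)

lemma solA_pos (n : ℕ) {x : ℝ} (hx : 0 < x) : 0 < solA n x := mul_pos hx (alphaN_pos n x)

lemma solB_pos (n : ℕ) {x : ℝ} (hx : 0 < x) : 0 < solB n x := mul_pos hx (betaN_pos n hx)

/-- The logarithmic-derivative bound `1 + (n + 1) / x`. -/
def logBound (n : ℕ) (x : ℝ) : ℝ := 1 + ((n : ℝ) + 1) / x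

lemma logBound_pos (n : ℕ) {x : ℝ} (hx : 0 < x) : 0 < logBound n x := by
  unfold logBound; positivity

lemma abs_solA1_le (n : ℕ) {x : ℝ} (hx : 0 < x) : |solA1 n x| ≤ logBound n x * solA n x := by
  have h1 := alphaN_pos n x
  have h2 := alphaD_nonneg n hx.le
  have h3 := alphaD_le n hx
  have hn := n.cast_nonneg (α := ℝ)
  rw [abs_of_nonneg (by unfold solA1; positivity), solA1, solA, logBound]
  have e : (1 + ((n : ℝ) + 1) / x) * (x * alphaN n x) = x * alphaN n x + (n + 1) * alphaN n x := by
    field_simp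
  rw [e]; nlinarith [mul_le_mul_of_nonneg_left h3 hx.le, mul_nonneg hn h1.le]

lemma abs_solB1_le {n : ℕ} (hn : 3 ≤ n) {x : ℝ} (hx : 0 < x) :
    |solB1 n x| ≤ logBound n x * solB n x := by
  have h1 := betaN_pos n hx
  have h2 := betaD_neg n hx
  have h3 := neg_betaD_le (by omega : 1 ≤ n) hx
  have hn' := n.cast_nonneg (α := ℝ)
  have e : logBound n x * solB n x = x * beta n x + (n + 1) * beta n x := by
    rw [logBound, solB]; field_simp
  have h4 : x * -betaD n x ≤ x * beta n x + n * beta n x := by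
    have := mul_le_mul_of_nonneg_left h3 hx.le
    have e2 : x * ((1 + n / x) * beta n x) = x * beta n x + n * beta n x := by field_simp
    linarith
  rw [e, solB1, abs_le]
  have := mul_pos hx h1
  have := mul_nonneg hn' h1.le
  have := mul_pos hx (neg_pos.2 h2)
  constructor <;> nlinarith

lemma abs_solA2_le {n : ℕ} (hn : 3 ≤ n) {x : ℝ} (hx : 0 < x) :
    |solA2 n x| ≤ logBound n x ^ 2 * solA n x := by
  have h1 := alphaN_pos n x
  have h2 := alphaD_nonneg n hx.le
  have h3 := alphaD_le n hx
  have hn3 : (3 : ℝ) ≤ n := by exact_mod_cast hn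
  have e : logBound n x ^ 2 * solA n x
      = x * alphaN n x + 2 * (n + 1) * alphaN n x + (n + 1) ^ 2 / x * alphaN n x := by
    rw [logBound, solA]; field_simp; ring
  have h5 : 0 ≤ (n + 1) ^ 2 / x * alphaN n x := by positivity
  have h6 : ((n : ℝ) - 1) * alphaD n x ≤ (n - 1) * alphaN n x :=
    mul_le_mul_of_nonneg_left h3 (by linarith)
  have h7 : 0 ≤ ((n : ℝ) - 1) * alphaD n x := mul_nonneg (by linarith) h2
  have h8 := mul_pos hx h1
  rw [e, solA2, abs_le]
  constructor <;> nlinarith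

lemma abs_solB2_le {n : ℕ} (hn : 3 ≤ n) {x : ℝ} (hx : 0 < x) :
    |solB2 n x| ≤ logBound n x ^ 2 * solB n x := by
  have h1 := betaN_pos n hx
  have h2 := betaD_neg n hx
  have h3 := neg_betaD_le (by omega : 1 ≤ n) hx
  have hn3 : (3 : ℝ) ≤ n := by exact_mod_cast hn
  have e : logBound n x ^ 2 * solB n x
      = x * beta n x + 2 * (n + 1) * beta n x + (n + 1) ^ 2 / x * beta n x := by
    rw [logBound, solB]; field_simp; ring
  have h6 : ((n : ℝ) - 1) * -betaD n x ≤ (n - 1) * ((1 + n / x) * beta n x) :=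
    mul_le_mul_of_nonneg_left h3 (by linarith)
  have h7 : 0 ≤ ((n : ℝ) - 1) * -betaD n x := mul_nonneg (by linarith) (by linarith)
  have h8 := mul_pos hx h1
  have h9 : (n - 1) * ((1 + n / x) * beta n x)
      = (n - 1) * beta n x + ((n - 1) * n) / x * beta n x := by ring
  have h10 : (((n : ℝ) - 1) * n) / x * beta n x ≤ (n + 1) ^ 2 / x * beta n x := by
    gcongr; nlinarith
  have h11 : 0 ≤ ((n : ℝ) + 1) ^ 2 / x * beta n x := by positivity
  rw [e, solB2, abs_le]
  constructor <;> nlinarith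

/-- The bilinear form in the values and derivatives of `solA` and `solB` that gives the Green
kernel and its partial derivatives. -/
def kernForm (n : ℕ) (f g u v : ℝ → ℝ) (x y : ℝ) : ℝ :=
  g x * u y * momA n x + f x * u y * (momM n y - momM n x) + f x * v y * momB n y

/-- In this identity and the three that follow, the Wronskian collapses the Pohozaev expressions of
the moments. They translate between the composition form of the kernel and its closed separable
form. -/
lemma betaN_momA_sub {n : ℕ} (hn : 1 ≤ n) {x : ℝ} (hx : 0 < x) :
    beta n x * momA n x - alphaN n x * momM n x = -(x * alphaD n x) / 2 - n / 4 * alphaN n x := by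
  have hw := alphaN_mul_betaD_sub hn hx
  simp only [momA, momM, pohozaev]
  linear_combination (x * alphaD n x / 2 + n / 4 * alphaN n x) * hw

lemma betaD_momA_sub {n : ℕ} (hn : 1 ≤ n) {x : ℝ} (hx : 0 < x) :
    betaD n x * momA n x - alphaD n x * momM n x = -(x * alphaN n x) / 2 + n / 4 * alphaD n x := by
  have hw := alphaN_mul_betaD_sub hn hx
  simp only [momA, momM, pohozaev]
  linear_combination (x * alphaN n x / 2 - n / 4 * alphaD n x) * hw

lemma betaN_momM_add {n : ℕ} (hn : 1 ≤ n) {x : ℝ} (hx : 0 < x) :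
    beta n x * momM n x + alphaN n x * momB n x = -(x * betaD n x) / 2 - n / 4 * beta n x := by
  have hw := alphaN_mul_betaD_sub hn hx
  simp only [momB, momM, pohozaev]
  linear_combination (x * betaD n x / 2 + n / 4 * beta n x) * hw

lemma betaD_momM_add {n : ℕ} (hn : 1 ≤ n) {x : ℝ} (hx : 0 < x) :
    betaD n x * momM n x + alphaD n x * momB n x = -(x * beta n x) / 2 + n / 4 * betaD n x := by
  have hw := alphaN_mul_betaD_sub hn hx
  simp only [momB, momM, pohozaev]
  linear_combination (x * beta n x / 2 - n / 4 * betaD n x) * hw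

lemma phi_eq {n : ℕ} (hn : 3 ≤ n) {x y : ℝ} (hx : 0 ≤ x) (hy : 0 < y) :
    phi n x y = (-(x * alphaD n x) * beta n y - n * alphaN n x * beta n y
      - alphaN n x * (y * betaD n y)) / 2 := by
  have hn3 : (3 : ℝ) ≤ n := by exact_mod_cast hn
  have hr := alphaSeries_rec (by linarith : 1 ≤ (n : ℝ)) x
  have hb := beta_rec (by linarith : 0 < (n : ℝ)) hy
  rw [phi, alpha_eq_alphaSeries (by linarith) hx, alpha_eq_alphaSeries (by linarith) hx, hr, hb,
    alphaN, alphaD, betaD]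
  have : (n : ℝ) + 2 ≠ 0 := by linarith
  field_simp
  ring

/-- The separable form of the Green kernel. -/
lemma greenKernel_eq {n : ℕ} (hn : 3 ≤ n) {x y : ℝ} (hx : 0 ≤ x) (hy : 0 < y) :
    greenKernel n x y = (-(x * solA1 n x) * solB n y
      + solA n x * ((2 - n) * solB n y - y * solB1 n y)) / 2 := by
  rw [greenKernel, phi_eq hn hx hy]
  simp only [solA, solA1, solB, solB1]
  ring

/-- The partial derivative of the Green kernel in its first argument. -/
def greenD1 (n : ℕ) (x y : ℝ) : ℝ := (-(solA1 n x + x * solA2 n x) * solB n y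
      + solA1 n x * ((2 - n) * solB n y - y * solB1 n y)) / 2

/-- The partial derivative of the Green kernel in its second argument. -/
def greenD2 (n : ℕ) (x y : ℝ) : ℝ := (-(x * solA1 n x) * solB1 n y
      + solA n x * ((1 - n) * solB1 n y - y * solB2 n y)) / 2

/-- The right-hand side is `∫ w^(n-1) G(x,w) G(y,w) dw` with `G(x,w) = a(min x w) b(max x w)`, split
at `w = x` and `w = y`. Positivity, hidden by the signs in `φ`, is visible here. -/
lemma greenKernel_eq_kernForm {n : ℕ} (hn : 3 ≤ n) {x y : ℝ} (hx : 0 < x) (hy : 0 < y) :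
    greenKernel n x y = kernForm n (solA n) (solB n) (solB n) (solA n) x y := by
  have h1 := betaN_momA_sub (by omega : 1 ≤ n) hx
  have h2 := betaN_momM_add (by omega : 1 ≤ n) hy
  rw [greenKernel_eq hn hx.le hy]
  simp only [kernForm, solA, solA1, solB, solB1]
  linear_combination (-(x * y * beta n y)) * h1 - (x * y * alphaN n x) * h2

lemma greenD1_eq_kernForm {n : ℕ} (hn : 3 ≤ n) {x y : ℝ} (hx : 0 < x) (hy : 0 < y) :
    greenD1 n x y = kernForm n (solA1 n) (solB1 n) (solB n) (solA n) x y := by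
  have h1 := betaN_momA_sub (by omega : 1 ≤ n) hx
  have h1' := betaD_momA_sub (by omega : 1 ≤ n) hx
  have h2 := betaN_momM_add (by omega : 1 ≤ n) hy
  simp only [greenD1, kernForm, solA, solA1, solB, solB1, solA2]
  linear_combination (-(y * beta n y)) * (h1 + x * h1')
    - (y * (alphaN n x + x * alphaD n x)) * h2

lemma greenD2_eq_kernForm {n : ℕ} (hn : 3 ≤ n) {x y : ℝ} (hx : 0 < x) (hy : 0 < y) :
    greenD2 n x y = kernForm n (solA n) (solB n) (solB1 n) (solA1 n) x y := by
  have h1 := betaN_momA_sub (by omega : 1 ≤ n) hx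
  have h2 := betaN_momM_add (by omega : 1 ≤ n) hy
  have h2' := betaD_momM_add (by omega : 1 ≤ n) hy
  simp only [greenD2, kernForm, solA, solA1, solB, solB1, solB2]
  linear_combination (-x * (beta n y + y * betaD n y)) * h1
    - (x * alphaN n x) * (h2 + y * h2')

/-- Besides differentiating the factors, moving the splitting points `x` and `y` produces two
boundary corrections. They vanish when the pairs `(f, g)` and `(u, v)` are `(a, b)` and `(b, a)`.
For the corresponding pairs of derivatives the Wronskian reduces them to multiples of `a(x) b(y)`.
-/
lemma kernForm_hasDerivAt (n : ℕ) {f g u v : ℝ → ℝ} {f' g' u' v' X Y : ℝ → ℝ} {X' Y' t : ℝ}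
    (hX : HasDerivAt X X' t) (hY : HasDerivAt Y Y' t) (hx : 0 < X t) (hy : 0 < Y t)
    (hf : HasDerivAt f (f' (X t)) (X t)) (hg : HasDerivAt g (g' (X t)) (X t))
    (hu : HasDerivAt u (u' (Y t)) (Y t)) (hv : HasDerivAt v (v' (Y t)) (Y t)) :
    HasDerivAt (fun t => kernForm n f g u v (X t) (Y t))
      ((kernForm n f' g' u v (X t) (Y t) + u (Y t) * ((X t) ^ (n + 1) * alphaN n (X t)
          * (g (X t) * alphaN n (X t) - f (X t) * beta n (X t)))) * X'
        + (kernForm n f g u' v' (X t) (Y t) + f (X t) * ((Y t) ^ (n + 1) * beta n (Y t)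
          * (u (Y t) * alphaN n (Y t) - v (Y t) * beta n (Y t)))) * Y') t := by
  have hf := hf.comp t hX
  have hg := hg.comp t hX
  have hu := hu.comp t hY
  have hv := hv.comp t hY
  have hA := (momA_hasDerivAt n hx).comp t hX
  have hM := (momM_hasDerivAt n hx).comp t hX
  have hM' := (momM_hasDerivAt n hy).comp t hY
  have hB := (momB_hasDerivAt n hy).comp t hY
  refine ((((hg.mul hu).mul hA).add ((hf.mul hu).mul (hM'.sub hM))).add
    ((hf.mul hv).mul hB)).congr_deriv ?_
  simp only [Function.comp, kernForm, Pi.mul_apply, Pi.sub_apply]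
  ring

/-- The second partial derivatives of the Green kernel. -/
def greenD11 (n : ℕ) (x y : ℝ) : ℝ :=
  kernForm n (solA2 n) (solB2 n) (solB n) (solA n) x y - solA n x * solB n y

/-- The mixed second partial derivative of the Green kernel. -/
def greenD12 (n : ℕ) (x y : ℝ) : ℝ := kernForm n (solA1 n) (solB1 n) (solB1 n) (solA1 n) x y

/-- The second partial derivative of the Green kernel in its second argument. -/
def greenD22 (n : ℕ) (x y : ℝ) : ℝ :=
  kernForm n (solA n) (solB n) (solB2 n) (solA2 n) x y - solA n x * solB n y

lemma eventually_pos_of_hasDerivAt {X : ℝ → ℝ} {X' t : ℝ} (hX : HasDerivAt X X' t)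
    (hx : 0 < X t) : ∀ᶠ s in 𝓝 t, 0 < X s :=
  hX.continuousAt.eventually (lt_mem_nhds hx)

lemma greenKernel_hasDerivAt {n : ℕ} (hn : 3 ≤ n) {X Y : ℝ → ℝ} {X' Y' t : ℝ}
    (hX : HasDerivAt X X' t) (hY : HasDerivAt Y Y' t) (hx : 0 < X t) (hy : 0 < Y t) :
    HasDerivAt (fun t => greenKernel n (X t) (Y t))
      (greenD1 n (X t) (Y t) * X' + greenD2 n (X t) (Y t) * Y') t := by
  have h := kernForm_hasDerivAt n hX hY hx hy (solA_hasDerivAt n (X t)) (solB_hasDerivAt n hx)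
    (solB_hasDerivAt n hy) (solA_hasDerivAt n (Y t))
  have h' := h.congr_of_eventuallyEq (f₁ := fun t => greenKernel n (X t) (Y t)) (by
    filter_upwards [eventually_pos_of_hasDerivAt hX hx, eventually_pos_of_hasDerivAt hY hy]
      with s h1 h2
    exact greenKernel_eq_kernForm hn h1 h2)
  refine h'.congr_deriv ?_
  rw [greenD1_eq_kernForm hn hx hy, greenD2_eq_kernForm hn hx hy]
  simp only [solA, solB]
  ring

lemma greenD1_hasDerivAt {n : ℕ} (hn : 3 ≤ n) {X Y : ℝ → ℝ} {X' Y' t : ℝ}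
    (hX : HasDerivAt X X' t) (hY : HasDerivAt Y Y' t) (hx : 0 < X t) (hy : 0 < Y t) :
    HasDerivAt (fun t => greenD1 n (X t) (Y t))
      (greenD11 n (X t) (Y t) * X' + greenD12 n (X t) (Y t) * Y') t := by
  have h := kernForm_hasDerivAt n hX hY hx hy (solA1_hasDerivAt n hx) (solB1_hasDerivAt n hx)
    (solB_hasDerivAt n hy) (solA_hasDerivAt n (Y t))
  have h' := h.congr_of_eventuallyEq (f₁ := fun t => greenD1 n (X t) (Y t)) (by
    filter_upwards [eventually_pos_of_hasDerivAt hX hx, eventually_pos_of_hasDerivAt hY hy]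
      with s h1 h2
    exact greenD1_eq_kernForm hn h1 h2)
  refine h'.congr_deriv ?_
  have hw := alphaN_mul_betaD_sub (by omega : 1 ≤ n) hx
  rw [greenD11, greenD12]
  simp only [solA, solB, solA1, solB1]
  linear_combination (X t * alphaN n (X t) * (Y t * beta n (Y t)) * X') * hw

lemma greenD2_hasDerivAt {n : ℕ} (hn : 3 ≤ n) {X Y : ℝ → ℝ} {X' Y' t : ℝ}
    (hX : HasDerivAt X X' t) (hY : HasDerivAt Y Y' t) (hx : 0 < X t) (hy : 0 < Y t) :
    HasDerivAt (fun t => greenD2 n (X t) (Y t))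
      (greenD12 n (X t) (Y t) * X' + greenD22 n (X t) (Y t) * Y') t := by
  have h := kernForm_hasDerivAt n hX hY hx hy (solA_hasDerivAt n (X t)) (solB_hasDerivAt n hx)
    (solB1_hasDerivAt n hy) (solA1_hasDerivAt n hy)
  have h' := h.congr_of_eventuallyEq (f₁ := fun t => greenD2 n (X t) (Y t)) (by
    filter_upwards [eventually_pos_of_hasDerivAt hX hx, eventually_pos_of_hasDerivAt hY hy]
      with s h1 h2
    exact greenD2_eq_kernForm hn h1 h2)
  refine h'.congr_deriv ?_
  have hw := alphaN_mul_betaD_sub (by omega : 1 ≤ n) hy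
  rw [greenD22, greenD12]
  simp only [solA, solB, solA1, solB1]
  linear_combination (X t * alphaN n (X t) * (Y t * beta n (Y t)) * Y') * hw

lemma momM_sub_bounds {n : ℕ} (hn : 1 ≤ n) {x y : ℝ} (hx : 0 < x) (hxy : x ≤ y) :
    0 ≤ momM n y - momM n x ∧ momM n y - momM n x ≤ y - x := by
  have hpos : ∀ w ∈ Ioi (0 : ℝ), 0 ≤ w ^ (n + 1) * (alphaN n w * beta n w) := fun w hw => by
    have hw : 0 < w := hw
    have := alphaN_pos n w
    have := betaN_pos n hw
    positivity
  have hc : ∀ w ∈ Ioi (0 : ℝ), HasDerivAt (momM n) (w ^ (n + 1) * (alphaN n w * beta n w)) w :=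
    fun w hw => momM_hasDerivAt n hw
  constructor
  · have hm : MonotoneOn (momM n) (Ioi 0) :=
      monotoneOn_of_hasDerivWithinAt_nonneg (convex_Ioi 0)
        (fun w hw => (hc w hw).continuousAt.continuousWithinAt)
        (fun w hw => (hc w (interior_subset hw)).hasDerivWithinAt)
        (fun w hw => hpos w (interior_subset hw))
    exact sub_nonneg.2 (hm hx (lt_of_lt_of_le hx hxy) hxy)
  · have hm : MonotoneOn (fun w => w - momM n w) (Ioi 0) :=
      monotoneOn_of_hasDerivWithinAt_nonneg (convex_Ioi 0)
        (fun w hw => ((hasDerivAt_id w).sub (hc w hw)).continuousAt.continuousWithinAt)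
        (fun w hw => ((hasDerivAt_id w).sub (hc w (interior_subset hw))).hasDerivWithinAt)
        (fun w hw => sub_nonneg.2
          (pow_mul_alphaN_mul_betaN_le hn (mem_Ioi.1 (interior_subset hw))).1)
    have := hm hx (lt_of_lt_of_le hx hxy) hxy
    simp only at this
    linarith

/-- The three moment coefficients are nonnegative for `x ≤ y`, so bounds relative to `a` and `b`
carry over term by term and reassemble into the kernel. All derivative bounds of the Green kernel
come from this. -/
lemma abs_kernForm_le {n : ℕ} (hn : 3 ≤ n) {f g u v : ℝ → ℝ} {x y k l : ℝ} (hx : 0 < x)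
    (hxy : x ≤ y) (hk : 0 ≤ k) (hf : |f x| ≤ k * solA n x) (hg : |g x| ≤ k * solB n x)
    (hu : |u y| ≤ l * solB n y) (hv : |v y| ≤ l * solA n y) :
    |kernForm n f g u v x y| ≤ k * l * greenKernel n x y := by
  have hy : 0 < y := hx.trans_le hxy
  have hA := momA_nonneg n hx.le
  have hB := momB_nonneg n hy
  have hM := (momM_sub_bounds (by omega : 1 ≤ n) hx hxy).1
  have a1 := (solA_pos n hx).le
  have a2 := (solA_pos n hy).le
  have b1 := (solB_pos n hx).le
  have b2 := (solB_pos n hy).le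
  rw [greenKernel_eq_kernForm hn hx hy]
  unfold kernForm
  calc _ ≤ |g x * u y * momA n x| + |f x * u y * (momM n y - momM n x)| + |f x * v y * momB n y| :=
        (abs_add_le _ _).trans (add_le_add_left (abs_add_le _ _) _)
    _ = |g x| * |u y| * momA n x + |f x| * |u y| * (momM n y - momM n x)
        + |f x| * |v y| * momB n y := by
        simp only [abs_mul, abs_of_nonneg hA, abs_of_nonneg hB, abs_of_nonneg hM]
    _ ≤ (k * solB n x) * (l * solB n y) * momA n x
        + (k * solA n x) * (l * solB n y) * (momM n y - momM n x)
        + (k * solA n x) * (l * solA n y) * momB n y := by gcongr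
    _ = _ := by ring

/-- Only the contribution of `w > y` is kept, with `α ≥ 1` used in the form `a(x) ≥ x`. -/
lemma greenKernel_pos_aux {n : ℕ} (hn : 3 ≤ n) {x y : ℝ} (hx : 0 < x) (hxy : x ≤ y) :
    x * y * momB n y ≤ greenKernel n x y := by
  have hy : 0 < y := hx.trans_le hxy
  have hA := momA_nonneg n hx.le
  have hB := momB_nonneg n hy
  have hM := (momM_sub_bounds (by omega : 1 ≤ n) hx hxy).1
  have a1 := solA_pos n hx
  have a2 := solA_pos n hy
  have b1 := solB_pos n hx
  have b2 := solB_pos n hy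
  rw [greenKernel_eq_kernForm hn hx hy, kernForm]
  have h1 : 0 ≤ solB n x * solB n y * momA n x := by positivity
  have h2 : 0 ≤ solA n x * solB n y * (momM n y - momM n x) := by positivity
  have h3 : x * y * momB n y ≤ solA n x * solA n y * momB n y := by
    have e1 : x ≤ solA n x := le_mul_of_one_le_right hx.le (one_le_alphaN n x)
    have e2 : y ≤ solA n y := le_mul_of_one_le_right hy.le (one_le_alphaN n y)
    gcongr
  linarith

lemma greenKernel_nonneg {n : ℕ} (hn : 3 ≤ n) {x y : ℝ} (hx : 0 < x) (hxy : x ≤ y) :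
    0 ≤ greenKernel n x y := by
  have hy : 0 < y := hx.trans_le hxy
  have hB := momB_nonneg n hy
  exact le_trans (by positivity) (greenKernel_pos_aux hn hx hxy)

lemma abs_greenD1_le {n : ℕ} (hn : 3 ≤ n) {x y : ℝ} (hx : 0 < x) (hxy : x ≤ y) :
    |greenD1 n x y| ≤ logBound n x * greenKernel n x y := by
  have hy : 0 < y := hx.trans_le hxy
  rw [greenD1_eq_kernForm hn hx hy]
  have := abs_kernForm_le hn hx hxy (logBound_pos n hx).le (abs_solA1_le n hx)
    (abs_solB1_le hn hx) (u := solB n) (v := solA n)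
    (by rw [abs_of_pos (solB_pos n hy), one_mul]) (by rw [abs_of_pos (solA_pos n hy), one_mul])
  simpa using this

lemma abs_greenD2_le {n : ℕ} (hn : 3 ≤ n) {x y : ℝ} (hx : 0 < x) (hxy : x ≤ y) :
    |greenD2 n x y| ≤ logBound n y * greenKernel n x y := by
  have hy : 0 < y := hx.trans_le hxy
  rw [greenD2_eq_kernForm hn hx hy]
  have := abs_kernForm_le hn hx hxy zero_le_one (f := solA n) (g := solB n)
    (by rw [abs_of_pos (solA_pos n hx), one_mul]) (by rw [abs_of_pos (solB_pos n hx), one_mul])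
    (abs_solB1_le hn hy) (abs_solA1_le n hy)
  simpa using this

lemma abs_greenD12_le {n : ℕ} (hn : 3 ≤ n) {x y : ℝ} (hx : 0 < x) (hxy : x ≤ y) :
    |greenD12 n x y| ≤ logBound n x * logBound n y * greenKernel n x y := by
  have hy : 0 < y := hx.trans_le hxy
  exact abs_kernForm_le hn hx hxy (logBound_pos n hx).le
    (abs_solA1_le n hx) (abs_solB1_le hn hx) (abs_solB1_le hn hy) (abs_solA1_le n hy)

lemma abs_greenD11_le {n : ℕ} (hn : 3 ≤ n) {x y : ℝ} (hx : 0 < x) (hxy : x ≤ y) :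
    |greenD11 n x y| ≤ logBound n x ^ 2 * greenKernel n x y + solA n x * solB n y := by
  have hy : 0 < y := hx.trans_le hxy
  have := abs_kernForm_le hn hx hxy (sq_nonneg (logBound n x)) (abs_solA2_le hn hx)
    (abs_solB2_le hn hx) (u := solB n) (v := solA n)
    (by rw [abs_of_pos (solB_pos n hy), one_mul]) (by rw [abs_of_pos (solA_pos n hy), one_mul])
  rw [mul_one] at this
  have h2 := mul_pos (solA_pos n hx) (solB_pos n hy)
  refine (abs_sub _ _).trans ?_
  rw [abs_of_pos h2]
  linarith

lemma abs_greenD22_le {n : ℕ} (hn : 3 ≤ n) {x y : ℝ} (hx : 0 < x) (hxy : x ≤ y) :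
    |greenD22 n x y| ≤ logBound n y ^ 2 * greenKernel n x y + solA n x * solB n y := by
  have hy : 0 < y := hx.trans_le hxy
  have := abs_kernForm_le hn hx hxy zero_le_one (f := solA n)
    (g := solB n) (by rw [abs_of_pos (solA_pos n hx), one_mul])
    (by rw [abs_of_pos (solB_pos n hx), one_mul]) (abs_solB2_le hn hy) (abs_solA2_le hn hy)
  rw [one_mul] at this
  have h2 := mul_pos (solA_pos n hx) (solB_pos n hy)
  refine (abs_sub _ _).trans ?_
  rw [abs_of_pos h2]
  linarith

end

/-! ### Decay, lower bounds and behaviour at the origin of the kernel -/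

noncomputable section

/-- The constant in the exponential bounds of the Green kernel. -/
def kernConst (n : ℕ) : ℝ := 2 * Real.exp n * (3 * n + 4)

lemma kernConst_pos (n : ℕ) : 0 < kernConst n := by unfold kernConst; positivity

/-- The growth of `α` moves its argument from `x` to `y` at the price of the exponential; at `y` the
two Wronskian bounds on `α β` combine into the weight `y^n (1 + y)`. -/
lemma alphaN_mul_betaN_le_exp {n : ℕ} (hn : 3 ≤ n) {x y : ℝ} (hx : 0 < x) (hxy : x ≤ y) :
    y ^ n * (1 + y) * (alphaN n x * beta n y) ≤ 2 * Real.exp n * Real.exp (-(y - x) / 2) := by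
  have hn3 : (3 : ℝ) ≤ n := by exact_mod_cast hn
  have hy : 0 < y := hx.trans_le hxy
  obtain ⟨h1, h2⟩ := pow_mul_alphaN_mul_betaN_le (by omega : 1 ≤ n) hy
  have hg := alphaN_growth hn hx.le hxy
  have ha := alphaN_pos n y
  have hb := betaN_pos n hy
  have h3 : y ^ n * (1 + y) * (alphaN n y * beta n y) ≤ 2 := by
    have e : y ^ n * (1 + y) * (alphaN n y * beta n y)
      = y ^ n * (alphaN n y * beta n y) + y ^ (n + 1) * (alphaN n y * beta n y) := by ring
    have h4 : 0 ≤ y ^ n * (alphaN n y * beta n y) := by positivity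
    rw [e]; nlinarith
  calc y ^ n * (1 + y) * (alphaN n x * beta n y)
      ≤ y ^ n * (1 + y) * (Real.exp n * Real.exp (-(y - x) / 2) * alphaN n y * beta n y) := by gcongr
    _ = Real.exp n * Real.exp (-(y - x) / 2) * (y ^ n * (1 + y) * (alphaN n y * beta n y)) := by ring
    _ ≤ Real.exp n * Real.exp (-(y - x) / 2) * 2 := by gcongr
    _ = _ := by ring

/-- In the composition form the three moments contribute at most `n`, `y - x` and `2n` times `a(x)
b(y)`. The first and third use the bounds on `α'` and `β'` in the Pohozaev expressions, the second
the bound `w^(n+1) α β ≤ 1` on its integrand. -/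
lemma greenKernel_le {n : ℕ} (hn : 3 ≤ n) {x y : ℝ} (hx : 0 < x) (hxy : x ≤ y) :
    greenKernel n x y ≤ (3 * n + (y - x)) * (solA n x * solB n y) := by
  have hn3 : (3 : ℝ) ≤ n := by exact_mod_cast hn
  have hy : 0 < y := hx.trans_le hxy
  obtain ⟨h1, -⟩ := pow_mul_alphaN_mul_betaN_le (by omega : 1 ≤ n) hx
  obtain ⟨h3, h4⟩ := pow_mul_alphaN_mul_betaN_le (by omega : 1 ≤ n) hy
  have ax := alphaN_pos n x
  have ay := alphaN_pos n y
  have bx := betaN_pos n hx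
  have by' := betaN_pos n hy
  have hM := (momM_sub_bounds (by omega : 1 ≤ n) hx hxy).2
  have hA : momA n x ≤ n * x ^ (n + 1) * alphaN n x ^ 2 := by
    have d1 := le_alphaD hn hx
    have d2 := alphaD_le n hx
    have d3 := alphaD_nonneg n hx.le
    have d4 : alphaN n x ^ 2 - alphaD n x ^ 2 ≤ n * alphaN n x / x * (2 * alphaN n x) := by
      have e : alphaN n x ^ 2 - alphaD n x ^ 2
        = (alphaN n x - alphaD n x) * (alphaN n x + alphaD n x) := by ring
      rw [e]
      refine mul_le_mul (by linarith) (by linarith) (by linarith) (by positivity)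
    have e : momA n x = x ^ (n + 2) * (alphaN n x ^ 2 - alphaD n x ^ 2) / 2
        - n / 2 * x ^ (n + 1) * (alphaN n x * alphaD n x) := by
      rw [momA, pohozaev]; ring
    have e2 : x ^ (n + 2) * (n * alphaN n x / x * (2 * alphaN n x)) / 2
        = n * x ^ (n + 1) * alphaN n x ^ 2 := by field_simp; ring
    have : x ^ (n + 2) * (alphaN n x ^ 2 - alphaD n x ^ 2) / 2
        ≤ x ^ (n + 2) * (n * alphaN n x / x * (2 * alphaN n x)) / 2 := by gcongr
    have : 0 ≤ n / 2 * x ^ (n + 1) * (alphaN n x * alphaD n x) := by positivity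
    linarith
  have hB : momB n y ≤ y ^ (n + 1) * beta n y ^ 2 * (n + n ^ 2 / (2 * y)) := by
    have d1 := neg_betaD_le (by omega : 1 ≤ n) hy
    have d2 := betaD_neg n hy
    have e : momB n y = y ^ (n + 2) * (betaD n y ^ 2 - beta n y ^ 2) / 2
        - n / 2 * y ^ (n + 1) * (beta n y * -betaD n y) := by
      rw [momB, pohozaev]; ring
    have d3 : betaD n y ^ 2 ≤ ((1 + n / y) * beta n y) ^ 2 := by
      rw [← neg_sq]; exact pow_le_pow_left₀ (by linarith) d1 2
    have d4 : y ^ (n + 2) * (betaD n y ^ 2 - beta n y ^ 2) / 2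
        ≤ y ^ (n + 2) * (((1 + n / y) * beta n y) ^ 2 - beta n y ^ 2) / 2 := by gcongr
    have e2 : y ^ (n + 2) * (((1 + n / y) * beta n y) ^ 2 - beta n y ^ 2) / 2
        = y ^ (n + 1) * beta n y ^ 2 * (n + n ^ 2 / (2 * y)) := by field_simp; ring
    have : 0 ≤ n / 2 * y ^ (n + 1) * (beta n y * -betaD n y) := by
      have : 0 < -betaD n y := by linarith
      positivity
    linarith
  have t1 : beta n x * beta n y * momA n x ≤ n * (alphaN n x * beta n y) := by
    calc beta n x * beta n y * momA n x
        ≤ beta n x * beta n y * (n * x ^ (n + 1) * alphaN n x ^ 2) := by gcongr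
      _ = n * (alphaN n x * beta n y) * (x ^ (n + 1) * (alphaN n x * beta n x)) := by ring
      _ ≤ n * (alphaN n x * beta n y) * 1 := by gcongr
      _ = _ := by ring
  have t2 : alphaN n x * beta n y * (momM n y - momM n x) ≤ (y - x) * (alphaN n x * beta n y) := by
    rw [mul_comm]; gcongr
  have t3 : alphaN n x * alphaN n y * momB n y ≤ 2 * n * (alphaN n x * beta n y) := by
    calc alphaN n x * alphaN n y * momB n y
        ≤ alphaN n x * alphaN n y * (y ^ (n + 1) * beta n y ^ 2 * (n + n ^ 2 / (2 * y))) := by gcongr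
      _ = (alphaN n x * beta n y) * (n * (y ^ (n + 1) * (alphaN n y * beta n y))
          + n / 2 * (n * (y ^ n * (alphaN n y * beta n y)))) := by field_simp; ring
      _ ≤ (alphaN n x * beta n y) * (n * 1 + n / 2 * 1) := by gcongr
      _ ≤ (alphaN n x * beta n y) * (2 * n) := by gcongr; linarith
      _ = _ := by ring
  rw [greenKernel_eq_kernForm hn hx hy, kernForm]
  simp only [solA, solB]
  have hxy' : 0 < x * y := by positivity
  nlinarith [mul_le_mul_of_nonneg_left (add_le_add (add_le_add t1 t2) t3) hxy'.le]

/-- Half of the exponential rate absorbs the linear factor, through `1 + d/4 ≤ exp(d/4)`. This is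
the origin of the rate `1/4` in the kernel bounds. -/
lemma add_mul_exp_le {c d : ℝ} (hc : 0 ≤ c) (hd : 0 ≤ d) :
    (c + d) * Real.exp (-d / 2) ≤ (c + 4) * Real.exp (-d / 4) := by
  have h1 := Real.add_one_le_exp (d / 4)
  have e : Real.exp (-d / 4) = Real.exp (d / 4) * Real.exp (-d / 2) := by
    rw [← Real.exp_add]; ring_nf
  rw [e, ← mul_assoc]
  refine mul_le_mul_of_nonneg_right ?_ (Real.exp_pos _).le
  nlinarith

lemma pow_mul_solA_solB_le {n : ℕ} (hn : 3 ≤ n) {x y c : ℝ} (hx : 0 < x) (hxy : x ≤ y)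
    (hc' : c ≤ 3 * n + (y - x)) :
    y ^ (n - 1) * (c * (solA n x * solB n y)) ≤
      kernConst n * (x / (1 + y)) * Real.exp (-(y - x) / 4) := by
  have hy : 0 < y := hx.trans_le hxy
  have h := alphaN_mul_betaN_le_exp hn hx hxy
  have ax := alphaN_pos n x
  have by' := betaN_pos n hy
  have hd : 0 ≤ y - x := by linarith
  have h2 := add_mul_exp_le (c := 3 * n) (by positivity) hd
  have ep : y ^ n = y ^ (n - 1) * y := by rw [← pow_succ]; congr 1; omega
  have e : y ^ (n - 1) * (c * (solA n x * solB n y))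
      = c * (x / (1 + y)) * (y ^ n * (1 + y) * (alphaN n x * beta n y)) := by
    rw [solA, solB, ep]; field_simp
  rw [e]
  calc _ ≤ (3 * n + (y - x)) * (x / (1 + y)) * (2 * Real.exp n * Real.exp (-(y - x) / 2)) := by
        gcongr
    _ = 2 * Real.exp n * (x / (1 + y)) * ((3 * n + (y - x)) * Real.exp (-(y - x) / 2)) := by ring
    _ ≤ 2 * Real.exp n * (x / (1 + y)) * ((3 * n + 4) * Real.exp (-(y - x) / 4)) := by gcongr
    _ = _ := by rw [kernConst]; ring

lemma pow_mul_greenKernel_le {n : ℕ} (hn : 3 ≤ n) {x y : ℝ} (hx : 0 < x) (hxy : x ≤ y) :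
    y ^ (n - 1) * greenKernel n x y ≤
      kernConst n * (x / (1 + y)) * Real.exp (-(y - x) / 4) := by
  have hy : 0 < y := hx.trans_le hxy
  have hd : 0 ≤ y - x := by linarith
  refine le_trans ?_ (pow_mul_solA_solB_le hn hx hxy le_rfl)
  exact mul_le_mul_of_nonneg_left (greenKernel_le hn hx hxy) (by positivity)

/-- The weight `x / (1 + x)`. -/
def wt (x : ℝ) : ℝ := x / (1 + x)

lemma wt_pos {x : ℝ} (hx : 0 < x) : 0 < wt x := by unfold wt; positivity

lemma wt_le_one {x : ℝ} (hx : 0 ≤ x) : wt x ≤ 1 := by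
  unfold wt; rw [div_le_one (by linarith)]; linarith

/-- The factor `1/x` lost by differentiating the kernel is regained from quantities that vanish
linearly at the origin, namely the velocity and the perturbations of a state. -/
lemma logBound_mul_wt_le (n : ℕ) {x : ℝ} (hx : 0 < x) : logBound n x * wt x ≤ n + 1 := by
  have hn := n.cast_nonneg (α := ℝ)
  have e : logBound n x * wt x = (x + (n + 1)) / (1 + x) := by
    rw [logBound, wt]; field_simp
  rw [e, div_le_iff₀ (by linarith)]; nlinarith

/-- The symmetric kernel. -/
def symK (n : ℕ) (x y : ℝ) : ℝ := if x ≤ y then greenKernel n x y else greenKernel n y x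

/-- The partial derivative of `symK` in its first argument. -/
def symK1 (n : ℕ) (x y : ℝ) : ℝ := if x ≤ y then greenD1 n x y else greenD2 n y x

lemma symK_of_le {n : ℕ} {x y : ℝ} (h : x ≤ y) : symK n x y = greenKernel n x y := if_pos h

lemma symK_of_ge {n : ℕ} {x y : ℝ} (h : y ≤ x) : symK n x y = greenKernel n y x := by
  rcases h.eq_or_lt with rfl | h
  · simp [symK]
  · exact if_neg (not_le.2 h)

lemma symK1_of_le {n : ℕ} {x y : ℝ} (h : x ≤ y) : symK1 n x y = greenD1 n x y := if_pos h

lemma symK1_of_gt {n : ℕ} {x y : ℝ} (h : y < x) : symK1 n x y = greenD2 n y x :=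
  if_neg (not_le.2 h)

lemma symK_comm (n : ℕ) (x y : ℝ) : symK n x y = symK n y x := by
  rcases le_total x y with h | h
  · rw [symK_of_le h, symK_of_ge h]
  · rw [symK_of_ge h, symK_of_le h]

lemma symK_nonneg {n : ℕ} (hn : 3 ≤ n) {x y : ℝ} (hx : 0 < x) (hy : 0 < y) : 0 ≤ symK n x y := by
  rcases le_total x y with h | h
  · rw [symK_of_le h]; exact greenKernel_nonneg hn hx h
  · rw [symK_of_ge h]; exact greenKernel_nonneg hn hy h

lemma majorant_swap {n : ℕ} {x y C E G : ℝ} (hy : 0 < y) (hyx : y ≤ x)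
    (hC : 0 ≤ C) (hE : 0 ≤ E) (h : x ^ (n - 1) * G ≤ C * (y / (1 + x)) * E) :
    y ^ (n - 1) * G ≤ C * wt x * E := by
  have hx : 0 < x := hy.trans_le hyx
  rcases le_or_gt G 0 with hG | hG
  · have := wt_pos hx
    exact (mul_nonpos_of_nonneg_of_nonpos (by positivity) hG).trans (by positivity)
  · calc y ^ (n - 1) * G ≤ x ^ (n - 1) * G := by gcongr
      _ ≤ C * (y / (1 + x)) * E := h
      _ ≤ C * wt x * E := by unfold wt; gcongr

lemma majorant_direct {n : ℕ} {x y C E G : ℝ} (hx : 0 < x) (hxy : x ≤ y)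
    (hC : 0 ≤ C) (hE : 0 ≤ E) (h : y ^ (n - 1) * G ≤ C * (x / (1 + y)) * E) :
    y ^ (n - 1) * G ≤ C * wt x * E := by
  refine h.trans ?_
  unfold wt; gcongr

lemma pow_mul_symK_le {n : ℕ} (hn : 3 ≤ n) {x y : ℝ} (hx : 0 < x) (hy : 0 < y) :
    y ^ (n - 1) * symK n x y ≤ kernConst n * wt x * Real.exp (-|x - y| / 4) := by
  have hC := (kernConst_pos n).le
  rcases le_total x y with h | h
  · rw [symK_of_le h, abs_sub_comm, abs_of_nonneg (sub_nonneg.2 h)]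
    exact majorant_direct hx h hC (Real.exp_pos _).le (pow_mul_greenKernel_le hn hx h)
  · rw [symK_of_ge h, abs_of_nonneg (sub_nonneg.2 h)]
    exact majorant_swap hy h hC (Real.exp_pos _).le (pow_mul_greenKernel_le hn hy h)

lemma abs_symK1_le {n : ℕ} (hn : 3 ≤ n) {x y : ℝ} (hx : 0 < x) (hy : 0 < y) :
    |symK1 n x y| ≤ logBound n x * symK n x y := by
  rcases le_or_gt x y with h | h
  · rw [symK_of_le h, symK1_of_le h]; exact abs_greenD1_le hn hx h
  · rw [symK_of_ge h.le, symK1_of_gt h]; exact abs_greenD2_le hn hy h.le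

lemma pow_mul_symK1_le {n : ℕ} (hn : 3 ≤ n) {x y : ℝ} (hx : 0 < x) (hy : 0 < y) :
    y ^ (n - 1) * |symK1 n x y| ≤ (n + 1) * kernConst n * Real.exp (-|x - y| / 4) := by
  have hC := (kernConst_pos n).le
  have hl := logBound_pos n hx
  calc y ^ (n - 1) * |symK1 n x y| ≤ y ^ (n - 1) * (logBound n x * symK n x y) := by
        gcongr; exact abs_symK1_le hn hx hy
    _ = logBound n x * (y ^ (n - 1) * symK n x y) := by ring
    _ ≤ logBound n x * (kernConst n * wt x * Real.exp (-|x - y| / 4)) :=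
        mul_le_mul_of_nonneg_left (pow_mul_symK_le hn hx hy) hl.le
    _ = (logBound n x * wt x) * (kernConst n * Real.exp (-|x - y| / 4)) := by ring
    _ ≤ (n + 1) * (kernConst n * Real.exp (-|x - y| / 4)) := by
        gcongr; exact logBound_mul_wt_le n hx
    _ = _ := by ring

/-- `∂₁δ(0, y) = y φ(0, y)`. -/
lemma greenD1_zero {n : ℕ} (hn : 3 ≤ n) {y : ℝ} (hy : 0 < y) :
    greenD1 n 0 y = y * beta ((n : ℝ) - 2) y / (2 * n) := by
  have hn3 : (3 : ℝ) ≤ n := by exact_mod_cast hn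
  have hb := beta_rec (by linarith : 0 < (n : ℝ)) hy
  rw [hb]
  simp only [greenD1, solA1, solB, solB1, alphaN,
    alphaSeries_zero (by linarith : -1 ≤ (n : ℝ)), betaD]
  field_simp
  ring

lemma greenD1_zero_pos {n : ℕ} (hn : 3 ≤ n) {y : ℝ} (hy : 0 < y) : 0 < greenD1 n 0 y := by
  have hn3 : (3 : ℝ) ≤ n := by exact_mod_cast hn
  rw [greenD1_zero hn hy]
  have := beta_pos (by linarith : -2 < (n : ℝ) - 2) hy
  positivity

/-- In the closed form of `φ` the term containing `α'` is negative and may be dropped; the rest is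
`α(x) φ(0, y)`. -/
lemma greenKernel_le_zero {n : ℕ} (hn : 3 ≤ n) {x y : ℝ} (hx : 0 < x) (hy : 0 < y) :
    greenKernel n x y ≤ x * alphaN n x * greenD1 n 0 y := by
  have hn3 : (3 : ℝ) ≤ n := by exact_mod_cast hn
  have hb := beta_rec (by linarith : 0 < (n : ℝ)) hy
  have h1 := alphaD_nonneg n hx.le
  have h2 := betaN_pos n hy
  rw [greenD1_zero hn hy, greenKernel, phi_eq hn hx.le hy, hb]
  have e : x * alphaN n x * (y * (n * ((n + 2) * y ^ 2 * beta (n + 2) y - n * beta n y)) / (2 * n))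
      = x * y * (- n * alphaN n x * beta n y - alphaN n x * (y * betaD n y)) / 2 := by
    rw [betaD]; field_simp; ring
  rw [e]
  have : 0 ≤ x * y * (x * alphaD n x * beta n y) := by positivity
  nlinarith

/-- For `y < x` the preceding bound has `x` and `y` interchanged; the factor `x y` is symmetric and
`β_{n-2}` is decreasing, so the same majorant works. -/
lemma symK_le_zero {n : ℕ} (hn : 3 ≤ n) {x y R : ℝ} (hx : 0 < x) (hy : 0 < y) (hxR : x ≤ R) :
    symK n x y ≤ x * alphaN n R * greenD1 n 0 y := by
  have hn3 : (3 : ℝ) ≤ n := by exact_mod_cast hn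
  have hmono := alphaN_monotoneOn n
  have hp := greenD1_zero_pos hn hy
  rcases le_total x y with h | h
  · rw [symK_of_le h]
    refine (greenKernel_le_zero hn hx hy).trans ?_
    have := hmono (mem_Ici.2 hx.le) (mem_Ici.2 (hx.le.trans hxR)) hxR
    gcongr
  · rw [symK_of_ge h]
    refine (greenKernel_le_zero hn hy hx).trans ?_
    have h1 := hmono (mem_Ici.2 hy.le) (mem_Ici.2 (hx.le.trans hxR)) (h.trans hxR)
    have h2 : beta ((n : ℝ) - 2) x ≤ beta ((n : ℝ) - 2) y := by
      have hanti : AntitoneOn (beta ((n : ℝ) - 2)) (Ioi 0) :=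
        antitoneOn_of_hasDerivWithinAt_nonpos (convex_Ioi 0)
          (fun w hw => (beta_hasDerivAt (by linarith) hw).continuousAt.continuousWithinAt)
          (fun w hw => (beta_hasDerivAt (by linarith) (interior_subset hw)).hasDerivWithinAt)
          (fun w hw => by
            have hw : 0 < w := by simpa using hw
            have := beta_pos (by linarith : -2 < (n : ℝ) - 2 + 2) hw
            have : 0 ≤ ((n : ℝ) - 2 + 2) * w * beta ((n : ℝ) - 2 + 2) w := by
              have : (0 : ℝ) ≤ (n : ℝ) - 2 + 2 := by linarith
              positivity
            linarith)
      exact hanti hy hx h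
    rw [greenD1_zero hn hx, greenD1_zero hn hy]
    have h3 := beta_pos (by linarith : -2 < (n : ℝ) - 2) hx
    have h4 := alphaN_pos n y
    have h5 := alphaN_pos n R
    calc y * alphaN n y * (x * beta ((n : ℝ) - 2) x / (2 * n))
        ≤ y * alphaN n R * (x * beta ((n : ℝ) - 2) y / (2 * n)) := by gcongr
      _ = _ := by ring

/-- On bounded sets the Green kernel is at least linear in its smaller argument. -/
lemma exists_le_greenKernel {n : ℕ} (hn : 3 ≤ n) {R : ℝ} (hR : 0 < R) :
    ∃ c > 0, ∀ x y, 0 < x → x ≤ y → y ≤ R → c * x ≤ greenKernel n x y := by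
  -- Integrating the lower bound `k/w²` from `y` to `2R` yields `k/y - k/(2R)`, which is at least
  -- `k/(2y)` for `y ≤ R`.
  set S := 2 * R
  have hS : 0 < S := by positivity
  have hanti : AntitoneOn (fun w => w ^ n * beta n w) (Ioi 0) := by
    have hd : ∀ w, 0 < w → HasDerivAt (fun w => w ^ n * beta n w)
        (n * w ^ (n - 1) * beta n w + w ^ n * betaD n w) w := fun w hw =>
      (hasDerivAt_pow n w).mul (betaN_hasDerivAt n hw)
    refine antitoneOn_of_hasDerivWithinAt_nonpos (convex_Ioi 0)
      (fun w hw => (hd w hw).continuousAt.continuousWithinAt)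
      (fun w hw => (hd w (by simpa using hw)).hasDerivWithinAt) ?_
    intro w hw
    have hw : 0 < w := by simpa using hw
    have h := (betaD_bounds n hw).2
    have e : w ^ n = w ^ (n - 1) * w := by rw [← pow_succ]; congr 1; omega
    have h2 : 0 ≤ w ^ (n - 1) * (w * -betaD n w - n * beta n w) :=
      mul_nonneg (by positivity) (by linarith)
    rw [e]; nlinarith
  -- Since `w^(n+1) β² = (w^n β)² / (w^(n-3) w²)`, with `w^n β` decreasing and `w^(n-3)`
  -- nondecreasing for `n ≥ 3`, the value at `S` is a lower bound for the coefficient of `w^(-2)`.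
  set k := (S ^ n * beta n S) ^ 2 / S ^ (n - 3)
  have hbS := betaN_pos n hS
  have hk : 0 < k := by positivity
  have hlow : ∀ w, 0 < w → w ≤ S → k / w ^ 2 ≤ w ^ (n + 1) * (beta n w * beta n w) := by
    intro w hw hwS
    have h1 : S ^ n * beta n S ≤ w ^ n * beta n w := hanti hw hS hwS
    have hbw := betaN_pos n hw
    have h2 : k ≤ (w ^ n * beta n w) ^ 2 / w ^ (n - 3) := by
      simp only [k]; gcongr
    rw [div_le_iff₀ (by positivity)]
    refine h2.trans (le_of_eq ?_)
    rw [div_eq_iff (by positivity)]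
    have e : w ^ n = w ^ (n - 3) * w ^ 3 := by rw [← pow_add]; congr 1; omega
    rw [pow_succ w n, e]; ring
  have hanti2 : AntitoneOn (fun w => momB n w - k / w) (Ioc 0 S) := by
    have hd : ∀ w, 0 < w → HasDerivAt (fun w => momB n w - k / w)
        (-(w ^ (n + 1) * (beta n w * beta n w)) - k * (-(w ^ 2)⁻¹)) w := fun w hw => by
      have h : HasDerivAt (fun w => k / w) (k * (-(w ^ 2)⁻¹)) w :=
        (hasDerivAt_inv hw.ne').const_mul k
      exact (momB_hasDerivAt n hw).sub h
    refine antitoneOn_of_hasDerivWithinAt_nonpos (convex_Ioc 0 S)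
      (fun w hw => (hd w hw.1).continuousAt.continuousWithinAt)
      (fun w hw => (hd w (interior_subset hw).1).hasDerivWithinAt) ?_
    intro w hw
    have hw := interior_subset hw
    have := hlow w hw.1 hw.2
    rw [div_eq_mul_inv] at this
    linarith
  refine ⟨k / 2, by positivity, fun x y hx hxy hyR => ?_⟩
  have hy : 0 < y := hx.trans_le hxy
  have h1 := hanti2 ⟨hy, by simp only [S]; linarith⟩ ⟨hS, le_rfl⟩ (by simp only [S]; linarith)
  simp only at h1
  have h2 := momB_nonneg n hS
  have h3 := greenKernel_pos_aux hn hx hxy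
  have h4 : k / S ≤ k / (2 * y) := by simp only [S]; gcongr
  have h5 : k / (2 * y) ≤ momB n y := by
    have : k / (2 * y) = k / y - k / (2 * y) := by field_simp; ring
    linarith
  have h6 : k / 2 * x = x * y * (k / (2 * y)) := by field_simp
  rw [h6]
  refine le_trans ?_ h3
  gcongr

/-- On the diagonal the kernel is at most `3n a b = 3n x² α β`, and `x² ≤ x^(n+1)` for `x ≥ 1`. It
is the pointwise factor in the Cauchy–Schwarz bound of the velocity. -/
lemma symK_self_le {n : ℕ} (hn : 3 ≤ n) {x : ℝ} (hx : 1 ≤ x) : symK n x x ≤ 3 * n := by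
  have hx0 : 0 < x := by linarith
  have h := greenKernel_le hn hx0 le_rfl
  obtain ⟨h1, -⟩ := pow_mul_alphaN_mul_betaN_le (by omega : 1 ≤ n) hx0
  rw [symK_of_le le_rfl]
  rw [sub_self, add_zero] at h
  refine h.trans ?_
  have ha := alphaN_pos n x
  have hb := betaN_pos n hx0
  have h2 : solA n x * solB n x ≤ x ^ (n + 1) * (alphaN n x * beta n x) := by
    have : x ^ 2 ≤ x ^ (n + 1) := pow_le_pow_right₀ hx (by omega)
    calc solA n x * solB n x = x ^ 2 * (alphaN n x * beta n x) := by rw [solA, solB]; ring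
      _ ≤ _ := by gcongr
  nlinarith [n.cast_nonneg (α := ℝ)]

end

/-! ### Admissible states and integrals along particles -/

noncomputable section

lemma integrable_exp_neg_abs {c : ℝ} (hc : 0 < c) (r : ℝ) :
    Integrable (fun s : ℝ => Real.exp (-c * |r - s|)) := by
  have h0 : Integrable (fun s : ℝ => Real.exp (-c * |s|)) := by
    have h1 : IntegrableOn (fun s : ℝ => Real.exp (-c * |s|)) (Ioi 0) :=
      (exp_neg_integrableOn_Ioi 0 hc).congr_fun (fun s hs => by
        simp only [abs_of_pos (mem_Ioi.1 hs)]) measurableSet_Ioi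
    have h2 : IntegrableOn (fun s : ℝ => Real.exp (-c * |s|)) (Iio 0) := by
      have h3 := ((integrable_indicator_iff measurableSet_Ioi).2 h1).comp_neg
      have h4 : (fun s : ℝ => (Ioi (0 : ℝ)).indicator (fun s : ℝ => Real.exp (-c * |s|)) (-s))
          = (Iio (0 : ℝ)).indicator (fun s : ℝ => Real.exp (-c * |s|)) := by
        ext s; simp [indicator]
      rw [h4, integrable_indicator_iff measurableSet_Iio] at h3
      exact h3
    have h5 := (integrableOn_Iic_iff_integrableOn_Iio).2 h2
    have := h5.union h1
    rwa [Iic_union_Ioi, integrableOn_univ] at this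
  exact h0.comp_sub_left r

lemma integral_exp_neg_abs {c : ℝ} (hc : 0 < c) (r : ℝ) :
    ∫ s : ℝ, Real.exp (-c * |r - s|) = 2 / c := by
  rw [integral_sub_left_eq_self (fun s : ℝ => Real.exp (-c * |s|)),
    integral_comp_abs (f := fun s => Real.exp (-c * s)), integral_exp_mul_Ioi (by linarith)]
  simp; field_simp

/-- A radial `C¹` diffeomorphism `γ` with derivative `ρ` between `a > 0` and `b`. -/
structure Adm (a b : ℝ) (γ ρ : ℝ → ℝ) : Prop where
  pos : 0 < a
  cont : ContinuousOn ρ (Ici 0)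
  bounds : ∀ r, 0 ≤ r → a ≤ ρ r ∧ ρ r ≤ b
  zero : γ 0 = 0
  deriv : ∀ r, 0 ≤ r → HasDerivWithinAt γ (ρ r) (Ici 0) r

namespace Adm

variable {a b : ℝ} {γ ρ : ℝ → ℝ}

lemma contγ (h : Adm a b γ ρ) : ContinuousOn γ (Ici 0) :=
  fun r hr => (h.deriv r hr).continuousWithinAt

lemma hasDerivAt (h : Adm a b γ ρ) {r : ℝ} (hr : 0 < r) : HasDerivAt γ (ρ r) r :=
  (h.deriv r hr.le).hasDerivAt (Ici_mem_nhds hr)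

lemma sub_bounds (h : Adm a b γ ρ) {r s : ℝ} (hr : 0 ≤ r) (hrs : r ≤ s) :
    a * (s - r) ≤ γ s - γ r ∧ γ s - γ r ≤ b * (s - r) := by
  have hd : ∀ w ∈ interior (Ici (0 : ℝ)), HasDerivAt γ (ρ w) w := fun w hw =>
    h.hasDerivAt (by simpa using hw)
  have hw0 : ∀ w ∈ interior (Ici (0 : ℝ)), 0 ≤ w := fun w hw => interior_subset hw
  constructor
  · have hm : MonotoneOn (fun w => γ w - a * w) (Ici 0) :=
      monotoneOn_of_hasDerivWithinAt_nonneg (convex_Ici 0) (f' := fun w => ρ w - a * 1)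
        (h.contγ.sub (by fun_prop))
        (fun w hw => ((hd w hw).sub ((hasDerivAt_id w).const_mul a)).hasDerivWithinAt)
        (fun w hw => by have := (h.bounds w (hw0 w hw)).1; linarith)
    have := hm hr (hr.trans hrs) hrs
    simp only at this; linarith
  · have hm : MonotoneOn (fun w => b * w - γ w) (Ici 0) :=
      monotoneOn_of_hasDerivWithinAt_nonneg (convex_Ici 0) (f' := fun w => b * 1 - ρ w)
        ((by fun_prop : ContinuousOn (fun w => b * w) (Ici 0)).sub h.contγ)
        (fun w hw => (((hasDerivAt_id w).const_mul b).sub (hd w hw)).hasDerivWithinAt)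
        (fun w hw => by have := (h.bounds w (hw0 w hw)).2; linarith)
    have := hm hr (hr.trans hrs) hrs
    simp only at this; linarith

lemma lower (h : Adm a b γ ρ) {r : ℝ} (hr : 0 ≤ r) : a * r ≤ γ r := by
  have := (h.sub_bounds le_rfl hr).1
  rw [h.zero] at this; linarith

lemma γ_pos (h : Adm a b γ ρ) {r : ℝ} (hr : 0 < r) : 0 < γ r :=
  lt_of_lt_of_le (mul_pos h.pos hr) (h.lower hr.le)

lemma γ_nonneg (h : Adm a b γ ρ) {r : ℝ} (hr : 0 ≤ r) : 0 ≤ γ r :=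
  (mul_nonneg h.pos.le hr).trans (h.lower hr)

lemma ρ_pos (h : Adm a b γ ρ) {r : ℝ} (hr : 0 ≤ r) : 0 < ρ r := h.pos.trans_le (h.bounds r hr).1

lemma mono (h : Adm a b γ ρ) {r s : ℝ} (hr : 0 ≤ r) (hrs : r ≤ s) : γ r ≤ γ s := by
  have := (h.sub_bounds hr hrs).1
  nlinarith [mul_nonneg h.pos.le (sub_nonneg.2 hrs)]

lemma strictMono (h : Adm a b γ ρ) {r s : ℝ} (hr : 0 ≤ r) (hrs : r < s) : γ r < γ s := by
  have := (h.sub_bounds hr hrs.le).1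
  nlinarith [mul_pos h.pos (sub_pos.2 hrs)]

lemma le_abs_sub (h : Adm a b γ ρ) {r s : ℝ} (hr : 0 ≤ r) (hs : 0 ≤ s) :
    a * |r - s| ≤ |γ r - γ s| := by
  rcases le_total r s with hrs | hrs
  · rw [abs_sub_comm r, abs_sub_comm (γ r), abs_of_nonneg (sub_nonneg.2 hrs),
      abs_of_nonneg (sub_nonneg.2 (h.mono hr hrs))]
    exact (h.sub_bounds hr hrs).1
  · rw [abs_of_nonneg (sub_nonneg.2 hrs), abs_of_nonneg (sub_nonneg.2 (h.mono hs hrs))]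
    exact (h.sub_bounds hs hrs).1

lemma exp_le (h : Adm a b γ ρ) {r s : ℝ} (hr : 0 ≤ r) (hs : 0 ≤ s) :
    Real.exp (-|γ r - γ s| / 4) ≤ Real.exp (-(a / 4) * |r - s|) := by
  apply Real.exp_le_exp.2
  have := h.le_abs_sub hr hs
  linarith

lemma weaken (h : Adm a b γ ρ) {a' b' : ℝ} (ha' : 0 < a') (ha : a' ≤ a) (hb : b ≤ b') :
    Adm a' b' γ ρ :=
  ⟨ha', h.cont, fun r hr => ⟨ha.trans (h.bounds r hr).1, (h.bounds r hr).2.trans hb⟩, h.zero,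
    h.deriv⟩

end Adm

/-- A continuous momentum bounded by `M`. -/
structure Dens (ω : ℝ → ℝ) (M : ℝ) : Prop where
  cont : ContinuousOn ω (Ici 0)
  bdd : ∀ r, 0 ≤ r → |ω r| ≤ M

lemma Dens.nonneg {ω : ℝ → ℝ} {M : ℝ} (h : Dens ω M) : 0 ≤ M :=
  (abs_nonneg _).trans (h.bdd 0 le_rfl)

/-- The Lagrangian momentum density `s ^ (n - 1) ω(s) / ρ(s)`. -/
def mass (n : ℕ) (ω ρ : ℝ → ℝ) (s : ℝ) : ℝ := s ^ (n - 1) * ω s / ρ s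

lemma continuousOn_mass (n : ℕ) {ω : ℝ → ℝ} {M a b : ℝ} {γ ρ : ℝ → ℝ} (hω : Dens ω M)
    (h : Adm a b γ ρ) : ContinuousOn (mass n ω ρ) (Ici 0) :=
  ((continuous_pow _).continuousOn.mul hω.cont).div h.cont fun _ hr => (h.ρ_pos hr).ne'

/-- Since `a s ≤ γ(s)`, the Lagrangian weight `s^(n-1)` is exchanged for `γ(s)^(n-1)`, in which the
kernel bounds are expressed. -/
lemma abs_mul_mass_le {n : ℕ} (hn : 3 ≤ n) {ω : ℝ → ℝ} {M a b : ℝ} {γ ρ : ℝ → ℝ} (hω : Dens ω M)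
    (h : Adm a b γ ρ) {s q B : ℝ} (hs : 0 < s) (hq : γ s ^ (n - 1) * |q| ≤ B) :
    |q * mass n ω ρ s| ≤ M / a ^ n * B := by
  have ha := h.pos
  have hρ := h.ρ_pos hs.le
  have hM := hω.nonneg
  have h1 := (h.bounds s hs.le).1
  have h2 : s ^ (n - 1) ≤ γ s ^ (n - 1) / a ^ (n - 1) := by
    rw [le_div_iff₀ (by positivity), ← mul_pow, mul_comm]
    exact pow_le_pow_left₀ (by positivity) (h.lower hs.le) _
  have hγ := h.γ_pos hs
  have e : a ^ n = a ^ (n - 1) * a := by rw [← pow_succ]; congr 1; omega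
  rw [mass, abs_mul, abs_div, abs_mul, abs_of_pos hρ, abs_of_pos (by positivity : 0 < s ^ (n - 1))]
  calc |q| * (s ^ (n - 1) * |ω s| / ρ s) ≤ |q| * (γ s ^ (n - 1) / a ^ (n - 1) * M / a) := by
        gcongr; exact hω.bdd s hs.le
    _ = M / a ^ n * (γ s ^ (n - 1) * |q|) := by rw [e]; field_simp
    _ ≤ M / a ^ n * B := by gcongr

/-- A kernel given by `k₁(x, y)` for `x ≤ y` and by `k₂(y, x)` for `y < x`. -/
def pairK (k₁ k₂ : ℝ → ℝ → ℝ) (x y : ℝ) : ℝ := if x ≤ y then k₁ x y else k₂ y x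

/-- The continuity and decay used to integrate a kernel against a momentum density. -/
structure GoodPair (n : ℕ) (k₁ k₂ : ℝ → ℝ → ℝ) (C : ℝ) : Prop where
  cont₁ : ContinuousOn (fun p : ℝ × ℝ => k₁ p.1 p.2) (Ici 0 ×ˢ Ioi 0)
  cont₂ : ContinuousOn (fun p : ℝ × ℝ => k₂ p.1 p.2) (Ici 0 ×ˢ Ioi 0)
  decay : ∀ x y, 0 ≤ x → 0 < y → y ^ (n - 1) * |pairK k₁ k₂ x y| ≤ C * Real.exp (-|x - y| / 4)

lemma continuousOn_greenKernel {n : ℕ} (hn : 3 ≤ n) :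
    ContinuousOn (fun p : ℝ × ℝ => greenKernel n p.1 p.2) (Ici 0 ×ˢ Ioi 0) := by
  have h1 := (continuous_solA n).comp_continuousOn
    (continuousOn_fst (s := Ici (0 : ℝ) ×ˢ Ioi (0 : ℝ)))
  have h2 := (continuous_solA1 n).comp_continuousOn
    (continuousOn_fst (s := Ici (0 : ℝ) ×ˢ Ioi (0 : ℝ)))
  have h3 := (continuousOn_solB n).comp (continuousOn_snd (s := Ici (0 : ℝ) ×ˢ Ioi (0 : ℝ)))
    (fun p hp => hp.2)
  have h4 := (continuousOn_solB1 n).comp (continuousOn_snd (s := Ici (0 : ℝ) ×ˢ Ioi (0 : ℝ)))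
    (fun p hp => hp.2)
  refine ContinuousOn.congr (f := fun p : ℝ × ℝ => (-(p.1 * solA1 n p.1) * solB n p.2
      + solA n p.1 * ((2 - n) * solB n p.2 - p.2 * solB1 n p.2)) / 2) ?_
    (fun p hp => greenKernel_eq hn hp.1 hp.2)
  exact ((((continuousOn_fst.mul h2).neg.mul h3).add (h1.mul ((continuousOn_const.mul h3).sub
    (continuousOn_snd.mul h4)))).div_const 2)

lemma continuousOn_greenD1 (n : ℕ) :
    ContinuousOn (fun p : ℝ × ℝ => greenD1 n p.1 p.2) (Ici 0 ×ˢ Ioi 0) := by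
  have h1 := (continuous_solA1 n).comp_continuousOn
    (continuousOn_fst (s := Ici (0 : ℝ) ×ˢ Ioi (0 : ℝ)))
  have h2 := (continuous_solA2 n).comp_continuousOn
    (continuousOn_fst (s := Ici (0 : ℝ) ×ˢ Ioi (0 : ℝ)))
  have h3 := (continuousOn_solB n).comp (continuousOn_snd (s := Ici (0 : ℝ) ×ˢ Ioi (0 : ℝ)))
    (fun p hp => hp.2)
  have h4 := (continuousOn_solB1 n).comp (continuousOn_snd (s := Ici (0 : ℝ) ×ˢ Ioi (0 : ℝ)))
    (fun p hp => hp.2)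
  exact ((((h1.add (continuousOn_fst.mul h2)).neg.mul h3).add (h1.mul ((continuousOn_const.mul h3).sub
    (continuousOn_snd.mul h4)))).div_const 2)

lemma continuousOn_greenD2 (n : ℕ) :
    ContinuousOn (fun p : ℝ × ℝ => greenD2 n p.1 p.2) (Ici 0 ×ˢ Ioi 0) := by
  have h1 := (continuous_solA n).comp_continuousOn
    (continuousOn_fst (s := Ici (0 : ℝ) ×ˢ Ioi (0 : ℝ)))
  have h2 := (continuous_solA1 n).comp_continuousOn
    (continuousOn_fst (s := Ici (0 : ℝ) ×ˢ Ioi (0 : ℝ)))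
  have h3 := (continuousOn_solB1 n).comp (continuousOn_snd (s := Ici (0 : ℝ) ×ˢ Ioi (0 : ℝ)))
    (fun p hp => hp.2)
  have h4 := (continuousOn_solB2 n).comp (continuousOn_snd (s := Ici (0 : ℝ) ×ˢ Ioi (0 : ℝ)))
    (fun p hp => hp.2)
  exact ((((continuousOn_fst.mul h2).neg.mul h3).add (h1.mul ((continuousOn_const.mul h3).sub
    (continuousOn_snd.mul h4)))).div_const 2)

lemma greenKernel_zero_left (n : ℕ) (y : ℝ) : greenKernel n 0 y = 0 := by simp [greenKernel]

lemma symK_zero_left (n : ℕ) {y : ℝ} (hy : 0 ≤ y) : symK n 0 y = 0 := by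
  rw [symK_of_le hy, greenKernel_zero_left]

lemma goodPair_symK {n : ℕ} (hn : 3 ≤ n) :
    GoodPair n (greenKernel n) (greenKernel n) (kernConst n) where
  cont₁ := continuousOn_greenKernel hn
  cont₂ := continuousOn_greenKernel hn
  decay x y hx hy := by
    have hC := kernConst_pos n
    change y ^ (n - 1) * |symK n x y| ≤ _
    rcases hx.eq_or_lt with rfl | hx
    · rw [symK_zero_left n hy.le]; simp; positivity
    rw [abs_of_nonneg (symK_nonneg hn hx hy)]
    refine (pow_mul_symK_le hn hx hy).trans ?_
    have := wt_le_one hx.le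
    have h2 := wt_pos hx
    gcongr
    nlinarith

lemma pow_mul_symK1_le_of_nonneg {n : ℕ} (hn : 3 ≤ n) {x y : ℝ} (hx : 0 ≤ x) (hy : 0 < y) :
    y ^ (n - 1) * |symK1 n x y| ≤ (n + 1) * kernConst n * Real.exp (-|x - y| / 4) := by
  rcases hx.eq_or_lt with rfl | hx
  · have hc : Continuous fun x => greenD1 n x y :=
      (((((continuous_solA1 n).add (continuous_id.mul (continuous_solA2 n))).neg.mul
        continuous_const).add ((continuous_solA1 n).mul continuous_const)).div_const 2)
    have hl : Tendsto (fun x => y ^ (n - 1) * |greenD1 n x y|) (𝓝[>] 0)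
        (𝓝 (y ^ (n - 1) * |greenD1 n 0 y|)) :=
      ((continuous_const.mul hc.abs).tendsto 0).mono_left nhdsWithin_le_nhds
    have hr : Tendsto (fun x : ℝ => (n + 1) * kernConst n * Real.exp (-|x - y| / 4)) (𝓝[>] 0)
        (𝓝 ((n + 1) * kernConst n * Real.exp (-|0 - y| / 4))) := by
      have : Continuous fun x : ℝ => (n + 1) * kernConst n * Real.exp (-|x - y| / 4) := by fun_prop
      exact (this.tendsto 0).mono_left nhdsWithin_le_nhds
    rw [symK1_of_le hy.le]
    refine le_of_tendsto_of_tendsto hl hr ?_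
    filter_upwards [Ioc_mem_nhdsGT hy] with x hx
    rw [← symK1_of_le hx.2]
    exact pow_mul_symK1_le hn hx.1 hy
  · exact pow_mul_symK1_le hn hx hy

lemma goodPair_symK1 {n : ℕ} (hn : 3 ≤ n) :
    GoodPair n (greenD1 n) (greenD2 n) ((n + 1) * kernConst n) where
  cont₁ := continuousOn_greenD1 n
  cont₂ := continuousOn_greenD2 n
  decay _ _ hx hy := pow_mul_symK1_le_of_nonneg hn hx hy

/-- The integral of a kernel against the Lagrangian momentum density. -/
def kernInt (n : ℕ) (k₁ k₂ : ℝ → ℝ → ℝ) (ω γ ρ : ℝ → ℝ) (r : ℝ) : ℝ :=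
  ∫ s in Ioi 0, pairK k₁ k₂ (γ r) (γ s) * mass n ω ρ s

section kernInt

variable {n : ℕ} {k₁ k₂ : ℝ → ℝ → ℝ} {C M a b : ℝ} {ω γ ρ : ℝ → ℝ}

lemma pairK_integrand_le (hn : 3 ≤ n) (hk : GoodPair n k₁ k₂ C) (hω : Dens ω M)
    (h : Adm a b γ ρ) {r s : ℝ} (hr : 0 ≤ r) (hs : 0 < s) (hC : 0 ≤ C) :
    |pairK k₁ k₂ (γ r) (γ s) * mass n ω ρ s|
      ≤ M / a ^ n * (C * Real.exp (-(a / 4) * |r - s|)) := by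
  refine abs_mul_mass_le hn hω h hs ((hk.decay _ _ (h.γ_nonneg hr) (h.γ_pos hs)).trans ?_)
  exact mul_le_mul_of_nonneg_left (h.exp_le hr hs.le) hC

lemma pairK_of_le {r s : ℝ} (h : Adm a b γ ρ) (hr : 0 ≤ r) (hrs : r ≤ s) :
    pairK k₁ k₂ (γ r) (γ s) = k₁ (γ r) (γ s) := if_pos (h.mono hr hrs)

lemma pairK_of_gt {r s : ℝ} (h : Adm a b γ ρ) (hs : 0 ≤ s) (hrs : s < r) :
    pairK k₁ k₂ (γ r) (γ s) = k₂ (γ s) (γ r) := if_neg (not_le.2 (h.strictMono hs hrs))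

lemma aestronglyMeasurable_pairK (hk : GoodPair n k₁ k₂ C) (hω : Dens ω M)
    (h : Adm a b γ ρ) {r : ℝ} (hr : 0 ≤ r) :
    AEStronglyMeasurable (fun s => pairK k₁ k₂ (γ r) (γ s) * mass n ω ρ s)
      (volume.restrict (Ioi 0)) := by
  refine AEStronglyMeasurable.mul ?_
    (((continuousOn_mass n hω h).mono Ioi_subset_Ici_self).aestronglyMeasurable measurableSet_Ioi)
  have e : Ioi (0 : ℝ) = Ioo 0 r ∪ (Ioi 0 ∩ Ici r) := by
    ext s
    simp only [mem_Ioi, mem_union, mem_Ioo, mem_inter_iff, mem_Ici]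
    constructor
    · intro hs; rcases lt_or_ge s r with h | h
      · exact Or.inl ⟨hs, h⟩
      · exact Or.inr ⟨hs, h⟩
    · rintro (h | h) <;> exact h.1
  rw [e, aestronglyMeasurable_union_iff]
  constructor
  · have hc : ContinuousOn (fun s => k₂ (γ s) (γ r)) (Ioo 0 r) := by
      refine hk.cont₂.comp (f := fun s => (γ s, γ r)) ((h.contγ.mono fun s hs => hs.1.le).prodMk
        continuousOn_const) fun s hs => ⟨h.γ_nonneg hs.1.le, h.γ_pos (hs.1.trans hs.2)⟩
    exact (hc.congr fun s hs => pairK_of_gt h hs.1.le hs.2).aestronglyMeasurable measurableSet_Ioo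
  · have hc : ContinuousOn (fun s => k₁ (γ r) (γ s)) (Ioi 0 ∩ Ici r) := by
      refine hk.cont₁.comp (f := fun s => (γ r, γ s)) (continuousOn_const.prodMk
        (h.contγ.mono fun s hs => mem_Ici.2 (le_of_lt hs.1))) fun s hs => ⟨h.γ_nonneg hr, h.γ_pos hs.1⟩
    exact (hc.congr fun s hs => pairK_of_le h hr hs.2).aestronglyMeasurable
      (measurableSet_Ioi.inter measurableSet_Ici)

lemma GoodPair.nonneg (hk : GoodPair n k₁ k₂ C) : 0 ≤ C := by
  have := hk.decay 1 1 (by norm_num) (by norm_num)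
  simp at this
  exact (abs_nonneg _).trans this

lemma integrableOn_pairK (hn : 3 ≤ n) (hk : GoodPair n k₁ k₂ C) (hω : Dens ω M)
    (h : Adm a b γ ρ) {r : ℝ} (hr : 0 ≤ r) :
    IntegrableOn (fun s => pairK k₁ k₂ (γ r) (γ s) * mass n ω ρ s) (Ioi 0) := by
  have ha := h.pos
  refine Integrable.mono' (g := fun s => M / a ^ n * (C * Real.exp (-(a / 4) * |r - s|)))
    (((integrable_exp_neg_abs (by positivity) r).const_mul C).const_mul _).restrict
    (aestronglyMeasurable_pairK hk hω h hr) ?_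
  refine (ae_restrict_mem measurableSet_Ioi).mono fun s hs => ?_
  exact pairK_integrand_le hn hk hω h hr hs hk.nonneg

lemma setIntegral_exp_neg_abs_le {c : ℝ} (hc : 0 < c) (r : ℝ) :
    ∫ s in Ioi 0, Real.exp (-c * |r - s|) ≤ 2 / c := by
  rw [← integral_exp_neg_abs hc r]
  exact setIntegral_le_integral (integrable_exp_neg_abs hc r)
    (Eventually.of_forall fun s => (Real.exp_pos _).le)

/-- Integrating a pointwise exponential bound. -/
lemma abs_setIntegral_le_of_exp {f : ℝ → ℝ} {c B r : ℝ} (hc : 0 < c)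
    (hf : ∀ᵐ s ∂(volume.restrict (Ioi (0 : ℝ))), |f s| ≤ B * Real.exp (-c * |r - s|)) (hB : 0 ≤ B) :
    |∫ s in Ioi 0, f s| ≤ B * (2 / c) := by
  have h1 := norm_integral_le_of_norm_le (f := f)
    ((integrable_exp_neg_abs hc r).restrict (s := Ioi 0) |>.const_mul B) hf
  rw [integral_const_mul] at h1
  exact h1.trans (mul_le_mul_of_nonneg_left (setIntegral_exp_neg_abs_le hc r) hB)

lemma abs_kernInt_le (hn : 3 ≤ n) (hk : GoodPair n k₁ k₂ C) (hω : Dens ω M)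
    (h : Adm a b γ ρ) {r : ℝ} (hr : 0 ≤ r) :
    |kernInt n k₁ k₂ ω γ ρ r| ≤ M / a ^ n * C * (8 / a) := by
  have ha := h.pos
  have hM := hω.nonneg
  have hC := hk.nonneg
  have := abs_setIntegral_le_of_exp (f := fun s => pairK k₁ k₂ (γ r) (γ s) * mass n ω ρ s)
    (c := a / 4) (B := M / a ^ n * C) (r := r) (by positivity)
    ((ae_restrict_mem measurableSet_Ioi).mono fun s hs => by
      rw [mul_assoc]; exact pairK_integrand_le hn hk hω h hr hs hC) (by positivity)
  refine this.trans (le_of_eq ?_)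
  field_simp; ring

/-- Continuity of `kernInt` in the state and in the point of evaluation. -/
lemma tendsto_kernInt {ι : Type*} {l : Filter ι} [l.IsCountablyGenerated] (hn : 3 ≤ n)
    (hk : GoodPair n k₁ k₂ C) (hω : Dens ω M) (h : Adm a b γ ρ) {r : ℝ} (hr : 0 ≤ r)
    {γ' ρ' : ι → ℝ → ℝ} {r' : ι → ℝ} (h' : ∀ᶠ i in l, Adm a b (γ' i) (ρ' i))
    (hr' : ∀ᶠ i in l, 0 ≤ r' i) (hlim : Tendsto r' l (𝓝 r))
    (hγr : Tendsto (fun i => γ' i (r' i)) l (𝓝 (γ r)))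
    (hγ : ∀ s, 0 < s → Tendsto (fun i => γ' i s) l (𝓝 (γ s)))
    (hρ : ∀ s, 0 < s → Tendsto (fun i => ρ' i s) l (𝓝 (ρ s))) :
    Tendsto (fun i => kernInt n k₁ k₂ ω (γ' i) (ρ' i) (r' i)) l
      (𝓝 (kernInt n k₁ k₂ ω γ ρ r)) := by
  have ha := h.pos
  have hM := hω.nonneg
  have hC := hk.nonneg
  refine tendsto_integral_filter_of_dominated_convergence
    (fun s => M / a ^ n * (C * (Real.exp (a / 4) * Real.exp (-(a / 4) * |r - s|)))) ?_ ?_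
    ((((integrable_exp_neg_abs (by positivity) r).const_mul _).const_mul C).const_mul _).restrict ?_
  · filter_upwards [h', hr'] with i hi hri
    exact aestronglyMeasurable_pairK hk hω hi hri
  · filter_upwards [h', hr', hlim (Metric.closedBall_mem_nhds r one_pos)] with i hi hri hball
    refine (ae_restrict_mem measurableSet_Ioi).mono fun s hs => ?_
    refine (pairK_integrand_le hn hk hω hi hri hs hC).trans ?_
    -- The points `r' i` are eventually within distance `1` of `r`; the factor `exp(a/4)` allows for
    -- this, so one exponential centred at `r` dominates the whole family.
    rw [← Real.exp_add]
    have : |r' i - r| ≤ 1 := by simpa [Real.dist_eq] using hball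
    have h3 : |r - s| ≤ |r' i - s| + 1 := by
      have := abs_sub_le r (r' i) s
      rw [abs_sub_comm r (r' i)] at this; linarith
    gcongr
    nlinarith
  -- At `s = r` the branch of `pairK` could change along the filter. Away from this null set the
  -- order of `s` and `r' i` is eventually constant.
  · have hne : ∀ᵐ s ∂(volume.restrict (Ioi (0 : ℝ))), s ≠ r :=
      (ae_restrict_of_ae (by simp [ae_iff, measure_singleton]))
    filter_upwards [ae_restrict_mem measurableSet_Ioi, hne] with s hs hsr
    have hs : 0 < s := hs
    refine Tendsto.mul ?_ (tendsto_const_nhds.div (hρ s hs) (h.ρ_pos hs.le).ne')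
    rcases lt_or_gt_of_ne hsr with hlt | hgt
    · rw [pairK_of_gt h hs.le hlt]
      have h1 := hk.cont₂ (γ s, γ r) ⟨h.γ_nonneg hs.le, h.γ_pos (hs.trans hlt)⟩
      have h2 : Tendsto (fun i => (γ' i s, γ' i (r' i))) l (𝓝[Ici 0 ×ˢ Ioi 0] (γ s, γ r)) := by
        refine tendsto_nhdsWithin_iff.2 ⟨(hγ s hs).prodMk_nhds hγr, ?_⟩
        filter_upwards [h', hlim (Ioi_mem_nhds hlt)] with i hi hri
        exact ⟨hi.γ_nonneg hs.le, hi.γ_pos (hs.trans hri)⟩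
      refine (Tendsto.comp h1 h2).congr' ?_
      filter_upwards [h', hlim (Ioi_mem_nhds hlt)] with i hi hri
      exact (pairK_of_gt hi hs.le hri).symm
    · rw [pairK_of_le h hr hgt.le]
      have h1 := hk.cont₁ (γ r, γ s) ⟨h.γ_nonneg hr, h.γ_pos hs⟩
      have h2 : Tendsto (fun i => (γ' i (r' i), γ' i s)) l (𝓝[Ici 0 ×ˢ Ioi 0] (γ r, γ s)) := by
        refine tendsto_nhdsWithin_iff.2 ⟨hγr.prodMk_nhds (hγ s hs), ?_⟩
        filter_upwards [h', hr'] with i hi hri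
        exact ⟨hi.γ_nonneg hri, hi.γ_pos hs⟩
      refine (Tendsto.comp h1 h2).congr' ?_
      filter_upwards [h', hr', hlim (Iio_mem_nhds hgt)] with i hi hri hri2
      exact (pairK_of_le hi hri (le_of_lt hri2)).symm

end kernInt

/-- The velocity along trajectories. -/
def velU (n : ℕ) (ω γ ρ : ℝ → ℝ) (r : ℝ) : ℝ :=
  kernInt n (greenKernel n) (greenKernel n) ω γ ρ r

/-- The velocity gradient along trajectories. -/
def velV (n : ℕ) (ω γ ρ : ℝ → ℝ) (r : ℝ) : ℝ := kernInt n (greenD1 n) (greenD2 n) ω γ ρ r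

lemma velU_eq (n : ℕ) (ω γ ρ : ℝ → ℝ) (r : ℝ) :
    velU n ω γ ρ r = ∫ s in Ioi 0, symK n (γ r) (γ s) * mass n ω ρ s := rfl

lemma velV_eq (n : ℕ) (ω γ ρ : ℝ → ℝ) (r : ℝ) :
    velV n ω γ ρ r = ∫ s in Ioi 0, symK1 n (γ r) (γ s) * mass n ω ρ s := rfl

section vel

variable {n : ℕ} {M a b : ℝ} {ω γ ρ : ℝ → ℝ}

lemma trajectory_integrand_left (h : Adm a b γ ρ) {r s : ℝ} (hs : s ∈ Ioc 0 r) :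
    greenKernel n (γ s) (γ r) * (s ^ (n - 1) * ω s / ρ s)
      = pairK (greenKernel n) (greenKernel n) (γ r) (γ s) * mass n ω ρ s := by
  have := symK_of_ge (n := n) (h.mono hs.1.le hs.2)
  rw [← this]; rfl

lemma trajectory_integrand_right (h : Adm a b γ ρ) {r s : ℝ} (hr : 0 ≤ r) (hs : s ∈ Ioi r) :
    greenKernel n (γ r) (γ s) * (s ^ (n - 1) * ω s / ρ s)
      = pairK (greenKernel n) (greenKernel n) (γ r) (γ s) * mass n ω ρ s := by
  have := symK_of_le (n := n) (h.mono hr (le_of_lt hs))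
  rw [← this]; rfl

lemma trajectoryIntegrable_of_adm (hn : 3 ≤ n) (hω : Dens ω M) (h : Adm a b γ ρ) {r : ℝ}
    (hr : 0 ≤ r) : TrajectoryIntegrable n (greenKernel n) ω γ ρ r := by
  have hi := integrableOn_pairK hn (goodPair_symK hn) hω h hr
  constructor
  · exact (hi.mono_set Ioc_subset_Ioi_self).congr_fun
      (fun s hs => (trajectory_integrand_left h hs).symm) measurableSet_Ioc
  · exact (hi.mono_set (Ioi_subset_Ioi hr)).congr_fun
      (fun s hs => (trajectory_integrand_right h hr hs).symm) measurableSet_Ioi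

lemma trajectoryField_eq_velU (hn : 3 ≤ n) (hω : Dens ω M) (h : Adm a b γ ρ) {r : ℝ}
    (hr : 0 ≤ r) : trajectoryField n (greenKernel n) ω γ ρ r = velU n ω γ ρ r := by
  have hi := integrableOn_pairK hn (goodPair_symK hn) hω h hr
  rw [trajectoryField, setIntegral_congr_fun measurableSet_Ioc
      (fun s hs => trajectory_integrand_left h hs),
    setIntegral_congr_fun measurableSet_Ioi (fun s hs => trajectory_integrand_right h hr hs),
    velU, kernInt, ← Ioc_union_Ioi_eq_Ioi hr, setIntegral_union (by
      rw [Set.disjoint_left]; intro s h1 h2; exact absurd h1.2 (not_le.2 h2)) measurableSet_Ioi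
      (hi.mono_set Ioc_subset_Ioi_self) (hi.mono_set (Ioi_subset_Ioi hr))]

lemma velU_zero (h : Adm a b γ ρ) : velU n ω γ ρ 0 = 0 := by
  rw [velU_eq, h.zero]
  rw [setIntegral_congr_fun measurableSet_Ioi (g := fun _ => 0)]
  · simp
  · intro s hs
    simp only [symK_zero_left n (h.γ_pos hs).le, zero_mul]

lemma abs_velU_le (hn : 3 ≤ n) (hω : Dens ω M) (h : Adm a b γ ρ) {r : ℝ} (hr : 0 ≤ r) :
    |velU n ω γ ρ r| ≤ M / a ^ n * kernConst n * (8 / a) * wt (γ r) := by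
  have ha := h.pos
  have hM := hω.nonneg
  have hC := (kernConst_pos n).le
  rcases hr.eq_or_lt with rfl | hr
  · rw [velU_zero h, h.zero]; simp [wt]
  have hγ := h.γ_pos hr
  have hw := wt_pos hγ
  rw [velU_eq]
  have := abs_setIntegral_le_of_exp (f := fun s => symK n (γ r) (γ s) * mass n ω ρ s)
    (c := a / 4) (B := M / a ^ n * (kernConst n * wt (γ r))) (r := r) (by positivity)
    ((ae_restrict_mem measurableSet_Ioi).mono fun s hs => by
      have hs : 0 < s := hs
      rw [mul_assoc]
      refine abs_mul_mass_le hn hω h hs ?_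
      rw [abs_of_nonneg (symK_nonneg hn hγ (h.γ_pos hs))]
      refine (pow_mul_symK_le hn hγ (h.γ_pos hs)).trans ?_
      have := h.exp_le hr.le hs.le
      gcongr) (by positivity)
  refine this.trans (le_of_eq ?_)
  field_simp; ring

lemma abs_velV_le (hn : 3 ≤ n) (hω : Dens ω M) (h : Adm a b γ ρ) {r : ℝ} (hr : 0 ≤ r) :
    |velV n ω γ ρ r| ≤ M / a ^ n * ((n + 1) * kernConst n) * (8 / a) :=
  abs_kernInt_le hn (goodPair_symK1 hn) hω h hr

end vel

end

/-! ### Separable form and spatial derivative of the velocity -/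

noncomputable section

lemma hasDerivAt_setIntegral_Ioc {F : ℝ → ℝ} (hF : ContinuousOn F (Ioi 0)) {r : ℝ} (hr : 0 < r)
    (hi : IntegrableOn F (Ioc 0 r)) : HasDerivAt (fun u => ∫ s in Ioc 0 u, F s) (F r) r := by
  have h := intervalIntegral.integral_hasDerivAt_right
    ((intervalIntegrable_iff_integrableOn_Ioc_of_le hr.le).2 hi)
    (hF.stronglyMeasurableAtFilter isOpen_Ioi r hr) (hF.continuousAt (Ioi_mem_nhds hr))
  refine h.congr_of_eventuallyEq ?_
  filter_upwards [Ioi_mem_nhds hr] with u hu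
  rw [intervalIntegral.integral_of_le (le_of_lt hu)]

lemma hasDerivAt_setIntegral_Ioi {G : ℝ → ℝ} (hG : ContinuousOn G (Ioi 0)) {r : ℝ} (hr : 0 < r)
    (hi : IntegrableOn G (Ioi (r / 2))) : HasDerivAt (fun u => ∫ s in Ioi u, G s) (-G r) r := by
  have hr2 : 0 < r / 2 := by positivity
  have h := intervalIntegral.integral_hasDerivAt_right (a := r / 2) (b := r) (f := G)
    ((intervalIntegrable_iff_integrableOn_Ioc_of_le (by linarith)).2
      (hi.mono_set Ioc_subset_Ioi_self))
    (hG.stronglyMeasurableAtFilter isOpen_Ioi r hr) (hG.continuousAt (Ioi_mem_nhds hr))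
  have h2 := (hasDerivAt_const r (∫ s in Ioi (r / 2), G s)).sub h
  refine (h2.congr_of_eventuallyEq ?_).congr_deriv (by simp)
  filter_upwards [Ioi_mem_nhds (by linarith : r / 2 < r)] with u hu
  have hu' : r / 2 ≤ u := le_of_lt hu
  simp only [Pi.sub_apply]
  rw [intervalIntegral.integral_of_le hu', ← Ioc_union_Ioi_eq_Ioi hu',
    setIntegral_union (by
      rw [Set.disjoint_left]; intro s h1 h2; exact absurd h1.2 (not_le.2 h2)) measurableSet_Ioi
      (hi.mono_set Ioc_subset_Ioi_self) (hi.mono_set (Ioi_subset_Ioi hu'))]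
  ring

lemma hasDerivAt_split {F G p q : ℝ → ℝ} {p' q' r : ℝ} (hF : ContinuousOn F (Ioi 0))
    (hG : ContinuousOn G (Ioi 0)) (hr : 0 < r) (hFi : IntegrableOn F (Ioc 0 r))
    (hGi : IntegrableOn G (Ioi (r / 2))) (hp : HasDerivAt p p' r) (hq : HasDerivAt q q' r) :
    HasDerivAt (fun u => q u * (∫ s in Ioc 0 u, F s) + p u * ∫ s in Ioi u, G s)
      (q' * (∫ s in Ioc 0 r, F s) + p' * (∫ s in Ioi r, G s) + (q r * F r - p r * G r)) r := by
  refine ((hq.mul (hasDerivAt_setIntegral_Ioc hF hr hFi)).add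
    (hp.mul (hasDerivAt_setIntegral_Ioi hG hr hGi))).congr_deriv ?_
  ring

/-- The function `y ↦ (2 - n) b(y) - y b'(y)` of the separable form of the Green kernel. -/
def solE (n : ℕ) (y : ℝ) : ℝ := (2 - n) * solB n y - y * solB1 n y

/-- The derivative of `solE`. -/
def solE1 (n : ℕ) (y : ℝ) : ℝ := (1 - n) * solB1 n y - y * solB2 n y

/-- The function `x ↦ x a'(x)` of the separable form of the Green kernel. -/
def solC (n : ℕ) (x : ℝ) : ℝ := x * solA1 n x

/-- The derivative of `solC`. -/
def solC1 (n : ℕ) (x : ℝ) : ℝ := solA1 n x + x * solA2 n x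

lemma solE_hasDerivAt (n : ℕ) {x : ℝ} (hx : 0 < x) : HasDerivAt (solE n) (solE1 n x) x := by
  refine (((solB_hasDerivAt n hx).const_mul (2 - (n : ℝ))).sub
    ((hasDerivAt_id x).mul (solB1_hasDerivAt n hx))).congr_deriv ?_
  simp only [solE1, id]; ring

lemma solC_hasDerivAt (n : ℕ) {x : ℝ} (hx : 0 < x) : HasDerivAt (solC n) (solC1 n x) x := by
  refine ((hasDerivAt_id x).mul (solA1_hasDerivAt n hx)).congr_deriv ?_
  simp only [solC1, id]; ring

lemma continuous_solC (n : ℕ) : Continuous (solC n) := continuous_id.mul (continuous_solA1 n)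

lemma continuousOn_solE (n : ℕ) : ContinuousOn (solE n) (Ioi 0) := fun _ hx =>
  (solE_hasDerivAt n hx).continuousAt.continuousWithinAt

section deriv

variable {n : ℕ} {M a b : ℝ} {ω γ ρ : ℝ → ℝ}

lemma integrableOn_reg {f : ℝ → ℝ} (hf : Continuous f) (hω : Dens ω M) (h : Adm a b γ ρ) (r : ℝ) :
    IntegrableOn (fun s => f (γ s) * mass n ω ρ s) (Ioc 0 r) := by
  have hc : ContinuousOn (fun s => f (γ s) * mass n ω ρ s) (Icc 0 r) :=
    ((hf.comp_continuousOn h.contγ).mul (continuousOn_mass n hω h)).mono Icc_subset_Ici_self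
  exact hc.integrableOn_Icc.mono_set Ioc_subset_Icc_self

lemma continuousOn_reg {f : ℝ → ℝ} (hf : Continuous f) (hω : Dens ω M) (h : Adm a b γ ρ) :
    ContinuousOn (fun s => f (γ s) * mass n ω ρ s) (Ioi 0) :=
  ((hf.comp_continuousOn h.contγ).mul (continuousOn_mass n hω h)).mono Ioi_subset_Ici_self

lemma continuousOn_dec {g : ℝ → ℝ} (hg : ContinuousOn g (Ioi 0)) (hω : Dens ω M)
    (h : Adm a b γ ρ) : ContinuousOn (fun s => g (γ s) * mass n ω ρ s) (Ioi 0) :=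
  (hg.comp (h.contγ.mono Ioi_subset_Ici_self) fun _ hs => h.γ_pos hs).mul
    ((continuousOn_mass n hω h).mono Ioi_subset_Ici_self)

/-- The bound on `γ(s)^(n-1) a(γ r) b(γ s)` is divided by the positive constant `a(γ r)`. -/
lemma integrableOn_solB (hn : 3 ≤ n) (hω : Dens ω M) (h : Adm a b γ ρ) {r : ℝ} (hr : 0 < r) :
    IntegrableOn (fun s => solB n (γ s) * mass n ω ρ s) (Ioi r) := by
  have ha := h.pos
  have hx := h.γ_pos hr
  have hA := solA_pos n hx
  have hC := (kernConst_pos n).le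
  refine Integrable.mono' (g := fun s => M / a ^ n * (kernConst n * (γ r / solA n (γ r))
      * Real.exp (-(a / 4) * |r - s|)))
    (((integrable_exp_neg_abs (by positivity) r).const_mul _).const_mul _).restrict
    (((continuousOn_dec (continuousOn_solB n) hω h).mono (Ioi_subset_Ioi hr.le)).aestronglyMeasurable
      measurableSet_Ioi) ?_
  refine (ae_restrict_mem measurableSet_Ioi).mono fun s hs => ?_
  have hs' : r < s := hs
  have hs0 : 0 < s := hr.trans hs'
  refine abs_mul_mass_le hn hω h hs0 ?_
  have hy := h.γ_pos hs0
  have hxy := h.mono hr.le hs'.le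
  rw [abs_of_pos (solB_pos n hy)]
  have h1 := pow_mul_solA_solB_le hn (c := 1) hx hxy (by
    have : (3 : ℝ) ≤ n := by exact_mod_cast hn
    linarith)
  have h2 := h.exp_le hr.le hs0.le
  rw [abs_sub_comm, abs_of_nonneg (sub_nonneg.2 hxy)] at h2
  have h3 : γ s ^ (n - 1) * solB n (γ s)
      = (γ s ^ (n - 1) * (1 * (solA n (γ r) * solB n (γ s)))) / solA n (γ r) := by field_simp
  rw [h3]
  calc _ ≤ kernConst n * (γ r / (1 + γ s)) * Real.exp (-(γ s - γ r) / 4) / solA n (γ r) := by gcongr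
    _ ≤ kernConst n * γ r * Real.exp (-(a / 4) * |r - s|) / solA n (γ r) := by
        gcongr; exact div_le_self hx.le (by linarith)
    _ = _ := by ring

/-- The separable formula is solved for this term: it is a combination of the kernel integrand and
the one with `b`, both already integrable. -/
lemma integrableOn_solE (hn : 3 ≤ n) (hω : Dens ω M) (h : Adm a b γ ρ) {r : ℝ} (hr : 0 < r) :
    IntegrableOn (fun s => solE n (γ s) * mass n ω ρ s) (Ioi r) := by
  have hx := h.γ_pos hr
  have hA := solA_pos n hx
  have h1 := (integrableOn_pairK hn (goodPair_symK hn) hω h hr.le).mono_set (Ioi_subset_Ioi hr.le)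
  have h2 := integrableOn_solB hn hω h hr
  refine IntegrableOn.congr_fun (((h1.const_mul 2).add (h2.const_mul (solC n (γ r)))).const_mul
    (1 / solA n (γ r))) (fun s hs => ?_) measurableSet_Ioi
  have hs' : r < s := hs
  simp only [Pi.add_apply]
  rw [pairK_of_le h hr.le hs'.le, greenKernel_eq hn hx.le (h.γ_pos (hr.trans hs')), solE, solC]
  field_simp
  ring

/-- The separable form of the velocity. -/
lemma velU_split (hn : 3 ≤ n) (hω : Dens ω M) (h : Adm a b γ ρ) {r : ℝ} (hr : 0 < r) :
    velU n ω γ ρ r =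
      ((-solB n (γ r) * (∫ s in Ioc 0 r, solC n (γ s) * mass n ω ρ s)
        + -solC n (γ r) * ∫ s in Ioi r, solB n (γ s) * mass n ω ρ s)
      + (solE n (γ r) * (∫ s in Ioc 0 r, solA n (γ s) * mass n ω ρ s)
        + solA n (γ r) * ∫ s in Ioi r, solE n (γ s) * mass n ω ρ s)) / 2 := by
  have hx := h.γ_pos hr
  have hi := integrableOn_pairK hn (goodPair_symK hn) hω h hr.le
  have hC := integrableOn_reg (n := n) (continuous_solC n) hω h r
  have hA := integrableOn_reg (n := n) (continuous_solA n) hω h r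
  have hB := integrableOn_solB hn hω h hr
  have hE := integrableOn_solE hn hω h hr
  rw [velU, kernInt, ← Ioc_union_Ioi_eq_Ioi hr.le, setIntegral_union (by
      rw [Set.disjoint_left]; intro s h1 h2; exact absurd h1.2 (not_le.2 h2)) measurableSet_Ioi
      (hi.mono_set Ioc_subset_Ioi_self) (hi.mono_set (Ioi_subset_Ioi hr.le))]
  have e1 : ∫ s in Ioc 0 r, pairK (greenKernel n) (greenKernel n) (γ r) (γ s) * mass n ω ρ s
      = ∫ s in Ioc 0 r, ((-solB n (γ r) / 2) * (solC n (γ s) * mass n ω ρ s)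
        + (solE n (γ r) / 2) * (solA n (γ s) * mass n ω ρ s)) := by
    refine setIntegral_congr_fun measurableSet_Ioc fun s hs => ?_
    have hs0 : 0 < s := hs.1
    rw [← trajectory_integrand_left h hs, greenKernel_eq hn (h.γ_pos hs0).le hx, mass, solE, solC]
    ring
  have e2 : ∫ s in Ioi r, pairK (greenKernel n) (greenKernel n) (γ r) (γ s) * mass n ω ρ s
      = ∫ s in Ioi r, ((-solC n (γ r) / 2) * (solB n (γ s) * mass n ω ρ s)
        + (solA n (γ r) / 2) * (solE n (γ s) * mass n ω ρ s)) := by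
    refine setIntegral_congr_fun measurableSet_Ioi fun s hs => ?_
    have hs' : r < s := hs
    rw [pairK_of_le h hr.le hs'.le, greenKernel_eq hn hx.le (h.γ_pos (hr.trans hs')), solE, solC]
    ring
  rw [e1, e2, integral_add (hC.const_mul _) (hA.const_mul _),
    integral_add (hB.const_mul _) (hE.const_mul _), integral_const_mul, integral_const_mul,
    integral_const_mul, integral_const_mul]
  ring

/-- The separable form of the velocity gradient. -/
lemma velV_split (hn : 3 ≤ n) (hω : Dens ω M) (h : Adm a b γ ρ) {r : ℝ} (hr : 0 < r) :
    velV n ω γ ρ r =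
      ((-solB1 n (γ r) * (∫ s in Ioc 0 r, solC n (γ s) * mass n ω ρ s)
        + -solC1 n (γ r) * ∫ s in Ioi r, solB n (γ s) * mass n ω ρ s)
      + (solE1 n (γ r) * (∫ s in Ioc 0 r, solA n (γ s) * mass n ω ρ s)
        + solA1 n (γ r) * ∫ s in Ioi r, solE n (γ s) * mass n ω ρ s)) / 2 := by
  have hx := h.γ_pos hr
  have hi := integrableOn_pairK hn (goodPair_symK1 hn) hω h hr.le
  have hC := integrableOn_reg (n := n) (continuous_solC n) hω h r
  have hA := integrableOn_reg (n := n) (continuous_solA n) hω h r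
  have hB := integrableOn_solB hn hω h hr
  have hE := integrableOn_solE hn hω h hr
  rw [velV, kernInt, ← Ioc_union_Ioi_eq_Ioi hr.le, setIntegral_union (by
      rw [Set.disjoint_left]; intro s h1 h2; exact absurd h1.2 (not_le.2 h2)) measurableSet_Ioi
      (hi.mono_set Ioc_subset_Ioi_self) (hi.mono_set (Ioi_subset_Ioi hr.le))]
  have e1 : ∫ s in Ioc 0 r, pairK (greenD1 n) (greenD2 n) (γ r) (γ s) * mass n ω ρ s
      = ∫ s in Ioc 0 r, ((-solB1 n (γ r) / 2) * (solC n (γ s) * mass n ω ρ s)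
        + (solE1 n (γ r) / 2) * (solA n (γ s) * mass n ω ρ s)) := by
    -- `pairK` takes its first branch at `s = r`, so the second one is available only off a null
    -- set.
    refine setIntegral_congr_ae measurableSet_Ioc ?_
    have hne : ∀ᵐ s : ℝ, s ≠ r := by simp [ae_iff, measure_singleton]
    filter_upwards [hne] with s hsr hs
    rw [pairK_of_gt h hs.1.le (lt_of_le_of_ne hs.2 hsr), greenD2, solE1, solC]
    ring
  have e2 : ∫ s in Ioi r, pairK (greenD1 n) (greenD2 n) (γ r) (γ s) * mass n ω ρ s
      = ∫ s in Ioi r, ((-solC1 n (γ r) / 2) * (solB n (γ s) * mass n ω ρ s)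
        + (solA1 n (γ r) / 2) * (solE n (γ s) * mass n ω ρ s)) := by
    refine setIntegral_congr_fun measurableSet_Ioi fun s hs => ?_
    have hs' : r < s := hs
    rw [pairK_of_le h hr.le hs'.le, greenD1, solE, solC1]
    ring
  rw [e1, e2, integral_add (hC.const_mul _) (hA.const_mul _),
    integral_add (hB.const_mul _) (hE.const_mul _), integral_const_mul, integral_const_mul,
    integral_const_mul, integral_const_mul]
  ring

/-- The boundary terms from the moving endpoint cancel within each separable pair, since the two
products agree at `s = r`. What remains is the integral against the differentiated kernel,
multiplied by `γ_r`. -/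
lemma velU_hasDerivAt (hn : 3 ≤ n) (hω : Dens ω M) (h : Adm a b γ ρ) {r : ℝ} (hr : 0 < r) :
    HasDerivAt (velU n ω γ ρ) (ρ r * velV n ω γ ρ r) r := by
  have hr2 : 0 < r / 2 := by positivity
  have hx := h.γ_pos hr
  have hγ := h.hasDerivAt hr
  have h1 := hasDerivAt_split (continuousOn_reg (n := n) (continuous_solC n) hω h)
    (continuousOn_dec (n := n) (continuousOn_solB n) hω h) hr
    (integrableOn_reg (continuous_solC n) hω h r) (integrableOn_solB hn hω h hr2)
    ((solC_hasDerivAt n hx).comp r hγ).neg ((solB_hasDerivAt n hx).comp r hγ).neg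
  have h2 := hasDerivAt_split (continuousOn_reg (n := n) (continuous_solA n) hω h)
    (continuousOn_dec (n := n) (continuousOn_solE n) hω h) hr
    (integrableOn_reg (continuous_solA n) hω h r) (integrableOn_solE hn hω h hr2)
    ((solA_hasDerivAt n _).comp r hγ) ((solE_hasDerivAt n hx).comp r hγ)
  refine (((h1.add h2).div_const 2).congr_of_eventuallyEq ?_).congr_deriv ?_
  · filter_upwards [Ioi_mem_nhds hr] with u hu
    exact velU_split hn hω h hu
  · rw [velV_split hn hω h hr]
    simp only [Function.comp, Pi.neg_apply]
    ring

end deriv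

end

/-! ### The kernel inverts the inertia operator -/

noncomputable section

lemma radialHelmholtz_eq {n : ℕ} {f g h : ℝ → ℝ} (hf : ∀ r, 0 < r → HasDerivAt f (g r) r)
    (hg : ∀ r, 0 < r →
      HasDerivAt g (f r + ((n : ℝ) - 1) / r ^ 2 * f r - ((n : ℝ) - 1) / r * g r - h r) r)
    {r : ℝ} (hr : 0 < r) : radialHelmholtz n f r = h r := by
  have e : deriv f =ᶠ[𝓝 r] g := by
    filter_upwards [Ioi_mem_nhds hr] with u hu using (hf u hu).deriv
  rw [radialHelmholtz, radialLaplacian, e.deriv_eq, (hg r hr).deriv, (hf r hr).deriv]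
  ring

lemma contDiffOn_succ_of_hasDerivAt {f g : ℝ → ℝ} (k : ℕ)
    (hf : ∀ r, 0 < r → HasDerivAt f (g r) r) (hg : ContDiffOn ℝ k g (Ioi 0)) :
    ContDiffOn ℝ (k + 1 : ℕ) f (Ioi 0) := by
  push_cast
  rw [contDiffOn_succ_iff_deriv_of_isOpen isOpen_Ioi]
  refine ⟨fun x hx => (hf x hx).differentiableAt.differentiableWithinAt, by simp,
    hg.congr fun x hx => (hf x hx).deriv⟩

lemma contDiffOn_helmholtz_rhs {n k : ℕ} {f g h : ℝ → ℝ} (hf : ContDiffOn ℝ k f (Ioi 0))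
    (hg : ContDiffOn ℝ k g (Ioi 0)) (hh : ContDiffOn ℝ k h (Ioi 0)) :
    ContDiffOn ℝ k
      (fun r => f r + ((n : ℝ) - 1) / r ^ 2 * f r - ((n : ℝ) - 1) / r * g r - h r) (Ioi 0) := by
  have h1 : ContDiffOn ℝ k (fun r : ℝ => ((n : ℝ) - 1) / r ^ 2) (Ioi 0) :=
    contDiffOn_const.div (contDiffOn_id.pow 2) fun r hr => pow_ne_zero 2 (ne_of_gt hr)
  have h2 : ContDiffOn ℝ k (fun r : ℝ => ((n : ℝ) - 1) / r) (Ioi 0) :=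
    contDiffOn_const.div contDiffOn_id fun r hr => ne_of_gt hr
  exact ((hf.add (h1.mul hf)).sub (h2.mul hg)).sub hh

/-- Two derivatives are gained by inverting a Helmholtz operator. -/
lemma contDiffOn_helmholtz {n k : ℕ} {f g h : ℝ → ℝ} (hf : ∀ r, 0 < r → HasDerivAt f (g r) r)
    (hg : ∀ r, 0 < r →
      HasDerivAt g (f r + ((n : ℝ) - 1) / r ^ 2 * f r - ((n : ℝ) - 1) / r * g r - h r) r)
    (hh : ContDiffOn ℝ k h (Ioi 0)) : ContDiffOn ℝ (k + 2 : ℕ) f (Ioi 0) := by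
  have key : ∀ j : ℕ, j ≤ k + 1 → ContDiffOn ℝ j g (Ioi 0) := by
    intro j
    induction j with
    | zero =>
      intro _
      exact contDiffOn_zero.2 fun x hx => (hg x hx).continuousAt.continuousWithinAt
    | succ j ih =>
      intro hj
      have h1 := ih (by omega)
      refine contDiffOn_succ_of_hasDerivAt j hg (contDiffOn_helmholtz_rhs ?_ h1
        (hh.of_le (by exact_mod_cast (by omega : j ≤ k))))
      exact (contDiffOn_succ_of_hasDerivAt j hf h1).of_le (by exact_mod_cast Nat.le_succ j)
  exact contDiffOn_succ_of_hasDerivAt (k + 1) hf (key (k + 1) le_rfl)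

lemma solA2_eq (n : ℕ) {x : ℝ} (hx : 0 < x) :
    solA2 n x = solA n x + ((n : ℝ) - 1) / x ^ 2 * solA n x - ((n : ℝ) - 1) / x * solA1 n x := by
  rw [solA2, solA, solA1]; field_simp; ring

lemma solB2_eq (n : ℕ) {x : ℝ} (hx : 0 < x) :
    solB2 n x = solB n x + ((n : ℝ) - 1) / x ^ 2 * solB n x - ((n : ℝ) - 1) / x * solB1 n x := by
  rw [solB2, solB, solB1]; field_simp; ring

/-- In terms of the operator, `(1 - Δ)(x a') = -2a`. Together with the companion identity, whose
source is `2b`, it explains why the separable form of the velocity is mapped by `1 - Δ` to a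
variation-of-constants integral. -/
lemma solC1_hasDerivAt (n : ℕ) {x : ℝ} (hx : 0 < x) :
    HasDerivAt (solC1 n) (solC n x + ((n : ℝ) - 1) / x ^ 2 * solC n x
      - ((n : ℝ) - 1) / x * solC1 n x + 2 * solA n x) x := by
  refine ((solA1_hasDerivAt n hx).add ((hasDerivAt_id x).mul (((hasDerivAt_id x).mul
    (alphaN_hasDerivAt n x)).sub ((alphaD_hasDerivAt n hx).const_mul ((n : ℝ) - 1))))).congr_deriv ?_
  simp only [solA2, solC, solC1, solA1, solA, id, Pi.sub_apply, Pi.mul_apply]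
  field_simp
  ring

lemma solE1_hasDerivAt (n : ℕ) {x : ℝ} (hx : 0 < x) :
    HasDerivAt (solE1 n) (solE n x + ((n : ℝ) - 1) / x ^ 2 * solE n x
      - ((n : ℝ) - 1) / x * solE1 n x - 2 * solB n x) x := by
  refine (((solB1_hasDerivAt n hx).const_mul (1 - (n : ℝ))).sub
    ((hasDerivAt_id x).mul (((hasDerivAt_id x).mul
    (betaN_hasDerivAt n hx)).sub ((betaD_hasDerivAt n hx).const_mul ((n : ℝ) - 1))))).congr_deriv ?_
  simp only [solB2, solE, solE1, solB1, solB, id, Pi.sub_apply, Pi.mul_apply]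
  field_simp
  ring

lemma wronskian (n : ℕ) (hn : 1 ≤ n) {x : ℝ} (hx : 0 < x) :
    x ^ (n - 1) * (solB1 n x * solA n x - solA1 n x * solB n x) = -1 := by
  rw [← alphaN_mul_betaD_sub hn hx, solA, solB, solA1, solB1]
  obtain ⟨m, rfl⟩ : ∃ m, n = m + 1 := ⟨n - 1, by omega⟩
  simp only [Nat.add_sub_cancel]
  ring

section green

variable {n : ℕ} {M : ℝ} {ω : ℝ → ℝ}

lemma adm_id : Adm 1 1 id (fun _ => 1) :=
  ⟨one_pos, continuousOn_const, fun _ _ => ⟨le_rfl, le_rfl⟩, rfl,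
    fun r _ => hasDerivWithinAt_id r _⟩

/-- The solution of the radial Helmholtz equation given by variation of constants. -/
def helmW (n : ℕ) (ω : ℝ → ℝ) (r : ℝ) : ℝ :=
  solB n r * (∫ s in Ioc 0 r, solA n s * mass n ω (fun _ => 1) s)
    + solA n r * ∫ s in Ioi r, solB n s * mass n ω (fun _ => 1) s

/-- The derivative of `helmW`. -/
def helmW1 (n : ℕ) (ω : ℝ → ℝ) (r : ℝ) : ℝ :=
  solB1 n r * (∫ s in Ioc 0 r, solA n s * mass n ω (fun _ => 1) s)
    + solA1 n r * ∫ s in Ioi r, solB n s * mass n ω (fun _ => 1) s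

lemma helmW_hasDerivAt (hn : 3 ≤ n) (hω : Dens ω M) {r : ℝ} (hr : 0 < r) :
    HasDerivAt (helmW n ω) (helmW1 n ω r) r := by
  have hr2 : 0 < r / 2 := by positivity
  refine (hasDerivAt_split (continuousOn_reg (n := n) (continuous_solA n) hω adm_id)
    (continuousOn_dec (n := n) (continuousOn_solB n) hω adm_id) hr
    (integrableOn_reg (continuous_solA n) hω adm_id r) (integrableOn_solB hn hω adm_id hr2)
    (solA_hasDerivAt n r) (solB_hasDerivAt n hr)).congr_deriv ?_
  simp only [helmW1, id]; ring

lemma helmW1_hasDerivAt (hn : 3 ≤ n) (hω : Dens ω M) {r : ℝ} (hr : 0 < r) :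
    HasDerivAt (helmW1 n ω) (helmW n ω r + ((n : ℝ) - 1) / r ^ 2 * helmW n ω r
      - ((n : ℝ) - 1) / r * helmW1 n ω r - ω r) r := by
  have hr2 : 0 < r / 2 := by positivity
  refine (hasDerivAt_split (continuousOn_reg (n := n) (continuous_solA n) hω adm_id)
    (continuousOn_dec (n := n) (continuousOn_solB n) hω adm_id) hr
    (integrableOn_reg (continuous_solA n) hω adm_id r) (integrableOn_solB hn hω adm_id hr2)
    (solA1_hasDerivAt n hr) (solB1_hasDerivAt n hr)).congr_deriv ?_
  -- The endpoint contribution is the Wronskian times `r^(n-1) ω(r)`, that is, the source term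
  -- `-ω(r)`.
  have hw := wronskian n (by omega) hr
  have h1 : solB1 n r * (solA n r * mass n ω (fun _ => 1) r)
      - solA1 n r * (solB n r * mass n ω (fun _ => 1) r) = -ω r := by
    rw [mass, div_one]
    linear_combination ω r * hw
  simp only [id]
  rw [h1, solA2_eq n hr, solB2_eq n hr, helmW1, helmW]
  ring

lemma velV_id_hasDerivAt (hn : 3 ≤ n) (hω : Dens ω M) {r : ℝ} (hr : 0 < r) :
    HasDerivAt (velV n ω id (fun _ => 1)) (velU n ω id (fun _ => 1) r
      + ((n : ℝ) - 1) / r ^ 2 * velU n ω id (fun _ => 1) r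
      - ((n : ℝ) - 1) / r * velV n ω id (fun _ => 1) r - helmW n ω r) r := by
  have hr2 : 0 < r / 2 := by positivity
  have h1 := hasDerivAt_split (continuousOn_reg (n := n) (continuous_solC n) hω adm_id)
    (continuousOn_dec (n := n) (continuousOn_solB n) hω adm_id) hr
    (integrableOn_reg (continuous_solC n) hω adm_id r) (integrableOn_solB hn hω adm_id hr2)
    (solC1_hasDerivAt n hr).neg (solB1_hasDerivAt n hr).neg
  have h2 := hasDerivAt_split (continuousOn_reg (n := n) (continuous_solA n) hω adm_id)
    (continuousOn_dec (n := n) (continuousOn_solE n) hω adm_id) hr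
    (integrableOn_reg (continuous_solA n) hω adm_id r) (integrableOn_solE hn hω adm_id hr2)
    (solA1_hasDerivAt n hr) (solE1_hasDerivAt n hr)
  refine (((h1.add h2).div_const 2).congr_of_eventuallyEq ?_).congr_deriv ?_
  · filter_upwards [Ioi_mem_nhds hr] with u hu
    exact velV_split hn hω adm_id hu
  · rw [velV_split hn hω adm_id hr, velU_split hn hω adm_id hr, helmW, solA2_eq n hr,
      solB2_eq n hr]
    -- The endpoint terms of the two separable pairs do not vanish separately; their sum does,
    -- because the first derivative of the kernel is continuous across the diagonal.
    have h0 : -solB1 n r * solC n r + solC1 n r * solB n r + solE1 n r * solA n r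
        - solA1 n r * solE n r = 0 := by
      rw [solC, solC1, solE1, solE, solA2_eq n hr, solB2_eq n hr]
      field_simp
      ring
    simp only [id, Pi.neg_apply]
    linear_combination (mass n ω (fun _ => 1) r / 2) * h0

lemma exists_dens (hω : ContinuousOn ω (Ici 0)) (hlim : Tendsto ω atTop (𝓝 0)) :
    ∃ M, Dens ω M := by
  obtain ⟨R, hR⟩ := eventually_atTop.1 ((hlim.abs).eventually (gt_mem_nhds (by simp : |(0:ℝ)| < 1)))
  obtain ⟨C, hC⟩ := (isCompact_Icc (a := (0:ℝ)) (b := R)).exists_bound_of_continuousOn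
    (hω.mono Icc_subset_Ici_self)
  refine ⟨max C 1, hω, fun r hr => ?_⟩
  rcases le_total r R with h | h
  · exact (hC r ⟨hr, h⟩).trans (le_max_left _ _)
  · exact (hR r h).le.trans (le_max_right _ _)

lemma velU_id_tendsto_zero (hn : 3 ≤ n) (hω : Dens ω M) :
    Tendsto (velU n ω id (fun _ => 1)) (𝓝[>] 0) (𝓝 0) := by
  have hc : Tendsto (fun r : ℝ => M / 1 ^ n * kernConst n * (8 / 1) * wt r) (𝓝[>] 0) (𝓝 0) := by
    have : ContinuousAt (fun r : ℝ => M / 1 ^ n * kernConst n * (8 / 1) * wt r) 0 := by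
      unfold wt
      refine continuousAt_const.mul (continuousAt_id.div (by fun_prop) (by norm_num))
    have h2 := this.tendsto
    simp only [wt, zero_div, mul_zero] at h2
    exact h2.mono_left nhdsWithin_le_nhds
  refine squeeze_zero_norm' ?_ hc
  filter_upwards [self_mem_nhdsWithin] with r hr
  exact abs_velU_le hn hω adm_id (le_of_lt hr)

lemma velU_id_tendsto_atTop (hn : 3 ≤ n) (hω : Dens ω M) (hlim : Tendsto ω atTop (𝓝 0)) :
    Tendsto (velU n ω id (fun _ => 1)) atTop (𝓝 0) := by
  have hM := hω.nonneg
  have hC := kernConst_pos n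
  rw [Metric.tendsto_atTop]
  intro ε hε
  obtain ⟨ε', hε', hε2⟩ : ∃ ε' > 0, (ε' * kernConst n) * (2 / (1 / 8)) < ε / 2 := by
    refine ⟨ε / (64 * kernConst n), by positivity, ?_⟩
    field_simp; norm_num
  obtain ⟨R, hR⟩ := eventually_atTop.1 ((hlim.abs).eventually (gt_mem_nhds (by simpa using hε' : |(0:ℝ)| < ε')))
  have hdec : Tendsto (fun r : ℝ => (M * kernConst n * Real.exp (-(r - R) / 8)) * (2 / (1 / 8)))
      atTop (𝓝 0) := by
    have h1 : Tendsto (fun r : ℝ => -(r - R) / 8) atTop atBot := by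
      have : Tendsto (fun r : ℝ => (r - R) / 8) atTop atTop :=
        (tendsto_atTop_add_const_right _ (-R) tendsto_id).atTop_div_const (by norm_num)
      refine (tendsto_neg_atTop_atBot.comp this).congr fun r => ?_
      simp only [Function.comp]; ring
    have h2 := ((Real.tendsto_exp_atBot.comp h1).const_mul (M * kernConst n)).mul_const (2 / (1 / 8) : ℝ)
    simpa using h2
  obtain ⟨R', hR'⟩ := eventually_atTop.1 (hdec.eventually (gt_mem_nhds (half_pos hε)))
  refine ⟨max 1 (max R R'), fun r hr => ?_⟩
  have hr1 : 1 ≤ r := (le_max_left _ _).trans hr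
  have hrR : R ≤ r := (le_max_left _ _).trans ((le_max_right _ _).trans hr)
  have hrR' : R' ≤ r := (le_max_right _ _).trans ((le_max_right _ _).trans hr)
  have hr0 : 0 < r := by linarith
  rw [dist_zero_right, Real.norm_eq_abs, velU_eq]
  -- The decay rate `1/4` is split into two halves. One, `1/8`, is kept for integrability in `s`.
  -- For `s ≥ R` the momentum is at most `ε'`; for `s ≤ R` the other half gives the small factor
  -- `exp(-(r-R)/8)`.
  have hb := abs_setIntegral_le_of_exp
    (f := fun s => symK n (id r) (id s) * mass n ω (fun _ => 1) s) (c := 1 / 8) (r := r)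
    (B := ε' * kernConst n + M * kernConst n * Real.exp (-(r - R) / 8)) (by norm_num) ?_
    (by positivity)
  · refine hb.trans_lt ?_
    have := hR' r hrR'
    rw [add_mul]; linarith
  · refine (ae_restrict_mem measurableSet_Ioi).mono fun s hs => ?_
    have hs : 0 < s := hs
    have h1 := (pow_mul_symK_le hn hr0 hs)
    have h2 := wt_le_one hr0.le
    have h3 := wt_pos hr0
    have h4 := symK_nonneg hn hr0 hs
    simp only [id, mass, div_one]
    rw [abs_mul, abs_mul, abs_of_nonneg h4, abs_of_nonneg (pow_nonneg hs.le _)]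
    have h5 : symK n r s * (s ^ (n - 1) * |ω s|)
        ≤ kernConst n * Real.exp (-|r - s| / 4) * |ω s| := by
      rw [← mul_assoc, mul_comm (symK n r s)]
      refine mul_le_mul_of_nonneg_right (h1.trans ?_) (abs_nonneg _)
      refine mul_le_mul_of_nonneg_right ?_ (Real.exp_pos _).le
      nlinarith
    refine h5.trans ?_
    rcases le_total R s with hsR | hsR
    · calc kernConst n * Real.exp (-|r - s| / 4) * |ω s|
          ≤ kernConst n * Real.exp (-(1 / 8) * |r - s|) * ε' := by
            gcongr
            · linarith [abs_nonneg (r - s)]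
            · exact (hR s hsR).le
        _ = ε' * kernConst n * Real.exp (-(1 / 8) * |r - s|) := by ring
        _ ≤ _ := by
            refine mul_le_mul_of_nonneg_right ?_ (Real.exp_pos _).le
            have : 0 ≤ M * kernConst n * Real.exp (-(r - R) / 8) := by positivity
            linarith
    · calc kernConst n * Real.exp (-|r - s| / 4) * |ω s|
          ≤ kernConst n * Real.exp (-(r - R) / 8 + -(1 / 8) * |r - s|) * M := by
            gcongr
            · have := le_abs_self (r - s); linarith
            · exact hω.bdd s hs.le
        _ = M * kernConst n * Real.exp (-(r - R) / 8) * Real.exp (-(1 / 8) * |r - s|) := by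
            rw [Real.exp_add]; ring
        _ ≤ _ := by
            refine mul_le_mul_of_nonneg_right ?_ (Real.exp_pos _).le
            have : 0 ≤ ε' * kernConst n := by positivity
            linarith

/-- The kernel `δ` inverts the inertia operator. -/
theorem isRadialGreenKernel (hn : 3 ≤ n) : IsRadialGreenKernel n (greenKernel n) := by
  intro ω hω hlim
  obtain ⟨M, hD⟩ := exists_dens hω hlim
  set F := trajectoryField n (greenKernel n) ω id (fun _ => 1) with hF
  have hFU : ∀ r, 0 ≤ r → F r = velU n ω id (fun _ => 1) r := fun r hr =>
    trajectoryField_eq_velU hn hD adm_id hr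
  have hFd : ∀ r, 0 < r → HasDerivAt F (velV n ω id (fun _ => 1) r) r := fun r hr => by
    refine ((velU_hasDerivAt hn hD adm_id hr).congr_of_eventuallyEq ?_).congr_deriv (one_mul _)
    filter_upwards [Ioi_mem_nhds hr] with u hu using hFU u (le_of_lt hu)
  have hVd : ∀ r, 0 < r → HasDerivAt (velV n ω id (fun _ => 1)) (F r
      + ((n : ℝ) - 1) / r ^ 2 * F r - ((n : ℝ) - 1) / r * velV n ω id (fun _ => 1) r
      - helmW n ω r) r := fun r hr => by
    rw [hFU r hr.le]; exact velV_id_hasDerivAt hn hD hr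
  have hH : ∀ r, 0 < r → radialHelmholtz n F r = helmW n ω r := fun r hr =>
    radialHelmholtz_eq hFd hVd hr
  refine ⟨fun r hr => trajectoryIntegrable_of_adm hn hD adm_id hr, ?_, fun r hr => ?_, ?_, ?_⟩
  · have h0 : ContDiffOn ℝ (0 : ℕ) ω (Ioi 0) := contDiffOn_zero.2 (hω.mono Ioi_subset_Ici_self)
    have h2 := contDiffOn_helmholtz (fun r hr => helmW_hasDerivAt hn hD hr)
      (fun r hr => helmW1_hasDerivAt hn hD hr) h0
    exact contDiffOn_helmholtz hFd hVd h2
  · refine radialHelmholtz_eq (g := helmW1 n ω) (fun u hu => ?_) (fun u hu => ?_) hr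
    · refine (helmW_hasDerivAt hn hD hu).congr_of_eventuallyEq ?_
      filter_upwards [Ioi_mem_nhds hu] with v hv using hH v hv
    · rw [hH u hu]; exact helmW1_hasDerivAt hn hD hu
  · refine (velU_id_tendsto_zero hn hD).congr' ?_
    filter_upwards [self_mem_nhdsWithin] with r hr using (hFU r (le_of_lt hr)).symm
  · refine (velU_id_tendsto_atTop hn hD hlim).congr' ?_
    filter_upwards [eventually_ge_atTop 0] with r hr using (hFU r hr).symm

end green

end

/-! ### Lipschitz dependence of velocity and gradient on the state -/

noncomputable section

lemma Adm.convexComb {a b : ℝ} {γ₁ ρ₁ γ₂ ρ₂ : ℝ → ℝ} (h₁ : Adm a b γ₁ ρ₁) (h₂ : Adm a b γ₂ ρ₂)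
    {t : ℝ} (ht : t ∈ Icc (0 : ℝ) 1) :
    Adm a b (fun r => γ₁ r + t * (γ₂ r - γ₁ r)) (fun r => ρ₁ r + t * (ρ₂ r - ρ₁ r)) where
  pos := h₁.pos
  cont := h₁.cont.add (continuousOn_const.mul (h₂.cont.sub h₁.cont))
  bounds r hr := by
    have h3 := h₁.bounds r hr
    have h4 := h₂.bounds r hr
    have h5 := mul_nonneg (sub_nonneg.2 ht.2) (sub_nonneg.2 h3.1)
    have h6 := mul_nonneg ht.1 (sub_nonneg.2 h4.1)
    have h7 := mul_nonneg (sub_nonneg.2 ht.2) (sub_nonneg.2 h3.2)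
    have h8 := mul_nonneg ht.1 (sub_nonneg.2 h4.2)
    constructor <;> linarith
  zero := by rw [h₁.zero, h₂.zero]; ring
  deriv r hr := (h₁.deriv r hr).add (((h₂.deriv r hr).sub (h₁.deriv r hr)).const_mul t)

lemma Adm.abs_sub_le {a b ε : ℝ} {γ₁ ρ₁ γ₂ ρ₂ : ℝ → ℝ} (h₁ : Adm a b γ₁ ρ₁) (h₂ : Adm a b γ₂ ρ₂)
    (hρ : ∀ r, 0 ≤ r → |ρ₂ r - ρ₁ r| ≤ ε) {r : ℝ} (hr : 0 ≤ r) : |γ₂ r - γ₁ r| ≤ ε * r := by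
  have := norm_image_sub_le_of_norm_deriv_le_segment' (f := fun w => γ₂ w - γ₁ w)
    (f' := fun w => ρ₂ w - ρ₁ w) (a := 0) (b := r) (C := ε)
    (fun w hw => ((h₂.deriv w hw.1).sub (h₁.deriv w hw.1)).mono Icc_subset_Ici_self)
    (fun w hw => hρ w hw.1) r ⟨hr, le_rfl⟩
  simpa [h₁.zero, h₂.zero] using this

/-- A perturbation of `γ` is bounded both by `ε` and, as it vanishes at the origin with derivative
at most `ε`, by `ε r`. The minimum of the two is comparable to the weight that compensates the
singularity of the differentiated kernel. -/
lemma min_le_wt {a r x ε D : ℝ} (ha : 0 < a) (hr : 0 < r) (hx : a * r ≤ x) (hε : 0 ≤ ε)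
    (h1 : D ≤ ε) (h2 : D ≤ ε * r) : D ≤ ε * (2 * (1 + 1 / a)) * wt x := by
  have hx0 : 0 < x := (mul_pos ha hr).trans_le hx
  have h3 : D ≤ ε * (2 * (r / (1 + r))) := by
    rcases le_total r 1 with h | h
    · refine h2.trans (mul_le_mul_of_nonneg_left ?_ hε)
      rw [← mul_div_assoc, le_div_iff₀ (by linarith)]; nlinarith
    · refine h1.trans ?_
      have : 1 ≤ 2 * (r / (1 + r)) := by
        rw [← mul_div_assoc, le_div_iff₀ (by linarith)]; linarith
      nlinarith
  refine h3.trans ?_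
  have h4 : r / (1 + r) ≤ (1 + 1 / a) * wt x := by
    unfold wt
    rw [← mul_div_assoc, div_le_div_iff₀ (by linarith) (by linarith)]
    have h5 : r ≤ 1 / a * x := by rw [one_div, ← div_eq_inv_mul, le_div_iff₀ ha]; linarith
    nlinarith [mul_nonneg hr.le hx0.le, mul_nonneg (mul_nonneg (one_div_pos.2 ha).le hr.le) hx0.le]
  calc ε * (2 * (r / (1 + r))) ≤ ε * (2 * ((1 + 1 / a) * wt x)) := by gcongr
    _ = _ := by ring

/-- A kernel with first derivatives that are integrable against the weight of perturbations. -/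
structure SmoothPair (n : ℕ) (k₁ k₂ p₁ q₁ p₂ q₂ : ℝ → ℝ → ℝ) (C L : ℝ) : Prop where
  good : GoodPair n k₁ k₂ C
  deriv₁ : ∀ (X Y : ℝ → ℝ) (X' Y' t : ℝ), HasDerivAt X X' t → HasDerivAt Y Y' t → 0 < X t →
    0 < Y t → HasDerivAt (fun t => k₁ (X t) (Y t)) (p₁ (X t) (Y t) * X' + q₁ (X t) (Y t) * Y') t
  deriv₂ : ∀ (X Y : ℝ → ℝ) (X' Y' t : ℝ), HasDerivAt X X' t → HasDerivAt Y Y' t → 0 < X t →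
    0 < Y t → HasDerivAt (fun t => k₂ (X t) (Y t)) (p₂ (X t) (Y t) * X' + q₂ (X t) (Y t) * Y') t
  bound₁ : ∀ x y, 0 < x → x ≤ y →
    y ^ (n - 1) * (|p₁ x y| * wt x + |q₁ x y| * wt y) ≤ L * Real.exp (-|x - y| / 4)
  bound₂ : ∀ x y, 0 < y → y ≤ x →
    y ^ (n - 1) * (|p₂ y x| * wt y + |q₂ y x| * wt x) ≤ L * Real.exp (-|x - y| / 4)

section lipschitz

variable {n : ℕ} {k₁ k₂ p₁ q₁ p₂ q₂ : ℝ → ℝ → ℝ} {C L M a b ε : ℝ} {ω γ₁ ρ₁ γ₂ ρ₂ : ℝ → ℝ}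

lemma continuousWithinAt_kernInt (hn : 3 ≤ n) (hk : GoodPair n k₁ k₂ C) (hω : Dens ω M)
    {γ ρ : ℝ → ℝ} (h : Adm a b γ ρ) {r : ℝ} (hr : 0 ≤ r) :
    ContinuousWithinAt (kernInt n k₁ k₂ ω γ ρ) (Ici 0) r :=
  tendsto_kernInt hn hk hω h hr (Eventually.of_forall fun _ => h) self_mem_nhdsWithin
    (tendsto_id.mono_left nhdsWithin_le_nhds) (h.contγ r hr) (fun _ _ => tendsto_const_nhds)
    (fun _ _ => tendsto_const_nhds)

lemma SmoothPair.nonneg (hk : SmoothPair n k₁ k₂ p₁ q₁ p₂ q₂ C L) : 0 ≤ L := by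
  have h := hk.bound₁ 1 1 one_pos le_rfl
  have h2 := wt_pos one_pos
  simp only [sub_self, abs_zero, neg_zero, zero_div, Real.exp_zero, mul_one, one_pow, one_mul] at h
  refine le_trans ?_ h
  positivity

/-- The constant in the Lipschitz bound for `kernInt`. -/
def lipConst (n : ℕ) (C L M a : ℝ) : ℝ := M / a ^ n * (2 * (1 + 1 / a) * L + C / a) * (8 / a)

lemma lipConst_nonneg (n : ℕ) (hC : 0 ≤ C) (hL : 0 ≤ L) (hM : 0 ≤ M) (ha : 0 < a) :
    0 ≤ lipConst n C L M a := by unfold lipConst; positivity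

/-- Mean value inequality along the segment joining the two states. Admissibility is convex and the
order of the particles `r` and `s` is the same along the segment, so only one branch of the kernel
is met and its corner on the diagonal plays no role. -/
lemma abs_integrand_sub_le (hn : 3 ≤ n) (hk : SmoothPair n k₁ k₂ p₁ q₁ p₂ q₂ C L) (hω : Dens ω M)
    (h₁ : Adm a b γ₁ ρ₁) (h₂ : Adm a b γ₂ ρ₂) (hε : 0 ≤ ε)
    (hγ : ∀ r, 0 ≤ r → |γ₂ r - γ₁ r| ≤ ε) (hρ : ∀ r, 0 ≤ r → |ρ₂ r - ρ₁ r| ≤ ε) {r s : ℝ}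
    (hr : 0 < r) (hs : 0 < s) (hsr : s ≠ r) :
    |pairK k₁ k₂ (γ₂ r) (γ₂ s) * mass n ω ρ₂ s - pairK k₁ k₂ (γ₁ r) (γ₁ s) * mass n ω ρ₁ s|
      ≤ M / a ^ n * (2 * (1 + 1 / a) * L + C / a) * ε * Real.exp (-(a / 4) * |r - s|) := by
  have ha := h₁.pos
  have hM := hω.nonneg
  have hC := hk.good.nonneg
  have hL := hk.nonneg
  set g : ℝ → ℝ → ℝ := fun t r => γ₁ r + t * (γ₂ r - γ₁ r) with hg
  set q : ℝ → ℝ → ℝ := fun t r => ρ₁ r + t * (ρ₂ r - ρ₁ r) with hq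
  have hA : ∀ t ∈ Icc (0 : ℝ) 1, Adm a b (g t) (q t) := fun t ht => h₁.convexComb h₂ ht
  have hd : ∀ t w, HasDerivAt (fun t => g t w) (γ₂ w - γ₁ w) t := fun t w => by
    exact (((hasDerivAt_id t).mul_const (γ₂ w - γ₁ w)).const_add (γ₁ w)).congr_deriv (one_mul _)
  have hdq : ∀ t w, HasDerivAt (fun t => q t w) (ρ₂ w - ρ₁ w) t := fun t w => by
    exact (((hasDerivAt_id t).mul_const (ρ₂ w - ρ₁ w)).const_add (ρ₁ w)).congr_deriv (one_mul _)
  have hwt : ∀ t ∈ Icc (0 : ℝ) 1, ∀ w, 0 < w →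
      |γ₂ w - γ₁ w| ≤ ε * (2 * (1 + 1 / a)) * wt (g t w) := fun t ht w hw =>
    min_le_wt ha hw ((hA t ht).lower hw.le) hε (hγ w hw.le) (h₁.abs_sub_le h₂ hρ hw.le)
  have key : ∀ t ∈ Icc (0 : ℝ) 1, ∃ D, HasDerivWithinAt
      (fun t => pairK k₁ k₂ (g t r) (g t s)) D (Icc 0 1) t ∧
      (g t s) ^ (n - 1) * |D| ≤ ε * (2 * (1 + 1 / a)) * L * Real.exp (-(a / 4) * |r - s|) := by
    intro t ht
    have hgr := (hA t ht).γ_pos hr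
    have hgs := (hA t ht).γ_pos hs
    have hexp := (hA t ht).exp_le hr.le hs.le
    have fin : ∀ P Q x y, x = g t r → y = g t s →
        (y ^ (n - 1) * (|P| * wt x + |Q| * wt y) ≤ L * Real.exp (-|x - y| / 4)) →
        y ^ (n - 1) * |P * (γ₂ r - γ₁ r) + Q * (γ₂ s - γ₁ s)|
          ≤ ε * (2 * (1 + 1 / a)) * L * Real.exp (-(a / 4) * |r - s|) := by
      rintro P Q x y rfl rfl hb
      have h5 := hwt t ht r hr
      have h6 := hwt t ht s hs
      have h7 : |P * (γ₂ r - γ₁ r) + Q * (γ₂ s - γ₁ s)|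
          ≤ ε * (2 * (1 + 1 / a)) * (|P| * wt (g t r) + |Q| * wt (g t s)) := by
        refine (abs_add_le _ _).trans ?_
        rw [abs_mul, abs_mul]
        have := mul_le_mul_of_nonneg_left h5 (abs_nonneg P)
        have := mul_le_mul_of_nonneg_left h6 (abs_nonneg Q)
        linarith
      calc _ ≤ g t s ^ (n - 1) * (ε * (2 * (1 + 1 / a)) * (|P| * wt (g t r) + |Q| * wt (g t s))) := by
            gcongr
        _ = ε * (2 * (1 + 1 / a)) * (g t s ^ (n - 1) * (|P| * wt (g t r) + |Q| * wt (g t s))) := by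
            ring
        _ ≤ ε * (2 * (1 + 1 / a)) * (L * Real.exp (-|g t r - g t s| / 4)) := by gcongr
        _ ≤ ε * (2 * (1 + 1 / a)) * (L * Real.exp (-(a / 4) * |r - s|)) := by gcongr
        _ = _ := by ring
    rcases lt_or_gt_of_ne hsr with hlt | hgt
    · refine ⟨p₂ (g t s) (g t r) * (γ₂ s - γ₁ s) + q₂ (g t s) (g t r) * (γ₂ r - γ₁ r), ?_, ?_⟩
      · refine (hk.deriv₂ _ _ _ _ t (hd t s) (hd t r) hgs hgr).hasDerivWithinAt.congr ?_ ?_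
        · intro w hw; exact pairK_of_gt (hA w hw) hs.le hlt
        · exact pairK_of_gt (hA t ht) hs.le hlt
      · have := hk.bound₂ (g t r) (g t s) hgs ((hA t ht).mono hs.le hlt.le)
        rw [add_comm (_ * _) (q₂ _ _ * _)]
        exact fin _ _ _ _ rfl rfl (by rw [add_comm]; exact this)
    · refine ⟨p₁ (g t r) (g t s) * (γ₂ r - γ₁ r) + q₁ (g t r) (g t s) * (γ₂ s - γ₁ s), ?_, ?_⟩
      · refine (hk.deriv₁ _ _ _ _ t (hd t r) (hd t s) hgr hgs).hasDerivWithinAt.congr ?_ ?_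
        · intro w hw; exact pairK_of_le (hA w hw) hr.le hgt.le
        · exact pairK_of_le (hA t ht) hr.le hgt.le
      · have := hk.bound₁ (g t r) (g t s) hgr ((hA t ht).mono hr.le hgt.le)
        exact fin _ _ _ _ rfl rfl this
  choose! D hD hDb using key
  have hmv := norm_image_sub_le_of_norm_deriv_le_segment_01'
    (f := fun t => pairK k₁ k₂ (g t r) (g t s) * mass n ω (q t) s)
    (f' := fun t => (D t - pairK k₁ k₂ (g t r) (g t s) * (ρ₂ s - ρ₁ s) / q t s) * mass n ω (q t) s)
    (C := M / a ^ n * (2 * (1 + 1 / a) * L + C / a) * ε * Real.exp (-(a / 4) * |r - s|)) ?_ ?_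
  · simpa [g, q] using hmv
  · intro t ht
    have hq0 := ((hA t ht).ρ_pos hs.le).ne'
    have h3 : HasDerivAt (fun t => mass n ω (q t) s)
        (-(s ^ (n - 1) * ω s * (ρ₂ s - ρ₁ s)) / q t s ^ 2) t := by
      refine ((hasDerivAt_const t (s ^ (n - 1) * ω s)).div (hdq t s) hq0).congr_deriv ?_
      ring
    refine ((hD t ht).mul h3.hasDerivWithinAt).congr_deriv ?_
    simp only [mass]
    field_simp
    ring
  · intro t ht'
    have ht : t ∈ Icc (0 : ℝ) 1 := ⟨ht'.1, ht'.2.le⟩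
    have hq0 := (hA t ht).ρ_pos hs.le
    have hqa := ((hA t ht).bounds s hs.le).1
    have hgs := (hA t ht).γ_pos hs
    have h5 : g t s ^ (n - 1) * |pairK k₁ k₂ (g t r) (g t s)|
        ≤ C * Real.exp (-(a / 4) * |r - s|) :=
      (hk.good.decay _ _ ((hA t ht).γ_nonneg hr.le) hgs).trans
        (mul_le_mul_of_nonneg_left ((hA t ht).exp_le hr.le hs.le) hC)
    have h6 : |pairK k₁ k₂ (g t r) (g t s) * (ρ₂ s - ρ₁ s) / q t s|
        ≤ |pairK k₁ k₂ (g t r) (g t s)| * (ε / a) := by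
      rw [abs_div, abs_mul, abs_of_pos hq0, mul_div_assoc]
      gcongr
      exact hρ s hs.le
    refine (abs_mul_mass_le hn hω (hA t ht) hs (B := ε * (2 * (1 + 1 / a)) * L
      * Real.exp (-(a / 4) * |r - s|) + C * Real.exp (-(a / 4) * |r - s|) * (ε / a)) ?_).trans
      (le_of_eq (by ring))
    calc _ ≤ g t s ^ (n - 1) * (|D t| + |pairK k₁ k₂ (g t r) (g t s)| * (ε / a)) := by
          gcongr
          exact (abs_sub _ _).trans (by linarith)
      _ = g t s ^ (n - 1) * |D t| + (g t s ^ (n - 1) * |pairK k₁ k₂ (g t r) (g t s)|) * (ε / a) := by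
          ring
      _ ≤ _ := by
          have := hDb t ht
          gcongr

/-- `kernInt` is Lipschitz in the state, uniformly in the point of evaluation. -/
lemma abs_kernInt_sub_le (hn : 3 ≤ n) (hk : SmoothPair n k₁ k₂ p₁ q₁ p₂ q₂ C L) (hω : Dens ω M)
    (h₁ : Adm a b γ₁ ρ₁) (h₂ : Adm a b γ₂ ρ₂)
    (hγ : ∀ r, 0 ≤ r → |γ₂ r - γ₁ r| ≤ ε) (hρ : ∀ r, 0 ≤ r → |ρ₂ r - ρ₁ r| ≤ ε) {r : ℝ}
    (hr : 0 ≤ r) :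
    |kernInt n k₁ k₂ ω γ₂ ρ₂ r - kernInt n k₁ k₂ ω γ₁ ρ₁ r| ≤ lipConst n C L M a * ε := by
  have ha := h₁.pos
  have hM := hω.nonneg
  have hC := hk.good.nonneg
  have hL := hk.nonneg
  have hε : 0 ≤ ε := (abs_nonneg _).trans (hγ 0 le_rfl)
  have hpos : ∀ r, 0 < r →
      |kernInt n k₁ k₂ ω γ₂ ρ₂ r - kernInt n k₁ k₂ ω γ₁ ρ₁ r| ≤ lipConst n C L M a * ε := by
    intro r hr
    rw [kernInt, kernInt, ← integral_sub (integrableOn_pairK hn hk.good hω h₂ hr.le)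
      (integrableOn_pairK hn hk.good hω h₁ hr.le)]
    have hne : ∀ᵐ s ∂(volume.restrict (Ioi (0 : ℝ))), s ≠ r :=
      (ae_restrict_of_ae (by simp [ae_iff, measure_singleton]))
    refine (abs_setIntegral_le_of_exp (c := a / 4)
      (B := M / a ^ n * (2 * (1 + 1 / a) * L + C / a) * ε) (r := r) (by positivity) ?_
      (by positivity)).trans (le_of_eq ?_)
    · filter_upwards [ae_restrict_mem measurableSet_Ioi, hne] with s hs hsr
      exact abs_integrand_sub_le hn hk hω h₁ h₂ hε hγ hρ hr hs hsr
    · unfold lipConst; field_simp; ring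
  rcases hr.eq_or_lt with rfl | hr
  -- The weighted estimate needs a positive radius; the value at the origin follows by continuity.
  · have hl := ((continuousWithinAt_kernInt hn hk.good hω h₂ le_rfl).sub
      (continuousWithinAt_kernInt hn hk.good hω h₁ le_rfl)).abs
    have hl' := hl.mono Ioi_subset_Ici_self
    refine le_of_tendsto hl' ?_
    filter_upwards [self_mem_nhdsWithin] with r hr using hpos r hr
  · exact hpos r hr

end lipschitz

lemma smoothPair_symK {n : ℕ} (hn : 3 ≤ n) :
    SmoothPair n (greenKernel n) (greenKernel n) (greenD1 n) (greenD2 n) (greenD1 n) (greenD2 n)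
      (kernConst n) (2 * (n + 1) * kernConst n) where
  good := goodPair_symK hn
  deriv₁ _ _ _ _ _ hX hY hx hy := greenKernel_hasDerivAt hn hX hY hx hy
  deriv₂ _ _ _ _ _ hX hY hx hy := greenKernel_hasDerivAt hn hX hY hx hy
  bound₁ x y hx hxy := by
    have hy := hx.trans_le hxy
    have h0 := (goodPair_symK hn).decay x y hx.le hy
    have hk := greenKernel_nonneg hn hx hxy
    rw [pairK, if_pos hxy, abs_of_nonneg hk] at h0
    have h1 := mul_le_mul_of_nonneg_right (abs_greenD1_le hn hx hxy) (wt_pos hx).le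
    have h2 := mul_le_mul_of_nonneg_right (abs_greenD2_le hn hx hxy) (wt_pos hy).le
    have h3 := mul_le_mul_of_nonneg_right (logBound_mul_wt_le n hx) hk
    have h4 := mul_le_mul_of_nonneg_right (logBound_mul_wt_le n hy) hk
    calc _ ≤ y ^ (n - 1) * (2 * (n + 1) * greenKernel n x y) := by gcongr; linarith
      _ = 2 * (n + 1) * (y ^ (n - 1) * greenKernel n x y) := by ring
      _ ≤ 2 * (n + 1) * (kernConst n * Real.exp (-|x - y| / 4)) := by gcongr
      _ = _ := by ring
  bound₂ x y hy hyx := by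
    have hx := hy.trans_le hyx
    have h0 := pow_mul_symK_le hn hx hy
    have hk := greenKernel_nonneg hn hy hyx
    rw [symK_of_ge hyx] at h0
    have h1 := mul_le_mul_of_nonneg_right (abs_greenD1_le hn hy hyx) (wt_pos hy).le
    have h2 := mul_le_mul_of_nonneg_right (abs_greenD2_le hn hy hyx) (wt_pos hx).le
    have h3 := mul_le_mul_of_nonneg_right (logBound_mul_wt_le n hy) hk
    have h4 := mul_le_mul_of_nonneg_right (logBound_mul_wt_le n hx) hk
    have hC := (kernConst_pos n).le
    calc _ ≤ y ^ (n - 1) * (2 * (n + 1) * greenKernel n y x) := by gcongr; linarith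
      _ = 2 * (n + 1) * (y ^ (n - 1) * greenKernel n y x) := by ring
      _ ≤ 2 * (n + 1) * (kernConst n * wt x * Real.exp (-|x - y| / 4)) := by gcongr
      _ ≤ 2 * (n + 1) * (kernConst n * 1 * Real.exp (-|x - y| / 4)) := by
          gcongr; exact wt_le_one hx.le
      _ = _ := by ring

lemma smoothPair_symK1 {n : ℕ} (hn : 3 ≤ n) :
    SmoothPair n (greenD1 n) (greenD2 n) (greenD11 n) (greenD12 n) (greenD12 n) (greenD22 n)
      ((n + 1) * kernConst n) ((2 * (n + 1) ^ 2 + 1) * kernConst n) where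
  good := goodPair_symK1 hn
  deriv₁ _ _ _ _ _ hX hY hx hy := greenD1_hasDerivAt hn hX hY hx hy
  deriv₂ _ _ _ _ _ hX hY hx hy := greenD2_hasDerivAt hn hX hY hx hy
  bound₁ x y hx hxy := by
    have hn3 : (3 : ℝ) ≤ n := by exact_mod_cast hn
    have hy := hx.trans_le hxy
    have hC := (kernConst_pos n).le
    have h0 := pow_mul_symK_le hn hx hy
    have hk := greenKernel_nonneg hn hx hxy
    rw [symK_of_le hxy] at h0
    have hl := logBound_pos n hx
    have h1 := mul_le_mul_of_nonneg_right (abs_greenD11_le hn hx hxy) (wt_pos hx).le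
    have h2 := mul_le_mul_of_nonneg_right (abs_greenD12_le hn hx hxy) (wt_pos hy).le
    have h3 := mul_le_mul_of_nonneg_right (logBound_mul_wt_le n hx) (mul_nonneg hl.le hk)
    have h4 := mul_le_mul_of_nonneg_right (logBound_mul_wt_le n hy) (mul_nonneg hl.le hk)
    have h5 := majorant_direct hx hxy hC (Real.exp_pos _).le
      (pow_mul_solA_solB_le hn (c := 1) hx hxy (by linarith))
    rw [← abs_of_nonneg (sub_nonneg.2 hxy), abs_sub_comm] at h5
    have hab : 0 ≤ solA n x * solB n y := (mul_pos (solA_pos n hx) (solB_pos n hy)).le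
    have h6 := mul_le_mul_of_nonneg_left (wt_le_one hx.le) hab
    calc _ ≤ y ^ (n - 1) * (2 * (n + 1) * (logBound n x * greenKernel n x y)
          + 1 * (solA n x * solB n y)) :=
          mul_le_mul_of_nonneg_left (by linarith) (by positivity)
      _ = 2 * (n + 1) * logBound n x * (y ^ (n - 1) * greenKernel n x y)
          + y ^ (n - 1) * (1 * (solA n x * solB n y)) := by ring
      _ ≤ 2 * (n + 1) * logBound n x * (kernConst n * wt x * Real.exp (-|x - y| / 4))
          + kernConst n * wt x * Real.exp (-|x - y| / 4) := by gcongr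
      _ = (2 * (n + 1) * (logBound n x * wt x) + wt x) * kernConst n
            * Real.exp (-|x - y| / 4) := by ring
      _ ≤ (2 * (n + 1) * (n + 1) + 1) * kernConst n * Real.exp (-|x - y| / 4) := by
          have := logBound_mul_wt_le n hx
          have := wt_le_one hx.le
          gcongr
      _ = _ := by ring
  bound₂ x y hy hyx := by
    have hn3 : (3 : ℝ) ≤ n := by exact_mod_cast hn
    have hx := hy.trans_le hyx
    have hC := (kernConst_pos n).le
    have h0 := pow_mul_symK_le hn hx hy
    have hk := greenKernel_nonneg hn hy hyx
    rw [symK_of_ge hyx] at h0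
    have hl := logBound_pos n hx
    have h1 := mul_le_mul_of_nonneg_right (abs_greenD22_le hn hy hyx) (wt_pos hx).le
    have h2 := mul_le_mul_of_nonneg_right (abs_greenD12_le hn hy hyx) (wt_pos hy).le
    have h3 := mul_le_mul_of_nonneg_right (logBound_mul_wt_le n hx) (mul_nonneg hl.le hk)
    have h4 := mul_le_mul_of_nonneg_right (logBound_mul_wt_le n hy) (mul_nonneg hl.le hk)
    have h5 := majorant_swap hy hyx hC (Real.exp_pos _).le
      (pow_mul_solA_solB_le hn (c := 1) hy hyx (by linarith))
    rw [← abs_of_nonneg (sub_nonneg.2 hyx)] at h5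
    have hab : 0 ≤ solA n y * solB n x := (mul_pos (solA_pos n hy) (solB_pos n hx)).le
    have h6 := mul_le_mul_of_nonneg_left (wt_le_one hx.le) hab
    calc _ ≤ y ^ (n - 1) * (2 * (n + 1) * (logBound n x * greenKernel n y x)
          + 1 * (solA n y * solB n x)) :=
          mul_le_mul_of_nonneg_left (by linarith) (by positivity)
      _ = 2 * (n + 1) * logBound n x * (y ^ (n - 1) * greenKernel n y x)
          + y ^ (n - 1) * (1 * (solA n y * solB n x)) := by ring
      _ ≤ 2 * (n + 1) * logBound n x * (kernConst n * wt x * Real.exp (-|x - y| / 4))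
          + kernConst n * wt x * Real.exp (-|x - y| / 4) := by gcongr
      _ = (2 * (n + 1) * (logBound n x * wt x) + wt x) * kernConst n
            * Real.exp (-|x - y| / 4) := by ring
      _ ≤ (2 * (n + 1) * (n + 1) + 1) * kernConst n * Real.exp (-|x - y| / 4) := by
          have := logBound_mul_wt_le n hx
          have := wt_le_one hx.le
          gcongr
      _ = _ := by ring

/-- A common Lipschitz and size bound for the velocity and its gradient. -/
lemma exists_velocity_bounds {n : ℕ} (hn : 3 ≤ n) {ω : ℝ → ℝ} {M : ℝ} (hω : Dens ω M) {a b : ℝ}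
    (ha : 0 < a) : ∃ Λ > 0,
      (∀ γ ρ, Adm a b γ ρ → ∀ r, 0 ≤ r → |velU n ω γ ρ r| ≤ Λ ∧ |ρ r * velV n ω γ ρ r| ≤ Λ) ∧
      ∀ γ₁ ρ₁ γ₂ ρ₂ ε, Adm a b γ₁ ρ₁ → Adm a b γ₂ ρ₂ → (∀ r, 0 ≤ r → |γ₂ r - γ₁ r| ≤ ε) →
        (∀ r, 0 ≤ r → |ρ₂ r - ρ₁ r| ≤ ε) → ∀ r, 0 ≤ r →
        |velU n ω γ₂ ρ₂ r - velU n ω γ₁ ρ₁ r| ≤ Λ * ε ∧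
        |ρ₂ r * velV n ω γ₂ ρ₂ r - ρ₁ r * velV n ω γ₁ ρ₁ r| ≤ Λ * ε := by
  have hM := hω.nonneg
  have hC := (kernConst_pos n).le
  set A := M / a ^ n * kernConst n * (8 / a)
  set B := M / a ^ n * ((n + 1) * kernConst n) * (8 / a)
  set P := lipConst n (kernConst n) (2 * (n + 1) * kernConst n) M a
  set Q := lipConst n ((n + 1) * kernConst n) ((2 * (n + 1) ^ 2 + 1) * kernConst n) M a
  have hA : 0 ≤ A := by positivity
  have hB : 0 ≤ B := by positivity
  have hP : 0 ≤ P := lipConst_nonneg n hC (by positivity) hM ha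
  have hQ : 0 ≤ Q := lipConst_nonneg n (by positivity) (by positivity) hM ha
  have hb0 : 0 ≤ |b| := abs_nonneg b
  refine ⟨A + |b| * B + P + |b| * Q + B + 1, by positivity, ?_, ?_⟩
  · intro γ ρ h r hr
    have h1 := abs_kernInt_le hn (goodPair_symK hn) hω h hr
    have h2 := abs_velV_le hn hω h hr
    have h3 : |ρ r| ≤ |b| := by
      rw [abs_of_pos (h.ρ_pos hr)]; exact (h.bounds r hr).2.trans (le_abs_self b)
    have h4 : |ρ r * velV n ω γ ρ r| ≤ |b| * B := by
      rw [abs_mul]; exact mul_le_mul h3 h2 (abs_nonneg _) hb0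
    have h5 : |velU n ω γ ρ r| ≤ A := h1
    have : 0 ≤ |b| * Q := by positivity
    have : 0 ≤ |b| * B := by positivity
    constructor <;> linarith
  · intro γ₁ ρ₁ γ₂ ρ₂ ε h₁ h₂ hγ hρ r hr
    have hε : 0 ≤ ε := (abs_nonneg _).trans (hγ 0 le_rfl)
    have h1 : |velU n ω γ₂ ρ₂ r - velU n ω γ₁ ρ₁ r| ≤ P * ε :=
      abs_kernInt_sub_le hn (smoothPair_symK hn) hω h₁ h₂ hγ hρ hr
    have h2 : |velV n ω γ₂ ρ₂ r - velV n ω γ₁ ρ₁ r| ≤ Q * ε :=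
      abs_kernInt_sub_le hn (smoothPair_symK1 hn) hω h₁ h₂ hγ hρ hr
    have h3 : |ρ₂ r| ≤ |b| := by
      rw [abs_of_pos (h₂.ρ_pos hr)]; exact (h₂.bounds r hr).2.trans (le_abs_self b)
    have h4 := abs_velV_le hn hω h₁ hr
    have h5 : |ρ₂ r * velV n ω γ₂ ρ₂ r - ρ₁ r * velV n ω γ₁ ρ₁ r| ≤ |b| * (Q * ε) + ε * B := by
      have e : ρ₂ r * velV n ω γ₂ ρ₂ r - ρ₁ r * velV n ω γ₁ ρ₁ r
          = ρ₂ r * (velV n ω γ₂ ρ₂ r - velV n ω γ₁ ρ₁ r) + (ρ₂ r - ρ₁ r) * velV n ω γ₁ ρ₁ r := by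
        ring
      rw [e]
      refine (abs_add_le _ _).trans ?_
      rw [abs_mul, abs_mul]
      exact add_le_add (mul_le_mul h3 h2 (abs_nonneg _) hb0)
        (mul_le_mul (hρ r hr) h4 (abs_nonneg _) hε)
    have : 0 ≤ A * ε := by positivity
    have : 0 ≤ |b| * B * ε := by positivity
    have : 0 ≤ |b| * Q * ε := by positivity
    have : 0 ≤ P * ε := by positivity
    have : 0 ≤ B * ε := by positivity
    constructor <;> nlinarith

end

/-! ### Local existence by Picard–Lindelöf -/

noncomputable section

open BoundedContinuousFunction

/-- Perturbations `(η, σ)` of a state, with `σ` the derivative of `η` on the half line. -/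
def pertSpace : Submodule ℝ ((ℝ →ᵇ ℝ) × (ℝ →ᵇ ℝ)) where
  carrier := {p | ∀ r, 0 ≤ r → p.1 r = ∫ s in (0 : ℝ)..r, p.2 s}
  add_mem' {p q} hp hq r hr := by
    have := intervalIntegral.integral_add (p.2.continuous.intervalIntegrable 0 r (μ := volume))
      (q.2.continuous.intervalIntegrable 0 r)
    simp only [Prod.fst_add, Prod.snd_add, BoundedContinuousFunction.coe_add, Pi.add_apply]
    rw [this, hp r hr, hq r hr]
  zero_mem' r _ := by simp
  smul_mem' c p hp r hr := by simp [hp r hr]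

/-- Evaluation and integration over `[0, r]` are continuous in the supremum norm. Closedness
supplies the completeness that the Picard–Lindelöf theorem requires. -/
lemma isClosed_pertSpace : IsClosed (pertSpace : Set ((ℝ →ᵇ ℝ) × (ℝ →ᵇ ℝ))) := by
  have e : (pertSpace : Set ((ℝ →ᵇ ℝ) × (ℝ →ᵇ ℝ)))
      = ⋂ r ∈ Ici (0 : ℝ), {p | p.1 r = ∫ s in (0 : ℝ)..r, p.2 s} := by
    ext p
    simp only [mem_iInter, mem_ofPred_eq, mem_Ici]
    rfl
  rw [e]
  refine isClosed_biInter fun r hr => isClosed_eq ?_ ?_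
  · exact (BoundedContinuousFunction.evalCLM ℝ r).continuous.comp continuous_fst
  · have hL : LipschitzWith (Real.toNNReal r) fun p : (ℝ →ᵇ ℝ) => ∫ s in (0 : ℝ)..r, p s := by
      refine LipschitzWith.of_dist_le_mul fun p q => ?_
      rw [Real.dist_eq, ← intervalIntegral.integral_sub (p.continuous.intervalIntegrable 0 r)
        (q.continuous.intervalIntegrable 0 r), Real.coe_toNNReal r hr]
      have := intervalIntegral.norm_integral_le_of_norm_le_const (a := 0) (b := r) (C := dist p q)
        (f := fun s => p s - q s) (fun s _ => by
          rw [Real.norm_eq_abs, ← Real.dist_eq]; exact BoundedContinuousFunction.dist_coe_le_dist s)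
      rw [sub_zero, abs_of_nonneg hr, mul_comm] at this
      exact this
    exact hL.continuous.comp continuous_snd

instance : CompleteSpace pertSpace := isClosed_pertSpace.completeSpace_coe

/-- The bounded continuous extension to the line of a bounded continuous function on `[0, ∞)`. -/
def extend (f : ℝ → ℝ) (C : ℝ) (hf : ContinuousOn f (Ici 0)) (hC : ∀ r, 0 ≤ r → |f r| ≤ C) :
    ℝ →ᵇ ℝ :=
  BoundedContinuousFunction.ofNormedAddCommGroup (fun r => f (max 0 r))
    (hf.comp_continuous (by fun_prop) fun r => mem_Ici.2 (le_max_left _ _)) C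
    fun r => hC _ (le_max_left _ _)

lemma extend_apply {f : ℝ → ℝ} {C : ℝ} (hf : ContinuousOn f (Ici 0))
    (hC : ∀ r, 0 ≤ r → |f r| ≤ C) {r : ℝ} (hr : 0 ≤ r) : extend f C hf hC r = f r := by
  change f (max 0 r) = f r
  rw [max_eq_right hr]

lemma pertSpace_norm_le {p : pertSpace} {C : ℝ} (hC : 0 ≤ C) (h₁ : ∀ x, |p.1.1 x| ≤ C)
    (h₂ : ∀ x, |p.1.2 x| ≤ C) : ‖p‖ ≤ C :=
  max_le ((BoundedContinuousFunction.norm_le hC).2 h₁) ((BoundedContinuousFunction.norm_le hC).2 h₂)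

section field

variable {n : ℕ} {ω γ ρ : ℝ → ℝ} {M a b : ℝ}

lemma continuousOn_velU (hn : 3 ≤ n) (hω : Dens ω M) (h : Adm a b γ ρ) :
    ContinuousOn (velU n ω γ ρ) (Ici 0) := fun _ hr =>
  continuousWithinAt_kernInt hn (goodPair_symK hn) hω h hr

lemma continuousOn_velV (hn : 3 ≤ n) (hω : Dens ω M) (h : Adm a b γ ρ) :
    ContinuousOn (velV n ω γ ρ) (Ici 0) := fun _ hr =>
  continuousWithinAt_kernInt hn (goodPair_symK1 hn) hω h hr

lemma velU_eq_integral (hn : 3 ≤ n) (hω : Dens ω M) (h : Adm a b γ ρ) {r : ℝ} (hr : 0 ≤ r) :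
    velU n ω γ ρ r = ∫ s in (0 : ℝ)..r, ρ s * velV n ω γ ρ s := by
  have hc := (h.cont.mul (continuousOn_velV hn hω h)).mono (Icc_subset_Ici_self : Icc 0 r ⊆ Ici 0)
  rw [intervalIntegral.integral_eq_sub_of_hasDerivAt_of_le hr
    ((continuousOn_velU hn hω h).mono Icc_subset_Ici_self)
    (fun s hs => velU_hasDerivAt hn hω h hs.1)
    (hc.intervalIntegrable_of_Icc hr), velU_zero h, sub_zero]

open Classical in
/-- The vector field on perturbations of the state `(γ₀, ρ₀)`, set to zero at inadmissible ones. -/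
def pertField (n : ℕ) (ω γ₀ ρ₀ : ℝ → ℝ) (a b Λ : ℝ) (hn : 3 ≤ n) (hω : Dens ω M)
    (hΛ : ∀ γ ρ, Adm a b γ ρ → ∀ r, 0 ≤ r → |velU n ω γ ρ r| ≤ Λ ∧ |ρ r * velV n ω γ ρ r| ≤ Λ)
    (p : pertSpace) : pertSpace :=
  if h : Adm a b (fun r => γ₀ r + p.1.1 r) (fun r => ρ₀ r + p.1.2 r) then
    ⟨(extend _ Λ (continuousOn_velU hn hω h) fun r hr => (hΛ _ _ h r hr).1,
      extend _ Λ (h.cont.mul (continuousOn_velV hn hω h)) fun r hr => (hΛ _ _ h r hr).2), by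
      intro r hr
      simp only
      rw [extend_apply _ _ hr, velU_eq_integral hn hω h hr]
      refine intervalIntegral.integral_congr fun s hs => ?_
      rw [uIcc_of_le hr] at hs
      exact (extend_apply (h.cont.mul (continuousOn_velV hn hω h)) _ hs.1).symm⟩
  else 0

lemma pertField_apply {γ₀ ρ₀ : ℝ → ℝ} {Λ : ℝ} (hn : 3 ≤ n) (hω : Dens ω M)
    (hΛ : ∀ γ ρ, Adm a b γ ρ → ∀ r, 0 ≤ r → |velU n ω γ ρ r| ≤ Λ ∧ |ρ r * velV n ω γ ρ r| ≤ Λ)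
    {p : pertSpace} (h : Adm a b (fun r => γ₀ r + p.1.1 r) (fun r => ρ₀ r + p.1.2 r)) (x : ℝ) :
    (pertField n ω γ₀ ρ₀ a b Λ hn hω hΛ p).1.1 x
      = velU n ω (fun r => γ₀ r + p.1.1 r) (fun r => ρ₀ r + p.1.2 r) (max 0 x) ∧
    (pertField n ω γ₀ ρ₀ a b Λ hn hω hΛ p).1.2 x = (ρ₀ (max 0 x) + p.1.2 (max 0 x))
      * velV n ω (fun r => γ₀ r + p.1.1 r) (fun r => ρ₀ r + p.1.2 r) (max 0 x) := by
  rw [pertField, dif_pos h]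
  exact ⟨rfl, rfl⟩

lemma pertField_of_not {γ₀ ρ₀ : ℝ → ℝ} {Λ : ℝ} (hn : 3 ≤ n) (hω : Dens ω M)
    (hΛ : ∀ γ ρ, Adm a b γ ρ → ∀ r, 0 ≤ r → |velU n ω γ ρ r| ≤ Λ ∧ |ρ r * velV n ω γ ρ r| ≤ Λ)
    {p : pertSpace} (h : ¬ Adm a b (fun r => γ₀ r + p.1.1 r) (fun r => ρ₀ r + p.1.2 r)) :
    pertField n ω γ₀ ρ₀ a b Λ hn hω hΛ p = 0 := dif_neg h

lemma adm_perturb (h : Adm a b γ ρ) {p : pertSpace} (hp : ‖p‖ ≤ a / 2) :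
    Adm (a / 2) (b + a / 2) (fun r => γ r + p.1.1 r) (fun r => ρ r + p.1.2 r) := by
  have hle : ∀ r, |p.1.2 r| ≤ a / 2 := fun r =>
    (p.1.2.norm_coe_le_norm r).trans ((norm_snd_le p.1).trans hp)
  have hd : ∀ r, 0 ≤ r → HasDerivWithinAt (p.1.1) (p.1.2 r) (Ici 0) r := fun r hr => by
    have h1 : HasDerivAt (fun u => ∫ s in (0 : ℝ)..u, p.1.2 s) (p.1.2 r) r :=
      (p.1.2.continuous.integral_hasStrictDerivAt 0 r).hasDerivAt
    exact h1.hasDerivWithinAt.congr (fun u hu => p.2 u hu) (p.2 r hr)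
  refine ⟨by linarith [h.pos], h.cont.add p.1.2.continuous.continuousOn, fun r hr => ?_, ?_,
    fun r hr => (h.deriv r hr).add (hd r hr)⟩
  · have h1 := h.bounds r hr
    have h2 := abs_le.1 (hle r)
    constructor <;> linarith
  · have := p.2 0 le_rfl
    rw [intervalIntegral.integral_same] at this
    rw [h.zero, this, add_zero]

/-- Local existence, with a lifespan controlled by the bounds on the initial state. -/
lemma exists_local_flow (hn : 3 ≤ n) (hω : Dens ω M) (ha : 0 < a) :
    ∃ ε > 0, ∀ γ₀ ρ₀, Adm a b γ₀ ρ₀ → ∃ γ ρ : ℝ → ℝ → ℝ,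
      (∀ r, 0 ≤ r → γ 0 r = γ₀ r ∧ ρ 0 r = ρ₀ r) ∧
      ∀ t ∈ Icc 0 ε, Adm (a / 2) (b + a / 2) (γ t) (ρ t) ∧ ∀ r, 0 ≤ r →
        HasDerivWithinAt (fun τ => γ τ r) (velU n ω (γ t) (ρ t) r) (Icc 0 ε) t ∧
        HasDerivWithinAt (fun τ => ρ τ r) (ρ t r * velV n ω (γ t) (ρ t) r) (Icc 0 ε) t := by
  obtain ⟨Λ, hΛ0, hΛ, hLip⟩ := exists_velocity_bounds hn hω (b := b + a / 2) (half_pos ha)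
  -- The field has norm at most `Λ`, so for this time the solution stays in the ball of radius
  -- `a/2`, where perturbed states are admissible. The constant `Λ` depends only on `a`, `b` and the
  -- momentum, hence the uniform lifespan.
  refine ⟨a / 2 / Λ, by positivity, fun γ₀ ρ₀ h₀ => ?_⟩
  set ε := a / 2 / Λ with hε
  have hε0 : 0 < ε := by positivity
  set F := pertField n ω γ₀ ρ₀ (a / 2) (b + a / 2) Λ hn hω hΛ with hF
  have hFb : ∀ p, ‖F p‖ ≤ Λ := by
    intro p
    by_cases h : Adm (a / 2) (b + a / 2) (fun r => γ₀ r + p.1.1 r) (fun r => ρ₀ r + p.1.2 r)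
    · refine pertSpace_norm_le hΛ0.le (fun x => ?_) (fun x => ?_)
      · rw [(pertField_apply hn hω hΛ h x).1]
        exact (hΛ _ _ h _ (le_max_left _ _)).1
      · rw [(pertField_apply hn hω hΛ h x).2]
        exact (hΛ _ _ h _ (le_max_left _ _)).2
    · rw [hF, pertField_of_not hn hω hΛ h]
      exact pertSpace_norm_le hΛ0.le (fun x => by simpa using hΛ0.le) (fun x => by simpa using hΛ0.le)
  have hFl : LipschitzOnWith (Real.toNNReal Λ) F (Metric.closedBall 0 (a / 2)) := by
    refine LipschitzOnWith.of_dist_le_mul fun p hp q hq => ?_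
    replace hp : ‖p‖ ≤ a / 2 := le_of_eq_of_le (dist_zero_right p).symm hp
    replace hq : ‖q‖ ≤ a / 2 := le_of_eq_of_le (dist_zero_right q).symm hq
    have hAp := adm_perturb h₀ hp
    have hAq := adm_perturb h₀ hq
    rw [Real.coe_toNNReal _ hΛ0.le]
    have hd1 : ∀ r, 0 ≤ r → |(γ₀ r + p.1.1 r) - (γ₀ r + q.1.1 r)| ≤ dist p q := fun r _ => by
      rw [add_sub_add_left_eq_sub, ← Real.dist_eq]
      exact (BoundedContinuousFunction.dist_coe_le_dist r).trans (le_max_left _ _)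
    have hd2 : ∀ r, 0 ≤ r → |(ρ₀ r + p.1.2 r) - (ρ₀ r + q.1.2 r)| ≤ dist p q := fun r _ => by
      rw [add_sub_add_left_eq_sub, ← Real.dist_eq]
      exact (BoundedContinuousFunction.dist_coe_le_dist r).trans (le_max_right _ _)
    have hl := hLip _ _ _ _ _ hAq hAp hd1 hd2
    have h0 : 0 ≤ Λ * dist p q := by positivity
    refine le_of_eq_of_le (dist_eq_norm (F p) (F q)) ?_
    refine pertSpace_norm_le h0 (fun x => ?_) (fun x => ?_)
    · change |(F p).1.1 x - (F q).1.1 x| ≤ _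
      rw [(pertField_apply hn hω hΛ hAp x).1, (pertField_apply hn hω hΛ hAq x).1]
      exact (hl _ (le_max_left _ _)).1
    · change |(F p).1.2 x - (F q).1.2 x| ≤ _
      rw [(pertField_apply hn hω hΛ hAp x).2, (pertField_apply hn hω hΛ hAq x).2]
      exact (hl _ (le_max_left _ _)).2
  have hPL : IsPicardLindelof (fun _ => F) (⟨0, le_rfl, hε0.le⟩ : Icc (0 : ℝ) ε) 0
      (Real.toNNReal (a / 2)) 0 (Real.toNNReal Λ) (Real.toNNReal Λ) := by
    refine IsPicardLindelof.of_time_independent (fun p _ => ?_) ?_ ?_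
    · rw [Real.coe_toNNReal _ hΛ0.le]; exact hFb p
    · rw [Real.coe_toNNReal _ (by positivity)]; exact hFl
    · rw [Real.coe_toNNReal _ hΛ0.le, Real.coe_toNNReal _ (by positivity)]
      simp only [sub_zero, sub_self, NNReal.coe_zero]
      rw [max_eq_left hε0.le, hε, mul_div_cancel₀ _ hΛ0.ne']
  obtain ⟨α, hα0, hα⟩ := hPL.exists_eq_forall_mem_Icc_hasDerivWithinAt₀
  have hball : ∀ t ∈ Icc 0 ε, ‖α t‖ ≤ a / 2 := by
    intro t ht
    have := norm_image_sub_le_of_norm_deriv_le_segment' hα (fun t _ => hFb _) t ht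
    have h0 : α 0 = 0 := hα0
    rw [sub_zero, h0] at this
    refine le_trans (le_of_eq ?_) (this.trans ?_)
    · congr 1; exact (sub_zero (α t)).symm
    calc Λ * t ≤ Λ * ε := by gcongr; exact ht.2
      _ = a / 2 := by rw [hε, mul_div_cancel₀ _ hΛ0.ne']
  refine ⟨fun t r => γ₀ r + (α t).1.1 r, fun t r => ρ₀ r + (α t).1.2 r, fun r _ => ?_,
    fun t ht => ?_⟩
  · have : α 0 = 0 := hα0
    simp [this]
  have hA := adm_perturb h₀ (hball t ht)
  refine ⟨hA, fun r hr => ?_⟩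
  have hd := hα t ht
  obtain ⟨e1, e2⟩ := pertField_apply hn hω hΛ hA r
  rw [max_eq_right hr] at e1 e2
  constructor
  · have h1 := (((BoundedContinuousFunction.evalCLM ℝ r).comp
      (ContinuousLinearMap.fst ℝ (ℝ →ᵇ ℝ) (ℝ →ᵇ ℝ))).comp
        pertSpace.subtypeL).hasFDerivAt.comp_hasDerivWithinAt t hd
    exact (h1.const_add (γ₀ r)).congr_deriv e1
  · have h1 := (((BoundedContinuousFunction.evalCLM ℝ r).comp
      (ContinuousLinearMap.snd ℝ (ℝ →ᵇ ℝ) (ℝ →ᵇ ℝ))).comp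
        pertSpace.subtypeL).hasFDerivAt.comp_hasDerivWithinAt t hd
    exact (h1.const_add (ρ₀ r)).congr_deriv e2

end field

end

/-! ### Flows: equivalence with trajectories, uniqueness, continuation -/

noncomputable section

/-- A curve of states on `[0, T)` starting at the identity and driven by its velocity. -/
structure Flow (n : ℕ) (ω : ℝ → ℝ) (T : ℝ) (γ ρ : ℝ → ℝ → ℝ) : Prop where
  init : ∀ r, 0 ≤ r → γ 0 r = r ∧ ρ 0 r = 1
  adm : ∀ T' < T, ∃ a b, ∀ t ∈ Icc 0 T', Adm a b (γ t) (ρ t)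
  dγ : ∀ t ∈ Ico 0 T, ∀ r, 0 ≤ r →
    HasDerivWithinAt (fun τ => γ τ r) (velU n ω (γ t) (ρ t) r) (Ico 0 T) t
  dρ : ∀ t ∈ Ico 0 T, ∀ r, 0 ≤ r →
    HasDerivWithinAt (fun τ => ρ τ r) (ρ t r * velV n ω (γ t) (ρ t) r) (Ico 0 T) t

lemma Icc_mem_nhdsWithin_Ico {t T' T : ℝ} (ht : t < T') :
    Icc 0 T' ∈ 𝓝[Ico 0 T] t := by
  filter_upwards [self_mem_nhdsWithin, mem_nhdsWithin_of_mem_nhds (Iio_mem_nhds ht)] with u hu hu'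
  exact ⟨hu.1, le_of_lt hu'⟩

section flow

variable {n : ℕ} {ω : ℝ → ℝ} {M T : ℝ} {γ ρ : ℝ → ℝ → ℝ}

lemma Flow.adm_at (h : Flow n ω T γ ρ) {t : ℝ} (ht : t ∈ Ico 0 T) : ∃ a b, Adm a b (γ t) (ρ t) := by
  obtain ⟨a, b, hab⟩ := h.adm t ht.2
  exact ⟨a, b, hab t ⟨ht.1, le_rfl⟩⟩

/-- A Lipschitz-in-time family of functions continuous in space is jointly continuous. -/
lemma continuousOn_of_lipschitz {f : ℝ → ℝ → ℝ} {T Λ : ℝ}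
    (hc : ∀ t ∈ Icc 0 T, ContinuousOn (f t) (Ici 0))
    (hl : ∀ t ∈ Icc 0 T, ∀ t' ∈ Icc 0 T, ∀ r, 0 ≤ r → |f t' r - f t r| ≤ Λ * |t' - t|) :
    ContinuousOn (fun x : ℝ × ℝ => f x.1 x.2) (Icc 0 T ×ˢ Ici 0) := by
  rintro ⟨t, r⟩ ⟨ht, hr⟩
  have h1 : Tendsto (fun x : ℝ × ℝ => f t x.2) (𝓝[Icc 0 T ×ˢ Ici 0] (t, r)) (𝓝 (f t r)) :=
    Tendsto.comp (hc t ht r hr) (tendsto_nhdsWithin_iff.2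
      ⟨(continuous_snd.tendsto (t, r)).mono_left nhdsWithin_le_nhds,
        by filter_upwards [self_mem_nhdsWithin] with x hx using hx.2⟩)
  have h2 : Tendsto (fun x : ℝ × ℝ => f x.1 x.2 - f t x.2) (𝓝[Icc 0 T ×ˢ Ici 0] (t, r)) (𝓝 0) := by
    have h3 : Tendsto (fun x : ℝ × ℝ => Λ * |x.1 - t|) (𝓝[Icc 0 T ×ˢ Ici 0] (t, r)) (𝓝 0) := by
      have : Continuous fun x : ℝ × ℝ => Λ * |x.1 - t| := by fun_prop
      have h4 := (this.tendsto (t, r)).mono_left (nhdsWithin_le_nhds (s := Icc 0 T ×ˢ Ici 0))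
      simpa using h4
    refine squeeze_zero_norm' ?_ h3
    filter_upwards [self_mem_nhdsWithin] with x hx
    exact hl t ht x.1 hx.1 x.2 hx.2
  have := h1.add h2
  simpa [ContinuousWithinAt] using this

lemma Flow.continuousOn_ρ (hn : 3 ≤ n) (hω : Dens ω M) (h : Flow n ω T γ ρ) {T' : ℝ} (hT : T' < T) :
    ContinuousOn (fun x : ℝ × ℝ => ρ x.1 x.2) (Icc 0 T' ×ˢ Ici 0) := by
  obtain ⟨a, b, hab⟩ := h.adm T' hT
  rcases lt_or_ge T' 0 with h0 | h0
  · simp [Icc_eq_empty (not_le.2 h0)]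
  obtain ⟨Λ, hΛ0, hΛ, -⟩ := exists_velocity_bounds hn hω (b := b) (hab 0 ⟨le_rfl, h0⟩).pos
  refine continuousOn_of_lipschitz (Λ := Λ) (fun t ht => (hab t ht).cont) fun t ht t' ht' r hr => ?_
  exact Convex.norm_image_sub_le_of_norm_hasDerivWithin_le (f := fun τ => ρ τ r) (s := Icc 0 T')
    (fun τ hτ => (h.dρ τ ⟨hτ.1, hτ.2.trans_lt hT⟩ r hr).mono
      (fun u hu => ⟨hu.1, hu.2.trans_lt hT⟩))
    (fun τ hτ => (hΛ _ _ (hab τ hτ) r hr).2) (convex_Icc 0 T') ht ht'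

/-- A flow is a solution of the particle-trajectory equation. -/
lemma Flow.isTrajectory (hn : 3 ≤ n) (hω : Dens ω M) (h : Flow n ω T γ ρ) :
    IsTrajectory n (greenKernel n) ω T γ ρ where
  initial r hr := (h.init r hr).1
  fixes_origin t ht := by
    obtain ⟨a, b, hab⟩ := h.adm_at ht
    exact hab.zero
  hasDeriv_space t ht r hr := by
    obtain ⟨a, b, hab⟩ := h.adm_at ht
    exact hab.deriv r hr
  continuous_deriv := by
    rintro ⟨t, r⟩ ⟨ht, hr⟩
    obtain ⟨T', h1, h2⟩ := exists_between ht.2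
    refine (h.continuousOn_ρ hn hω h2 (t, r) ⟨⟨ht.1, h1.le⟩, hr⟩).mono_of_mem_nhdsWithin ?_
    rw [nhdsWithin_prod_eq]
    exact prod_mem_prod (Icc_mem_nhdsWithin_Ico h1) self_mem_nhdsWithin
  bounds T' hT := by
    obtain ⟨a, b, hab⟩ := h.adm T' hT
    rcases lt_or_ge T' 0 with h0 | h0
    · exact ⟨1, 1, one_pos, fun t ht => absurd (ht.1.trans ht.2) (not_le.2 h0)⟩
    · exact ⟨a, b, (hab 0 ⟨le_rfl, h0⟩).pos, fun t ht r hr => (hab t ht).bounds r hr⟩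
  integrable t ht r hr := by
    obtain ⟨a, b, hab⟩ := h.adm_at ht
    exact trajectoryIntegrable_of_adm hn hω hab hr
  hasDeriv_time t ht r hr := by
    obtain ⟨a, b, hab⟩ := h.adm_at ht
    rw [trajectoryField_eq_velU hn hω hab hr]
    exact h.dγ t ht r hr

lemma IsTrajectory.exists_adm (h : IsTrajectory n (greenKernel n) ω T γ ρ) {T' : ℝ} (hT : T' < T) :
    ∃ a b, ∀ t ∈ Icc 0 T', Adm a b (γ t) (ρ t) := by
  obtain ⟨a, b, ha, hab⟩ := h.bounds T' hT
  refine ⟨a, b, fun t ht => ?_⟩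
  have ht' : t ∈ Ico 0 T := ⟨ht.1, ht.2.trans_lt hT⟩
  exact ⟨ha, h.continuous_deriv.comp (f := fun r => (t, r)) (by fun_prop) fun r hr => ⟨ht', hr⟩,
    hab t ht, h.fixes_origin t ht', h.hasDeriv_space t ht'⟩

lemma IsTrajectory.continuousOn_kernInt (hn : 3 ≤ n) (hω : Dens ω M)
    (h : IsTrajectory n (greenKernel n) ω T γ ρ) {T' : ℝ} (hT : T' < T)
    {k₁ k₂ : ℝ → ℝ → ℝ} {C : ℝ} (hk : GoodPair n k₁ k₂ C) {r : ℝ} (hr : 0 ≤ r) :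
    ContinuousOn (fun t => kernInt n k₁ k₂ ω (γ t) (ρ t) r) (Icc 0 T') := by
  obtain ⟨a, b, hab⟩ := h.exists_adm hT
  have hsub : Icc 0 T' ⊆ Ico 0 T := fun u hu => ⟨hu.1, hu.2.trans_lt hT⟩
  intro t ht
  have hγ : ∀ s, 0 ≤ s → Tendsto (fun τ => γ τ s) (𝓝[Icc 0 T'] t) (𝓝 (γ t s)) := fun s hs =>
    ((h.hasDeriv_time t (hsub ht) s hs).mono hsub).continuousWithinAt
  refine tendsto_kernInt hn hk hω (hab t ht) hr
    (by filter_upwards [self_mem_nhdsWithin] with τ hτ using hab τ hτ)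
    (Eventually.of_forall fun _ => hr) tendsto_const_nhds (hγ r hr) (fun s hs => hγ s hs.le)
    fun s hs => ?_
  exact (h.continuous_deriv.comp (f := fun τ => (τ, s)) (s := Icc 0 T') (by fun_prop)
    fun τ hτ => ⟨hsub hτ, mem_Ici.2 hs.le⟩) t ht

/-- The spatial derivative of a trajectory solves the integrated linearised equation. -/
lemma IsTrajectory.ρ_eq (hn : 3 ≤ n) (hω : Dens ω M)
    (h : IsTrajectory n (greenKernel n) ω T γ ρ) {t : ℝ} (ht : t ∈ Ico 0 T) {r : ℝ} (hr : 0 ≤ r) :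
    ρ t r = 1 + ∫ τ in (0 : ℝ)..t, ρ τ r * velV n ω (γ τ) (ρ τ) r := by
  obtain ⟨a, b, hab⟩ := h.exists_adm ht.2
  have hsub : Icc 0 t ⊆ Ico 0 T := fun u hu => ⟨hu.1, hu.2.trans_lt ht.2⟩
  have ht0 : t ∈ Icc 0 t := ⟨ht.1, le_rfl⟩
  obtain ⟨Λ, hΛ0, hΛ, -⟩ := exists_velocity_bounds hn hω (b := b) (hab t ht0).pos
  have hU : ∀ r, 0 ≤ r → ContinuousOn (fun τ => velU n ω (γ τ) (ρ τ) r) (Icc 0 t) := fun r hr =>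
    h.continuousOn_kernInt hn hω ht.2 (goodPair_symK hn) hr
  have hW : ∀ r, 0 ≤ r → ContinuousOn (fun τ => ρ τ r * velV n ω (γ τ) (ρ τ) r) (Icc 0 t) :=
    fun r hr => (h.continuous_deriv.comp (f := fun τ => (τ, r)) (s := Icc 0 t) (by fun_prop)
      fun τ hτ => ⟨hsub hτ, hr⟩).mul (h.continuousOn_kernInt hn hω ht.2 (goodPair_symK1 hn) hr)
  have huI : uIoc (0 : ℝ) t = Ioc 0 t := uIoc_of_le ht.1
  have hγ : ∀ r, 0 ≤ r → γ t r = r + ∫ τ in (0 : ℝ)..t, velU n ω (γ τ) (ρ τ) r := by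
    intro r hr
    rw [intervalIntegral.integral_eq_sub_of_hasDerivAt_of_le (f := fun τ => γ τ r) ht.1
      (fun τ hτ => ((h.hasDeriv_time τ (hsub hτ) r hr).mono hsub).continuousWithinAt)
      (fun τ hτ => ?_) ((hU r hr).intervalIntegrable_of_Icc ht.1), h.initial r hr]
    · ring
    · have hd := h.hasDeriv_time τ ⟨hτ.1.le, hτ.2.trans ht.2⟩ r hr
      rw [trajectoryField_eq_velU hn hω (hab τ ⟨hτ.1.le, hτ.2.le⟩) hr] at hd
      exact hd.hasDerivAt (Ico_mem_nhds hτ.1 (hτ.2.trans ht.2))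
  have hpos : ∀ r, 0 < r → ρ t r = 1 + ∫ τ in (0 : ℝ)..t, ρ τ r * velV n ω (γ τ) (ρ τ) r := by
    intro r hr
    -- The time-integrated equation for `γ` is differentiated in `r` under the integral; uniqueness
    -- of the derivative identifies the result with `ρ`. The point `r = 0` is reached afterwards by
    -- one-sided continuity.
    have hd := (intervalIntegral.hasDerivAt_integral_of_dominated_loc_of_deriv_le
      (F := fun r τ => velU n ω (γ τ) (ρ τ) r) (F' := fun r τ => ρ τ r * velV n ω (γ τ) (ρ τ) r)
      (μ := volume) (a := 0) (b := t) (bound := fun _ => Λ) (x₀ := r) (s := Ioi 0)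
      (Ioi_mem_nhds hr) ?_ ((hU r hr.le).intervalIntegrable_of_Icc ht.1) ?_ ?_
      intervalIntegrable_const ?_).2
    · refine ((hab t ht0).hasDerivAt hr).unique (((hasDerivAt_id r).add hd).congr_of_eventuallyEq ?_)
      filter_upwards [Ioi_mem_nhds hr] with u hu using hγ u (le_of_lt hu)
    · filter_upwards [Ioi_mem_nhds hr] with u hu
      rw [huI]
      exact ((hU u (le_of_lt hu)).mono Ioc_subset_Icc_self).aestronglyMeasurable measurableSet_Ioc
    · rw [huI]
      exact ((hW r hr.le).mono Ioc_subset_Icc_self).aestronglyMeasurable measurableSet_Ioc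
    · refine Eventually.of_forall fun τ hτ u hu => ?_
      rw [huI] at hτ
      exact (hΛ _ _ (hab τ ⟨hτ.1.le, hτ.2⟩) u (le_of_lt hu)).2
    · refine Eventually.of_forall fun τ hτ u hu => ?_
      rw [huI] at hτ
      exact velU_hasDerivAt hn hω (hab τ ⟨hτ.1.le, hτ.2⟩) hu
  rcases hr.eq_or_lt with rfl | hr
  · have hc1 : Tendsto (ρ t) (𝓝[>] 0) (𝓝 (ρ t 0)) :=
      ((hab t ht0).cont 0 (mem_Ici.2 le_rfl)).mono Ioi_subset_Ici_self
    have hc2 : ContinuousWithinAt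
        (fun r => ∫ τ in (0 : ℝ)..t, ρ τ r * velV n ω (γ τ) (ρ τ) r) (Ioi 0) 0 := by
      refine intervalIntegral.continuousWithinAt_of_dominated_interval (bound := fun _ => Λ)
        ?_ ?_ intervalIntegrable_const ?_
      · filter_upwards [self_mem_nhdsWithin] with u hu
        rw [huI]
        exact ((hW u (le_of_lt hu)).mono Ioc_subset_Icc_self).aestronglyMeasurable measurableSet_Ioc
      · filter_upwards [self_mem_nhdsWithin] with u hu
        refine Eventually.of_forall fun τ hτ => ?_
        rw [huI] at hτ
        exact (hΛ _ _ (hab τ ⟨hτ.1.le, hτ.2⟩) u (le_of_lt hu)).2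
      · refine Eventually.of_forall fun τ hτ => ?_
        rw [huI] at hτ
        have hA := hab τ ⟨hτ.1.le, hτ.2⟩
        exact ((hA.cont.mul (continuousOn_velV hn hω hA)) 0 (mem_Ici.2 le_rfl)).mono Ioi_subset_Ici_self
    refine tendsto_nhds_unique hc1 ((tendsto_const_nhds.add hc2).congr' ?_)
    filter_upwards [self_mem_nhdsWithin] with u hu using (hpos u hu).symm
  · exact hpos r hr

/-- The notion of trajectory does not require `γ_r` to be differentiable in time. This is recovered
from the integrated equation for `ρ`, whose integrand is continuous in time, so uniqueness of flows
applies to all trajectories. -/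
lemma IsTrajectory.flow (hn : 3 ≤ n) (hω : Dens ω M) (hT : 0 < T)
    (h : IsTrajectory n (greenKernel n) ω T γ ρ) : Flow n ω T γ ρ where
  init r hr := ⟨h.initial r hr, by rw [h.ρ_eq hn hω ⟨le_rfl, hT⟩ hr]; simp⟩
  adm T' hT' := h.exists_adm hT'
  dγ t ht r hr := by
    obtain ⟨a, b, hab⟩ := h.exists_adm ht.2
    rw [← trajectoryField_eq_velU hn hω (hab t ⟨ht.1, le_rfl⟩) hr]
    exact h.hasDeriv_time t ht r hr
  dρ t ht r hr := by
    obtain ⟨T', h1, h2⟩ := exists_between ht.2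
    have hsub : Icc 0 T' ⊆ Ico 0 T := fun u hu => ⟨hu.1, hu.2.trans_lt h2⟩
    have hW : ContinuousOn (fun τ => ρ τ r * velV n ω (γ τ) (ρ τ) r) (Icc 0 T') :=
      (h.continuous_deriv.comp (f := fun τ => (τ, r)) (s := Icc 0 T') (by fun_prop)
        fun τ hτ => ⟨hsub hτ, hr⟩).mul (h.continuousOn_kernInt hn hω h2 (goodPair_symK1 hn) hr)
    have htT : t ∈ Icc 0 T' := ⟨ht.1, h1.le⟩
    -- With a right-hand side independent of the unknown and initial value `1`, this is the
    -- one-sided fundamental theorem of calculus for the integral formula of `ρ`.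
    have hd := ODE.hasDerivWithinAt_picard_Icc (t₀ := 0) (tmin := 0) (tmax := T') (u := univ)
      (f := fun τ (_ : ℝ) => ρ τ r * velV n ω (γ τ) (ρ τ) r) (α := fun _ => 0)
      ⟨le_rfl, ht.1.trans h1.le⟩ (hW.comp continuousOn_fst fun x hx => hx.1) continuousOn_const
      (fun _ _ => mem_univ _) 1 htT
    exact (hd.congr (fun u hu => h.ρ_eq hn hω (hsub hu) hr)
      (h.ρ_eq hn hω ht hr)).mono_of_mem_nhdsWithin (Icc_mem_nhdsWithin_Ico h1)

end flow

/-- A derivative bound that halves an exponentially weighted bound. -/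
lemma abs_le_half_exp {f f' : ℝ → ℝ} {t C Λ : ℝ}
    (hf : ∀ τ ∈ Icc 0 t, HasDerivWithinAt f (f' τ) (Icc 0 t) τ) (h0 : f 0 = 0) (hC : 0 ≤ C)
    (hb : ∀ τ ∈ Icc 0 t, |f' τ| ≤ Λ * (C * Real.exp (2 * Λ * τ))) :
    ∀ τ ∈ Icc 0 t, |f τ| ≤ C / 2 * Real.exp (2 * Λ * τ) := by
  have hB : ∀ x : ℝ, HasDerivAt (fun x => C / 2 * Real.exp (2 * Λ * x))
      (Λ * (C * Real.exp (2 * Λ * x))) x := fun x => by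
    refine ((((hasDerivAt_id x).const_mul (2 * Λ)).exp).const_mul (C / 2)).congr_deriv ?_
    simp only [id]; ring
  refine image_norm_le_of_norm_deriv_right_le_deriv_boundary (f := f) (f' := f')
    (fun τ hτ => (hf τ hτ).continuousWithinAt) (fun x hx => ?_) ?_ hB
    (fun x hx => hb x ⟨hx.1, hx.2.le⟩)
  · refine (hf x ⟨hx.1, hx.2.le⟩).mono_of_mem_nhdsWithin ?_
    filter_upwards [self_mem_nhdsWithin, mem_nhdsWithin_of_mem_nhds (Iio_mem_nhds hx.2)] with u hu hu'
    exact ⟨hx.1.trans hu, le_of_lt hu'⟩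
  · simp only [h0, norm_zero]; positivity

section unique

variable {n : ℕ} {ω : ℝ → ℝ} {M T₁ T₂ : ℝ} {γ₁ ρ₁ γ₂ ρ₂ : ℝ → ℝ → ℝ}

/-- Flows are determined by the momentum. -/
lemma Flow.unique (hn : 3 ≤ n) (hω : Dens ω M) (h₁ : Flow n ω T₁ γ₁ ρ₁) (h₂ : Flow n ω T₂ γ₂ ρ₂)
    {t : ℝ} (ht₀ : 0 ≤ t) (ht₁ : t < T₁) (ht₂ : t < T₂) {r : ℝ} (hr : 0 ≤ r) :
    γ₂ t r = γ₁ t r ∧ ρ₂ t r = ρ₁ t r := by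
  obtain ⟨a₁, b₁, hA₁⟩ := h₁.adm t ht₁
  obtain ⟨a₂, b₂, hA₂⟩ := h₂.adm t ht₂
  have hz : (0 : ℝ) ∈ Icc 0 t := ⟨le_rfl, ht₀⟩
  have ha : 0 < min a₁ a₂ := lt_min (hA₁ 0 hz).pos (hA₂ 0 hz).pos
  set a := min a₁ a₂
  set b := max b₁ b₂
  have hB₁ : ∀ τ ∈ Icc 0 t, Adm a b (γ₁ τ) (ρ₁ τ) := fun τ hτ =>
    (hA₁ τ hτ).weaken ha (min_le_left _ _) (le_max_left _ _)
  have hB₂ : ∀ τ ∈ Icc 0 t, Adm a b (γ₂ τ) (ρ₂ τ) := fun τ hτ =>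
    (hA₂ τ hτ).weaken ha (min_le_right _ _) (le_max_right _ _)
  obtain ⟨Λ, hΛ0, hΛ, hLip⟩ := exists_velocity_bounds hn hω (b := b) ha
  have hs₁ : Icc 0 t ⊆ Ico 0 T₁ := fun u hu => ⟨hu.1, hu.2.trans_lt ht₁⟩
  have hs₂ : Icc 0 t ⊆ Ico 0 T₂ := fun u hu => ⟨hu.1, hu.2.trans_lt ht₂⟩
  have hdγ : ∀ r, 0 ≤ r → ∀ τ ∈ Icc 0 t, HasDerivWithinAt (fun τ => γ₂ τ r - γ₁ τ r)
      (velU n ω (γ₂ τ) (ρ₂ τ) r - velU n ω (γ₁ τ) (ρ₁ τ) r) (Icc 0 t) τ := fun r hr τ hτ =>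
    ((h₂.dγ τ (hs₂ hτ) r hr).mono hs₂).sub ((h₁.dγ τ (hs₁ hτ) r hr).mono hs₁)
  have hdρ : ∀ r, 0 ≤ r → ∀ τ ∈ Icc 0 t, HasDerivWithinAt (fun τ => ρ₂ τ r - ρ₁ τ r)
      (ρ₂ τ r * velV n ω (γ₂ τ) (ρ₂ τ) r - ρ₁ τ r * velV n ω (γ₁ τ) (ρ₁ τ) r) (Icc 0 t) τ :=
    fun r hr τ hτ => ((h₂.dρ τ (hs₂ hτ) r hr).mono hs₂).sub ((h₁.dρ τ (hs₁ hτ) r hr).mono hs₁)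
  have hγ0 : ∀ r, 0 ≤ r → γ₂ 0 r - γ₁ 0 r = 0 := fun r hr => by
    rw [(h₁.init r hr).1, (h₂.init r hr).1, sub_self]
  have hρ0 : ∀ r, 0 ≤ r → ρ₂ 0 r - ρ₁ 0 r = 0 := fun r hr => by
    rw [(h₁.init r hr).2, (h₂.init r hr).2, sub_self]
  have key : ∀ k : ℕ, ∀ τ ∈ Icc 0 t, ∀ r, 0 ≤ r →
      |γ₂ τ r - γ₁ τ r| ≤ 1 / 2 ^ k * Real.exp (2 * Λ * τ) ∧
      |ρ₂ τ r - ρ₁ τ r| ≤ 1 / 2 ^ k * Real.exp (2 * Λ * τ) := by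
    intro k
    induction k with
    | zero =>
      have hexp : ∀ τ : ℝ, 0 ≤ τ → 1 ≤ Real.exp (2 * Λ * τ) := fun τ hτ =>
        Real.one_le_exp (by positivity)
      intro τ hτ r hr
      -- The induction starts from the size bound `Λ` on each velocity, so the difference of the
      -- derivatives is at most `2Λ` and `C = 2`. Each later step halves the constant through the
      -- weight `exp(2Λτ)`.
      have e : (1 : ℝ) / 2 ^ 0 = 2 / 2 := by norm_num
      rw [e]
      have hb1 : ∀ τ ∈ Icc 0 t, |velU n ω (γ₂ τ) (ρ₂ τ) r - velU n ω (γ₁ τ) (ρ₁ τ) r|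
          ≤ Λ * (2 * Real.exp (2 * Λ * τ)) := fun τ hτ => by
        have h3 := (hΛ _ _ (hB₂ τ hτ) r hr).1
        have h4 := (hΛ _ _ (hB₁ τ hτ) r hr).1
        have h5 := hexp τ hτ.1
        refine (abs_sub _ _).trans ?_
        nlinarith
      have hb2 : ∀ τ ∈ Icc 0 t, |ρ₂ τ r * velV n ω (γ₂ τ) (ρ₂ τ) r
          - ρ₁ τ r * velV n ω (γ₁ τ) (ρ₁ τ) r| ≤ Λ * (2 * Real.exp (2 * Λ * τ)) := fun τ hτ => by
        have h3 := (hΛ _ _ (hB₂ τ hτ) r hr).2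
        have h4 := (hΛ _ _ (hB₁ τ hτ) r hr).2
        have h5 := hexp τ hτ.1
        refine (abs_sub _ _).trans ?_
        nlinarith
      exact ⟨abs_le_half_exp (hdγ r hr) (hγ0 r hr) (by norm_num) hb1 τ hτ,
        abs_le_half_exp (hdρ r hr) (hρ0 r hr) (by norm_num) hb2 τ hτ⟩
    | succ k ih =>
      intro τ hτ r hr
      have e : (1 : ℝ) / 2 ^ (k + 1) = 1 / 2 ^ k / 2 := by rw [pow_succ]; field_simp
      rw [e]
      have hl := fun τ hτ => hLip _ _ _ _ _ (hB₁ τ hτ) (hB₂ τ hτ) (fun r hr => (ih τ hτ r hr).1)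
        (fun r hr => (ih τ hτ r hr).2) r hr
      exact ⟨abs_le_half_exp (hdγ r hr) (hγ0 r hr) (by positivity)
          (fun τ hτ => (hl τ hτ).1) τ hτ,
        abs_le_half_exp (hdρ r hr) (hρ0 r hr) (by positivity) (fun τ hτ => (hl τ hτ).2) τ hτ⟩
  have hlim : Tendsto (fun k : ℕ => 1 / 2 ^ k * Real.exp (2 * Λ * t)) atTop (𝓝 0) := by
    have := (tendsto_pow_atTop_nhds_zero_of_lt_one (r := (1 / 2 : ℝ)) (by norm_num)
      (by norm_num)).mul_const (Real.exp (2 * Λ * t))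
    simpa using this
  have htt : t ∈ Icc 0 t := ⟨ht₀, le_rfl⟩
  constructor
  · have := ge_of_tendsto' hlim fun k => (key k t htt r hr).1
    exact sub_eq_zero.1 (abs_nonpos_iff.1 this)
  · have := ge_of_tendsto' hlim fun k => (key k t htt r hr).2
    exact sub_eq_zero.1 (abs_nonpos_iff.1 this)

end unique

/-- The derivatives match at the junction because the velocity depends only on the state and the
second flow starts from the state reached by the first. -/
lemma hasDerivWithinAt_glue {f₁ f₂ d₁ d₂ : ℝ → ℝ} {t₀ ε : ℝ}
    (h₁ : ∀ t ∈ Icc 0 t₀, HasDerivWithinAt f₁ (d₁ t) (Icc 0 t₀) t)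
    (h₂ : ∀ t ∈ Icc 0 ε, HasDerivWithinAt f₂ (d₂ t) (Icc 0 ε) t)
    (hf : f₁ t₀ = f₂ 0) (hd : d₁ t₀ = d₂ 0) {t : ℝ} (ht : t ∈ Ico 0 (t₀ + ε)) :
    HasDerivWithinAt (fun t => if t ≤ t₀ then f₁ t else f₂ (t - t₀))
      (if t ≤ t₀ then d₁ t else d₂ (t - t₀)) (Ico 0 (t₀ + ε)) t := by
  have h₂' : ∀ t ∈ Icc t₀ (t₀ + ε), HasDerivWithinAt (fun t => f₂ (t - t₀)) (d₂ (t - t₀))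
      (Icc t₀ (t₀ + ε)) t := fun t ht => by
    have h3 : HasDerivWithinAt (fun t => t - t₀) 1 (Icc t₀ (t₀ + ε)) t :=
      ((hasDerivAt_id t).sub_const t₀).hasDerivWithinAt
    have hm : MapsTo (fun t => t - t₀) (Icc t₀ (t₀ + ε)) (Icc 0 ε) := fun u hu =>
      ⟨by linarith [hu.1], by linarith [hu.2]⟩
    exact ((h₂ (t - t₀) (hm ht)).comp t h3 hm).congr_deriv (mul_one _)
  have e₁ : ∀ u ∈ Icc 0 t₀, (if u ≤ t₀ then f₁ u else f₂ (u - t₀)) = f₁ u := fun u hu =>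
    if_pos hu.2
  have e₂ : ∀ u ∈ Icc t₀ (t₀ + ε), (if u ≤ t₀ then f₁ u else f₂ (u - t₀)) = f₂ (u - t₀) := by
    intro u hu
    split_ifs with h
    · have : u = t₀ := le_antisymm h hu.1
      rw [this, sub_self, hf]
    · rfl
  rcases lt_trichotomy t t₀ with h | rfl | h
  · rw [if_pos h.le]
    have ht' : t ∈ Icc 0 t₀ := ⟨ht.1, h.le⟩
    refine ((h₁ t ht').congr e₁ (e₁ t ht')).mono_of_mem_nhdsWithin ?_
    filter_upwards [self_mem_nhdsWithin, mem_nhdsWithin_of_mem_nhds (Iio_mem_nhds h)] with u hu hu'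
    exact ⟨hu.1, le_of_lt hu'⟩
  · rw [if_pos le_rfl]
    have ht₁ : t ∈ Icc 0 t := ⟨ht.1, le_rfl⟩
    have ht₂ : t ∈ Icc t (t + ε) := ⟨le_rfl, ht.2.le⟩
    have h5 := (h₁ t ht₁).congr e₁ (e₁ t ht₁)
    have h6 := (h₂' t ht₂).congr e₂ (e₂ t ht₂)
    rw [sub_self, ← hd] at h6
    refine (h5.union h6).mono fun u hu => ?_
    rcases le_total u t with h | h
    · exact Or.inl ⟨hu.1, h⟩
    · exact Or.inr ⟨h, hu.2.le⟩
  · rw [if_neg (not_le.2 h)]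
    have ht' : t ∈ Icc t₀ (t₀ + ε) := ⟨h.le, ht.2.le⟩
    refine ((h₂' t ht').congr e₂ (e₂ t ht')).mono_of_mem_nhdsWithin ?_
    filter_upwards [self_mem_nhdsWithin, mem_nhdsWithin_of_mem_nhds (Ioi_mem_nhds h)] with u hu hu'
    exact ⟨le_of_lt hu', hu.2.le⟩

lemma kernInt_congr {n : ℕ} {k₁ k₂ : ℝ → ℝ → ℝ} {ω γ ρ γ' ρ' : ℝ → ℝ}
    (hγ : ∀ r, 0 ≤ r → γ r = γ' r) (hρ : ∀ r, 0 ≤ r → ρ r = ρ' r) {r : ℝ} (hr : 0 ≤ r) :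
    kernInt n k₁ k₂ ω γ ρ r = kernInt n k₁ k₂ ω γ' ρ' r := by
  refine setIntegral_congr_fun measurableSet_Ioi fun s hs => ?_
  simp only [mass]
  rw [hγ r hr, hγ s (le_of_lt hs), hρ s (le_of_lt hs)]

section extension

variable {n : ℕ} {ω : ℝ → ℝ} {M T a b : ℝ} {γ ρ : ℝ → ℝ → ℝ}

lemma exists_flow (hn : 3 ≤ n) (hω : Dens ω M) : ∃ T > 0, ∃ γ ρ, Flow n ω T γ ρ := by
  obtain ⟨ε, hε, h⟩ := exists_local_flow (b := 1) hn hω one_pos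
  obtain ⟨γ, ρ, h0, hd⟩ := h id (fun _ => 1) adm_id
  have hsub : Ico 0 ε ⊆ Icc 0 ε := Ico_subset_Icc_self
  exact ⟨ε, hε, γ, ρ, h0, fun T' hT' => ⟨_, _, fun t ht => (hd t ⟨ht.1, ht.2.trans hT'.le⟩).1⟩,
    fun t ht r hr => ((hd t (hsub ht)).2 r hr).1.mono hsub,
    fun t ht r hr => ((hd t (hsub ht)).2 r hr).2.mono hsub⟩

/-- A flow with uniform bounds can be continued. -/
lemma Flow.exists_extension (hn : 3 ≤ n) (hω : Dens ω M) (h : Flow n ω T γ ρ) (hT : 0 < T)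
    (hA : ∀ t ∈ Ico 0 T, Adm a b (γ t) (ρ t)) : ∃ T' > T, ∃ γ' ρ', Flow n ω T' γ' ρ' := by
  have ha := (hA 0 ⟨le_rfl, hT⟩).pos
  obtain ⟨ε, hε, hloc⟩ := exists_local_flow (b := b) hn hω ha
  -- Restarting less than `ε` before `T` with the uniform lifespan `ε` carries the flow past `T`.
  set t₀ := max 0 (T - ε / 2) with ht₀
  have h0 : 0 ≤ t₀ := le_max_left _ _
  have ht₀T : t₀ < T := max_lt hT (by linarith)
  have htε : T < t₀ + ε := by have := le_max_right 0 (T - ε / 2); linarith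
  have hmem : t₀ ∈ Ico 0 T := ⟨h0, ht₀T⟩
  have hz : (0 : ℝ) ∈ Icc 0 ε := ⟨le_rfl, hε.le⟩
  obtain ⟨g, q, hinit, hg⟩ := hloc _ _ (hA t₀ hmem)
  have hsub : Icc 0 t₀ ⊆ Ico 0 T := fun u hu => ⟨hu.1, hu.2.trans_lt ht₀T⟩
  have eγ : ∀ t, (fun r => if t ≤ t₀ then γ t r else g (t - t₀) r)
      = if t ≤ t₀ then γ t else g (t - t₀) := fun t => by split_ifs <;> rfl
  have eρ : ∀ t, (fun r => if t ≤ t₀ then ρ t r else q (t - t₀) r)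
      = if t ≤ t₀ then ρ t else q (t - t₀) := fun t => by split_ifs <;> rfl
  refine ⟨t₀ + ε, htε, fun t r => if t ≤ t₀ then γ t r else g (t - t₀) r,
    fun t r => if t ≤ t₀ then ρ t r else q (t - t₀) r, ?_, ?_, ?_, ?_⟩
  · intro r hr
    simp only [if_pos h0]
    exact h.init r hr
  · intro T' hT'
    refine ⟨a / 2, b + a / 2, fun t ht => ?_⟩
    rw [eγ, eρ]
    split_ifs with hc
    · exact (hA t (hsub ⟨ht.1, hc⟩)).weaken (by positivity) (by linarith) (by linarith)
    · exact (hg (t - t₀) ⟨by linarith [not_le.1 hc], by linarith [ht.2]⟩).1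
  · intro t ht r hr
    have := hasDerivWithinAt_glue (f₁ := fun τ => γ τ r) (f₂ := fun τ => g τ r)
      (d₁ := fun τ => velU n ω (γ τ) (ρ τ) r) (d₂ := fun τ => velU n ω (g τ) (q τ) r)
      (fun τ hτ => (h.dγ τ (hsub hτ) r hr).mono hsub) (fun τ hτ => ((hg τ hτ).2 r hr).1)
      (hinit r hr).1.symm
      (kernInt_congr (fun s hs => (hinit s hs).1.symm) (fun s hs => (hinit s hs).2.symm) hr) ht
    refine this.congr_deriv ?_
    rw [eγ, eρ]
    split_ifs <;> rfl
  · intro t ht r hr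
    have := hasDerivWithinAt_glue (f₁ := fun τ => ρ τ r) (f₂ := fun τ => q τ r)
      (d₁ := fun τ => ρ τ r * velV n ω (γ τ) (ρ τ) r)
      (d₂ := fun τ => q τ r * velV n ω (g τ) (q τ) r)
      (fun τ hτ => (h.dρ τ (hsub hτ) r hr).mono hsub) (fun τ hτ => ((hg τ hτ).2 r hr).2)
      (hinit r hr).2.symm
      (congrArg₂ (· * ·) (hinit r hr).2.symm (kernInt_congr (fun s hs => (hinit s hs).1.symm)
        (fun s hs => (hinit s hs).2.symm) hr)) ht
    refine this.congr_deriv ?_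
    rw [eγ, eρ]
    split_ifs <;> rfl

end extension

end

/-! ### Inward motion and the bound on lifespans -/

noncomputable section

section sign

variable {n : ℕ} {ω γ ρ : ℝ → ℝ} {M a b : ℝ}

lemma mass_nonpos (hneg : ∀ r, 0 ≤ r → ω r ≤ 0) (h : Adm a b γ ρ) {s : ℝ} (hs : 0 ≤ s) :
    mass n ω ρ s ≤ 0 :=
  div_nonpos_of_nonpos_of_nonneg (mul_nonpos_of_nonneg_of_nonpos (pow_nonneg hs _) (hneg s hs))
    (h.ρ_pos hs).le

lemma symK_mul_mass_nonpos (hn : 3 ≤ n) (hneg : ∀ r, 0 ≤ r → ω r ≤ 0) (h : Adm a b γ ρ) {r s : ℝ}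
    (hr : 0 < r) (hs : 0 < s) : symK n (γ r) (γ s) * mass n ω ρ s ≤ 0 :=
  mul_nonpos_of_nonneg_of_nonpos (symK_nonneg hn (h.γ_pos hr) (h.γ_pos hs)) (mass_nonpos hneg h hs.le)

lemma velU_nonpos (hn : 3 ≤ n) (hneg : ∀ r, 0 ≤ r → ω r ≤ 0) (h : Adm a b γ ρ) {r : ℝ}
    (hr : 0 ≤ r) : velU n ω γ ρ r ≤ 0 := by
  rcases hr.eq_or_lt with rfl | hr
  · exact (velU_zero h).le
  rw [velU_eq]
  exact setIntegral_nonpos measurableSet_Ioi fun s hs => symK_mul_mass_nonpos hn hneg h hr hs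

lemma integral_ρ (h : Adm a b γ ρ) {r r' : ℝ} (hr : 0 ≤ r) (hrr : r ≤ r') :
    IntegrableOn ρ (Ioc r r') ∧ ∫ s in Ioc r r', ρ s = γ r' - γ r := by
  have hsub : Icc r r' ⊆ Ici 0 := fun s hs => hr.trans hs.1
  have hi : IntervalIntegrable ρ volume r r' := (h.cont.mono hsub).intervalIntegrable_of_Icc hrr
  refine ⟨(intervalIntegrable_iff_integrableOn_Ioc_of_le hrr).1 hi, ?_⟩
  rw [← intervalIntegral.integral_of_le hrr]
  exact intervalIntegral.integral_eq_sub_of_hasDerivAt_of_le hrr (h.contγ.mono hsub)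
    (fun s hs => h.hasDerivAt (hr.trans_lt hs.1)) hi

/-- Negative momentum between `r` and `r'` draws the particle at `r` inwards. -/
lemma velU_le_neg (hn : 3 ≤ n) (hω : Dens ω M) (hneg : ∀ r, 0 ≤ r → ω r ≤ 0) (h : Adm a b γ ρ)
    {c R p r r' z : ℝ} (hc : 0 < c)
    (hcK : ∀ x y, 0 < x → x ≤ y → y ≤ R → c * x ≤ greenKernel n x y) (hp : 0 < p) (hpr : p ≤ r)
    (hrr : r < r') (hz : 0 ≤ z) (hωz : ∀ s ∈ Icc r r', ω s ≤ -z) (hR : γ r' ≤ R) :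
    velU n ω γ ρ r ≤ -(c * p ^ (n - 1) * z * (r' - r) ^ 2 / γ r') * γ r := by
  have hr : 0 < r := hp.trans_le hpr
  have hg := h.γ_pos hr
  have hg' := h.γ_pos (hr.trans hrr)
  have hh : 0 < r' - r := sub_pos.2 hrr
  have hi := integrableOn_pairK hn (goodPair_symK hn) hω h hr.le
  obtain ⟨hρi, hρ⟩ := integral_ρ h hr.le hrr.le
  -- `l` bounds the mean of `ρ` on `[r, r']`. The tangent line of the convex function `1/ρ` at `ρ =
  -- l` integrates to an expression in `∫ ρ = γ(r') - γ(r) ≤ γ(r')`, which gives `∫ 1/ρ ≥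
  -- (r'-r)²/γ(r')`.
  set l := γ r' / (r' - r) with hl
  have hl0 : 0 < l := div_pos hg' hh
  set D := c * γ r * (p ^ (n - 1) * z) with hD
  have hD0 : 0 ≤ D := by positivity
  have h1 : velU n ω γ ρ r ≤ ∫ s in Ioc r r', symK n (γ r) (γ s) * mass n ω ρ s := by
    rw [velU_eq, ← neg_le_neg_iff, ← integral_neg, ← integral_neg]
    refine setIntegral_mono_set hi.neg ?_ (Eventually.of_forall fun s hs => hr.trans hs.1)
    refine (ae_restrict_mem measurableSet_Ioi).mono fun s hs => ?_
    have := symK_mul_mass_nonpos hn hneg h hr hs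
    simpa using this
  have hcon : IntegrableOn (fun _ : ℝ => 2 / l) (Ioc r r') := integrableOn_const (by simp)
  have hci : IntegrableOn (fun s => -D * (2 / l - ρ s / l ^ 2)) (Ioc r r') :=
    (hcon.sub (hρi.div_const _)).const_mul _
  have h2 : ∫ s in Ioc r r', symK n (γ r) (γ s) * mass n ω ρ s
      ≤ ∫ s in Ioc r r', -D * (2 / l - ρ s / l ^ 2) := by
    refine setIntegral_mono_on (hi.mono_set fun s hs => hr.trans hs.1) hci measurableSet_Ioc
      fun s hs => ?_
    have hs0 : 0 < s := hr.trans hs.1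
    have hρs := h.ρ_pos hs0.le
    have h3 : c * γ r ≤ symK n (γ r) (γ s) := by
      rw [symK_of_le (h.mono hr.le hs.1.le)]
      exact hcK _ _ hg (h.mono hr.le hs.1.le) ((h.mono hs0.le hs.2).trans hR)
    have h4 : 2 / l - ρ s / l ^ 2 ≤ 1 / ρ s := by
      have e : 1 / ρ s - (2 / l - ρ s / l ^ 2) = (l - ρ s) ^ 2 / (ρ s * l ^ 2) := by
        field_simp; ring
      have : 0 ≤ (l - ρ s) ^ 2 / (ρ s * l ^ 2) := by positivity
      linarith
    have h5 : p ^ (n - 1) * z ≤ s ^ (n - 1) * -ω s := by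
      have := hωz s ⟨hs.1.le, hs.2⟩
      have : z ≤ -ω s := by linarith
      have : p ≤ s := hpr.trans hs.1.le
      gcongr
    have h6 : D * (2 / l - ρ s / l ^ 2) ≤ symK n (γ r) (γ s) * (s ^ (n - 1) * -ω s / ρ s) := by
      calc D * (2 / l - ρ s / l ^ 2) ≤ D * (1 / ρ s) := by gcongr
        _ = (c * γ r) * ((p ^ (n - 1) * z) * (1 / ρ s)) := by rw [hD]; ring
        _ ≤ symK n (γ r) (γ s) * ((s ^ (n - 1) * -ω s) * (1 / ρ s)) := by
            have := symK_nonneg hn hg (h.γ_pos hs0)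
            gcongr
        _ = _ := by ring
    have e7 : symK n (γ r) (γ s) * mass n ω ρ s
        = -(symK n (γ r) (γ s) * (s ^ (n - 1) * -ω s / ρ s)) := by rw [mass]; ring
    rw [e7]; linarith
  have h8 : ∫ s in Ioc r r', -D * (2 / l - ρ s / l ^ 2)
      = -D * ((r' - r) * (2 / l) - (γ r' - γ r) / l ^ 2) := by
    rw [integral_const_mul, integral_sub hcon (hρi.div_const _),
      integral_div, integral_div, hρ]
    simp [hrr.le]
    ring_nf
    simp
  refine h1.trans (h2.trans ?_)
  rw [h8]
  have e9 : (c * p ^ (n - 1) * z * (r' - r) ^ 2 / γ r') * γ r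
      = D * ((r' - r) * (2 / l) - γ r' / l ^ 2) := by
    rw [hD, hl]; field_simp; ring
  have h10 : γ r' / l ^ 2 ≥ (γ r' - γ r) / l ^ 2 := by gcongr; linarith
  rw [neg_mul, neg_mul, e9, neg_le_neg_iff]
  gcongr

end sign

section lifespan

variable {n : ℕ} {ω : ℝ → ℝ} {M T : ℝ} {γ ρ : ℝ → ℝ → ℝ}

lemma Flow.hasDerivAt_γ (h : Flow n ω T γ ρ) {t : ℝ} (ht : t ∈ Ioo 0 T) {r : ℝ} (hr : 0 ≤ r) :
    HasDerivAt (fun τ => γ τ r) (velU n ω (γ t) (ρ t) r) t :=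
  (h.dγ t ⟨ht.1.le, ht.2⟩ r hr).hasDerivAt (Ico_mem_nhds ht.1 ht.2)

lemma Flow.hasDerivAt_ρ (h : Flow n ω T γ ρ) {t : ℝ} (ht : t ∈ Ioo 0 T) {r : ℝ} (hr : 0 ≤ r) :
    HasDerivAt (fun τ => ρ τ r) (ρ t r * velV n ω (γ t) (ρ t) r) t :=
  (h.dρ t ⟨ht.1.le, ht.2⟩ r hr).hasDerivAt (Ico_mem_nhds ht.1 ht.2)

lemma Flow.antitoneOn_γ (hn : 3 ≤ n) (hneg : ∀ r, 0 ≤ r → ω r ≤ 0) (h : Flow n ω T γ ρ) {r : ℝ}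
    (hr : 0 ≤ r) : AntitoneOn (fun τ => γ τ r) (Ico 0 T) := by
  refine antitoneOn_of_hasDerivWithinAt_nonpos (f' := fun t => velU n ω (γ t) (ρ t) r)
    (convex_Ico 0 T) (fun t ht => (h.dγ t ht r hr).continuousWithinAt)
    (fun t ht => ?_) (fun t ht => ?_)
  · rw [interior_Ico] at ht
    exact (h.hasDerivAt_γ ht hr).hasDerivWithinAt
  · obtain ⟨a, b, hab⟩ := h.adm_at (interior_subset ht)
    exact velU_nonpos hn hneg hab hr

lemma Flow.γ_le (hn : 3 ≤ n) (hneg : ∀ r, 0 ≤ r → ω r ≤ 0) (h : Flow n ω T γ ρ) {t r : ℝ}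
    (ht : t ∈ Ico 0 T) (hr : 0 ≤ r) : γ t r ≤ r := by
  have := h.antitoneOn_γ hn hneg hr ⟨le_rfl, ht.1.trans_lt ht.2⟩ ht ht.1
  simpa [(h.init r hr).1] using this

lemma exists_neg_interval (hcont : ContinuousOn ω (Ici 0)) (hneg : ∀ r, 0 ≤ r → ω r ≤ 0)
    (hne : ∃ r, 0 ≤ r ∧ ω r ≠ 0) :
    ∃ p q z : ℝ, 0 < p ∧ p < q ∧ 0 < z ∧ ∀ s ∈ Icc p q, ω s ≤ -z := by
  obtain ⟨r, hr, hωr⟩ := hne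
  have hlt : ω r < 0 := lt_of_le_of_ne (hneg r hr) hωr
  have h1 : ∀ᶠ s in 𝓝[Ici 0] r, ω s < ω r / 2 :=
    (hcont r hr).eventually (gt_mem_nhds (by linarith))
  have h2 : ∀ᶠ s in 𝓝[>] r, ω s < ω r / 2 :=
    h1.filter_mono (nhdsWithin_mono _ fun s hs => hr.trans (le_of_lt hs))
  obtain ⟨u, hu, hsub⟩ := mem_nhdsGT_iff_exists_Ioo_subset.1 h2
  have hu : r < u := hu
  refine ⟨r + (u - r) / 3, r + 2 * (u - r) / 3, -ω r / 2, by linarith, by linarith, by linarith,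
    fun s hs => ?_⟩
  have := hsub (show s ∈ Ioo r u from ⟨by linarith [hs.1], by linarith [hs.2]⟩)
  have : ω s < ω r / 2 := this
  linarith

/-- Gronwall: an exponential upper bound from a differential inequality. -/
lemma le_mul_exp_neg {f f' : ℝ → ℝ} {κ s t : ℝ} (hst : s ≤ t) (hf : ContinuousOn f (Icc s t))
    (hd : ∀ τ ∈ Ioo s t, HasDerivAt f (f' τ) τ) (hb : ∀ τ ∈ Ioo s t, f' τ ≤ -κ * f τ) :
    f t ≤ f s * Real.exp (-(κ * (t - s))) := by
  have hanti : AntitoneOn (fun τ => f τ * Real.exp (κ * (τ - s))) (Icc s t) := by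
    refine antitoneOn_of_hasDerivWithinAt_nonpos
      (f' := fun τ => f' τ * Real.exp (κ * (τ - s)) + f τ * (Real.exp (κ * (τ - s)) * κ))
      (convex_Icc s t) (hf.mul (by fun_prop)) (fun τ hτ => ?_) (fun τ hτ => ?_)
    · rw [interior_Icc] at hτ
      refine ((hd τ hτ).mul (((((hasDerivAt_id τ).sub_const s).const_mul κ).exp).congr_deriv
        ?_)).hasDerivWithinAt
      simp
    · rw [interior_Icc] at hτ
      have h1 := hb τ hτ
      have h2 := Real.exp_pos (κ * (τ - s))
      nlinarith
  have := hanti ⟨le_rfl, hst⟩ ⟨hst, le_rfl⟩ hst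
  simp only [sub_self, mul_zero, Real.exp_zero, mul_one] at this
  rw [Real.exp_neg, ← div_eq_mul_inv, le_div_iff₀ (Real.exp_pos _)]
  exact this

/-- With negative momentum all lifespans are bounded. -/
lemma exists_lifespan_bound (hn : 3 ≤ n) (hω : Dens ω M) (hneg : ∀ r, 0 ≤ r → ω r ≤ 0)
    (hne : ∃ r, 0 ≤ r ∧ ω r ≠ 0) : ∃ B, ∀ T γ ρ, Flow n ω T γ ρ → T ≤ B := by
  obtain ⟨p, q, z, hp, hpq, hz, hωz⟩ := exists_neg_interval hω.cont hneg hne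
  have hq : 0 < q := hp.trans hpq
  obtain ⟨c, hc, hcK⟩ := exists_le_greenKernel hn hq
  -- With gap `(q-p)/2^(k+1)` and `γ(x k) ≤ q/8^k`, the decay rate of the next particle is at least
  -- `4^(-k-1) 8^k` times `c p^(n-1) z (q-p)²/q`, that is `K 2^k`.
  set K := c * p ^ (n - 1) * z * (q - p) ^ 2 / (4 * q) with hK
  have hqp : 0 < q - p := sub_pos.2 hpq
  have hK0 : 0 < K := by positivity
  refine ⟨6 / K, fun T γ ρ h => ?_⟩
  by_contra! hlt
  set x : ℕ → ℝ := fun k => p + (q - p) / 2 ^ k with hx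
  -- The waiting times `3/(K 2^k)` make rate times duration equal to `3`, enough for a factor
  -- `exp(-3) ≤ 1/8`; their sum is `6/K`.
  set τ : ℕ → ℝ := fun k => 6 / K * (1 - 1 / 2 ^ k) with hτ
  have hxp : ∀ k, p < x k := fun k => by
    have : 0 < (q - p) / 2 ^ k := by positivity
    simp only [hx]; linarith
  have hxs : ∀ k, x k - x (k + 1) = (q - p) / 2 ^ (k + 1) := fun k => by
    simp only [hx]; rw [pow_succ]; field_simp; ring
  have hxlt : ∀ k, x (k + 1) < x k := fun k => by
    have h1 := hxs k
    have h2 : 0 < (q - p) / 2 ^ (k + 1) := by positivity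
    linarith
  have hxq : ∀ k, x k ≤ q := fun k => by
    have h1 : (q - p) / 2 ^ k ≤ q - p := div_le_self hqp.le (one_le_pow₀ (by norm_num))
    simp only [hx]; linarith
  have hτ0 : ∀ k, 0 ≤ τ k := fun k => by
    have : (1 : ℝ) / 2 ^ k ≤ 1 := by
      rw [div_le_one (by positivity)]; exact one_le_pow₀ (by norm_num)
    have : 0 ≤ 1 - (1 : ℝ) / 2 ^ k := by linarith
    simp only [hτ]; positivity
  have hτs : ∀ k, τ (k + 1) - τ k = 3 / (K * 2 ^ k) := fun k => by
    simp only [hτ]; rw [pow_succ]; field_simp; ring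
  have key : ∀ k, ∀ t ∈ Ico 0 T, τ k ≤ t → γ t (x k) ≤ q / 8 ^ k := by
    intro k
    induction k with
    | zero =>
      intro t ht _
      have h1 := h.γ_le hn hneg ht (hp.trans (hxp 0)).le
      simpa using h1.trans (hxq 0)
    | succ k ih =>
      intro t ht hkt
      have hx1 : 0 < x (k + 1) := hp.trans (hxp _)
      have hstep := hτs k
      have hpos : 0 < 3 / (K * 2 ^ k) := by positivity
      have hle : τ k ≤ t := by linarith
      have hdec := le_mul_exp_neg (f := fun s => γ s (x (k + 1))) (κ := K * 2 ^ k)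
        (f' := fun s => velU n ω (γ s) (ρ s) (x (k + 1))) hle
        (fun s hs => ((h.dγ s ⟨(hτ0 k).trans hs.1, hs.2.trans_lt ht.2⟩ _ hx1.le).mono
          (fun u hu => ⟨(hτ0 k).trans hu.1, hu.2.trans_lt ht.2⟩)).continuousWithinAt)
        (fun s hs => h.hasDerivAt_γ ⟨(hτ0 k).trans_lt hs.1, hs.2.trans ht.2⟩ hx1.le)
        (fun s hs => ?_)
      · have hτk : τ k ∈ Ico 0 T := ⟨hτ0 k, hle.trans_lt ht.2⟩
        obtain ⟨a, b, hab⟩ := h.adm_at hτk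
        have h1 := ih (τ k) hτk le_rfl
        have h2 := hab.mono hx1.le (hxlt k).le
        have h3 : Real.exp (-(K * 2 ^ k * (t - τ k))) ≤ 1 / 8 := by
          have h4 : 3 ≤ K * 2 ^ k * (t - τ k) := by
            have : 3 / (K * 2 ^ k) ≤ t - τ k := by linarith
            rw [div_le_iff₀ (by positivity)] at this
            linarith
          rw [Real.exp_neg, one_div]
          refine inv_anti₀ (by norm_num) ?_
          calc (8 : ℝ) = 2 ^ 3 := by norm_num
            _ ≤ Real.exp 1 ^ 3 := by
                gcongr; have := Real.add_one_le_exp (1 : ℝ); linarith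
            _ = Real.exp 3 := by rw [← Real.exp_nat_mul]; norm_num
            _ ≤ _ := Real.exp_le_exp.2 h4
        calc γ t (x (k + 1)) ≤ γ (τ k) (x (k + 1)) * Real.exp (-(K * 2 ^ k * (t - τ k))) := hdec
          _ ≤ (q / 8 ^ k) * (1 / 8) := by
              have := hab.γ_pos hx1
              gcongr
              linarith
          _ = q / 8 ^ (k + 1) := by rw [pow_succ]; field_simp
      · have hs' : s ∈ Ico 0 T := ⟨(hτ0 k).trans hs.1.le, hs.2.trans ht.2⟩
        obtain ⟨a, b, hab⟩ := h.adm_at hs'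
        have hxk : 0 < x k := hp.trans (hxp k)
        have hg := hab.γ_pos hx1
        have hg' := hab.γ_pos hxk
        have h1 := ih s hs' hs.1.le
        refine (velU_le_neg hn hω hneg hab hc hcK hp (hxp _).le (hxlt k) hz.le
          (fun u hu => hωz u ⟨(hxp _).le.trans hu.1, hu.2.trans (hxq k)⟩)
          ((h.γ_le hn hneg hs' hxk.le).trans (hxq k))).trans ?_
        refine mul_le_mul_of_nonneg_right (neg_le_neg ?_) hg.le
        rw [hxs k, le_div_iff₀ hg']
        calc K * 2 ^ k * γ s (x k) ≤ K * 2 ^ k * (q / 8 ^ k) := by gcongr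
          _ = c * p ^ (n - 1) * z * ((q - p) / 2 ^ (k + 1)) ^ 2 := by
              rw [hK, (by norm_num : (8 : ℝ) = 2 * (2 * 2)), mul_pow, mul_pow, pow_succ]
              field_simp
              ring
  -- At time `6/K` all steps have been completed. Since `γ(p) ≤ γ(x k) ≤ q/8^k` for every `k`, the
  -- particle `p` would have reached the origin, which admissibility forbids.
  have hB0 : 0 < 6 / K := by positivity
  have hmem : 6 / K ∈ Ico 0 T := ⟨hB0.le, hlt⟩
  obtain ⟨a, b, hab⟩ := h.adm_at hmem
  have hgp := hab.γ_pos hp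
  have hle : ∀ k, γ (6 / K) p ≤ q * (1 / 8) ^ k := fun k => by
    have h1 := key k (6 / K) hmem (by
      have : 0 ≤ 6 / K * (1 / 2 ^ k) := by positivity
      simp only [hτ]; linarith)
    have h2 := hab.mono hp.le (hxp k).le
    have e : q * (1 / 8) ^ k = q / 8 ^ k := by rw [div_pow, one_pow]; ring
    rw [e]; linarith
  have hlim : Tendsto (fun k : ℕ => q * (1 / 8 : ℝ) ^ k) atTop (𝓝 0) := by
    have := (tendsto_pow_atTop_nhds_zero_of_lt_one (r := (1 / 8 : ℝ)) (by norm_num)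
      (by norm_num)).const_mul q
    simpa using this
  exact absurd (ge_of_tendsto' hlim hle) (not_le.2 hgp)

end lifespan

end

/-! ### The velocity is controlled by the energy -/

noncomputable section

open scoped ENNReal

/-- The square-root kernel, whose self-convolution is the Green kernel. -/
def rootK (n : ℕ) (x w : ℝ) : ℝ := √(w ^ (n - 1)) * (solA n (min x w) * solB n (max x w))

lemma rootK_nonneg (n : ℕ) {x w : ℝ} (hx : 0 < x) (hw : 0 < w) : 0 ≤ rootK n x w :=
  mul_nonneg (Real.sqrt_nonneg _)
    (mul_pos (solA_pos n (lt_min hx hw)) (solB_pos n (lt_max_of_lt_left hx))).le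

lemma continuousOn_rootK (n : ℕ) :
    ContinuousOn (fun p : ℝ × ℝ => rootK n p.1 p.2) (Ioi 0 ×ˢ Ioi 0) := by
  have h1 : Continuous fun p : ℝ × ℝ => √(p.2 ^ (n - 1)) := by fun_prop
  have h2 : Continuous fun p : ℝ × ℝ => solA n (min p.1 p.2) :=
    (continuous_solA n).comp (continuous_fst.min continuous_snd)
  have h3 : ContinuousOn (fun p : ℝ × ℝ => solB n (max p.1 p.2)) (Ioi 0 ×ˢ Ioi 0) :=
    (continuousOn_solB n).comp (continuous_fst.max continuous_snd).continuousOn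
      fun p hp => mem_Ioi.2 (lt_max_of_lt_left hp.1)
  exact h1.continuousOn.mul (h2.continuousOn.mul h3)

lemma pow_mul_sq (n : ℕ) (hn : 1 ≤ n) (w : ℝ) {f g : ℝ} :
    w ^ (n - 1) * ((w * f) * (w * g)) = w ^ (n + 1) * (f * g) := by
  obtain ⟨m, rfl⟩ : ∃ m, n = m + 1 := ⟨n - 1, by omega⟩
  simp only [Nat.add_sub_cancel]
  ring

lemma lintegral_ofReal_of_integral {f : ℝ → ℝ} {s : Set ℝ} {I : ℝ} (hs : MeasurableSet s)
    (hf : IntegrableOn f s) (h0 : ∀ w ∈ s, 0 ≤ f w) (hI : ∫ w in s, f w = I) :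
    ∫⁻ w in s, ENNReal.ofReal (f w) = ENNReal.ofReal I := by
  rw [← hI, ofReal_integral_eq_lintegral_ofReal hf ((ae_restrict_mem hs).mono h0)]

lemma lintegral_rootK_mul {n : ℕ} (hn : 3 ≤ n) {x y : ℝ} (hx : 0 < x) (hxy : x ≤ y) :
    ∫⁻ w in Ioi 0, ENNReal.ofReal (rootK n x w * rootK n y w)
      = ENNReal.ofReal (greenKernel n x y) := by
  have hn1 : 1 ≤ n := by omega
  have hy : 0 < y := hx.trans_le hxy
  have hax := (solA_pos n hx).le
  have hay := (solA_pos n hy).le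
  have hbx := (solB_pos n hx).le
  have hby := (solB_pos n hy).le
  have hsq : ∀ w : ℝ, 0 < w → √(w ^ (n - 1)) * √(w ^ (n - 1)) = w ^ (n - 1) := fun w hw =>
    Real.mul_self_sqrt (by positivity)
  have cA : ∀ u v, 0 < u → ContinuousOn (fun w => w ^ (n + 1) * (alphaN n w * beta n w)) (Icc u v) :=
    fun u v hu w hw => ((continuous_pow _).continuousAt.mul ((continuous_alphaN n).continuousAt.mul
      (betaN_hasDerivAt n (hu.trans_le hw.1)).continuousAt)).continuousWithinAt
  have i1 : IntervalIntegrable (fun w => w ^ (n + 1) * (alphaN n w * alphaN n w)) volume 0 x :=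
    ((continuous_pow _).mul ((continuous_alphaN n).mul (continuous_alphaN n))).intervalIntegrable _ _
  have i2 : IntervalIntegrable (fun w => w ^ (n + 1) * (alphaN n w * beta n w)) volume x y :=
    (cA x y hx).intervalIntegrable_of_Icc hxy
  have e1 : ∫ w in Ioc 0 x, w ^ (n + 1) * (alphaN n w * alphaN n w) = momA n x := by
    rw [← intervalIntegral.integral_of_le hx.le,
      intervalIntegral.integral_eq_sub_of_hasDerivAt_of_le hx.le (continuous_momA n).continuousOn
        (fun w hw => momA_hasDerivAt n hw.1) i1, momA_zero, sub_zero]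
  have e2 : ∫ w in Ioc x y, w ^ (n + 1) * (alphaN n w * beta n w) = momM n y - momM n x := by
    rw [← intervalIntegral.integral_of_le hxy,
      intervalIntegral.integral_eq_sub_of_hasDerivAt_of_le hxy
        (fun w hw => (momM_hasDerivAt n (hx.trans_le hw.1)).continuousAt.continuousWithinAt)
        (fun w hw => momM_hasDerivAt n (hx.trans hw.1)) i2]
  have hB' : ∀ w ∈ Ioi y, HasDerivAt (fun w => -momB n w) (w ^ (n + 1) * (beta n w * beta n w)) w :=
    fun w hw => ((momB_hasDerivAt n (hy.trans hw)).neg).congr_deriv (neg_neg _)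
  have hBc : ContinuousWithinAt (fun w => -momB n w) (Ici y) y :=
    (momB_hasDerivAt n hy).continuousAt.neg.continuousWithinAt
  have hB0 : ∀ w ∈ Ioi y, 0 ≤ w ^ (n + 1) * (beta n w * beta n w) := fun w hw => by
    have : 0 < w := hy.trans hw
    have := betaN_pos n this
    positivity
  have hBl : Tendsto (fun w => -momB n w) atTop (𝓝 0) := by simpa using (tendsto_momB n).neg
  have i3 := integrableOn_Ioi_deriv_of_nonneg hBc hB' hB0 hBl
  have e3 : ∫ w in Ioi y, w ^ (n + 1) * (beta n w * beta n w) = momB n y := by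
    rw [integral_Ioi_of_hasDerivAt_of_nonneg hBc hB' hB0 hBl]; ring
  -- The integral is split at `x` and `y`; the three pieces are the three terms of the composition
  -- form. The square roots of the weight pair up to `w^(n-1)`.
  have l1 : ∫⁻ w in Ioc 0 x, ENNReal.ofReal (rootK n x w * rootK n y w)
      = ENNReal.ofReal (solB n x * solB n y * momA n x) := by
    refine lintegral_ofReal_of_integral measurableSet_Ioc ?_ (fun w hw =>
      mul_nonneg (rootK_nonneg n hx hw.1) (rootK_nonneg n hy hw.1)) ?_
    · refine IntegrableOn.congr_fun (((intervalIntegrable_iff_integrableOn_Ioc_of_le hx.le).1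
        i1).const_mul (solB n x * solB n y)) (fun w hw => ?_) measurableSet_Ioc
      simp only [rootK]
      rw [min_eq_right hw.2, max_eq_left hw.2, min_eq_right (hw.2.trans hxy),
        max_eq_left (hw.2.trans hxy), ← pow_mul_sq n hn1, solA]
      have e := hsq w hw.1
      generalize √(w ^ (n - 1)) = S at e ⊢
      rw [← e]
      ring
    · rw [← e1, ← integral_const_mul]
      refine setIntegral_congr_fun measurableSet_Ioc fun w hw => ?_
      simp only [rootK]
      rw [min_eq_right hw.2, max_eq_left hw.2, min_eq_right (hw.2.trans hxy),
        max_eq_left (hw.2.trans hxy), ← pow_mul_sq n hn1, solA]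
      have e := hsq w hw.1
      generalize √(w ^ (n - 1)) = S at e ⊢
      rw [← e]
      ring
  have l2 : ∫⁻ w in Ioc x y, ENNReal.ofReal (rootK n x w * rootK n y w)
      = ENNReal.ofReal (solA n x * solB n y * (momM n y - momM n x)) := by
    have hc : ∀ w ∈ Ioc x y, solA n x * solB n y * (w ^ (n + 1) * (alphaN n w * beta n w))
        = rootK n x w * rootK n y w := fun w hw => by
      simp only [rootK]
      rw [min_eq_left hw.1.le, max_eq_right hw.1.le, min_eq_right hw.2,
        max_eq_left hw.2, ← pow_mul_sq n hn1, solA, solA, solB, solB]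
      have e := hsq w (hx.trans hw.1)
      generalize √(w ^ (n - 1)) = S at e ⊢
      rw [← e]
      ring
    refine lintegral_ofReal_of_integral measurableSet_Ioc ?_ (fun w hw =>
      mul_nonneg (rootK_nonneg n hx (hx.trans hw.1)) (rootK_nonneg n hy (hx.trans hw.1))) ?_
    · exact IntegrableOn.congr_fun (((intervalIntegrable_iff_integrableOn_Ioc_of_le hxy).1
        i2).const_mul _) hc measurableSet_Ioc
    · rw [← e2, ← integral_const_mul]
      exact (setIntegral_congr_fun measurableSet_Ioc hc).symm
  have l3 : ∫⁻ w in Ioi y, ENNReal.ofReal (rootK n x w * rootK n y w)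
      = ENNReal.ofReal (solA n x * solA n y * momB n y) := by
    have hc : ∀ w ∈ Ioi y, solA n x * solA n y * (w ^ (n + 1) * (beta n w * beta n w))
        = rootK n x w * rootK n y w := fun w hw => by
      have hw' : y ≤ w := le_of_lt hw
      simp only [rootK]
      rw [min_eq_left (hxy.trans hw'), max_eq_right (hxy.trans hw'), min_eq_left hw',
        max_eq_right hw', ← pow_mul_sq n hn1, solB]
      have e := hsq w (hy.trans hw)
      generalize √(w ^ (n - 1)) = S at e ⊢
      rw [← e]
      ring
    refine lintegral_ofReal_of_integral measurableSet_Ioi ?_ (fun w hw =>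
      mul_nonneg (rootK_nonneg n hx (hy.trans hw)) (rootK_nonneg n hy (hy.trans hw))) ?_
    · exact IntegrableOn.congr_fun (i3.const_mul _) hc measurableSet_Ioi
    · rw [← e3, ← integral_const_mul]
      exact (setIntegral_congr_fun measurableSet_Ioi hc).symm
  rw [← Ioc_union_Ioi_eq_Ioi hy.le, lintegral_union measurableSet_Ioi (by
      rw [Set.disjoint_left]; intro s h1 h2; exact absurd h1.2 (not_le.2 h2)), l3,
    ← Ioc_union_Ioc_eq_Ioc hx.le hxy, lintegral_union measurableSet_Ioc (by
      rw [Set.disjoint_left]; intro s h1 h2; exact absurd h1.2 (not_le.2 h2.1)), l1, l2,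
    greenKernel_eq_kernForm hn hx hy, kernForm]
  have hA := momA_nonneg n hx.le
  have hM : 0 ≤ momM n y - momM n x := by
    rw [← e2]
    refine setIntegral_nonneg measurableSet_Ioc fun w hw => ?_
    have hw0 : 0 < w := hx.trans hw.1
    have := betaN_pos n hw0
    have := alphaN_pos n w
    positivity
  have hB := momB_nonneg n hy
  rw [← ENNReal.ofReal_add (by positivity) (by positivity),
    ← ENNReal.ofReal_add (by positivity) (by positivity)]

lemma lintegral_rootK_symK {n : ℕ} (hn : 3 ≤ n) {x y : ℝ} (hx : 0 < x) (hy : 0 < y) :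
    ∫⁻ w in Ioi 0, ENNReal.ofReal (rootK n x w) * ENNReal.ofReal (rootK n y w)
      = ENNReal.ofReal (symK n x y) := by
  have e : ∀ x y : ℝ, 0 < x → ∫⁻ w in Ioi 0, ENNReal.ofReal (rootK n x w) * ENNReal.ofReal (rootK n y w)
      = ∫⁻ w in Ioi 0, ENNReal.ofReal (rootK n x w * rootK n y w) := fun x y hx =>
    setLIntegral_congr_fun measurableSet_Ioi fun w hw =>
      (ENNReal.ofReal_mul (rootK_nonneg n hx hw)).symm
  rcases le_total x y with h | h
  · rw [e x y hx, lintegral_rootK_mul hn hx h, symK_of_le h]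
  · rw [symK_of_ge h, ← lintegral_rootK_mul hn hy h, ← e y x hy]
    simp only [mul_comm]

lemma lintegral_mul_sq_le {α : Type*} [MeasurableSpace α] {μ : Measure α} {f g : α → ℝ≥0∞}
    (hf : AEMeasurable f μ) (hg : AEMeasurable g μ) :
    (∫⁻ w, f w * g w ∂μ) ^ 2 ≤ (∫⁻ w, f w * f w ∂μ) * ∫⁻ w, g w * g w ∂μ := by
  have h := ENNReal.lintegral_mul_le_Lp_mul_Lq μ (p := 2) (q := 2)
    (Real.holderConjugate_iff.2 ⟨by norm_num, by norm_num⟩) hf hg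
  have e : ∀ k : α → ℝ≥0∞, ∫⁻ w, k w ^ (2 : ℝ) ∂μ = ∫⁻ w, k w * k w ∂μ := fun k => by
    refine lintegral_congr fun w => ?_
    rw [ENNReal.rpow_two, sq]
  simp only [Pi.mul_apply] at h
  rw [e, e] at h
  calc (∫⁻ w, f w * g w ∂μ) ^ 2 ≤ ((∫⁻ w, f w * f w ∂μ) ^ (1 / 2 : ℝ)
        * (∫⁻ w, g w * g w ∂μ) ^ (1 / 2 : ℝ)) ^ 2 := by gcongr
    _ = _ := by
        rw [mul_pow, ← ENNReal.rpow_two, ← ENNReal.rpow_two, ← ENNReal.rpow_mul,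
          ← ENNReal.rpow_mul]
        norm_num

section cauchySchwarz

variable {n : ℕ} {ω γ ρ : ℝ → ℝ} {M a b : ℝ}

/-- Cauchy–Schwarz for the Green kernel: the velocity is controlled by the energy. -/
lemma velU_sq_le (hn : 3 ≤ n) (hω : Dens ω M) (hneg : ∀ r, 0 ≤ r → ω r ≤ 0) (h : Adm a b γ ρ)
    (hE : IntegrableOn (fun s => velU n ω γ ρ s * mass n ω ρ s) (Ioi 0)) {r : ℝ} (hr : 0 < r) :
    velU n ω γ ρ r ^ 2
      ≤ symK n (γ r) (γ r) * ∫ s in Ioi 0, velU n ω γ ρ s * mass n ω ρ s := by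
  set μ : Measure ℝ := volume.restrict (Ioi 0) with hμ
  have hμμ : μ.prod μ = (volume.prod volume).restrict (Ioi 0 ×ˢ Ioi 0) := by
    rw [hμ, Measure.prod_restrict]
  have hprod : MeasurableSet ((Ioi (0 : ℝ)) ×ˢ (Ioi (0 : ℝ))) := measurableSet_Ioi.prod measurableSet_Ioi
  have hmc : ContinuousOn (mass n ω ρ) (Ioi 0) := (continuousOn_mass n hω h).mono Ioi_subset_Ici_self
  have hγc : ContinuousOn γ (Ioi 0) := h.contγ.mono Ioi_subset_Ici_self
  set q : ℝ → ℝ≥0∞ := fun s => ENNReal.ofReal (-mass n ω ρ s) with hq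
  have hqm : AEMeasurable q μ := (hmc.neg.aemeasurable measurableSet_Ioi).ennreal_ofReal
  set k : ℝ → ℝ → ℝ≥0∞ := fun s w => ENNReal.ofReal (rootK n (γ s) w) with hk
  have hkm : AEMeasurable (fun p : ℝ × ℝ => k p.2 p.1) (μ.prod μ) := by
    rw [hμμ]
    refine AEMeasurable.ennreal_ofReal (ContinuousOn.aemeasurable ?_ hprod)
    exact (continuousOn_rootK n).comp (f := fun p : ℝ × ℝ => (γ p.2, p.1))
      ((hγc.comp continuousOn_snd fun p hp => hp.2).prodMk continuousOn_fst)
      fun p hp => ⟨h.γ_pos hp.2, hp.1⟩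
  have hk1 : ∀ s, 0 < s → AEMeasurable (k s) μ := fun s hs => by
    refine AEMeasurable.ennreal_ofReal (ContinuousOn.aemeasurable ?_ measurableSet_Ioi)
    exact (continuousOn_rootK n).comp (f := fun w => (γ s, w))
      (continuousOn_const.prodMk continuousOn_id) fun w hw => ⟨h.γ_pos hs, hw⟩
  have hkq : AEMeasurable (fun p : ℝ × ℝ => k p.2 p.1 * q p.2) (μ.prod μ) := hkm.mul hqm.comp_snd
  have hkq1 : ∀ w ∈ Ioi (0 : ℝ), AEMeasurable (fun s => k s w * q s) μ := fun w hw => by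
    refine (AEMeasurable.ennreal_ofReal (ContinuousOn.aemeasurable ?_ measurableSet_Ioi)).mul hqm
    exact (continuousOn_rootK n).comp (f := fun s => (γ s, w))
      (hγc.prodMk continuousOn_const) fun s hs => ⟨h.γ_pos hs, hw⟩
  -- Here the momentum is composed with the root kernel only once. By Tonelli `-U(r) = ∫ k_r Q` and
  -- the energy is `∫ Q²`, so Cauchy–Schwarz for `k_r` and `Q` is the claim, with `∫ k_r²` the
  -- kernel on the diagonal. All functions are nonnegative, so `Q` may be handled without an
  -- integrability condition.
  set Q : ℝ → ℝ≥0∞ := fun w => ∫⁻ s, k s w * q s ∂μ with hQ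
  have hQm : AEMeasurable Q μ := hkq.lintegral_prod_right'
  have hU : ∀ r, 0 < r → ∫⁻ w, k r w * Q w ∂μ = ENNReal.ofReal (-velU n ω γ ρ r) := by
    intro r hr
    have h1 : ∀ᵐ w ∂μ, k r w * Q w = ∫⁻ s, k r w * (k s w * q s) ∂μ := by
      filter_upwards [ae_restrict_mem measurableSet_Ioi] with w hw
      rw [hQ, lintegral_const_mul'' _ (hkq1 w hw)]
    rw [lintegral_congr_ae h1, lintegral_lintegral_swap (((hk1 r hr).comp_fst).mul hkq)]
    have h2 : ∀ s ∈ Ioi (0 : ℝ), ∫⁻ w, k r w * (k s w * q s) ∂μ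
        = ENNReal.ofReal (-(symK n (γ r) (γ s) * mass n ω ρ s)) := by
      intro s hs
      simp only [← mul_assoc]
      rw [lintegral_mul_const'' (f := fun w => k r w * k s w) _ ((hk1 r hr).mul (hk1 s hs)), hk]
      simp only
      rw [lintegral_rootK_symK hn (h.γ_pos hr) (h.γ_pos hs), hq, ← ENNReal.ofReal_mul
        (symK_nonneg hn (h.γ_pos hr) (h.γ_pos hs))]
      congr 1; ring
    rw [setLIntegral_congr_fun measurableSet_Ioi h2, velU_eq, ← integral_neg,
      ofReal_integral_eq_lintegral_ofReal
        (f := fun s => -(symK n (γ r) (γ s) * mass n ω ρ s))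
        (integrableOn_pairK hn (goodPair_symK hn) hω h hr.le).neg]
    · refine (ae_restrict_mem measurableSet_Ioi).mono fun s hs => ?_
      have := symK_mul_mass_nonpos hn hneg h hr hs
      simpa using this
  have hUm : ∀ s ∈ Ioi (0 : ℝ), 0 ≤ velU n ω γ ρ s * mass n ω ρ s := fun s hs =>
    mul_nonneg_of_nonpos_of_nonpos (velU_nonpos hn hneg h (le_of_lt hs))
      (mass_nonpos hneg h (le_of_lt hs))
  have hQQ : ∫⁻ w, Q w * Q w ∂μ = ENNReal.ofReal (∫ s in Ioi 0, velU n ω γ ρ s * mass n ω ρ s) := by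
    have h1 : ∀ᵐ w ∂μ, Q w * Q w = ∫⁻ s, Q w * (k s w * q s) ∂μ := by
      filter_upwards [ae_restrict_mem measurableSet_Ioi] with w hw
      rw [lintegral_const_mul'' _ (hkq1 w hw)]
    rw [lintegral_congr_ae h1, lintegral_lintegral_swap ((hQm.comp_fst).mul hkq)]
    have h2 : ∀ s ∈ Ioi (0 : ℝ), ∫⁻ w, Q w * (k s w * q s) ∂μ
        = ENNReal.ofReal (velU n ω γ ρ s * mass n ω ρ s) := by
      intro s hs
      have e : ∀ w, Q w * (k s w * q s) = (k s w * Q w) * q s := fun w => by ring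
      simp only [e]
      rw [lintegral_mul_const'' (f := fun w => k s w * Q w) _ ((hk1 s hs).mul hQm), hU s hs, hq, ← ENNReal.ofReal_mul
        (by have := velU_nonpos hn hneg h (le_of_lt hs); linarith)]
      congr 1; ring
    rw [setLIntegral_congr_fun measurableSet_Ioi h2, ofReal_integral_eq_lintegral_ofReal hE]
    exact (ae_restrict_mem measurableSet_Ioi).mono hUm
  have hcs := lintegral_mul_sq_le (hk1 r hr) hQm
  have hkk : ∫⁻ w, k r w * k r w ∂μ = ENNReal.ofReal (symK n (γ r) (γ r)) :=
    lintegral_rootK_symK hn (h.γ_pos hr) (h.γ_pos hr)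
  have hK0 := symK_nonneg hn (h.γ_pos hr) (h.γ_pos hr)
  rw [hU r hr, hQQ, hkk, ← ENNReal.ofReal_mul hK0, ← ENNReal.ofReal_pow
    (by have := velU_nonpos hn hneg h hr.le; linarith), neg_sq,
    ENNReal.ofReal_le_ofReal_iff (mul_nonneg hK0 (setIntegral_nonneg measurableSet_Ioi hUm))] at hcs
  exact hcs

end cauchySchwarz

end

/-! ### Conservation of energy -/

noncomputable section

/-- Lebesgue measure on the open half line. -/
def halfLine : Measure ℝ := volume.restrict (Ioi 0)

instance : SFinite halfLine := by unfold halfLine; infer_instance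

lemma halfLine_prod : halfLine.prod halfLine = (volume.prod volume).restrict (Ioi 0 ×ˢ Ioi 0) := by
  rw [halfLine, Measure.prod_restrict]

lemma ae_halfLine_prod {P : ℝ × ℝ → Prop} (h : ∀ r s, 0 < r → 0 < s → P (r, s)) :
    ∀ᵐ p ∂halfLine.prod halfLine, P p := by
  rw [halfLine_prod]
  exact (ae_restrict_mem (measurableSet_Ioi.prod measurableSet_Ioi)).mono fun p hp =>
    h p.1 p.2 hp.1 hp.2

/-- The dominating function of the energy density. -/
def energyDom (n : ℕ) (ω : ℝ → ℝ) (c : ℝ) (p : ℝ × ℝ) : ℝ :=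
  Real.exp (-c * |p.1 - p.2|) * (p.1 ^ (n - 1) * ω p.1 ^ 2 + p.2 ^ (n - 1) * ω p.2 ^ 2)

lemma integrable_energyDom {n : ℕ} {ω : ℝ → ℝ}
    (hL2 : IntegrableOn (fun r : ℝ => r ^ (n - 1) * ω r ^ 2) (Ioi 0)) {c : ℝ} (hc : 0 < c) :
    Integrable (energyDom n ω c) (halfLine.prod halfLine) := by
  have h0 : Integrable (fun x : ℝ => Real.exp (-c * |x|)) := by
    have := integrable_exp_neg_abs hc 0
    simpa using this
  -- Both `exp(-c|x|)` and the extension by zero of `w^(n-1) ω²` are integrable on the line, hence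
  -- so is the integrand of their convolution on the plane. The other half follows by exchanging the
  -- variables.
  have h1 := ((integrable_indicator_iff measurableSet_Ioi).2 hL2).convolution_integrand
    (ContinuousLinearMap.mul ℝ ℝ) h0
  have h2 : Integrable (fun p : ℝ × ℝ => Real.exp (-c * |p.1 - p.2|) * (p.2 ^ (n - 1) * ω p.2 ^ 2))
      (halfLine.prod halfLine) := by
    rw [halfLine_prod]
    refine IntegrableOn.congr_fun h1.integrableOn (fun p hp => ?_)
      (measurableSet_Ioi.prod measurableSet_Ioi)
    simp only [ContinuousLinearMap.mul_apply']
    rw [indicator_of_mem hp.2, mul_comm]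
  have h3 := h2.swap
  refine (h2.add h3).congr (Eventually.of_forall fun p => ?_)
  simp only [Pi.add_apply, Function.comp, energyDom, Prod.fst_swap, Prod.snd_swap]
  rw [abs_sub_comm p.2 p.1]
  ring

lemma energyDom_swap (n : ℕ) (ω : ℝ → ℝ) (c : ℝ) (p : ℝ × ℝ) :
    energyDom n ω c p.swap = energyDom n ω c p := by
  simp only [energyDom, Prod.fst_swap, Prod.snd_swap]
  rw [abs_sub_comm p.2 p.1]
  ring

section static

variable {n : ℕ} {ω γ ρ : ℝ → ℝ} {M a b : ℝ}

/-- For `r ≤ s` the weight `s^(n-1)` is consumed by the decay of the kernel, and the remaining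
`r^(n-1) |ω(r) ω(s)|` is bounded through `2|ω(r) ω(s)| ≤ ω(r)² + ω(s)²` and `r^(n-1) ≤ s^(n-1)`. The
square integrability of the momentum enters through this majorant. -/
lemma symK_mass_mass_le (hn : 3 ≤ n) (h : Adm a b γ ρ) {r s : ℝ} (hr : 0 < r) (hs : 0 < s) :
    symK n (γ r) (γ s) * |mass n ω ρ r * mass n ω ρ s|
      ≤ kernConst n / a ^ (n + 1) * energyDom n ω (a / 4) (r, s) := by
  wlog hrs : r ≤ s generalizing r s
  · have := this hs hr (le_of_not_ge hrs)
    rw [symK_comm, mul_comm (mass n ω ρ r), ← energyDom_swap]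
    exact this
  have ha := h.pos
  have hC := (kernConst_pos n).le
  have hK := symK_nonneg hn (h.γ_pos hr) (h.γ_pos hs)
  -- The momentum is frozen at its value at `s`, so that the estimate keeps the factor `|ω s|` in
  -- place of the global bound `M`.
  have hD : Dens (fun _ => ω s) |ω s| := ⟨continuousOn_const, fun _ _ => le_rfl⟩
  have h1 : |symK n (γ r) (γ s) * mass n ω ρ s|
      ≤ |ω s| / a ^ n * (kernConst n * Real.exp (-(a / 4) * |r - s|)) :=
    abs_mul_mass_le hn hD h hs (((goodPair_symK hn).decay _ _ (h.γ_nonneg hr.le) (h.γ_pos hs)).trans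
      (mul_le_mul_of_nonneg_left (h.exp_le hr.le hs.le) hC))
  have h2 : |mass n ω ρ r| ≤ r ^ (n - 1) * |ω r| / a := by
    have := (h.bounds r hr.le).1
    have := h.ρ_pos hr.le
    rw [mass, abs_div, abs_mul, abs_of_pos (h.ρ_pos hr.le), abs_of_pos (pow_pos hr _)]
    gcongr
  have h3 : r ^ (n - 1) * |ω r| * |ω s| ≤ r ^ (n - 1) * ω r ^ 2 + s ^ (n - 1) * ω s ^ 2 := by
    have h4 : |ω r| * |ω s| ≤ ω r ^ 2 + ω s ^ 2 := by
      rw [← sq_abs (ω r), ← sq_abs (ω s)]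
      nlinarith [sq_nonneg (|ω r| - |ω s|), sq_nonneg (|ω r|), sq_nonneg (|ω s|)]
    have h5 : r ^ (n - 1) * ω s ^ 2 ≤ s ^ (n - 1) * ω s ^ 2 := by gcongr
    have h6 : 0 ≤ r ^ (n - 1) := by positivity
    calc r ^ (n - 1) * |ω r| * |ω s| = r ^ (n - 1) * (|ω r| * |ω s|) := by ring
      _ ≤ r ^ (n - 1) * (ω r ^ 2 + ω s ^ 2) := by gcongr
      _ ≤ _ := by linarith
  calc symK n (γ r) (γ s) * |mass n ω ρ r * mass n ω ρ s|
      = |mass n ω ρ r| * |symK n (γ r) (γ s) * mass n ω ρ s| := by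
        rw [abs_mul, abs_mul, abs_of_nonneg hK]; ring
    _ ≤ (r ^ (n - 1) * |ω r| / a)
        * (|ω s| / a ^ n * (kernConst n * Real.exp (-(a / 4) * |r - s|))) := by gcongr
    _ = kernConst n / a ^ (n + 1) * (Real.exp (-(a / 4) * |r - s|)
        * (r ^ (n - 1) * |ω r| * |ω s|)) := by rw [pow_succ]; field_simp
    _ ≤ _ := by
        unfold energyDom
        gcongr

lemma aestronglyMeasurable_pairK_prod {k₁ k₂ : ℝ → ℝ → ℝ} {C : ℝ} (hk : GoodPair n k₁ k₂ C)
    (h : Adm a b γ ρ) : AEStronglyMeasurable (fun p : ℝ × ℝ => pairK k₁ k₂ (γ p.1) (γ p.2))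
      (halfLine.prod halfLine) := by
  have hγ : ContinuousOn γ (Ioi 0) := h.contγ.mono Ioi_subset_Ici_self
  set S : Set (ℝ × ℝ) := Ioi 0 ×ˢ Ioi 0 with hS
  have hSm : MeasurableSet S := measurableSet_Ioi.prod measurableSet_Ioi
  have h1 : ContinuousOn (fun p : ℝ × ℝ => γ p.1) S := hγ.comp continuousOn_fst fun p hp => hp.1
  have h2 : ContinuousOn (fun p : ℝ × ℝ => γ p.2) S := hγ.comp continuousOn_snd fun p hp => hp.2
  have e : S = (S ∩ {p | p.1 ≤ p.2}) ∪ (S ∩ {p | p.2 < p.1}) := by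
    ext p
    simp only [mem_union, mem_inter_iff, mem_ofPred_eq]
    constructor
    · intro hp
      rcases le_or_gt p.1 p.2 with h | h
      · exact Or.inl ⟨hp, h⟩
      · exact Or.inr ⟨hp, h⟩
    · rintro (h | h) <;> exact h.1
  rw [halfLine_prod, ← hS, e, aestronglyMeasurable_union_iff]
  constructor
  · refine ContinuousOn.aestronglyMeasurable ?_
      (hSm.inter (measurableSet_le measurable_fst measurable_snd))
    refine ContinuousOn.congr (f := fun p : ℝ × ℝ => k₁ (γ p.1) (γ p.2)) ?_ fun p hp =>
      pairK_of_le h (le_of_lt hp.1.1) hp.2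
    exact hk.cont₁.comp (f := fun p : ℝ × ℝ => (γ p.1, γ p.2))
      ((h1.prodMk h2).mono inter_subset_left) fun p hp =>
        ⟨h.γ_nonneg (le_of_lt hp.1.1), h.γ_pos hp.1.2⟩
  · refine ContinuousOn.aestronglyMeasurable ?_
      (hSm.inter (measurableSet_lt measurable_snd measurable_fst))
    refine ContinuousOn.congr (f := fun p : ℝ × ℝ => k₂ (γ p.2) (γ p.1)) ?_ fun p hp =>
      pairK_of_gt h (le_of_lt hp.1.2) hp.2
    exact hk.cont₂.comp (f := fun p : ℝ × ℝ => (γ p.2, γ p.1))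
      ((h2.prodMk h1).mono inter_subset_left) fun p hp =>
        ⟨h.γ_nonneg (le_of_lt hp.1.2), h.γ_pos hp.1.1⟩

lemma aestronglyMeasurable_half {f : ℝ → ℝ} (hf : ContinuousOn f (Ici 0)) :
    AEStronglyMeasurable f halfLine :=
  (hf.mono Ioi_subset_Ici_self).aestronglyMeasurable measurableSet_Ioi

/-- The energy density. -/
def energyDensity (n : ℕ) (ω γ ρ : ℝ → ℝ) (p : ℝ × ℝ) : ℝ :=
  symK n (γ p.1) (γ p.2) * (mass n ω ρ p.1 * mass n ω ρ p.2)

/-- The kinetic energy of a state. -/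
def energy (n : ℕ) (ω γ ρ : ℝ → ℝ) : ℝ :=
  ∫ p, energyDensity n ω γ ρ p ∂halfLine.prod halfLine

lemma aestronglyMeasurable_energyDensity (hn : 3 ≤ n) (hω : Dens ω M) (h : Adm a b γ ρ) :
    AEStronglyMeasurable (energyDensity n ω γ ρ) (halfLine.prod halfLine) := by
  have hm := aestronglyMeasurable_half (continuousOn_mass n hω h)
  exact (aestronglyMeasurable_pairK_prod (goodPair_symK hn) h).mul (hm.comp_fst.mul hm.comp_snd)

lemma integrable_energyDensity (hn : 3 ≤ n) (hω : Dens ω M)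
    (hL2 : IntegrableOn (fun r : ℝ => r ^ (n - 1) * ω r ^ 2) (Ioi 0)) (h : Adm a b γ ρ) :
    Integrable (energyDensity n ω γ ρ) (halfLine.prod halfLine) := by
  have ha := h.pos
  refine Integrable.mono' ((integrable_energyDom hL2 (c := a / 4) (by positivity)).const_mul
    (kernConst n / a ^ (n + 1))) (aestronglyMeasurable_energyDensity hn hω h)
    (ae_halfLine_prod fun r s hr hs => ?_)
  rw [energyDensity, norm_mul, Real.norm_eq_abs, Real.norm_eq_abs,
    abs_of_nonneg (symK_nonneg hn (h.γ_pos hr) (h.γ_pos hs))]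
  exact symK_mass_mass_le hn h hr hs

lemma energy_eq (hn : 3 ≤ n) (hω : Dens ω M)
    (hL2 : IntegrableOn (fun r : ℝ => r ^ (n - 1) * ω r ^ 2) (Ioi 0)) (h : Adm a b γ ρ) :
    IntegrableOn (fun s => velU n ω γ ρ s * mass n ω ρ s) (Ioi 0) ∧
      energy n ω γ ρ = ∫ s in Ioi 0, velU n ω γ ρ s * mass n ω ρ s := by
  have hi := integrable_energyDensity hn hω hL2 h
  have e : ∀ r, ∫ s, energyDensity n ω γ ρ (r, s) ∂halfLine = velU n ω γ ρ r * mass n ω ρ r := by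
    intro r
    rw [velU_eq, ← integral_mul_const]
    refine integral_congr_ae (Eventually.of_forall fun s => ?_)
    simp only [energyDensity]; ring
  refine ⟨hi.integral_prod_left.congr (Eventually.of_forall e), ?_⟩
  rw [energy, integral_prod _ hi]
  exact integral_congr_ae (Eventually.of_forall e)

/-- Half of the time derivative of the energy density. -/
def energyFlux (n : ℕ) (ω γ ρ : ℝ → ℝ) (p : ℝ × ℝ) : ℝ :=
  (symK1 n (γ p.1) (γ p.2) * velU n ω γ ρ p.1 - symK n (γ p.1) (γ p.2) * velV n ω γ ρ p.1)
    * (mass n ω ρ p.1 * mass n ω ρ p.2)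

lemma aestronglyMeasurable_energyFlux (hn : 3 ≤ n) (hω : Dens ω M) (h : Adm a b γ ρ) :
    AEStronglyMeasurable (energyFlux n ω γ ρ) (halfLine.prod halfLine) := by
  have hm := aestronglyMeasurable_half (continuousOn_mass n hω h)
  have hU := aestronglyMeasurable_half (continuousOn_velU hn hω h)
  have hV := aestronglyMeasurable_half (continuousOn_velV hn hω h)
  exact (((aestronglyMeasurable_pairK_prod (goodPair_symK1 hn) h).mul hU.comp_fst).sub
    ((aestronglyMeasurable_pairK_prod (goodPair_symK hn) h).mul hV.comp_fst)).mul
    (hm.comp_fst.mul hm.comp_snd)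

/-- The constant in the domination of the energy flux. -/
def fluxConst (n : ℕ) (M a : ℝ) : ℝ :=
  2 * ((n + 1) * (M / a ^ n * kernConst n * (8 / a))) * (kernConst n / a ^ (n + 1))

lemma abs_energyFlux_le (hn : 3 ≤ n) (hω : Dens ω M) (h : Adm a b γ ρ) {r s : ℝ} (hr : 0 < r)
    (hs : 0 < s) : |energyFlux n ω γ ρ (r, s)| ≤ fluxConst n M a * energyDom n ω (a / 4) (r, s) := by
  have ha := h.pos
  have hM := hω.nonneg
  have hC := (kernConst_pos n).le
  have hx := h.γ_pos hr
  have hK := symK_nonneg hn hx (h.γ_pos hs)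
  set A := M / a ^ n * kernConst n * (8 / a) with hA
  have hA0 : 0 ≤ A := by positivity
  have h1 : |symK1 n (γ r) (γ s) * velU n ω γ ρ r| ≤ (n + 1) * A * symK n (γ r) (γ s) := by
    rw [abs_mul]
    calc |symK1 n (γ r) (γ s)| * |velU n ω γ ρ r|
        ≤ (logBound n (γ r) * symK n (γ r) (γ s)) * (A * wt (γ r)) :=
          mul_le_mul (abs_symK1_le hn hx (h.γ_pos hs)) (abs_velU_le hn hω h hr.le) (abs_nonneg _)
            (mul_nonneg (logBound_pos n hx).le hK)
      _ = (logBound n (γ r) * wt (γ r)) * (A * symK n (γ r) (γ s)) := by ring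
      _ ≤ (n + 1) * (A * symK n (γ r) (γ s)) := by
          gcongr
          exact logBound_mul_wt_le n hx
      _ = _ := by ring
  have h2 : |symK n (γ r) (γ s) * velV n ω γ ρ r| ≤ (n + 1) * A * symK n (γ r) (γ s) := by
    rw [abs_mul, abs_of_nonneg hK, mul_comm]
    refine mul_le_mul_of_nonneg_right ((abs_velV_le hn hω h hr.le).trans (le_of_eq ?_)) hK
    rw [hA]; ring
  have h3 := symK_mass_mass_le (ω := ω) hn h hr hs
  rw [energyFlux, abs_mul]
  calc _ ≤ (2 * ((n + 1) * A) * symK n (γ r) (γ s)) * |mass n ω ρ r * mass n ω ρ s| := by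
        gcongr
        refine (abs_sub _ _).trans ?_
        linarith
    _ = 2 * ((n + 1) * A) * (symK n (γ r) (γ s) * |mass n ω ρ r * mass n ω ρ s|) := by ring
    _ ≤ 2 * ((n + 1) * A) * (kernConst n / a ^ (n + 1) * energyDom n ω (a / 4) (r, s)) := by
        gcongr
    _ = _ := by rw [fluxConst]; ring

/-- Integrating in the second variable first turns the kernels into `V` and `U`, and leaves the mass
at the first particle times `V U - U V`. -/
lemma integral_energyFlux (hn : 3 ≤ n) (hω : Dens ω M)
    (hL2 : IntegrableOn (fun r : ℝ => r ^ (n - 1) * ω r ^ 2) (Ioi 0)) (h : Adm a b γ ρ) :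
    ∫ p, (energyFlux n ω γ ρ p + energyFlux n ω γ ρ p.swap) ∂halfLine.prod halfLine = 0 := by
  have ha := h.pos
  have hi : Integrable (energyFlux n ω γ ρ) (halfLine.prod halfLine) :=
    Integrable.mono' ((integrable_energyDom hL2 (c := a / 4) (by positivity)).const_mul
      (fluxConst n M a)) (aestronglyMeasurable_energyFlux hn hω h)
      (ae_halfLine_prod fun r s hr hs => abs_energyFlux_le hn hω h hr hs)
  have h0 : ∫ p, energyFlux n ω γ ρ p ∂halfLine.prod halfLine = 0 := by
    rw [integral_prod _ hi]
    refine integral_eq_zero_of_ae ((ae_restrict_mem measurableSet_Ioi).mono fun r hr => ?_)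
    have hr : 0 < r := hr
    have i1 := integrableOn_pairK hn (goodPair_symK1 hn) hω h hr.le
    have i2 := integrableOn_pairK hn (goodPair_symK hn) hω h hr.le
    have e : ∀ s, energyFlux n ω γ ρ (r, s)
        = mass n ω ρ r * velU n ω γ ρ r
            * (pairK (greenD1 n) (greenD2 n) (γ r) (γ s) * mass n ω ρ s)
          - mass n ω ρ r * velV n ω γ ρ r
            * (pairK (greenKernel n) (greenKernel n) (γ r) (γ s) * mass n ω ρ s) := fun s => by
      change (pairK (greenD1 n) (greenD2 n) (γ r) (γ s) * velU n ω γ ρ r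
        - pairK (greenKernel n) (greenKernel n) (γ r) (γ s) * velV n ω γ ρ r)
        * (mass n ω ρ r * mass n ω ρ s) = _
      ring
    simp only [e, Pi.zero_apply]
    rw [halfLine, integral_sub (i1.const_mul _) (i2.const_mul _), integral_const_mul,
      integral_const_mul]
    change mass n ω ρ r * velU n ω γ ρ r * velV n ω γ ρ r
      - mass n ω ρ r * velV n ω γ ρ r * velU n ω γ ρ r = 0
    ring
  have h1 : ∫ p, energyFlux n ω γ ρ p.swap ∂halfLine.prod halfLine = 0 := by
    rw [integral_prod_swap, h0]
  have hi' : Integrable (fun p => energyFlux n ω γ ρ p.swap) (halfLine.prod halfLine) := hi.swap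
  rw [integral_add hi hi', h0, h1, add_zero]

end static

/-- On the diagonal `symK1` is defined by the other branch; both agree there because the middle
moment vanishes when `x = y`. -/
lemma symK1_of_ge {n : ℕ} (hn : 3 ≤ n) {x y : ℝ} (hx : 0 < x) (hxy : x ≤ y) :
    symK1 n y x = greenD2 n x y := by
  rcases hxy.eq_or_lt with rfl | h
  · rw [symK1_of_le le_rfl, greenD1_eq_kernForm hn hx hx, greenD2_eq_kernForm hn hx hx]
    simp only [kernForm]; ring
  · exact symK1_of_gt h

section conservation

variable {n : ℕ} {ω : ℝ → ℝ} {M T : ℝ} {γ ρ : ℝ → ℝ → ℝ}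

lemma Flow.hasDerivAt_mass (h : Flow n ω T γ ρ) {t : ℝ} (ht : t ∈ Ioo 0 T) {s : ℝ} (hs : 0 ≤ s) :
    HasDerivAt (fun τ => mass n ω (ρ τ) s) (-(velV n ω (γ t) (ρ t) s * mass n ω (ρ t) s)) t := by
  obtain ⟨a, b, hab⟩ := h.adm_at ⟨ht.1.le, ht.2⟩
  have hρ := (hab.ρ_pos hs).ne'
  refine ((hasDerivAt_const t (s ^ (n - 1) * ω s)).div (h.hasDerivAt_ρ ht hs) hρ).congr_deriv ?_
  rw [mass]; field_simp; ring

lemma Flow.hasDerivAt_symK (hn : 3 ≤ n) (h : Flow n ω T γ ρ) {t : ℝ} (ht : t ∈ Ioo 0 T) {r s : ℝ}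
    (hr : 0 < r) (hs : 0 < s) :
    HasDerivAt (fun τ => symK n (γ τ r) (γ τ s))
      (symK1 n (γ t r) (γ t s) * velU n ω (γ t) (ρ t) r
        + symK1 n (γ t s) (γ t r) * velU n ω (γ t) (ρ t) s) t := by
  wlog hrs : r ≤ s generalizing r s
  · have := this hs hr (le_of_not_ge hrs)
    rw [add_comm]
    simpa only [symK_comm n] using this
  obtain ⟨a, b, hab⟩ := h.adm_at ⟨ht.1.le, ht.2⟩
  have hx := hab.γ_pos hr
  have hxy := hab.mono hr.le hrs
  rw [symK1_of_le hxy, symK1_of_ge hn hx hxy]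
  refine (greenKernel_hasDerivAt hn (h.hasDerivAt_γ ht hr.le) (h.hasDerivAt_γ ht hs.le) hx
    (hab.γ_pos hs)).congr_of_eventuallyEq ?_
  filter_upwards [Ioo_mem_nhds ht.1 ht.2] with τ hτ
  obtain ⟨a', b', hab'⟩ := h.adm_at ⟨hτ.1.le, hτ.2⟩
  exact symK_of_le (hab'.mono hr.le hrs)

lemma Flow.hasDerivAt_energyDensity (hn : 3 ≤ n) (h : Flow n ω T γ ρ) {t : ℝ} (ht : t ∈ Ioo 0 T)
    {r s : ℝ} (hr : 0 < r) (hs : 0 < s) :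
    HasDerivAt (fun τ => energyDensity n ω (γ τ) (ρ τ) (r, s))
      (energyFlux n ω (γ t) (ρ t) (r, s) + energyFlux n ω (γ t) (ρ t) (s, r)) t := by
  refine ((h.hasDerivAt_symK hn ht hr hs).mul
    ((h.hasDerivAt_mass ht hr.le).mul (h.hasDerivAt_mass ht hs.le))).congr_deriv ?_
  simp only [energyFlux, symK_comm n (γ t s) (γ t r), Pi.mul_apply]
  ring

/-- Conservation of energy. -/
lemma Flow.hasDerivAt_energy (hn : 3 ≤ n) (hω : Dens ω M)
    (hL2 : IntegrableOn (fun r : ℝ => r ^ (n - 1) * ω r ^ 2) (Ioi 0)) (h : Flow n ω T γ ρ) {t : ℝ}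
    (ht : t ∈ Ioo 0 T) : HasDerivAt (fun τ => energy n ω (γ τ) (ρ τ)) 0 t := by
  obtain ⟨T', h1, h2⟩ := exists_between ht.2
  obtain ⟨a, b, hab⟩ := h.adm T' h2
  have hA : ∀ τ ∈ Ioo 0 T', Adm a b (γ τ) (ρ τ) := fun τ hτ => hab τ ⟨hτ.1.le, hτ.2.le⟩
  have ht' : t ∈ Ioo 0 T' := ⟨ht.1, h1⟩
  have ha := (hA t ht').pos
  have hd := (hasDerivAt_integral_of_dominated_loc_of_deriv_le (μ := halfLine.prod halfLine)
    (F := fun τ p => energyDensity n ω (γ τ) (ρ τ) p)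
    (F' := fun τ p => energyFlux n ω (γ τ) (ρ τ) p + energyFlux n ω (γ τ) (ρ τ) p.swap)
    (bound := fun p => 2 * (fluxConst n M a * energyDom n ω (a / 4) p)) (x₀ := t) (s := Ioo 0 T')
    (Ioo_mem_nhds ht.1 h1) ?_ (integrable_energyDensity hn hω hL2 (hA t ht')) ?_ ?_ ?_ ?_).2
  · rw [integral_energyFlux hn hω hL2 (hA t ht')] at hd
    exact hd
  · filter_upwards [Ioo_mem_nhds ht.1 h1] with τ hτ
    exact aestronglyMeasurable_energyDensity hn hω (hA τ hτ)
  · have := aestronglyMeasurable_energyFlux hn hω (hA t ht')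
    exact this.add this.prod_swap
  · refine ae_halfLine_prod fun r s hr hs τ hτ => ?_
    have h3 := abs_energyFlux_le hn hω (hA τ hτ) hr hs
    have h4 := abs_energyFlux_le hn hω (hA τ hτ) hs hr
    rw [← energyDom_swap] at h4
    refine (abs_add_le _ _).trans ?_
    simp only [Prod.swap_prod_mk] at h4 ⊢
    linarith
  · exact ((integrable_energyDom hL2 (by positivity)).const_mul _).const_mul _
  · refine ae_halfLine_prod fun r s hr hs τ hτ => ?_
    exact h.hasDerivAt_energyDensity hn ⟨hτ.1, hτ.2.trans h2⟩ hr hs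

/-- The velocity stays bounded away from the origin. -/
lemma Flow.exists_velU_bound (hn : 3 ≤ n) (hω : Dens ω M)
    (hL2 : IntegrableOn (fun r : ℝ => r ^ (n - 1) * ω r ^ 2) (Ioi 0))
    (hneg : ∀ r, 0 ≤ r → ω r ≤ 0) (hT : 0 < T) (h : Flow n ω T γ ρ) :
    ∃ C, 0 ≤ C ∧ ∀ t ∈ Ioo 0 T, ∀ r, 0 < r → 1 ≤ γ t r → |velU n ω (γ t) (ρ t) r| ≤ C := by
  set E := energy n ω (γ (T / 2)) (ρ (T / 2)) with hE
  have hmid : T / 2 ∈ Ioo 0 T := ⟨by linarith, by linarith⟩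
  have hconst : ∀ t ∈ Ioo 0 T, energy n ω (γ t) (ρ t) = E := by
    intro t ht
    have := Convex.norm_image_sub_le_of_norm_hasDerivWithin_le (s := Ioo 0 T) (C := 0)
      (fun τ hτ => (h.hasDerivAt_energy hn hω hL2 hτ).hasDerivWithinAt) (fun _ _ => by simp)
      (convex_Ioo 0 T) hmid ht
    rw [zero_mul] at this
    exact sub_eq_zero.1 (norm_le_zero_iff.1 this)
  have hE0 : 0 ≤ E := by
    obtain ⟨a, b, hab⟩ := h.adm_at ⟨hmid.1.le, hmid.2⟩
    rw [hE, (energy_eq hn hω hL2 hab).2]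
    exact setIntegral_nonneg measurableSet_Ioi fun s hs =>
      mul_nonneg_of_nonpos_of_nonpos (velU_nonpos hn hneg hab (le_of_lt hs))
        (mass_nonpos hneg hab (le_of_lt hs))
  -- The factor `3n` bounds the kernel on the diagonal where `γ ≥ 1`, and `E` is the conserved
  -- energy.
  refine ⟨√(3 * n * E), Real.sqrt_nonneg _, fun t ht r hr h1 => ?_⟩
  obtain ⟨a, b, hab⟩ := h.adm_at ⟨ht.1.le, ht.2⟩
  obtain ⟨hi, he⟩ := energy_eq hn hω hL2 hab
  have hcs := velU_sq_le hn hω hneg hab hi hr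
  rw [← he, hconst t ht] at hcs
  refine Real.abs_le_sqrt (hcs.trans ?_)
  exact mul_le_mul_of_nonneg_right (symK_self_le hn h1) hE0

end conservation

end

/-! ### Continuation criterion at the origin -/

noncomputable section

section gradient

variable {n : ℕ} {ω γ ρ : ℝ → ℝ} {M a b : ℝ}

lemma velV_zero_nonpos (hn : 3 ≤ n) (hneg : ∀ r, 0 ≤ r → ω r ≤ 0) (h : Adm a b γ ρ) :
    velV n ω γ ρ 0 ≤ 0 := by
  rw [velV_eq, h.zero]
  refine setIntegral_nonpos measurableSet_Ioi fun s hs => ?_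
  have hg := h.γ_pos (mem_Ioi.1 hs)
  rw [symK1_of_le hg.le]
  exact mul_nonpos_of_nonneg_of_nonpos (greenD1_zero_pos hn hg).le (mass_nonpos hneg h (le_of_lt hs))

/-- The velocity gradient at the origin controls the velocity on bounded sets. -/
lemma neg_velU_le_velV_zero (hn : 3 ≤ n) (hω : Dens ω M) (hneg : ∀ r, 0 ≤ r → ω r ≤ 0)
    (h : Adm a b γ ρ) {r R : ℝ} (hr : 0 < r) (hR : γ r ≤ R) :
    -velU n ω γ ρ r ≤ γ r * alphaN n R * -velV n ω γ ρ 0 := by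
  have hU := integrableOn_pairK hn (goodPair_symK hn) hω h hr.le
  have hV := integrableOn_pairK hn (goodPair_symK1 hn) hω h le_rfl
  rw [velU_eq, velV_eq, ← integral_neg, ← integral_neg, ← integral_const_mul]
  refine setIntegral_mono_on hU.neg (hV.neg.const_mul _) measurableSet_Ioi fun s hs => ?_
  have hg := h.γ_pos (mem_Ioi.1 hs)
  have h1 := symK_le_zero hn (h.γ_pos hr) hg hR
  have h2 := mass_nonpos (n := n) hneg h (le_of_lt hs)
  rw [h.zero, symK1_of_le hg.le]
  nlinarith

lemma abs_velV_le_logBound (hn : 3 ≤ n) (hω : Dens ω M) (hneg : ∀ r, 0 ≤ r → ω r ≤ 0)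
    (h : Adm a b γ ρ) {r : ℝ} (hr : 0 < r) :
    |velV n ω γ ρ r| ≤ logBound n (γ r) * -velU n ω γ ρ r := by
  have hU := integrableOn_pairK hn (goodPair_symK hn) hω h hr.le
  rw [velU_eq, velV_eq, ← integral_neg, ← integral_const_mul]
  rw [← Real.norm_eq_abs]
  refine norm_integral_le_of_norm_le (hU.neg.const_mul (logBound n (γ r))) ?_
  refine (ae_restrict_mem measurableSet_Ioi).mono fun s hs => ?_
  have h1 := abs_symK1_le hn (h.γ_pos hr) (h.γ_pos (mem_Ioi.1 hs))
  have h2 := mass_nonpos (n := n) hneg h (le_of_lt hs)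
  rw [Real.norm_eq_abs, abs_mul, abs_of_nonpos h2]
  change |symK1 n (γ r) (γ s)| * -mass n ω ρ s
    ≤ logBound n (γ r) * -(symK n (γ r) (γ s) * mass n ω ρ s)
  nlinarith

/-- The logarithmic bound costs a factor `1/γ(r)`, which is cancelled by the factor `γ(r)` in the
estimate of the velocity by the gradient at the origin. -/
lemma abs_velV_le_velV_zero (hn : 3 ≤ n) (hω : Dens ω M) (hneg : ∀ r, 0 ≤ r → ω r ≤ 0)
    (h : Adm a b γ ρ) {r R : ℝ} (hr : 0 < r) (hR : γ r ≤ R) :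
    |velV n ω γ ρ r| ≤ (R + n + 1) * alphaN n R * -velV n ω γ ρ 0 := by
  have hg := h.γ_pos hr
  have h1 := abs_velV_le_logBound hn hω hneg h hr
  have h2 := neg_velU_le_velV_zero hn hω hneg h hr hR
  have h3 : 0 ≤ -velV n ω γ ρ 0 := neg_nonneg.2 (velV_zero_nonpos hn hneg h)
  have h4 : logBound n (γ r) * γ r = γ r + n + 1 := by unfold logBound; field_simp; ring
  have h5 := mul_le_mul_of_nonneg_left h2 (logBound_pos n hg).le
  have h6 := alphaN_pos n R
  have e : logBound n (γ r) * (γ r * alphaN n R * -velV n ω γ ρ 0)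
      = (γ r + n + 1) * alphaN n R * -velV n ω γ ρ 0 := by rw [← h4]; ring
  refine h1.trans (h5.trans (e.le.trans ?_))
  gcongr

end gradient

section continuation

variable {n : ℕ} {ω : ℝ → ℝ} {M T : ℝ} {γ ρ : ℝ → ℝ → ℝ}

lemma Flow.ρ_pos (h : Flow n ω T γ ρ) {t r : ℝ} (ht : t ∈ Ico 0 T) (hr : 0 ≤ r) : 0 < ρ t r := by
  obtain ⟨a, b, hab⟩ := h.adm_at ht
  exact hab.ρ_pos hr

lemma Flow.hasDerivWithinAt_log_ρ (h : Flow n ω T γ ρ) {t r : ℝ} (ht : t ∈ Ico 0 T) (hr : 0 ≤ r) :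
    HasDerivWithinAt (fun τ => Real.log (ρ τ r)) (velV n ω (γ t) (ρ t) r) (Ico 0 T) t := by
  have hp := h.ρ_pos ht hr
  refine ((h.dρ t ht r hr).log hp.ne').congr_deriv ?_
  field_simp

/-- A bound on the velocity gradient bounds the stretching of the flow. -/
lemma Flow.abs_log_ρ_le (h : Flow n ω T γ ρ) {r : ℝ} (hr : 0 ≤ r) {G g : ℝ → ℝ}
    (hG : ∀ t ∈ Ico 0 T, HasDerivWithinAt G (g t) (Ico 0 T) t) (hG0 : G 0 = 0)
    (hb : ∀ t ∈ Ioo 0 T, |velV n ω (γ t) (ρ t) r| ≤ g t) {t : ℝ} (ht : t ∈ Ico 0 T) :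
    |Real.log (ρ t r)| ≤ G t := by
  have hz : (0 : ℝ) ∈ Ico 0 T := ⟨le_rfl, ht.1.trans_lt ht.2⟩
  have hl0 : Real.log (ρ 0 r) = 0 := by rw [(h.init r hr).2, Real.log_one]
  have h1 : AntitoneOn (fun τ => Real.log (ρ τ r) - G τ) (Ico 0 T) := by
    refine antitoneOn_of_hasDerivWithinAt_nonpos (f' := fun t => velV n ω (γ t) (ρ t) r - g t)
      (convex_Ico 0 T)
      (fun t ht => ((h.hasDerivWithinAt_log_ρ ht hr).sub (hG t ht)).continuousWithinAt)
      (fun t ht => ?_) (fun t ht => ?_)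
    · have ht' := interior_subset ht
      exact ((h.hasDerivWithinAt_log_ρ ht' hr).sub (hG t ht')).mono interior_subset
    · rw [interior_Ico] at ht
      exact sub_nonpos.2 ((le_abs_self _).trans (hb t ht))
  have h2 : MonotoneOn (fun τ => Real.log (ρ τ r) + G τ) (Ico 0 T) := by
    refine monotoneOn_of_hasDerivWithinAt_nonneg (f' := fun t => velV n ω (γ t) (ρ t) r + g t)
      (convex_Ico 0 T)
      (fun t ht => ((h.hasDerivWithinAt_log_ρ ht hr).add (hG t ht)).continuousWithinAt)
      (fun t ht => ?_) (fun t ht => ?_)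
    · have ht' := interior_subset ht
      exact ((h.hasDerivWithinAt_log_ρ ht' hr).add (hG t ht')).mono interior_subset
    · rw [interior_Ico] at ht
      linarith [(abs_le.1 (hb t ht)).1]
  have h3 := h1 hz ht ht.1
  have h4 := h2 hz ht ht.1
  simp only [hl0, hG0, sub_zero, add_zero] at h3 h4
  exact abs_le.2 ⟨by linarith, by linarith⟩

lemma Flow.antitoneOn_ρ_zero (hn : 3 ≤ n) (hneg : ∀ r, 0 ≤ r → ω r ≤ 0) (h : Flow n ω T γ ρ) :
    AntitoneOn (fun τ => ρ τ 0) (Ico 0 T) := by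
  refine antitoneOn_of_hasDerivWithinAt_nonpos (f' := fun t => ρ t 0 * velV n ω (γ t) (ρ t) 0)
    (convex_Ico 0 T) (fun t ht => (h.dρ t ht 0 le_rfl).continuousWithinAt)
    (fun t ht => (h.dρ t (interior_subset ht) 0 le_rfl).mono interior_subset) (fun t ht => ?_)
  obtain ⟨a, b, hab⟩ := h.adm_at (interior_subset ht)
  exact mul_nonpos_of_nonneg_of_nonpos (hab.ρ_pos le_rfl).le (velV_zero_nonpos hn hneg hab)

/-- Particles starting far from the origin stay away from it. -/
lemma Flow.one_le_γ (hn : 3 ≤ n) (hneg : ∀ r, 0 ≤ r → ω r ≤ 0) (h : Flow n ω T γ ρ) {C : ℝ}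
    (hC0 : 0 ≤ C)
    (hC : ∀ t ∈ Ioo 0 T, ∀ r, 0 < r → 1 ≤ γ t r → |velU n ω (γ t) (ρ t) r| ≤ C) {t r : ℝ}
    (ht : t ∈ Ico 0 T) (hr : 2 + C * T ≤ r) : 1 ≤ γ t r := by
  by_contra! hlt
  have hT : 0 < T := ht.1.trans_lt ht.2
  have hr1 : 1 < r := by nlinarith
  have hr0 : 0 < r := by linarith
  have hsub : Icc 0 t ⊆ Ico 0 T := fun u hu => ⟨hu.1, hu.2.trans_lt ht.2⟩
  have hcont : ContinuousOn (fun τ => γ τ r) (Icc 0 t) := fun u hu =>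
    ((h.dγ u (hsub hu) r hr0.le).continuousWithinAt).mono hsub
  -- At a time when the particle is at distance `1`, monotonicity shows that it was at distance at
  -- least `1` before. Its speed was then at most `C`, so it travelled at most `C T`, less than the
  -- required `r - 1`.
  obtain ⟨τ, hτ, hτ1⟩ : (1 : ℝ) ∈ (fun τ => γ τ r) '' Icc 0 t :=
    intermediate_value_Icc' ht.1 hcont ⟨hlt.le, by simpa [(h.init r hr0.le).1] using hr1.le⟩
  have hτT := hsub hτ
  have hsub' : Icc 0 τ ⊆ Ico 0 T := fun u hu => ⟨hu.1, hu.2.trans_lt hτT.2⟩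
  have hmono : MonotoneOn (fun u => γ u r + C * u) (Icc 0 τ) := by
    have hd : ∀ u ∈ Icc 0 τ, HasDerivWithinAt (fun u => γ u r + C * u)
        (velU n ω (γ u) (ρ u) r + C * 1) (Icc 0 τ) u := fun u hu =>
      ((h.dγ u (hsub' hu) r hr0.le).mono hsub').add ((hasDerivWithinAt_id u _).const_mul C)
    refine monotoneOn_of_hasDerivWithinAt_nonneg (convex_Icc 0 τ)
      (fun u hu => (hd u hu).continuousWithinAt)
      (fun u hu => (hd u (interior_subset hu)).mono interior_subset) (fun u hu => ?_)
    rw [interior_Icc] at hu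
    have hu' := hsub' ⟨hu.1.le, hu.2.le⟩
    have h1 : 1 ≤ γ u r := hτ1.symm.le.trans (h.antitoneOn_γ hn hneg hr0.le hu' hτT hu.2.le)
    have h2 := hC u ⟨hu.1, hu'.2⟩ r hr0 h1
    linarith [(abs_le.1 h2).1]
  have h3 := hmono ⟨le_rfl, hτ.1⟩ ⟨hτ.1, le_rfl⟩ hτ.1
  simp only [(h.init r hr0.le).1, mul_zero, add_zero] at h3
  simp only at hτ1
  rw [hτ1] at h3
  nlinarith [hτT.2]

/-- A flow whose stretching at the origin stays away from zero can be continued. -/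
lemma Flow.exists_extension_of_le_ρ_zero (hn : 3 ≤ n) (hω : Dens ω M)
    (hL2 : IntegrableOn (fun r : ℝ => r ^ (n - 1) * ω r ^ 2) (Ioi 0))
    (hneg : ∀ r, 0 ≤ r → ω r ≤ 0) (hT : 0 < T) (h : Flow n ω T γ ρ) {L : ℝ} (hL : 0 < L)
    (hL' : ∀ t ∈ Ico 0 T, L ≤ ρ t 0) : ∃ T' > T, ∃ γ' ρ', Flow n ω T' γ' ρ' := by
  obtain ⟨C, hC0, hC⟩ := h.exists_velU_bound hn hω hL2 hneg hT
  have hz : (0 : ℝ) ∈ Ico 0 T := ⟨le_rfl, hT⟩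
  set R := 2 + C * T with hR
  have hR0 : 0 < R := by positivity
  set c := (R + n + 1) * alphaN n R with hc
  have hc1 : 1 ≤ c := by
    have h1 := one_le_alphaN n R
    have h2 : (0 : ℝ) ≤ n := Nat.cast_nonneg n
    have h3 : 1 ≤ R + n + 1 := by linarith
    rw [hc]; nlinarith
  have hlogL : ∀ t ∈ Ico 0 T, -Real.log (ρ t 0) ≤ -Real.log L := fun t ht =>
    neg_le_neg (Real.log_le_log hL (hL' t ht))
  have hLn : 0 ≤ -Real.log L := by
    have := hlogL 0 hz
    rwa [(h.init 0 le_rfl).2, Real.log_one, neg_zero] at this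
  have hlogn : ∀ t ∈ Ico 0 T, 0 ≤ -Real.log (ρ t 0) := fun t ht => by
    have := h.antitoneOn_ρ_zero hn hneg hz ht ht.1
    simp only [(h.init 0 le_rfl).2] at this
    exact neg_nonneg.2 (Real.log_nonpos (h.ρ_pos ht le_rfl).le this)
  -- The first summand serves the particles starting in `[0, R]`, the second those starting beyond
  -- `R`, where `γ ≥ 1` gives `1 + (n+1)/γ ≤ n + 2` and speed at most `C`.
  set K := c * -Real.log L + (n + 2) * C * T with hK
  have hK2 : 0 ≤ ((n : ℝ) + 2) * C * T := by positivity
  have hK1 : 0 ≤ c * -Real.log L := mul_nonneg (by linarith) hLn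
  have key : ∀ t ∈ Ico 0 T, ∀ r, 0 ≤ r → |Real.log (ρ t r)| ≤ K := by
    intro t ht r hr
    rcases hr.eq_or_lt with rfl | hr
    · rw [abs_of_nonpos (neg_nonneg.1 (hlogn t ht))]
      nlinarith [hlogL t ht, hlogn t ht]
    rcases le_total r R with hrR | hrR
    -- The gradient at the origin is the time derivative of `log ρ(τ, 0)`, so this bound on `V`
    -- integrates exactly, whatever the length of the time interval.
    · have h1 := h.abs_log_ρ_le (G := fun τ => -(c * Real.log (ρ τ 0)))
        (g := fun τ => -(c * velV n ω (γ τ) (ρ τ) 0)) hr.le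
        (fun τ hτ => ((h.hasDerivWithinAt_log_ρ hτ le_rfl).const_mul c).neg)
        (by simp [(h.init 0 le_rfl).2]) (fun τ hτ => ?_) ht
      · have := mul_le_mul_of_nonneg_left (hlogL t ht) (by linarith : 0 ≤ c)
        linarith
      · have hτ' : τ ∈ Ico 0 T := ⟨hτ.1.le, hτ.2⟩
        obtain ⟨a, b, hab⟩ := h.adm_at hτ'
        have := abs_velV_le_velV_zero hn hω hneg hab hr ((h.γ_le hn hneg hτ' hr.le).trans hrR)
        rw [← hc] at this
        linarith
    · have h1 := h.abs_log_ρ_le (G := fun τ => (n + 2) * C * τ) (g := fun _ => (n + 2) * C * 1) hr.le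
        (fun τ _ => (hasDerivWithinAt_id τ _).const_mul _) (mul_zero _) (fun τ hτ => ?_) ht
      · have : (n + 2) * C * t ≤ (n + 2) * C * T := by have := ht.2; gcongr
        linarith
      · have hτ' : τ ∈ Ico 0 T := ⟨hτ.1.le, hτ.2⟩
        obtain ⟨a, b, hab⟩ := h.adm_at hτ'
        have hg := h.one_le_γ hn hneg hC0 hC hτ' hrR
        have h2 := abs_velV_le_logBound hn hω hneg hab hr
        have h3 := hC τ hτ r hr hg
        rw [abs_of_nonpos (velU_nonpos hn hneg hab hr.le)] at h3
        have h4 : logBound n (γ τ r) ≤ n + 2 := by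
          have : ((n : ℝ) + 1) / γ τ r ≤ n + 1 := div_le_self (by positivity) hg
          unfold logBound; linarith
        have h5 := neg_nonneg.2 (velU_nonpos hn hneg hab hr.le)
        rw [mul_one]
        exact h2.trans (mul_le_mul h4 h3 h5 (by positivity))
  refine h.exists_extension (a := Real.exp (-K)) (b := Real.exp K) hn hω hT fun t ht => ?_
  obtain ⟨a, b, hab⟩ := h.adm_at ht
  refine ⟨Real.exp_pos _, hab.cont, fun r hr => ?_, hab.zero, hab.deriv⟩
  have hp := h.ρ_pos ht hr
  have h1 := abs_le.1 (key t ht r hr)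
  exact ⟨(Real.le_log_iff_exp_le hp).1 h1.1, (Real.log_le_iff_le_exp hp).1 h1.2⟩

end continuation

end

/-! ### The maximal flow and its behaviour at the final time -/

noncomputable section

lemma Adm.congr {a b : ℝ} {γ ρ γ' ρ' : ℝ → ℝ} (h : Adm a b γ ρ) (hγ : ∀ r, 0 ≤ r → γ' r = γ r)
    (hρ : ∀ r, 0 ≤ r → ρ' r = ρ r) : Adm a b γ' ρ' where
  pos := h.pos
  cont := h.cont.congr hρ
  bounds r hr := by rw [hρ r hr]; exact h.bounds r hr
  zero := by rw [hγ 0 le_rfl, h.zero]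
  deriv r hr := by rw [hρ r hr]; exact (h.deriv r hr).congr hγ (hγ r hr)

section agree

variable {n : ℕ} {ω : ℝ → ℝ} {T T₁ : ℝ} {γ ρ : ℝ → ℝ → ℝ}

lemma hasDerivWithinAt_of_agree {f f₁ : ℝ → ℝ} {d t : ℝ}
    (hd : HasDerivWithinAt f₁ d (Ico 0 T₁) t) (ht : t ∈ Ico 0 T) (ht₁ : t < T₁)
    (he : ∀ u, 0 ≤ u → u < T₁ → u < T → f u = f₁ u) : HasDerivWithinAt f d (Ico 0 T) t := by
  have hs : Ico 0 T₁ ∩ Iio T ∈ 𝓝[Ico 0 T] t := by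
    filter_upwards [self_mem_nhdsWithin, mem_nhdsWithin_of_mem_nhds (Iio_mem_nhds ht₁)] with u hu hu'
    exact ⟨⟨hu.1, hu'⟩, hu.2⟩
  exact ((hd.mono inter_subset_left).congr (fun u hu => he u hu.1.1 hu.1.2 hu.2)
    (he t ht.1 ht₁ ht.2)).mono_of_mem_nhdsWithin hs

/-- A curve that agrees with flows on arbitrarily long subintervals is a flow. -/
lemma Flow.of_agree (hT : 0 < T)
    (h : ∀ T' < T, ∃ T₁ > T', ∃ γ₁ ρ₁, Flow n ω T₁ γ₁ ρ₁ ∧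
      ∀ t, 0 ≤ t → t < T₁ → t < T → ∀ r, 0 ≤ r → γ t r = γ₁ t r ∧ ρ t r = ρ₁ t r) :
    Flow n ω T γ ρ := by
  refine ⟨fun r hr => ?_, fun T' hT' => ?_, fun t ht r hr => ?_, fun t ht r hr => ?_⟩
  · obtain ⟨T₁, hT₁, γ₁, ρ₁, hf, he⟩ := h 0 hT
    rw [(he 0 le_rfl hT₁ hT r hr).1, (he 0 le_rfl hT₁ hT r hr).2]
    exact hf.init r hr
  · obtain ⟨T₁, hT₁, γ₁, ρ₁, hf, he⟩ := h T' hT'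
    obtain ⟨a, b, hab⟩ := hf.adm T' hT₁
    refine ⟨a, b, fun t ht => ?_⟩
    have he' := he t ht.1 (ht.2.trans_lt hT₁) (ht.2.trans_lt hT')
    exact (hab t ht).congr (fun r hr => (he' r hr).1) fun r hr => (he' r hr).2
  · obtain ⟨T₁, hT₁, γ₁, ρ₁, hf, he⟩ := h t ht.2
    have he' := he t ht.1 hT₁ ht.2
    have e : velU n ω (γ₁ t) (ρ₁ t) r = velU n ω (γ t) (ρ t) r :=
      kernInt_congr (fun s hs => (he' s hs).1.symm) (fun s hs => (he' s hs).2.symm) hr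
    rw [← e]
    exact hasDerivWithinAt_of_agree (hf.dγ t ⟨ht.1, hT₁⟩ r hr) ht hT₁
      fun u h0 h1 h2 => (he u h0 h1 h2 r hr).1
  · obtain ⟨T₁, hT₁, γ₁, ρ₁, hf, he⟩ := h t ht.2
    have he' := he t ht.1 hT₁ ht.2
    have e : velV n ω (γ₁ t) (ρ₁ t) r = velV n ω (γ t) (ρ t) r :=
      kernInt_congr (fun s hs => (he' s hs).1.symm) (fun s hs => (he' s hs).2.symm) hr
    rw [← e, (he' r hr).2]
    exact hasDerivWithinAt_of_agree (hf.dρ t ⟨ht.1, hT₁⟩ r hr) ht hT₁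
      fun u h0 h1 h2 => (he u h0 h1 h2 r hr).2

end agree

section maximal

variable {n : ℕ} {ω : ℝ → ℝ} {M : ℝ}

/-- For nonzero nonpositive momentum there is a flow of maximal, finite lifespan. -/
lemma exists_maximal_flow (hn : 3 ≤ n) (hω : Dens ω M) (hneg : ∀ r, 0 ≤ r → ω r ≤ 0)
    (hne : ∃ r, 0 ≤ r ∧ ω r ≠ 0) :
    ∃ T > 0, ∃ γ ρ, Flow n ω T γ ρ ∧ ∀ T' γ' ρ', Flow n ω T' γ' ρ' → T' ≤ T := by
  obtain ⟨B, hB⟩ := exists_lifespan_bound hn hω hneg hne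
  obtain ⟨T₀, hT₀, γ₀, ρ₀, h₀⟩ := exists_flow hn hω
  set S := {T : ℝ | ∃ γ ρ, Flow n ω T γ ρ} with hS
  have hbdd : BddAbove S := ⟨B, fun T ⟨γ, ρ, h⟩ => hB T γ ρ h⟩
  have hle : ∀ T' γ' ρ', Flow n ω T' γ' ρ' → T' ≤ sSup S := fun T' γ' ρ' h =>
    le_csSup hbdd ⟨γ', ρ', h⟩
  have hex : ∀ t < sSup S, ∃ T₁ > t, ∃ γ₁ ρ₁, Flow n ω T₁ γ₁ ρ₁ := fun t ht => by
    obtain ⟨T₁, ⟨γ₁, ρ₁, h⟩, h1⟩ := exists_lt_of_lt_csSup (s := S) ⟨T₀, γ₀, ρ₀, h₀⟩ ht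
    exact ⟨T₁, h1, γ₁, ρ₁, h⟩
  have hT : 0 < sSup S := hT₀.trans_le (hle _ _ _ h₀)
  have hex' : ∀ t, ∃ g q : ℝ → ℝ → ℝ, t < sSup S → ∃ T₁ > t, Flow n ω T₁ g q := fun t => by
    by_cases ht : t < sSup S
    · obtain ⟨T₁, h1, g, q, h⟩ := hex t ht
      exact ⟨g, q, fun _ => ⟨T₁, h1, h⟩⟩
    · exact ⟨0, 0, fun h => absurd h ht⟩
  choose g q hgq using hex'
  -- At each time `t` the state is taken from a flow chosen for that `t`; uniqueness makes the
  -- choices compatible.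
  refine ⟨sSup S, hT, fun t => g t t, fun t => q t t, ?_, hle⟩
  refine Flow.of_agree hT fun T' hT' => ?_
  obtain ⟨T₁, h1, γ₁, ρ₁, h⟩ := hex T' hT'
  refine ⟨T₁, h1, γ₁, ρ₁, h, fun t ht0 ht1 htS r hr => ?_⟩
  obtain ⟨T₂, h2, hf⟩ := hgq t htS
  exact Flow.unique hn hω h hf ht0 ht1 h2 hr

end maximal

/-- An antitone function on `[0, T)` that is bounded below has a limit at `T`. -/
lemma exists_tendsto_of_antitoneOn {g : ℝ → ℝ} {T m : ℝ} (hT : 0 < T) (hg : AntitoneOn g (Ico 0 T))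
    (hm : ∀ t ∈ Ico 0 T, m ≤ g t) :
    ∃ l, m ≤ l ∧ (∀ t ∈ Ico 0 T, l ≤ g t) ∧ Tendsto g (𝓝[<] T) (𝓝 l) := by
  have hne : (g '' Ico 0 T).Nonempty := ⟨g 0, 0, ⟨le_rfl, hT⟩, rfl⟩
  have hbdd : BddBelow (g '' Ico 0 T) := ⟨m, by rintro _ ⟨t, ht, rfl⟩; exact hm t ht⟩
  have hle : ∀ t ∈ Ico 0 T, sInf (g '' Ico 0 T) ≤ g t := fun t ht => csInf_le hbdd ⟨t, ht, rfl⟩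
  refine ⟨sInf (g '' Ico 0 T), le_csInf hne (by rintro _ ⟨t, ht, rfl⟩; exact hm t ht), hle, ?_⟩
  refine tendsto_order.2 ⟨fun x hx => ?_, fun x hx => ?_⟩
  · filter_upwards [Ico_mem_nhdsLT hT] with t ht using hx.trans_le (hle t ht)
  · obtain ⟨_, ⟨t₀, ht₀, rfl⟩, h⟩ := exists_lt_of_csInf_lt hne hx
    filter_upwards [Ico_mem_nhdsLT ht₀.2] with t ht
    exact (hg ht₀ ⟨ht₀.1.trans ht.1, ht.2⟩ ht.1).trans_lt h

end

end RadialEPDiff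

open RadialEPDiff in
theorem theorem5p3 (n : ℕ) (hn : 3 ≤ n) (ω₀ : ℝ → ℝ)
    (hcont : ContinuousOn ω₀ (Set.Ici 0))
    (hbdd : ∃ M : ℝ, ∀ r, 0 ≤ r → |ω₀ r| ≤ M)
    (hL2 : MeasureTheory.IntegrableOn (fun r : ℝ => r ^ (n - 1) * ω₀ r ^ 2) (Set.Ioi 0))
    (hneg : ∀ r, 0 ≤ r → ω₀ r ≤ 0)
    (hne : ∃ r, 0 ≤ r ∧ ω₀ r ≠ 0) :
    -- the kernel is the Green kernel of the inertia operator `(1 - Δ)²`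
    IsRadialGreenKernel n (greenKernel n) ∧
    -- the maximal solution exists, is unique, has a finite lifespan `T`,
    -- and `γ_r` vanishes somewhere at time `T`
    ∃ T : ℝ, 0 < T ∧ ∃ γ ρ : ℝ → ℝ → ℝ,
      IsTrajectory n (greenKernel n) ω₀ T γ ρ ∧
      (∀ (T' : ℝ) (γ' ρ' : ℝ → ℝ → ℝ), IsTrajectory n (greenKernel n) ω₀ T' γ' ρ' →
        T' ≤ T ∧ ∀ t ∈ Set.Ico 0 T', ∀ r, 0 ≤ r → γ' t r = γ t r) ∧
      (∀ r, 0 ≤ r → Filter.Tendsto (fun t => γ t r) (nhdsWithin T (Set.Iio T)) (nhds (γ T r))) ∧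
      ∃ r, 0 ≤ r ∧
        Filter.Tendsto (fun t => ρ t r) (nhdsWithin T (Set.Iio T)) (nhds 0) ∧
        HasDerivWithinAt (γ T) 0 (Set.Ici 0) r := by
  obtain ⟨M, hM⟩ := hbdd
  have hω : Dens ω₀ M := ⟨hcont, hM⟩
  refine ⟨isRadialGreenKernel hn, ?_⟩
  obtain ⟨T, hT, γ, ρ, h, hmax⟩ := exists_maximal_flow hn hω hneg hne
  have hlim : ∀ r, ∃ l, 0 ≤ r → 0 ≤ l ∧ (∀ t ∈ Ico 0 T, l ≤ γ t r) ∧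
      Tendsto (fun t => γ t r) (𝓝[<] T) (𝓝 l) := fun r => by
    by_cases hr : 0 ≤ r
    · obtain ⟨l, hl⟩ := exists_tendsto_of_antitoneOn (m := 0) hT (h.antitoneOn_γ hn hneg hr)
        fun t ht => by
          obtain ⟨a, b, hab⟩ := h.adm_at ht
          exact hab.γ_nonneg hr
      exact ⟨l, fun _ => hl⟩
    · exact ⟨0, fun h => absurd h hr⟩
  choose l hl using hlim
  -- The flow is unaffected by its values at `T`, so `γ(T, ·)` may be redefined there as the
  -- pointwise limit `l`.
  have hlt : ∀ t < T, (if t < T then γ t else l) = γ t := fun t ht => if_pos ht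
  have hTl : (if T < T then γ T else l) = l := if_neg (lt_irrefl T)
  have hf : Flow n ω₀ T (fun t => if t < T then γ t else l) ρ :=
    Flow.of_agree hT fun T' hT' => ⟨T, hT', γ, ρ, h, fun t _ ht _ r _ => by rw [hlt t ht]; simp⟩
  obtain ⟨m, hm0, hm, hmlim⟩ := exists_tendsto_of_antitoneOn (m := 0) hT
    (h.antitoneOn_ρ_zero hn hneg) fun t ht => (h.ρ_pos ht le_rfl).le
  -- A positive limit of `ρ(t, 0)` would be a lower bound for it, since this quantity decreases, and
  -- the flow could be continued beyond its maximal lifespan.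
  have hm' : m = 0 := by
    rcases hm0.eq_or_lt with hm0 | hm0
    · exact hm0.symm
    · obtain ⟨T', hT', γ', ρ', h'⟩ := h.exists_extension_of_le_ρ_zero hn hω hL2 hneg hT hm0 hm
      exact absurd (hmax T' γ' ρ' h') (not_le.2 hT')
  rw [hm'] at hmlim
  refine ⟨T, hT, fun t => if t < T then γ t else l, ρ, hf.isTrajectory hn hω, ?_, ?_, 0, le_rfl,
    hmlim, ?_⟩
  · intro T' γ' ρ' h'
    rcases le_or_gt T' 0 with h0 | h0
    · exact ⟨h0.trans hT.le, fun t ht => absurd (ht.1.trans_lt ht.2) (not_lt.2 h0)⟩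
    · have h'' := h'.flow hn hω h0
      have hle := hmax T' γ' ρ' h''
      exact ⟨hle, fun t ht r hr =>
        (Flow.unique hn hω hf h'' ht.1 (ht.2.trans_le hle) ht.2 hr).1⟩
  · intro r hr
    simp only [hTl]
    refine (hl r hr).2.2.congr' ?_
    filter_upwards [self_mem_nhdsWithin] with t ht
    rw [hlt t ht]
  · simp only [hTl]
    have hl0 : l 0 = 0 := by
      refine le_antisymm ?_ (hl 0 le_rfl).1
      obtain ⟨a, b, hab⟩ := h.adm_at ⟨le_rfl, hT⟩
      exact ((hl 0 le_rfl).2.1 0 ⟨le_rfl, hT⟩).trans_eq hab.zero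
    rw [hasDerivWithinAt_iff_isLittleO, Asymptotics.isLittleO_iff]
    intro c hc
    -- Fix a time with `ρ(t, 0) < c/2`. Near the origin `γ(T, x) ≤ γ(t, x) ≤ (ρ(t, 0) + c/2) x ≤ c
    -- x`, since particles only move inwards.
    obtain ⟨t, htc, ht⟩ := ((hmlim.eventually (gt_mem_nhds (half_pos hc))).and
      (Ico_mem_nhdsLT hT)).exists
    obtain ⟨a, b, hab⟩ := h.adm_at ht
    have hd := hab.deriv 0 le_rfl
    rw [hasDerivWithinAt_iff_isLittleO, Asymptotics.isLittleO_iff] at hd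
    filter_upwards [hd (half_pos hc), self_mem_nhdsWithin] with x hx hx0
    have hx0' : 0 ≤ x := hx0
    simp only [hab.zero, sub_zero, smul_eq_mul, Real.norm_eq_abs, abs_of_nonneg hx0'] at hx
    simp only [hl0, sub_zero, smul_eq_mul, mul_zero, Real.norm_eq_abs, abs_of_nonneg hx0',
      abs_of_nonneg (hl x hx0').1]
    have h1 := (hl x hx0').2.1 t ht
    have h2 := (abs_le.1 hx).2
    nlinarith
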